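/- \textbf{Conventions.} Let $K$ be a field of characteristic $0$. A \emph{bicomplex} is a bigraded $K$-vector space with anti-commuting differentials $\partial,\bar\partial$ of bidegrees $(1,0),(0,1)$; a \emph{cbba} is a unital graded-commutative algebra object in bicomplexes. The cbba's $\mathcal A,\mathcal B,\mathcal C,\mathcal C'$ are concentrated in bidegrees $(i,j)$ with $i,j\ge 0$ (other bicomplexes, such as cylinders and cones, may have negative bidegrees). $\mathcal B^+$ is the part of $\mathcal B$ of positive total degree. $\mathcal A$ is a \emph{successive linear Hirsch extension of $\mathcal B$} (with local coefficients in $\mathcal B$) if there are bicomplexes $V_0,V_1,\dots$ such that $\mathcal A=\mathcal B\otimes\bigwedge(V_0\oplus V_1\oplus\cdots)$ as an algebra, $\mathcal B\to\mathcal A$ is a map of cbba's, and with $\mathcal A_n=\mathcal B\otimes\bigwedge(V_0\oplus\dots\oplus V_{n-1})$ the differentials on $V_n$ are $\partial=\partial_{V_n}+\phi_n+\Theta_n$ and $\bar\partial=\bar\partial_{V_n}+\bar\phi_n+\bar\Theta_n$, where $\phi_n,\bar\phi_n:V_n\to\mathcal A_n$ and $\Theta_n,\bar\Theta_n:V_n\to\mathcal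 B^+\otimes V_n$. Put $\pi(\mathcal A,\mathcal B)=\bigoplus_n V_n$. For a bicomplex $M$ with a compatible action of $\mathcal B$, the bigraded space $\mathrm{Hom}(V_n,M)$ carries the twisted differentials $\partial_\Theta\psi=\partial_M\psi-(-1)^{|\psi|}\bigl(\psi\partial_{V_n}+(1\otimes\psi)\Theta_n\bigr)$ and, likewise, $\bar\partial_{\bar\Theta}$. The \emph{twisted homotopy} $[V_n,M]$ is its Bott--Chern cohomology $(\ker\partial_\Theta\cap\ker\bar\partial_{\bar\Theta})/\mathrm{im}\,\partial_\Theta\bar\partial_{\bar\Theta}$ in bidegree $(0,0)$. A map $M\to N$ is a \emph{quasi-isomorphism for coefficients in $\pi(\mathcal A,\mathcal B)$} if, for every $n$, $\mathrm{Hom}(V_n,M)\to\mathrm{Hom}(V_n,N)$ induces isomorphisms on Bott--Chern cohomology and on Aeppli cohomology $\ker\partial_\Theta\bar\partial_{\bar\Theta}/(\mathrm{im}\,\partial_\Theta+\mathrm{im}\,\bar\partial_{\bar\Theta})$ in all bidegrees. For $p:M\to N$, $\mathrm{Cone}(p)=N\oplus(L\otimes M)$ with $L$ spanned by $l,\partial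 l,\bar\partial l$ in bidegrees $(-1,-1),(0,-1),(-1,0)$, the differentials being those of the cokernel of $M\to N\oplus(\square\otimes M)$, $m\mapsto (p(m),\partial\bar\partial l\otimes m)$, where $\square$ is spanned by $l,\partial l,\bar\partial l,\partial\bar\partial l$. A \emph{cylinder} is a cbba $\mathcal A^\square=\mathcal B(x,y;\varphi,\partial\varphi,\bar\partial\varphi)$, freely generated over $\mathcal B$ by two copies $x,y$ of the generators of $\mathcal A$ (each copy giving a map of cbba's $\mathcal A\to\mathcal A^\square$ under $\mathcal B$) and, for each $n$, by $\varphi$, $\partial\varphi=\partial_\Theta\varphi$, $\bar\partial\varphi=\bar\partial_{\bar\Theta}\varphi$ with $\varphi:V_n\to\mathcal A^\square$ of bidegree $(-1,-1)$, such that $\partial_\Theta\bar\partial_{\bar\Theta}\varphi=x-y+\omega_n$ with $\omega_n$ having values in the ideal of $\mathcal A_n^\square$ generated by the previous $\varphi,\partial\varphi,\bar\partial\varphi,x-y$ (those on $V_0,\dots,V_{n-1}$). Here $\mathcal A^\square_n\subset\mathcal A^\square$ is generated by $\mathcal B$ and all generators on $V_0,\dots,V_{n-1}$. Two maps $f,g:\mathcal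 A\to\mathcal C$ extending $\nu:\mathcal B\to\mathcal C$ are \emph{homotopic} (rel $\nu$) if there is a map of cbba's $\mathcal A^\square\to\mathcal C$ restricting to $f$ along $x$ and to $g$ along $y$; $hHom(\mathcal A,\mathcal C;\nu)$ is the set of homotopy classes. \textbf{Theorem.} Let $\mathcal A$ be a successive linear Hirsch extension of $\mathcal B$, and let $\nu:\mathcal B\to\mathcal C$, $\nu':\mathcal B\to\mathcal C'$, $p:\mathcal C'\to\mathcal C$ be maps of cbba's with $p\nu'=\nu$. A cylinder $\mathcal A^\square$ exists, and for every cylinder homotopy is an equivalence relation on the maps $\mathcal A\to\mathcal C$ extending $\nu$ and on the maps $\mathcal A\to\mathcal C'$ extending $\nu'$. Moreover: (i) Fix a cylinder and $f:\mathcal A\to\mathcal C$ extending $\nu$. A \emph{partial lift} at stage $n$ is a pair $(g,h)$ of a map of cbba's $g:\mathcal A_n\to\mathcal C'$ extending $\nu'$ and a map of cbba's $h:\mathcal A_n^\square\to\mathcal C$ which is a homotopy from $f|_{\mathcal A_n}$ to $pg$. At stage $0$ there is exactly one partial lift. For a partial lift $(g,h)$ at stage $n$, the map $$f|_{V_n}+h\omega_n+l\otimes\bar\partial_{\bar\Theta}(g\phi_n)-\partial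 l\otimes g\bar\phi_n+\bar\partial l\otimes g\phi_n\ :\ V_n\to\mathrm{Cone}(p)$$ is a cocycle, and its class in $[V_n,\mathrm{Cone}(p)]$ vanishes if and only if $(g,h)$ extends to a partial lift at stage $n+1$. Every sequence of partial lifts, one for each $n$, each extending the previous one, is the restriction of a map $f':\mathcal A\to\mathcal C'$ extending $\nu'$ together with a homotopy from $f$ to $pf'$. (ii) If $p$ is surjective and a quasi-isomorphism for coefficients in $\pi(\mathcal A,\mathcal B)$, then every $f:\mathcal A\to\mathcal C$ extending $\nu$ has a lift $f':\mathcal A\to\mathcal C'$ extending $\nu'$ with $pf'=f$. (iii) If $p$ is a quasi-isomorphism for coefficients in $\pi(\mathcal A,\mathcal B)$ (surjective or not), then for every cylinder composition with $p$ induces a bijection $hHom(\mathcal A,\mathcal C';\nu')\to hHom(\mathcal A,\mathcal C;\nu)$. -/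

import Mathlib

open scoped TensorProduct DirectSum

universe u

/-! ## Bicomplexes and cbba's -/

/-- A bicomplex over `K`: a `ℤ × ℤ`-graded vector space with two anti-commuting differentials
`d` (that is, `∂`) of bidegree `(1,0)` and `dbar` of bidegree `(0,1)`. -/
structure Bicomplex (K : Type u) [Field K] where
  carrier : Type u
  [addCommGroup : AddCommGroup carrier]
  [module : Module K carrier]
  gr : ℤ × ℤ → Submodule K carrier
  internal : DirectSum.IsInternal gr
  d : carrier →ₗ[K] carrier
  dbar : carrier →ₗ[K] carrier
  d_mem : ∀ {a : ℤ × ℤ} {x : carrier}, x ∈ gr a → d x ∈ gr (a + (1, 0))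
  dbar_mem : ∀ {a : ℤ × ℤ} {x : carrier}, x ∈ gr a → dbar x ∈ gr (a + (0, 1))
  d_d : ∀ x, d (d x) = 0
  dbar_dbar : ∀ x, dbar (dbar x) = 0
  d_dbar : ∀ x, d (dbar x) + dbar (d x) = 0

attribute [instance] Bicomplex.addCommGroup Bicomplex.module

/-- A cbba over `K`: a commutative (in the graded sense, with respect to the total degree)
unital algebra object in bicomplexes; both differentials are derivations. -/
structure CBBA (K : Type u) [Field K] where
  carrier : Type u
  [ring : Ring carrier]
  [algebra : Algebra K carrier]
  gr : ℤ × ℤ → Submodule K carrier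
  internal : DirectSum.IsInternal gr
  one_mem : (1 : carrier) ∈ gr 0
  mul_mem : ∀ {a b : ℤ × ℤ} {x y : carrier}, x ∈ gr a → y ∈ gr b → x * y ∈ gr (a + b)
  mul_comm : ∀ {a b : ℤ × ℤ} {x y : carrier}, x ∈ gr a → y ∈ gr b →
    x * y = ((a.1 + a.2) * (b.1 + b.2)).negOnePow • (y * x)
  d : carrier →ₗ[K] carrier
  dbar : carrier →ₗ[K] carrier
  d_mem : ∀ {a : ℤ × ℤ} {x : carrier}, x ∈ gr a → d x ∈ gr (a + (1, 0))
  dbar_mem : ∀ {a : ℤ × ℤ} {x : carrier}, x ∈ gr a → dbar x ∈ gr (a + (0, 1))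
  d_d : ∀ x, d (d x) = 0
  dbar_dbar : ∀ x, dbar (dbar x) = 0
  d_dbar : ∀ x, d (dbar x) + dbar (d x) = 0
  d_mul : ∀ {a : ℤ × ℤ} {x : carrier} (y : carrier), x ∈ gr a →
    d (x * y) = d x * y + (a.1 + a.2).negOnePow • (x * d y)
  dbar_mul : ∀ {a : ℤ × ℤ} {x : carrier} (y : carrier), x ∈ gr a →
    dbar (x * y) = dbar x * y + (a.1 + a.2).negOnePow • (x * dbar y)

attribute [instance] CBBA.ring CBBA.algebra

section
variable {K : Type u} [Field K]

/-- Concentrated in bidegrees `(i, j)` with `i ≥ 0` and `j ≥ 0`. -/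
def CBBA.Nonneg (A : CBBA K) : Prop := ∀ a : ℤ × ℤ, ¬ 0 ≤ a → A.gr a = ⊥

/-- Maps of cbba's. -/
structure CBBA.Hom (A B : CBBA K) where
  toAlgHom : A.carrier →ₐ[K] B.carrier
  map_gr : ∀ {a : ℤ × ℤ} {x : A.carrier}, x ∈ A.gr a → toAlgHom x ∈ B.gr a
  map_d : ∀ x, toAlgHom (A.d x) = B.d (toAlgHom x)
  map_dbar : ∀ x, toAlgHom (A.dbar x) = B.dbar (toAlgHom x)

instance (A B : CBBA K) : CoeFun (A.Hom B) (fun _ => A.carrier → B.carrier) :=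
  ⟨fun f => f.toAlgHom⟩

/-- `g.comp f` is `g ∘ f`. -/
def CBBA.Hom.comp {A B C : CBBA K} (g : B.Hom C) (f : A.Hom B) : A.Hom C where
  toAlgHom := g.toAlgHom.comp f.toAlgHom
  map_gr hx := g.map_gr (f.map_gr hx)
  map_d x := by simp [f.map_d, g.map_d]
  map_dbar x := by simp [f.map_dbar, g.map_dbar]

/-- A cbba map defined on a subalgebra `S` of `A` (used for differential bigraded subalgebras). -/
structure CBBA.PartialHom (A : CBBA K) (S : Subalgebra K A.carrier) (C : CBBA K) where
  toAlgHom : S →ₐ[K] C.carrier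
  map_gr : ∀ {a : ℤ × ℤ} {x : S}, (x : A.carrier) ∈ A.gr a → toAlgHom x ∈ C.gr a
  map_d : ∀ x y : S, (y : A.carrier) = A.d x → toAlgHom y = C.d (toAlgHom x)
  map_dbar : ∀ x y : S, (y : A.carrier) = A.dbar x → toAlgHom y = C.dbar (toAlgHom x)

/-! ## Bicomplexes with an action of a cbba, and mapping cones -/

/-- A bicomplex with a compatible right action of the cbba `B`. -/
structure DGModule (B : CBBA K) extends Bicomplex K where
  act : carrier →ₗ[K] B.carrier →ₗ[K] carrier
  act_one : ∀ x, act x 1 = x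
  act_mul : ∀ x b b', act x (b * b') = act (act x b) b'
  act_mem : ∀ {a c : ℤ × ℤ} {x : carrier} {b : B.carrier},
    x ∈ gr a → b ∈ B.gr c → act x b ∈ gr (a + c)
  d_act : ∀ {a : ℤ × ℤ} {x : carrier} (b : B.carrier), x ∈ gr a →
    d (act x b) = act (d x) b + (a.1 + a.2).negOnePow • act x (B.d b)
  dbar_act : ∀ {a : ℤ × ℤ} {x : carrier} (b : B.carrier), x ∈ gr a →
    dbar (act x b) = act (dbar x) b + (a.1 + a.2).negOnePow • act x (B.dbar b)

/-- Maps of bicomplexes that commute with the action of `B`. -/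
structure DGModule.Hom {B : CBBA K} (M N : DGModule B) where
  toLinearMap : M.carrier →ₗ[K] N.carrier
  map_gr : ∀ {a : ℤ × ℤ} {x : M.carrier}, x ∈ M.gr a → toLinearMap x ∈ N.gr a
  map_d : ∀ x, toLinearMap (M.d x) = N.d (toLinearMap x)
  map_dbar : ∀ x, toLinearMap (M.dbar x) = N.dbar (toLinearMap x)
  map_act : ∀ x b, toLinearMap (M.act x b) = N.act (toLinearMap x) b

/-- A cbba map `ν : B → C` makes `C` a bicomplex with an action of `B`: `c · b = c * ν b`. -/
def CBBA.Hom.toModule {B C : CBBA K} (ν : B.Hom C) : DGModule B where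
  carrier := C.carrier
  gr := C.gr
  internal := C.internal
  d := C.d
  dbar := C.dbar
  d_mem := C.d_mem
  dbar_mem := C.dbar_mem
  d_d := C.d_d
  dbar_dbar := C.dbar_dbar
  d_dbar := C.d_dbar
  act := (LinearMap.mul K C.carrier).compl₂ ν.toAlgHom.toLinearMap
  act_one x := by simp
  act_mul x b b' := by simp [mul_assoc]
  act_mem hx hb := by simpa using C.mul_mem hx (ν.map_gr hb)
  d_act b hx := by simpa [ν.map_d] using C.d_mul (ν b) hx
  dbar_act b hx := by simpa [ν.map_dbar] using C.dbar_mul (ν b) hx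

/-- A map `p` of cbba's under `B` is a map of bicomplexes with an action of `B`. -/
def CBBA.Hom.toModuleHom {B C C' : CBBA K} (p : C'.Hom C) (ν' : B.Hom C') (ν : B.Hom C)
    (h : p.comp ν' = ν) : DGModule.Hom ν'.toModule ν.toModule where
  toLinearMap := p.toAlgHom.toLinearMap
  map_gr hx := p.map_gr hx
  map_d x := p.map_d x
  map_dbar x := p.map_dbar x
  map_act x b := by
    subst h
    exact map_mul p.toAlgHom _ _

theorem isInternal_prod {M N : Type u} [AddCommGroup M] [Module K M] [AddCommGroup N]
    [Module K N] {P : ℤ × ℤ → Submodule K M} {Q : ℤ × ℤ → Submodule K N}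
    (hP : DirectSum.IsInternal P) (hQ : DirectSum.IsInternal Q) :
    DirectSum.IsInternal (fun a => (P a).prod (Q a)) := by
  rw [DirectSum.isInternal_submodule_iff_iSupIndep_and_iSup_eq_top] at *
  refine ⟨fun i => ?_, ?_⟩
  · have h : (⨆ j, ⨆ (_ : j ≠ i), (P j).prod (Q j)) ≤
        (⨆ j, ⨆ (_ : j ≠ i), P j).prod (⨆ j, ⨆ (_ : j ≠ i), Q j) :=
      iSup₂_le fun j hj => Submodule.prod_mono (le_iSup₂_of_le j hj le_rfl)
        (le_iSup₂_of_le j hj le_rfl)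
    refine Disjoint.mono_right h ?_
    rw [disjoint_iff, Submodule.prod_inf_prod, (hP.1 i).eq_bot, (hQ.1 i).eq_bot,
      Submodule.prod_bot]
  · rw [eq_top_iff]
    have h1 : ∀ x : M, (x, (0 : N)) ∈ ⨆ a, (P a).prod (Q a) := by
      intro x
      have hx : x ∈ ⨆ a, P a := by rw [hP.2]; trivial
      have : Submodule.map (LinearMap.inl K M N) (⨆ a, P a) ≤ ⨆ a, (P a).prod (Q a) := by
        rw [Submodule.map_iSup]
        refine iSup_mono fun a => ?_
        rintro _ ⟨y, hy, rfl⟩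
        exact ⟨hy, (Q a).zero_mem⟩
      exact this ⟨x, hx, rfl⟩
    have h2 : ∀ y : N, ((0 : M), y) ∈ ⨆ a, (P a).prod (Q a) := by
      intro x
      have hx : x ∈ ⨆ a, Q a := by rw [hQ.2]; trivial
      have : Submodule.map (LinearMap.inr K M N) (⨆ a, Q a) ≤ ⨆ a, (P a).prod (Q a) := by
        rw [Submodule.map_iSup]
        refine iSup_mono fun a => ?_
        rintro _ ⟨y, hy, rfl⟩
        exact ⟨(P a).zero_mem, hy⟩
      exact this ⟨x, hx, rfl⟩
    rintro ⟨x, y⟩ -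
    simpa using Submodule.add_mem _ (h1 x) (h2 y)

theorem isInternal_shift {M : Type u} [AddCommGroup M] [Module K M]
    {P : ℤ × ℤ → Submodule K M} (hP : DirectSum.IsInternal P) (s : ℤ × ℤ) :
    DirectSum.IsInternal (fun a => P (a + s)) := by
  rw [DirectSum.isInternal_submodule_iff_iSupIndep_and_iSup_eq_top] at *
  exact ⟨hP.1.comp (add_left_injective s), by
    rw [← hP.2]; exact (Equiv.addRight s).iSup_comp (g := P)⟩

/-- The mapping cone of `f : M → N`. With `L` the bicomplex spanned by `l` in bidegree `(-1,-1)`,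
`∂l` in bidegree `(0,-1)` and `∂̄l` in bidegree `(-1,0)`, the quadruple `(w, a, b, c)` stands for
`w + l ⊗ a + ∂l ⊗ b + ∂̄l ⊗ c` in `N ⊕ L ⊗ M`, so that `∂∂̄l ⊗ m` is identified with `-f m`. -/
def DGModule.Cone {B : CBBA K} {M N : DGModule B} (f : DGModule.Hom M N) : DGModule B where
  carrier := N.carrier × M.carrier × M.carrier × M.carrier
  gr a := (N.gr a).prod ((M.gr (a + (1, 1))).prod
    ((M.gr (a + (0, 1))).prod (M.gr (a + (1, 0)))))
  internal := isInternal_prod N.internal (isInternal_prod (isInternal_shift M.internal _)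
    (isInternal_prod (isInternal_shift M.internal _) (isInternal_shift M.internal _)))
  d :=
    { toFun := fun z => (N.d z.1 - f.toLinearMap z.2.2.2, M.d z.2.1, z.2.1 - M.d z.2.2.1,
        -M.d z.2.2.2)
      map_add' := fun z z' => by
        ext <;> simp <;> abel
      map_smul' := fun r z => by
        ext <;> simp [smul_sub] }
  dbar :=
    { toFun := fun z => (N.dbar z.1 + f.toLinearMap z.2.2.1, M.dbar z.2.1, -M.dbar z.2.2.1,
        z.2.1 - M.dbar z.2.2.2)
      map_add' := fun z z' => by
        ext <;> simp <;> abel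
      map_smul' := fun r z => by
        ext <;> simp [smul_sub] }
  d_mem := by
    rintro a ⟨w, x, y, z⟩ ⟨hw, hx, hy, hz⟩
    simp only at hw hx hy hz
    refine ⟨Submodule.sub_mem _ (N.d_mem hw) (f.map_gr hz), ?_, Submodule.sub_mem _ ?_ ?_,
      Submodule.neg_mem _ ?_⟩
    · simpa [add_right_comm] using M.d_mem hx
    · simpa [add_assoc] using hx
    · simpa [add_right_comm] using M.d_mem hy
    · simpa [add_right_comm] using M.d_mem hz
  dbar_mem := by
    rintro a ⟨w, x, y, z⟩ ⟨hw, hx, hy, hz⟩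
    simp only at hw hx hy hz
    refine ⟨Submodule.add_mem _ (N.dbar_mem hw) (f.map_gr hy), ?_, Submodule.neg_mem _ ?_,
      Submodule.sub_mem _ ?_ ?_⟩
    · simpa [add_right_comm] using M.dbar_mem hx
    · simpa [add_right_comm] using M.dbar_mem hy
    · simpa [add_assoc] using hx
    · simpa [add_right_comm] using M.dbar_mem hz
  d_d := by
    rintro ⟨w, x, y, z⟩
    ext <;> simp [N.d_d, M.d_d, f.map_d]
  dbar_dbar := by
    rintro ⟨w, x, y, z⟩
    ext <;> simp [N.dbar_dbar, M.dbar_dbar, f.map_dbar]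
  d_dbar := by
    rintro ⟨w, x, y, z⟩
    have h1 := N.d_dbar w
    have h2 := M.d_dbar x
    have h3 := M.d_dbar y
    have h4 := M.d_dbar z
    ext
    · simp only [LinearMap.coe_mk, AddHom.coe_mk, Prod.mk_add_mk, map_add, map_sub, f.map_d,
        f.map_dbar, Prod.fst_zero]
      rw [← h1]; abel
    · simpa using h2
    · simp only [LinearMap.coe_mk, AddHom.coe_mk, Prod.mk_add_mk, map_neg, map_sub,
        Prod.fst_zero, Prod.snd_zero]
      rw [← h3]; abel
    · simp only [LinearMap.coe_mk, AddHom.coe_mk, Prod.mk_add_mk, map_neg, map_sub,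
        Prod.snd_zero]
      rw [← h4]; abel
  act := LinearMap.mk₂ K (fun z b => (N.act z.1 b, M.act z.2.1 b, M.act z.2.2.1 b,
      M.act z.2.2.2 b)) (by intros; simp) (by intros; simp) (by intros; simp) (by intros; simp)
  act_one := by rintro ⟨w, x, y, z⟩; simp [N.act_one, M.act_one]
  act_mul := by rintro ⟨w, x, y, z⟩ b b'; simp [N.act_mul, M.act_mul]
  act_mem := by
    rintro a c ⟨w, x, y, z⟩ b ⟨hw, hx, hy, hz⟩ hb
    simp only at hw hx hy hz
    refine ⟨N.act_mem hw hb, ?_, ?_, ?_⟩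
    · simpa [add_right_comm] using M.act_mem hx hb
    · simpa [add_right_comm] using M.act_mem hy hb
    · simpa [add_right_comm] using M.act_mem hz hb
  d_act := by
    rintro a ⟨w, x, y, z⟩ b ⟨hw, hx, hy, hz⟩
    simp only at hw hx hy hz
    have e1 := N.d_act b hw
    have e2 := M.d_act b hx
    have e3 := M.d_act b hy
    have e4 := M.d_act b hz
    have s2 : (a.1 + 1 + (a.2 + 1)).negOnePow = (a.1 + a.2).negOnePow := by
      rw [show a.1 + 1 + (a.2 + 1) = a.1 + a.2 + 1 + 1 by ring, Int.negOnePow_succ,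
        Int.negOnePow_succ, neg_neg]
    have s3 : (a.1 + 0 + (a.2 + 1)).negOnePow = -(a.1 + a.2).negOnePow := by
      rw [show a.1 + 0 + (a.2 + 1) = a.1 + a.2 + 1 by ring, Int.negOnePow_succ]
    have s4 : (a.1 + 1 + (a.2 + 0)).negOnePow = -(a.1 + a.2).negOnePow := by
      rw [show a.1 + 1 + (a.2 + 0) = a.1 + a.2 + 1 by ring, Int.negOnePow_succ]
    simp only [Prod.fst_add, Prod.snd_add, s2, s3, s4, Units.neg_smul] at e2 e3 e4
    ext
    · simp [e1, f.map_act]; abel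
    · simp [e2]
    · simp [e3]; abel
    · simp [e4]; abel
  dbar_act := by
    rintro a ⟨w, x, y, z⟩ b ⟨hw, hx, hy, hz⟩
    simp only at hw hx hy hz
    have e1 := N.dbar_act b hw
    have e2 := M.dbar_act b hx
    have e3 := M.dbar_act b hy
    have e4 := M.dbar_act b hz
    have s2 : (a.1 + 1 + (a.2 + 1)).negOnePow = (a.1 + a.2).negOnePow := by
      rw [show a.1 + 1 + (a.2 + 1) = a.1 + a.2 + 1 + 1 by ring, Int.negOnePow_succ,
        Int.negOnePow_succ, neg_neg]
    have s3 : (a.1 + 0 + (a.2 + 1)).negOnePow = -(a.1 + a.2).negOnePow := by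
      rw [show a.1 + 0 + (a.2 + 1) = a.1 + a.2 + 1 by ring, Int.negOnePow_succ]
    have s4 : (a.1 + 1 + (a.2 + 0)).negOnePow = -(a.1 + a.2).negOnePow := by
      rw [show a.1 + 1 + (a.2 + 0) = a.1 + a.2 + 1 by ring, Int.negOnePow_succ]
    simp only [Prod.fst_add, Prod.snd_add, s2, s3, s4, Units.neg_smul] at e2 e3 e4
    ext
    · simp [e1, f.map_act]; abel
    · simp [e2]
    · simp [e3]; abel
    · simp [e4]; abel

/-! ## Twisting coefficients and twisted homotopy -/

/-- The part of bidegree `a` of `V ⊗ B⁺`, where `B⁺` is the part of `B` of positive total degree. -/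
def tensorPlus (V : Bicomplex K) (B : CBBA K) (a : ℤ × ℤ) :
    Submodule K (V.carrier ⊗[K] B.carrier) :=
  ⨆ (b : ℤ × ℤ) (c : ℤ × ℤ) (_ : b + c = a ∧ 0 < c.1 + c.2),
    LinearMap.range (TensorProduct.mapIncl (V.gr b) (B.gr c))

/-- A pair of twisting coefficients `Θ, Θ̄ : V → B⁺ ⊗ V` of bidegrees `(1,0)` and `(0,1)`.
The factor `V` is written on the left, through the symmetry
`b ⊗ v ↦ (-1)^(|b| |v|) v ⊗ b` of graded tensor products. -/
structure Twisting (V : Bicomplex K) (B : CBBA K) where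
  Θ : V.carrier →ₗ[K] V.carrier ⊗[K] B.carrier
  Θbar : V.carrier →ₗ[K] V.carrier ⊗[K] B.carrier
  Θ_mem : ∀ {a : ℤ × ℤ} {x : V.carrier}, x ∈ V.gr a → Θ x ∈ tensorPlus V B (a + (1, 0))
  Θbar_mem : ∀ {a : ℤ × ℤ} {x : V.carrier}, x ∈ V.gr a → Θbar x ∈ tensorPlus V B (a + (0, 1))

namespace DGModule
variable {B : CBBA K} {V : Bicomplex K}

/-- Linear maps `V → M` of bidegree `a`. -/
def homDeg (V : Bicomplex K) (M : DGModule B) (a : ℤ × ℤ) :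
    Submodule K (V.carrier →ₗ[K] M.carrier) where
  carrier := {ψ | ∀ (b : ℤ × ℤ) (x : V.carrier), x ∈ V.gr b → ψ x ∈ M.gr (b + a)}
  add_mem' h h' b x hx := Submodule.add_mem _ (h b x hx) (h' b x hx)
  zero_mem' _ _ _ := Submodule.zero_mem _
  smul_mem' r _ h b x hx := Submodule.smul_mem _ r (h b x hx)

/-- The composite of `Θ : V → V ⊗ B` with `v ⊗ b ↦ ψ(v) · b`. No sign occurs, since `B` acts from
the right; in terms of `B ⊗ V` and a left action this is `(1 ⊗ ψ) Θ` with the Koszul sign rule. -/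
noncomputable def twist (M : DGModule B) (Θ : V.carrier →ₗ[K] V.carrier ⊗[K] B.carrier)
    (ψ : V.carrier →ₗ[K] M.carrier) : V.carrier →ₗ[K] M.carrier :=
  TensorProduct.lift (M.act ∘ₗ ψ) ∘ₗ Θ

theorem twist_add (M : DGModule B) (Θ : V.carrier →ₗ[K] V.carrier ⊗[K] B.carrier)
    (ψ ψ' : V.carrier →ₗ[K] M.carrier) : M.twist Θ (ψ + ψ') = M.twist Θ ψ + M.twist Θ ψ' := by
  have : TensorProduct.lift (M.act ∘ₗ (ψ + ψ')) =
      TensorProduct.lift (M.act ∘ₗ ψ) + TensorProduct.lift (M.act ∘ₗ ψ') :=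
    TensorProduct.ext' fun v b => by simp
  simp only [twist, this, LinearMap.add_comp]

theorem twist_smul (M : DGModule B) (Θ : V.carrier →ₗ[K] V.carrier ⊗[K] B.carrier) (r : K)
    (ψ : V.carrier →ₗ[K] M.carrier) : M.twist Θ (r • ψ) = r • M.twist Θ ψ := by
  have : TensorProduct.lift (M.act ∘ₗ (r • ψ)) = r • TensorProduct.lift (M.act ∘ₗ ψ) :=
    TensorProduct.ext' fun v b => by simp
  simp only [twist, this, LinearMap.smul_comp]

/-- The twisted differential `∂_Θ ψ = ∂ ψ - (-1)^n ψ ∂_V - (-1)^n (1 ⊗ ψ) Θ` on maps `ψ : V → M`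
of total degree `n`. -/
noncomputable def tD (M : DGModule B) (T : Twisting V B) (n : ℤ) :
    (V.carrier →ₗ[K] M.carrier) →ₗ[K] (V.carrier →ₗ[K] M.carrier) where
  toFun ψ := M.d ∘ₗ ψ - n.negOnePow • (ψ ∘ₗ V.d + M.twist T.Θ ψ)
  map_add' ψ ψ' := by
    simp only [twist_add, LinearMap.comp_add, LinearMap.add_comp, smul_add]
    abel
  map_smul' r ψ := by
    simp only [twist_smul, LinearMap.comp_smul, LinearMap.smul_comp, smul_add, smul_sub,
      RingHom.id_apply, smul_comm r]

/-- The twisted differential `∂̄_Θ̄ ψ = ∂̄ ψ - (-1)^n ψ ∂̄_V - (-1)^n (1 ⊗ ψ) Θ̄` on maps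
`ψ : V → M` of total degree `n`. -/
noncomputable def tDbar (M : DGModule B) (T : Twisting V B) (n : ℤ) :
    (V.carrier →ₗ[K] M.carrier) →ₗ[K] (V.carrier →ₗ[K] M.carrier) where
  toFun ψ := M.dbar ∘ₗ ψ - n.negOnePow • (ψ ∘ₗ V.dbar + M.twist T.Θbar ψ)
  map_add' ψ ψ' := by
    simp only [twist_add, LinearMap.comp_add, LinearMap.add_comp, smul_add]
    abel
  map_smul' r ψ := by
    simp only [twist_smul, LinearMap.comp_smul, LinearMap.smul_comp, smul_add, smul_sub,
      RingHom.id_apply, smul_comm r]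

/-- Bott-Chern cocycles of bidegree `a` in `Hom(V, M)`: `ker ∂_Θ ∩ ker ∂̄_Θ̄`. -/
noncomputable def cocyclesBC (M : DGModule B) (T : Twisting V B) (a : ℤ × ℤ) :
    Submodule K (V.carrier →ₗ[K] M.carrier) :=
  homDeg V M a ⊓ LinearMap.ker (M.tD T (a.1 + a.2)) ⊓ LinearMap.ker (M.tDbar T (a.1 + a.2))

/-- Bott-Chern coboundaries of bidegree `a` in `Hom(V, M)`: `im ∂_Θ ∂̄_Θ̄`. -/
noncomputable def boundariesBC (M : DGModule B) (T : Twisting V B) (a : ℤ × ℤ) :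
    Submodule K (V.carrier →ₗ[K] M.carrier) :=
  (homDeg V M (a - (1, 1))).map (M.tD T (a.1 + a.2 - 1) ∘ₗ M.tDbar T (a.1 + a.2 - 2))

/-- Aeppli cocycles of bidegree `a` in `Hom(V, M)`: `ker ∂_Θ ∂̄_Θ̄`. -/
noncomputable def cocyclesA (M : DGModule B) (T : Twisting V B) (a : ℤ × ℤ) :
    Submodule K (V.carrier →ₗ[K] M.carrier) :=
  homDeg V M a ⊓ LinearMap.ker (M.tD T (a.1 + a.2 + 1) ∘ₗ M.tDbar T (a.1 + a.2))

/-- Aeppli coboundaries of bidegree `a` in `Hom(V, M)`: `im ∂_Θ + im ∂̄_Θ̄`. -/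
noncomputable def boundariesA (M : DGModule B) (T : Twisting V B) (a : ℤ × ℤ) :
    Submodule K (V.carrier →ₗ[K] M.carrier) :=
  (homDeg V M (a - (1, 0))).map (M.tD T (a.1 + a.2 - 1)) ⊔
    (homDeg V M (a - (0, 1))).map (M.tDbar T (a.1 + a.2 - 1))

/-- Twisted Bott-Chern cohomology of `Hom(V, M)` in bidegree `a`. -/
abbrev HBC (M : DGModule B) (T : Twisting V B) (a : ℤ × ℤ) : Type u :=
  M.cocyclesBC T a ⧸ (M.boundariesBC T a).submoduleOf (M.cocyclesBC T a)

/-- Twisted Aeppli cohomology of `Hom(V, M)` in bidegree `a`. -/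
abbrev HA (M : DGModule B) (T : Twisting V B) (a : ℤ × ℤ) : Type u :=
  M.cocyclesA T a ⧸ (M.boundariesA T a).submoduleOf (M.cocyclesA T a)

/-- Twisted homotopy `[V, M]_{Θ,Θ̄}`: the Bott-Chern cohomology of `Hom(V, M)` in bidegree 0. -/
abbrev TwistedHomotopy (M : DGModule B) (T : Twisting V B) : Type u := M.HBC T 0

namespace Hom
variable {M N : DGModule B}

/-- Composition with `f : M → N`. -/
def post (f : DGModule.Hom M N) (V : Bicomplex K) :
    (V.carrier →ₗ[K] M.carrier) →ₗ[K] (V.carrier →ₗ[K] N.carrier) where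
  toFun ψ := f.toLinearMap ∘ₗ ψ
  map_add' _ _ := LinearMap.comp_add _ _ _
  map_smul' _ _ := LinearMap.comp_smul _ _ _

theorem post_mem (f : DGModule.Hom M N) {a : ℤ × ℤ} {ψ : V.carrier →ₗ[K] M.carrier}
    (h : ψ ∈ homDeg V M a) : f.post V ψ ∈ homDeg V N a := fun b x hx => f.map_gr (h b x hx)

theorem post_twist (f : DGModule.Hom M N) (Θ : V.carrier →ₗ[K] V.carrier ⊗[K] B.carrier)
    (ψ : V.carrier →ₗ[K] M.carrier) : f.post V (M.twist Θ ψ) = N.twist Θ (f.post V ψ) := by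
  have : f.toLinearMap ∘ₗ TensorProduct.lift (M.act ∘ₗ ψ) =
      TensorProduct.lift (N.act ∘ₗ (f.toLinearMap ∘ₗ ψ)) :=
    TensorProduct.ext' fun v b => by simp [f.map_act]
  simp only [twist, post, LinearMap.coe_mk, AddHom.coe_mk, ← LinearMap.comp_assoc, this]

theorem post_tD (f : DGModule.Hom M N) (T : Twisting V B) (n : ℤ)
    (ψ : V.carrier →ₗ[K] M.carrier) : f.post V (M.tD T n ψ) = N.tD T n (f.post V ψ) := by
  ext v
  have h := LinearMap.congr_fun (f.post_twist T.Θ ψ) v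
  simp only [post, LinearMap.coe_mk, AddHom.coe_mk, LinearMap.comp_apply] at h
  simp [tD, post, f.map_d, Units.smul_def, h]

theorem post_tDbar (f : DGModule.Hom M N) (T : Twisting V B) (n : ℤ)
    (ψ : V.carrier →ₗ[K] M.carrier) : f.post V (M.tDbar T n ψ) = N.tDbar T n (f.post V ψ) := by
  ext v
  have h := LinearMap.congr_fun (f.post_twist T.Θbar ψ) v
  simp only [post, LinearMap.coe_mk, AddHom.coe_mk, LinearMap.comp_apply] at h
  simp [tDbar, post, f.map_dbar, Units.smul_def, h]

theorem post_cocyclesBC (f : DGModule.Hom M N) (T : Twisting V B) (a : ℤ × ℤ) :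
    ∀ ψ ∈ M.cocyclesBC T a, f.post V ψ ∈ N.cocyclesBC T a := by
  rintro ψ ⟨⟨h0, h1⟩, h2⟩
  simp only [SetLike.mem_coe, LinearMap.mem_ker] at h1 h2
  refine ⟨⟨f.post_mem h0, ?_⟩, ?_⟩
  · simp only [SetLike.mem_coe, LinearMap.mem_ker]; rw [← post_tD, h1, map_zero]
  · simp only [SetLike.mem_coe, LinearMap.mem_ker]; rw [← post_tDbar, h2, map_zero]

theorem post_cocyclesA (f : DGModule.Hom M N) (T : Twisting V B) (a : ℤ × ℤ) :
    ∀ ψ ∈ M.cocyclesA T a, f.post V ψ ∈ N.cocyclesA T a := by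
  rintro ψ ⟨h0, h1⟩
  simp only [SetLike.mem_coe, LinearMap.mem_ker, LinearMap.comp_apply] at h1
  refine ⟨f.post_mem h0, ?_⟩
  simp only [SetLike.mem_coe, LinearMap.mem_ker, LinearMap.comp_apply]
  rw [← post_tDbar, ← post_tD, h1, map_zero]

/-- The map induced by `f` on twisted Bott-Chern cohomology. -/
noncomputable def mapHBC (f : DGModule.Hom M N) (T : Twisting V B) (a : ℤ × ℤ) :
    M.HBC T a →ₗ[K] N.HBC T a :=
  Submodule.mapQ _ _ ((f.post V).restrict (f.post_cocyclesBC T a)) (by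
    rintro ⟨ψ, hψ⟩ ⟨χ, hχ, e⟩
    refine ⟨f.post V χ, f.post_mem hχ, ?_⟩
    simp only [Submodule.subtype_apply, LinearMap.comp_apply] at e
    subst e
    simp [post_tD, post_tDbar])

/-- The map induced by `f` on twisted Aeppli cohomology. -/
noncomputable def mapHA (f : DGModule.Hom M N) (T : Twisting V B) (a : ℤ × ℤ) :
    M.HA T a →ₗ[K] N.HA T a :=
  Submodule.mapQ _ _ ((f.post V).restrict (f.post_cocyclesA T a)) (by
    rintro ⟨ψ, hψ⟩ h
    simp only [Submodule.submoduleOf, Submodule.mem_comap, Submodule.subtype_apply, boundariesA,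
      Submodule.mem_sup] at h ⊢
    obtain ⟨_, ⟨χ, hχ, rfl⟩, _, ⟨χ', hχ', rfl⟩, rfl⟩ := h
    refine ⟨_, ⟨f.post V χ, f.post_mem hχ, rfl⟩, _, ⟨f.post V χ', f.post_mem hχ', rfl⟩, ?_⟩
    simp [post_tD, post_tDbar])

/-- `f` is a quasi-isomorphism for the coefficients `(V, Θ, Θ̄)`: the induced map
`Hom(V, M) → Hom(V, N)` is an isomorphism on twisted Bott-Chern and Aeppli cohomology. -/
def IsQuasiIsoFor (f : DGModule.Hom M N) (T : Twisting V B) : Prop :=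
  ∀ a : ℤ × ℤ, Function.Bijective (f.mapHBC T a) ∧ Function.Bijective (f.mapHA T a)

end Hom
end DGModule

/-! ## Free graded-commutative extensions and Hirsch extensions -/

/-- The relations of graded commutativity (total degree) in the tensor algebra. -/
inductive FreeGCA.Rel {U : Type u} [AddCommGroup U] [Module K U] (gr : ℤ × ℤ → Submodule K U) :
    TensorAlgebra K U → TensorAlgebra K U → Prop
  | comm {a b : ℤ × ℤ} {x y : U} (hx : x ∈ gr a) (hy : y ∈ gr b) :
      FreeGCA.Rel gr (TensorAlgebra.ι K x * TensorAlgebra.ι K y)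
        (((a.1 + a.2) * (b.1 + b.2)).negOnePow • (TensorAlgebra.ι K y * TensorAlgebra.ι K x))

/-- The free graded-commutative algebra `⋀ U` on a bigraded vector space `U`. -/
abbrev FreeGCA {U : Type u} [AddCommGroup U] [Module K U] (gr : ℤ × ℤ → Submodule K U) : Type u :=
  RingQuot (FreeGCA.Rel gr)

/-- With the map `g : U → A` of bidegree 0 and the map `i : B → A`, one has `A = B ⊗ ⋀ U` as an
algebra. -/
def IsFreeOver {B A : CBBA K} (i : B.Hom A) {U : Type u} [AddCommGroup U] [Module K U]
    (gr : ℤ × ℤ → Submodule K U) (g : U →ₗ[K] A.carrier) : Prop :=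
  (∀ (a : ℤ × ℤ) (x : U), x ∈ gr a → g x ∈ A.gr a) ∧
  ∃ Φ : FreeGCA gr →ₐ[K] A.carrier,
    (∀ x : U, Φ (RingQuot.mkAlgHom K (FreeGCA.Rel gr) (TensorAlgebra.ι K x)) = g x) ∧
    Function.Bijective
      (LinearMap.mul' K A.carrier ∘ₗ TensorProduct.map i.toAlgHom.toLinearMap Φ.toLinearMap)

/-- The bigrading of the direct sum of the spaces `W i`, where the `i`-th one is shifted so that
`(W i)^b` is placed in bidegree `b + s i`. -/
def sumGr {ι : Type} [DecidableEq ι] (W : ι → Bicomplex K) (s : ι → ℤ × ℤ) (a : ℤ × ℤ) :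
    Submodule K (⨁ i, (W i).carrier) :=
  ⨆ i, ((W i).gr (a - s i)).map (DirectSum.lof K ι (fun i => (W i).carrier) i)

/-- The subalgebra of `A` generated by `B` and the generators `V 0, …, V (n - 1)`. -/
def stageOf {B A : CBBA K} (incl : B.Hom A) {V : ℕ → Bicomplex K}
    (gen : ∀ n, (V n).carrier →ₗ[K] A.carrier) (n : ℕ) : Subalgebra K A.carrier :=
  Algebra.adjoin K (Set.range incl ∪ ⋃ k ∈ Set.Iio n, Set.range (gen k))

/-- `A` is a successive linear Hirsch extension of `B` with local coefficients in `B`: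
`A = B ⊗ ⋀ (V 0 ⊕ V 1 ⊕ …)`, and with `A_n = B ⊗ ⋀ (V 0 ⊕ … ⊕ V (n - 1))` the differentials of
`A` on the generators `V n` have the form `∂ = ∂_V + φ + Θ`, `∂̄ = ∂̄_V + φ̄ + Θ̄` with
`φ, φ̄ : V n → A_n` and `Θ, Θ̄ : V n → B⁺ ⊗ V n`. So `A_0 = B`, each `A_{n+1}` is a linear
Hirsch extension of `A_n` by `V n`, and `A` is the union of the `A_n`. (That `Θ, Θ̄` is a commuting
pair of local systems is the vanishing of `∂²`, `∂̄²` and `∂∂̄ + ∂̄∂` in `A`.) -/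
structure SuccHirschExt (B A : CBBA K) where
  incl : B.Hom A
  V : ℕ → Bicomplex K
  T : ∀ n, Twisting (V n) B
  gen : ∀ n, (V n).carrier →ₗ[K] A.carrier
  free : IsFreeOver incl (sumGr V (fun _ => 0))
    (DirectSum.toModule K ℕ A.carrier gen)
  phi_mem : ∀ n x, incl.toModule.tD (T n) 0 (gen n) x ∈ stageOf incl gen n
  phibar_mem : ∀ n x, incl.toModule.tDbar (T n) 0 (gen n) x ∈ stageOf incl gen n

namespace SuccHirschExt
variable {B A : CBBA K}

/-- The `n`-th stage `A_n` of the extension. -/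
def stage (E : SuccHirschExt B A) (n : ℕ) : Subalgebra K A.carrier := stageOf E.incl E.gen n

/-- The map `φ : V n → A_n`, that is `x ↦ ∂ x - ∂_V x - Θ x`. -/
noncomputable def phi (E : SuccHirschExt B A) (n : ℕ) : (E.V n).carrier →ₗ[K] E.stage n :=
  (E.incl.toModule.tD (E.T n) 0 (E.gen n)).codRestrict (Subalgebra.toSubmodule (E.stage n))
    (E.phi_mem n)

/-- The map `φ̄ : V n → A_n`, that is `x ↦ ∂̄ x - ∂̄_V x - Θ̄ x`. -/
noncomputable def phibar (E : SuccHirschExt B A) (n : ℕ) : (E.V n).carrier →ₗ[K] E.stage n :=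
  (E.incl.toModule.tDbar (E.T n) 0 (E.gen n)).codRestrict (Subalgebra.toSubmodule (E.stage n))
    (E.phibar_mem n)

/-! ## Cylinder objects and homotopy -/

/-- The underlying data of a cylinder object: a cbba with two maps `x, y` from `A` that agree on
`B`, and maps `φ_n : V n → A^□` of bidegree `(-1,-1)`. -/
structure CylinderData (E : SuccHirschExt B A) where
  obj : CBBA K
  x : A.Hom obj
  y : A.Hom obj
  base_eq : x.comp E.incl = y.comp E.incl
  φ : ∀ n, (E.V n).carrier →ₗ[K] obj.carrier

namespace CylinderData
variable {E : SuccHirschExt B A} (Z : E.CylinderData)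

/-- The map `B → A^□`. -/
def base : B.Hom Z.obj := Z.x.comp E.incl

/-- The generators `∂φ` (formed with the twisted differential). -/
noncomputable def dφ (n : ℕ) : (E.V n).carrier →ₗ[K] Z.obj.carrier :=
  Z.base.toModule.tD (E.T n) (-2) (Z.φ n)

/-- The generators `∂̄φ` (formed with the twisted differential). -/
noncomputable def dbarφ (n : ℕ) : (E.V n).carrier →ₗ[K] Z.obj.carrier :=
  Z.base.toModule.tDbar (E.T n) (-2) (Z.φ n)

/-- The element `∂∂̄φ` (formed with the twisted differentials). -/
noncomputable def ddbarφ (n : ℕ) : (E.V n).carrier →ₗ[K] Z.obj.carrier :=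
  Z.base.toModule.tD (E.T n) (-1) (Z.dbarφ n)

/-- The difference `δ = x - y` of the two copies of the generators. -/
def δ (n : ℕ) : (E.V n).carrier →ₗ[K] Z.obj.carrier :=
  Z.x.toAlgHom.toLinearMap ∘ₗ E.gen n - Z.y.toAlgHom.toLinearMap ∘ₗ E.gen n

/-- The five families of generators `x, y, φ, ∂φ, ∂̄φ` of the cylinder on `V n`. -/
noncomputable def gens (n : ℕ) : Fin 5 → ((E.V n).carrier →ₗ[K] Z.obj.carrier) :=
  ![Z.x.toAlgHom.toLinearMap ∘ₗ E.gen n, Z.y.toAlgHom.toLinearMap ∘ₗ E.gen n, Z.φ n,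
    Z.dφ n, Z.dbarφ n]

/-- The stage `A_n^□`: the subalgebra generated by `B` and the generators on `V 0, …, V (n - 1)`. -/
def stage (n : ℕ) : Subalgebra K Z.obj.carrier :=
  Algebra.adjoin K (Set.range Z.base ∪ ⋃ k ∈ Set.Iio n, ⋃ i : Fin 5, Set.range (Z.gens k i))

/-- The ideal `(φ, ∂φ, ∂̄φ, δ)` of `A_n^□`, with generators taken on `V 0, …, V (n - 1)`. -/
def ideal (n : ℕ) : Submodule K Z.obj.carrier :=
  Subalgebra.toSubmodule (Z.stage n) *
    Submodule.span K (⋃ k ∈ Set.Iio n, (Set.range (Z.φ k) ∪ Set.range (Z.dφ k) ∪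
      Set.range (Z.dbarφ k) ∪ Set.range (Z.δ k)))

theorem gens_mem_stage {n k : ℕ} (hk : k < n) (i : Fin 5) (v : (E.V k).carrier) :
    Z.gens k i v ∈ Z.stage n :=
  Algebra.subset_adjoin (Or.inr (by
    simp only [Set.mem_iUnion]
    exact ⟨k, hk, i, v, rfl⟩))

theorem ideal_le_stage (n : ℕ) : Z.ideal n ≤ Subalgebra.toSubmodule (Z.stage n) := by
  rw [ideal, Submodule.mul_le]
  intro s hs t ht
  refine (Z.stage n).mul_mem hs ?_
  have : Submodule.span K (⋃ k ∈ Set.Iio n, (Set.range (Z.φ k) ∪ Set.range (Z.dφ k) ∪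
      Set.range (Z.dbarφ k) ∪ Set.range (Z.δ k))) ≤ Subalgebra.toSubmodule (Z.stage n) := by
    rw [Submodule.span_le]
    intro t ht
    simp only [Set.mem_iUnion] at ht
    obtain ⟨k, hk, ((⟨v, rfl⟩ | ⟨v, rfl⟩) | ⟨v, rfl⟩) | ⟨v, rfl⟩⟩ := ht
    · exact Z.gens_mem_stage hk 2 v
    · exact Z.gens_mem_stage hk 3 v
    · exact Z.gens_mem_stage hk 4 v
    · exact (Z.stage n).sub_mem (Z.gens_mem_stage hk 0 v) (Z.gens_mem_stage hk 1 v)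
  exact this ht

end CylinderData

/-- A cylinder object `A^□` for the extension: `A^□ = B(x, y; φ, ∂φ, ∂̄φ)` is freely generated
over `B` by two copies `x, y` of the generators of `A` and by `φ, ∂φ, ∂̄φ`, and
`∂∂̄φ = δ + ω` where the correction term `ω = ε + ∂ζ + ∂̄η` has values in the ideal
`(φ, ∂φ, ∂̄φ, δ)` generated by the previous generators. All differentials are the twisted ones. -/
structure Cylinder (E : SuccHirschExt B A) extends CylinderData E where
  φ_deg : ∀ n, φ n ∈ DGModule.homDeg (E.V n) toCylinderData.base.toModule (-1, -1)
  free : IsFreeOver toCylinderData.base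
    (sumGr (fun i : ℕ × Fin 5 => E.V i.1) (fun i =>
      (![(0, 0), (0, 0), (-1, -1), (0, -1), (-1, 0)] : Fin 5 → ℤ × ℤ) i.2))
    (DirectSum.toModule K (ℕ × Fin 5) obj.carrier (fun i => toCylinderData.gens i.1 i.2))
  ω : ∀ n, (E.V n).carrier →ₗ[K] obj.carrier
  ω_mem : ∀ n v, ω n v ∈ toCylinderData.ideal n
  eq : ∀ n, toCylinderData.ddbarφ n = toCylinderData.δ n + ω n

/-- The correction term `ω` as a map into the stage `A_n^□`. -/
def Cylinder.ωStage {E : SuccHirschExt B A} (Z : E.Cylinder) (n : ℕ) :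
    (E.V n).carrier →ₗ[K] Z.stage n :=
  (Z.ω n).codRestrict (Subalgebra.toSubmodule (Z.stage n))
    fun v => Z.ideal_le_stage n (Z.ω_mem n v)

/-- The cbba maps `A → C` that extend `ν : B → C`. -/
abbrev MapsRel (E : SuccHirschExt B A) {C : CBBA K} (ν : B.Hom C) : Type u :=
  {f : A.Hom C // f.comp E.incl = ν}

/-- `f` and `g` are homotopic (rel `ν`): the map `(f, g)` extends to the cylinder object. -/
def Homotopic {E : SuccHirschExt B A} (Z : E.Cylinder) {C : CBBA K} {ν : B.Hom C}
    (f g : E.MapsRel ν) : Prop :=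
  ∃ H : Z.obj.Hom C, H.comp Z.x = f.1 ∧ H.comp Z.y = g.1

/-- `hHom(A, C; ν)`: the classes of cbba maps `A → C` extending `ν`, up to homotopy. -/
def hHom {E : SuccHirschExt B A} (Z : E.Cylinder) {C : CBBA K} (ν : B.Hom C) : Type u :=
  Quot (Homotopic Z (ν := ν))

/-- Composition with `p : C' → C`. -/
def MapsRel.post {E : SuccHirschExt B A} {C C' : CBBA K} {ν : B.Hom C} {ν' : B.Hom C'}
    (p : C'.Hom C) (h : p.comp ν' = ν) (f : E.MapsRel ν') : E.MapsRel ν :=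
  ⟨p.comp f.1, by obtain ⟨f, rfl⟩ := f; exact h⟩

/-- The map `hHom(A, C'; ν') → hHom(A, C; ν)` induced by `p : C' → C`. -/
def hHom.map {E : SuccHirschExt B A} (Z : E.Cylinder) {C C' : CBBA K} {ν : B.Hom C}
    {ν' : B.Hom C'} (p : C'.Hom C) (h : p.comp ν' = ν) : hHom Z ν' → hHom Z ν :=
  Quot.map (MapsRel.post p h) (by
    rintro ⟨f, hf⟩ ⟨g, hg⟩ ⟨H, rfl, rfl⟩
    exact ⟨p.comp H, rfl, rfl⟩)

/-- `p : C' → C` is a quasi-isomorphism for coefficients in `π(A, B) = V 0 ⊕ V 1 ⊕ …`. -/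
def IsQuasiIso (E : SuccHirschExt B A) {C C' : CBBA K} {ν : B.Hom C} {ν' : B.Hom C'}
    (p : C'.Hom C) (h : p.comp ν' = ν) : Prop :=
  ∀ n, (p.toModuleHom ν' ν h).IsQuasiIsoFor (E.T n)

/-! ## Lifting up to homotopy -/

/-- The `n`-th step of lifting `f : A → C` up to homotopy through `p : C' → C`, with `ν'` given
on `B`: a map `g : A_n → C'` extending `ν'` and a homotopy `h : A_n^□ → C` from the restriction of
`f` to `p g`. -/
structure PartialLift {E : SuccHirschExt B A} (Z : E.Cylinder) {C C' : CBBA K}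
    (ν' : B.Hom C') (p : C'.Hom C) (f : A.Hom C) (n : ℕ) where
  g : A.PartialHom (E.stage n) C'
  h : Z.obj.PartialHom (Z.stage n) C
  g_base : ∀ (b : B.carrier) (a : E.stage n), (a : A.carrier) = E.incl b → g.toAlgHom a = ν' b
  h_x : ∀ (a : E.stage n) (z : Z.stage n), (z : Z.obj.carrier) = Z.x a → h.toAlgHom z = f a
  h_y : ∀ (a : E.stage n) (z : Z.stage n), (z : Z.obj.carrier) = Z.y a →
    h.toAlgHom z = p (g.toAlgHom a)

namespace PartialLift
variable {E : SuccHirschExt B A} {Z : E.Cylinder} {C C' : CBBA K} {ν' : B.Hom C'}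
  {p : C'.Hom C} {f : A.Hom C} {n : ℕ}

/-- `L'` extends `L` from the `n`-th to the `(n+1)`-st stage. -/
def Extends (L' : PartialLift Z ν' p f (n + 1)) (L : PartialLift Z ν' p f n) : Prop :=
  (∀ (a : E.stage n) (a' : E.stage (n + 1)), (a' : A.carrier) = a →
    L'.g.toAlgHom a' = L.g.toAlgHom a) ∧
  (∀ (z : Z.stage n) (z' : Z.stage (n + 1)), (z' : Z.obj.carrier) = z →
    L'.h.toAlgHom z' = L.h.toAlgHom z)

/-- The obstruction cochain `V n → Cone(p)` of a partial lift `(g, h)`: with `x` the restriction of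
`f` to `V n`, and `φ' = g φ`, `φ̄' = g φ̄`, it is
`(x + h(ω)) + l ⊗ ∂̄φ' - ∂l ⊗ φ̄' + ∂̄l ⊗ φ'`. -/
noncomputable def obstruction {ν : B.Hom C} (hp : p.comp ν' = ν)
    (L : PartialLift Z ν' p f n) :
    (E.V n).carrier →ₗ[K] (DGModule.Cone (p.toModuleHom ν' ν hp)).carrier :=
  LinearMap.prod
    (f.toAlgHom.toLinearMap ∘ₗ E.gen n + L.h.toAlgHom.toLinearMap ∘ₗ Z.ωStage n)
    (LinearMap.prod (ν'.toModule.tDbar (E.T n) 1 (L.g.toAlgHom.toLinearMap ∘ₗ E.phi n))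
      (LinearMap.prod (-(L.g.toAlgHom.toLinearMap ∘ₗ E.phibar n))
        (L.g.toAlgHom.toLinearMap ∘ₗ E.phi n)))

end PartialLift
end SuccHirschExt
end

/-! The proof rests on stagewise extension of maps and on acyclic kernels in which the errors of a
tentative extension can be removed.

Calculus. A map ψ : V → M extends to V ⊗ B → M, and its twisted differential is the commutator of
this extension with the differentials of M and of V ⊗ B. Since ∂², ∂̄² and ∂∂̄ + ∂̄∂ vanish in A,
and V_n ⊗ B embeds in A, the differentials of V_n ⊗ B square to zero and anticommute
(`SuccHirschExt.flat`). Hence Hom(V_n, M) is a bicomplex. Extending a map g from A_n to A_{n+1}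
means choosing X on V_n with ∂X = gφ and ∂̄X = gφ̄. Extending a map h on the n-th stage of a
cylinder means choosing such X and Y for the two ends and a ψ with ∂∂̄ψ = X - Y + hω.

Acyclicity. Suppose that every Bott-Chern cocycle with values in the kernel of a surjection q is ∂∂̄
of a map into that kernel. Then any compatible pair of errors in the kernel has a common primitive
(`CBBA.Hom.IsAcyclicOn.exists_primitive`). So maps out of A lift strictly through q
(`SuccHirschExt.exists_strict_lift`), and homotopies lift with prescribed ends
(`SuccHirschExt.Cylinder.exists_lift`).

Squares. Acyclic retractions come from freely adjoining squares φ, ∂φ, ∂̄φ, ∂∂̄φ to a cbba P. The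
derivation s with s(∂∂̄φ) = φ satisfies [∂, [∂̄, s]] = E, where E counts the adjoined generators. In
characteristic 0 the operator E is invertible on the kernel of the retraction to P, so sE⁻¹ produces
∂∂̄-primitives there (`SquareExt.exists_contraction`).

Cylinders. The relation ∂∂̄φ = x - y + ω allows x to be traded for ∂∂̄φ, so a cylinder has the
universal property of the square extension of its y-copy of A. Read backwards, a cylinder is built
by finding a second section x of the retraction of the square extension. Symmetry and transitivity
of homotopy are obtained by lifting suitable homotopies through acyclic retractions.

The three parts. (i) Being a coboundary in the cone, written in components, is exactly the existence
of the data that extend a partial lift. (ii) A surjection that is injective on Bott-Chern and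
surjective on Aeppli cohomology has an acyclic kernel, so strict lifting applies. (iii) Factor p = q
i, where i is a section of an acyclic retraction r and q is onto. Then q has an acyclic kernel as
well, and lifting through q and r gives injectivity and surjectivity on homotopy classes. -/

set_option linter.unusedSectionVars false

/-! ## Bigraded linear algebra -/

namespace Bigraded
variable {K : Type u} [Field K]

/-- Eigenspaces for distinct eigenvalues are independent. Gradings of free algebras are obtained in
this way, since the eigenspaces of an algebra automorphism multiply as a grading should. -/
theorem isInternal_of_eigen {ι V : Type*} [DecidableEq ι] [AddCommGroup V] [Module K V]
    {gr : ι → Submodule K V} (σ : V →ₗ[K] V) {c : ι → K} (hc : Function.Injective c)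
    (hσ : ∀ a x, x ∈ gr a → σ x = c a • x) (htop : ⨆ a, gr a = ⊤) :
    DirectSum.IsInternal gr := by
  rw [DirectSum.isInternal_submodule_iff_iSupIndep_and_iSup_eq_top]
  refine ⟨?_, htop⟩
  exact ((Module.End.eigenspaces_iSupIndep σ).comp hc).mono fun a x hx =>
    Module.End.mem_eigenspace_iff.2 (hσ a x hx)

/-- A multiplicative character of `ℤ × ℤ` separating the bidegrees. -/
def weight (K : Type u) [Field K] (a : ℤ × ℤ) : K := 2 ^ a.1 * 3 ^ a.2

theorem weight_zero : weight K 0 = 1 := by simp [weight]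

theorem weight_add [CharZero K] (a b : ℤ × ℤ) : weight K (a + b) = weight K a * weight K b := by
  simp only [weight, Prod.fst_add, Prod.snd_add]
  rw [zpow_add₀ two_ne_zero, zpow_add₀ three_ne_zero]
  ring

/-- In characteristic 0 the equation descends to ℚ, where the 2-adic and 3-adic valuations read off
the two exponents. -/
theorem weight_eq_one [CharZero K] {a : ℤ × ℤ} (h : weight K a = 1) : a = 0 := by
  have h' : (2 : ℚ) ^ a.1 * 3 ^ a.2 = 1 := by
    have : ((2 ^ a.1 * 3 ^ a.2 : ℚ) : K) = ((1 : ℚ) : K) := by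
      push_cast; exact h
    exact_mod_cast this
  have p2 := congrArg (padicValRat 2) h'
  have p3 := congrArg (padicValRat 3) h'
  have n2 : (2 : ℚ) ^ a.1 ≠ 0 := zpow_ne_zero _ two_ne_zero
  have n3 : (3 : ℚ) ^ a.2 ≠ 0 := zpow_ne_zero _ three_ne_zero
  have : Fact (Nat.Prime 2) := ⟨Nat.prime_two⟩
  have : Fact (Nat.Prime 3) := ⟨Nat.prime_three⟩
  have e23 : padicValRat 2 (3 : ℚ) = 0 := by
    rw [show (3 : ℚ) = ((3 : ℕ) : ℚ) by norm_num, padicValRat.of_nat,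
      padicValNat.eq_zero_of_not_dvd (by norm_num)]; rfl
  have e32 : padicValRat 3 (2 : ℚ) = 0 := by
    rw [show (2 : ℚ) = ((2 : ℕ) : ℚ) by norm_num, padicValRat.of_nat,
      padicValNat.eq_zero_of_not_dvd (by norm_num)]; rfl
  have e22 : padicValRat 2 (2 : ℚ) = 1 := padicValRat.self (p := 2) (by norm_num)
  have e33 : padicValRat 3 (3 : ℚ) = 1 := padicValRat.self (p := 3) (by norm_num)
  rw [padicValRat.mul n2 n3, padicValRat.zpow, padicValRat.zpow, e23, e22, padicValRat.one] at p2
  rw [padicValRat.mul n2 n3, padicValRat.zpow, padicValRat.zpow, e33, e32, padicValRat.one] at p3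
  ext <;> simp <;> linarith

theorem weight_injective [CharZero K] : Function.Injective (weight K) := by
  intro a b h
  have hb : weight K b ≠ 0 := mul_ne_zero (zpow_ne_zero _ two_ne_zero) (zpow_ne_zero _ three_ne_zero)
  have : weight K (a - b) = 1 := by
    have e := weight_add (K := K) (a - b) b
    rw [sub_add_cancel, h] at e
    exact (mul_eq_right₀ hb).1 e.symm
  exact sub_eq_zero.1 (weight_eq_one this)

section
variable {ι V N : Type*} [AddCommGroup V] [Module K V] [AddCommGroup N] [Module K N]
  {gr : ι → Submodule K V}

theorem hom_ext (h : ⨆ a, gr a = ⊤) {f g : V →ₗ[K] N} (hfg : ∀ a, ∀ x ∈ gr a, f x = g x) :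
    f = g := by
  have : ⨆ a, gr a ≤ LinearMap.eqLocus f g := iSup_le fun a x hx => hfg a x hx
  rw [h] at this
  exact LinearMap.ext fun x => this trivial

variable [DecidableEq ι]

/-- The linear map given on the homogeneous components. -/
noncomputable def glue (h : DirectSum.IsInternal gr) (F : ∀ a, gr a →ₗ[K] N) : V →ₗ[K] N :=
  DirectSum.toModule K ι N F ∘ₗ
    (LinearEquiv.ofBijective (DirectSum.coeLinearMap gr) h).symm.toLinearMap

theorem glue_of_mem (h : DirectSum.IsInternal gr) (F : ∀ a, gr a →ₗ[K] N) {a : ι} {x : V}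
    (hx : x ∈ gr a) : glue h F x = F a ⟨x, hx⟩ := by
  have : (LinearEquiv.ofBijective (DirectSum.coeLinearMap gr) h).symm x =
      DirectSum.lof K ι (fun a => gr a) a ⟨x, hx⟩ := by
    rw [LinearEquiv.symm_apply_eq]
    exact (DirectSum.coeLinearMap_lof gr a ⟨x, hx⟩).symm
  rw [glue, LinearMap.comp_apply, LinearEquiv.coe_coe, this, DirectSum.toModule_lof]

/-- The projection onto the component `gr a` carries each `G b` into `G a`, and the `G b` span, so
it carries everything into `G a`; it fixes `gr a`. This reduces statements about homogeneous
elements to homogeneous generators. -/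
theorem eq_of_le_of_iSup_eq_top (h : iSupIndep gr) {G : ι → Submodule K V} (hG : ∀ a, G a ≤ gr a)
    (htop : ⨆ a, G a = ⊤) (a : ι) : G a = gr a := by
  have hG' : DirectSum.IsInternal G := by
    rw [DirectSum.isInternal_submodule_iff_iSupIndep_and_iSup_eq_top]
    exact ⟨h.mono hG, htop⟩
  have hgr : DirectSum.IsInternal gr := by
    rw [DirectSum.isInternal_submodule_iff_iSupIndep_and_iSup_eq_top]
    exact ⟨h, eq_top_iff.2 (htop ▸ iSup_mono hG)⟩
  refine le_antisymm (hG a) fun x hx => ?_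
  let F : ∀ b, gr b →ₗ[K] V := fun b => if b = a then (gr b).subtype else 0
  have e : ∀ y : V, glue hgr F y ∈ G a := by
    intro y
    have : y ∈ ⨆ b, G b := htop ▸ trivial
    induction this using Submodule.iSup_induction' with
    | mem b z hz =>
      rw [glue_of_mem hgr F (hG b hz)]
      by_cases hb : b = a
      · subst hb; simpa [F] using hz
      · simp [F, hb]
    | zero => simp
    | add y z _ _ hy hz => rw [map_add]; exact add_mem hy hz
  have := e x
  rw [glue_of_mem hgr F hx] at this
  simpa [F] using this

end

section
variable {V N : Type*} [AddCommGroup V] [Module K V] [AddCommGroup N] [Module K N]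
  {gr : ℤ × ℤ → Submodule K V}

/-- The sign operator: multiplication by `(-1)^(i+j)` in bidegree `(i,j)`. -/
noncomputable def sgn (h : DirectSum.IsInternal gr) : V →ₗ[K] V :=
  glue h fun a => (a.1 + a.2).negOnePow • (gr a).subtype

theorem sgn_of_mem (h : DirectSum.IsInternal gr) {a : ℤ × ℤ} {x : V} (hx : x ∈ gr a) :
    sgn h x = (a.1 + a.2).negOnePow • x := by
  rw [sgn, glue_of_mem h _ hx]; rfl

theorem units_smul_mem (S : Submodule K V) (ε : ℤˣ) {x : V} (hx : x ∈ S) : ε • x ∈ S := by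
  rcases Int.units_eq_one_or ε with rfl | rfl
  · simpa
  · simpa using hx

theorem map_units_smul {F : Type*} [FunLike F V N] [LinearMapClass F K V N] (f : F) (ε : ℤˣ)
    (x : V) : f (ε • x) = ε • f x := by
  rcases Int.units_eq_one_or ε with rfl | rfl <;> simp

theorem sgn_mem (h : DirectSum.IsInternal gr) {a : ℤ × ℤ} {x : V} (hx : x ∈ gr a) :
    sgn h x ∈ gr a := by
  rw [sgn_of_mem h hx]; exact units_smul_mem _ _ hx

theorem sgn_sgn (h : DirectSum.IsInternal gr) (x : V) : sgn h (sgn h x) = x := by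
  have : sgn h ∘ₗ sgn h = LinearMap.id := hom_ext h.submodule_iSup_eq_top fun a x hx => by
    rw [LinearMap.comp_apply, sgn_of_mem h hx, map_units_smul, sgn_of_mem h hx, smul_smul,
      Int.units_mul_self, one_smul]; rfl
  exact LinearMap.congr_fun this x

/-- The images of the graded pieces span and lie in the right degrees, so a graded surjection is
onto in every bidegree. Over a field it has a linear section in each bidegree, and these are glued.
-/
theorem exists_graded_lift {N' : Type*} [AddCommGroup N'] [Module K N']
    (h : DirectSum.IsInternal gr) {grN : ℤ × ℤ → Submodule K N} {grN' : ℤ × ℤ → Submodule K N'}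
    (hN : DirectSum.IsInternal grN) (hN' : DirectSum.IsInternal grN')
    (p : N' →ₗ[K] N) (hp : Function.Surjective p) (hgr : ∀ a x, x ∈ grN' a → p x ∈ grN a)
    {s : ℤ × ℤ} {f : V →ₗ[K] N} (hf : ∀ b x, x ∈ gr b → f x ∈ grN (b + s)) :
    ∃ f' : V →ₗ[K] N', (∀ b x, x ∈ gr b → f' x ∈ grN' (b + s)) ∧ p ∘ₗ f' = f := by
  have hs : ∀ a, (grN' a).map p = grN a := by
    refine eq_of_le_of_iSup_eq_top hN.submodule_iSupIndep (fun a => ?_) ?_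
    · rintro _ ⟨x, hx, rfl⟩; exact hgr a x hx
    · rw [← Submodule.map_iSup, hN'.submodule_iSup_eq_top, Submodule.map_top,
        LinearMap.range_eq_top.2 hp]
  have hr : ∀ a, ∃ g : grN a →ₗ[K] grN' a, ∀ x, p (g x) = x := by
    intro a
    let pa : grN' a →ₗ[K] grN a := p.restrict (hgr a)
    have : Function.Surjective pa := by
      rintro ⟨x, hx⟩
      rw [← hs a] at hx
      obtain ⟨y, hy, rfl⟩ := hx
      exact ⟨⟨y, hy⟩, rfl⟩
    obtain ⟨g, hg⟩ := pa.exists_rightInverse_of_surjective (LinearMap.range_eq_top.2 this)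
    exact ⟨g, fun x => congrArg Subtype.val (LinearMap.congr_fun hg x)⟩
  choose g hg using hr
  let F : ∀ b, gr b →ₗ[K] N' := fun b => (grN' (b + s)).subtype ∘ₗ g (b + s) ∘ₗ f.restrict (hf b)
  refine ⟨glue h F, fun b x hx => ?_, hom_ext h.submodule_iSup_eq_top fun b x hx => ?_⟩
  · rw [glue_of_mem h F hx]; exact (g (b + s) _).2
  · rw [LinearMap.comp_apply, glue_of_mem h F hx]; exact hg _ _

end

section
variable {R : Type*} [Ring R] [Algebra K R]

theorem iSup_eq_top_of_adjoin {ι : Type*} [AddMonoid ι] {G : ι → Submodule K R} {S : Set R}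
    (hS : Algebra.adjoin K S = ⊤) (one : 1 ∈ G 0)
    (mul : ∀ a b, ∀ x ∈ G a, ∀ y ∈ G b, x * y ∈ G (a + b)) (hSG : ∀ x ∈ S, x ∈ ⨆ a, G a) :
    ⨆ a, G a = ⊤ := by
  rw [eq_top_iff]
  rintro x -
  have hx : x ∈ Algebra.adjoin K S := hS ▸ trivial
  have hmul : ∀ x ∈ ⨆ a, G a, ∀ y ∈ ⨆ a, G a, x * y ∈ ⨆ a, G a := by
    intro x hx y hy
    induction hx using Submodule.iSup_induction' with
    | zero => simp
    | add x x' _ _ h h' => rw [add_mul]; exact add_mem h h'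
    | mem a x hx =>
      induction hy using Submodule.iSup_induction' with
      | zero => simp
      | add x x' _ _ h h' => rw [mul_add]; exact add_mem h h'
      | mem b y hy => exact Submodule.mem_iSup_of_mem (a + b) (mul a b x hx y hy)
  induction hx using Algebra.adjoin_induction with
  | mem x hx => exact hSG x hx
  | algebraMap r =>
    rw [Algebra.algebraMap_eq_smul_one]
    exact Submodule.smul_mem _ _ (Submodule.mem_iSup_of_mem 0 one)
  | add x y _ _ hx hy => exact add_mem hx hy
  | mul x y _ _ hx hy => exact hmul x hx y hy

/-- Induction over homogeneous elements of an algebra with homogeneous generators. -/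
theorem eq_of_adjoin {gr : ℤ × ℤ → Submodule K R} (h : iSupIndep gr)
    {G : ℤ × ℤ → Submodule K R} (hG : ∀ a, G a ≤ gr a) {S : Set R}
    (hS : Algebra.adjoin K S = ⊤) (one : 1 ∈ G 0)
    (mul : ∀ a b, ∀ x ∈ G a, ∀ y ∈ G b, x * y ∈ G (a + b)) (hSG : ∀ x ∈ S, x ∈ ⨆ a, G a)
    (a : ℤ × ℤ) : G a = gr a :=
  eq_of_le_of_iSup_eq_top h hG (iSup_eq_top_of_adjoin hS one mul hSG) a

end

end Bigraded

section
variable {K : Type u} [Field K]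

/-! ## Uniform notation for the two differentials -/

/-- The bidegree of `∂` (`false`) and of `∂̄` (`true`). -/
def eDeg (c : Bool) : ℤ × ℤ := bif c then (0, 1) else (1, 0)

theorem eDeg_sum (c : Bool) : (eDeg c).1 + (eDeg c).2 = 1 := by cases c <;> rfl

theorem negOnePow_add_eDeg (a : ℤ × ℤ) (c : Bool) :
    ((a + eDeg c).1 + (a + eDeg c).2).negOnePow = -(a.1 + a.2).negOnePow := by
  rw [← Int.negOnePow_succ]; congr 1
  have := eDeg_sum c
  simp only [Prod.fst_add, Prod.snd_add]; linarith

namespace Bicomplex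
variable (V : Bicomplex K)

/-- The differentials `∂` (`false`) and `∂̄` (`true`). -/
def D (c : Bool) : V.carrier →ₗ[K] V.carrier := bif c then V.dbar else V.d

theorem D_mem (c : Bool) {a : ℤ × ℤ} {x : V.carrier} (hx : x ∈ V.gr a) :
    V.D c x ∈ V.gr (a + eDeg c) := by
  cases c
  · exact V.d_mem hx
  · exact V.dbar_mem hx

/-- For `c = c'` this is twice the square of a differential, so a single identity carries all the
relations; the squares are recovered when 2 is invertible. -/
theorem D_D (c c' : Bool) (x : V.carrier) : V.D c (V.D c' x) + V.D c' (V.D c x) = 0 := by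
  cases c <;> cases c' <;> simp only [D, cond_false, cond_true]
  · simp [V.d_d]
  · exact V.d_dbar x
  · rw [add_comm]; exact V.d_dbar x
  · simp [V.dbar_dbar]

/-- The sign operator. -/
noncomputable def sgn : V.carrier →ₗ[K] V.carrier := Bigraded.sgn V.internal

theorem sgn_of_mem {a : ℤ × ℤ} {x : V.carrier} (hx : x ∈ V.gr a) :
    V.sgn x = (a.1 + a.2).negOnePow • x := Bigraded.sgn_of_mem _ hx

theorem sgn_sgn (x : V.carrier) : V.sgn (V.sgn x) = x := Bigraded.sgn_sgn _ x

theorem hom_ext {N : Type*} [AddCommGroup N] [Module K N] {f g : V.carrier →ₗ[K] N}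
    (h : ∀ a, ∀ x ∈ V.gr a, f x = g x) : f = g :=
  Bigraded.hom_ext V.internal.submodule_iSup_eq_top h

theorem D_sgn (c : Bool) (x : V.carrier) : V.D c (V.sgn x) = -V.sgn (V.D c x) := by
  have : V.D c ∘ₗ V.sgn = -(V.sgn ∘ₗ V.D c) := V.hom_ext fun a x hx => by
    simp only [LinearMap.comp_apply, LinearMap.neg_apply]
    rw [V.sgn_of_mem hx, V.sgn_of_mem (V.D_mem c hx), Bigraded.map_units_smul, negOnePow_add_eDeg,
      Units.neg_smul, neg_neg]
  exact LinearMap.congr_fun this x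

end Bicomplex

namespace CBBA
variable (C : CBBA K)

/-- The underlying bicomplex. -/
abbrev toBicomplex : Bicomplex K where
  carrier := C.carrier
  gr := C.gr
  internal := C.internal
  d := C.d
  dbar := C.dbar
  d_mem := C.d_mem
  dbar_mem := C.dbar_mem
  d_d := C.d_d
  dbar_dbar := C.dbar_dbar
  d_dbar := C.d_dbar

/-- The differentials `∂` (`false`) and `∂̄` (`true`). -/
def D (c : Bool) : C.carrier →ₗ[K] C.carrier := C.toBicomplex.D c

theorem D_mem (c : Bool) {a : ℤ × ℤ} {x : C.carrier} (hx : x ∈ C.gr a) :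
    C.D c x ∈ C.gr (a + eDeg c) := C.toBicomplex.D_mem c hx

theorem D_D (c c' : Bool) (x : C.carrier) : C.D c (C.D c' x) + C.D c' (C.D c x) = 0 :=
  C.toBicomplex.D_D c c' x

theorem hom_ext {N : Type*} [AddCommGroup N] [Module K N] {f g : C.carrier →ₗ[K] N}
    (h : ∀ a, ∀ x ∈ C.gr a, f x = g x) : f = g := C.toBicomplex.hom_ext h

theorem sgn_mul_aux (x y : C.carrier) :
    C.toBicomplex.sgn (x * y) = C.toBicomplex.sgn x * C.toBicomplex.sgn y := by
  have : (LinearMap.mul K C.carrier).compr₂ C.toBicomplex.sgn =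
      (LinearMap.mul K C.carrier).compl₁₂ C.toBicomplex.sgn C.toBicomplex.sgn :=
    C.hom_ext fun a x hx => C.hom_ext fun b y hy => by
      simp only [LinearMap.compr₂_apply, LinearMap.compl₁₂_apply, LinearMap.mul_apply']
      rw [C.toBicomplex.sgn_of_mem hx, C.toBicomplex.sgn_of_mem hy,
        C.toBicomplex.sgn_of_mem (C.mul_mem hx hy), smul_mul_smul_comm, ← Int.negOnePow_add]
      congr 2
      simp only [Prod.fst_add, Prod.snd_add]; ring
  exact LinearMap.congr_fun (LinearMap.congr_fun this x) y

/-- The sign operator, an involutive automorphism of the algebra. -/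
noncomputable def sgn : C.carrier →ₐ[K] C.carrier :=
  AlgHom.ofLinearMap C.toBicomplex.sgn
    (by rw [C.toBicomplex.sgn_of_mem C.one_mem]; simp) C.sgn_mul_aux

theorem sgn_of_mem {a : ℤ × ℤ} {x : C.carrier} (hx : x ∈ C.gr a) :
    C.sgn x = (a.1 + a.2).negOnePow • x := C.toBicomplex.sgn_of_mem hx

theorem sgn_sgn (x : C.carrier) : C.sgn (C.sgn x) = x := C.toBicomplex.sgn_sgn x

theorem D_sgn (c : Bool) (x : C.carrier) : C.D c (C.sgn x) = -C.sgn (C.D c x) :=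
  C.toBicomplex.D_sgn c x

/-- Writing the Koszul sign through the sign operator removes the homogeneity assumption on `x`, so
later computations need no degree bookkeeping. -/
theorem D_mul (c : Bool) (x y : C.carrier) :
    C.D c (x * y) = C.D c x * y + C.sgn x * C.D c y := by
  have : (LinearMap.mul K C.carrier).compr₂ (C.D c) =
      (LinearMap.mul K C.carrier).comp (C.D c) +
        (LinearMap.mul K C.carrier).compl₁₂ C.sgn.toLinearMap (C.D c) :=
    C.hom_ext fun a x hx => LinearMap.ext fun y => by
      simp only [LinearMap.compr₂_apply, LinearMap.compl₁₂_apply, LinearMap.mul_apply',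
        LinearMap.add_apply, LinearMap.comp_apply, AlgHom.toLinearMap_apply]
      rw [C.sgn_of_mem hx, smul_mul_assoc]
      cases c
      · exact C.d_mul y hx
      · exact C.dbar_mul y hx
  exact LinearMap.congr_fun (LinearMap.congr_fun this x) y

theorem D_algebraMap (c : Bool) (r : K) : C.D c (algebraMap K C.carrier r) = 0 := by
  have h : C.D c (1 : C.carrier) = 0 := by
    have := C.D_mul c 1 1
    simpa using this
  rw [Algebra.algebraMap_eq_smul_one, map_smul, h, smul_zero]

theorem Hom.map_D {A B : CBBA K} (f : A.Hom B) (c : Bool) (x : A.carrier) :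
    f (A.D c x) = B.D c (f x) := by
  cases c
  · exact f.map_d x
  · exact f.map_dbar x

theorem Hom.ext' {A B : CBBA K} {f g : A.Hom B} (h : ∀ x, f x = g x) : f = g := by
  obtain ⟨f, _⟩ := f
  obtain ⟨g, _⟩ := g
  have : f = g := AlgHom.ext h
  subst this
  rfl

/-- A graded algebra homomorphism is compatible with the sign operators. -/
theorem map_sgn {A B : CBBA K} {f : A.carrier →ₐ[K] B.carrier}
    (hf : ∀ a x, x ∈ A.gr a → f x ∈ B.gr a) (x : A.carrier) : f (A.sgn x) = B.sgn (f x) := by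
  have : f.toLinearMap ∘ₗ A.sgn.toLinearMap = B.sgn.toLinearMap ∘ₗ f.toLinearMap :=
    A.hom_ext fun a x hx => by
      simp only [LinearMap.comp_apply, AlgHom.toLinearMap_apply]
      rw [A.sgn_of_mem hx, B.sgn_of_mem (hf a x hx), Bigraded.map_units_smul]
  exact LinearMap.congr_fun this x

end CBBA

/-! ## The twisted calculus -/

namespace Twisting
variable {B : CBBA K} {V : Bicomplex K} (T : Twisting V B)

/-- The two twisting coefficients. -/
def coef (c : Bool) : V.carrier →ₗ[K] V.carrier ⊗[K] B.carrier := bif c then T.Θbar else T.Θ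

theorem coef_mem (c : Bool) {a : ℤ × ℤ} {x : V.carrier} (hx : x ∈ V.gr a) :
    T.coef c x ∈ tensorPlus V B (a + eDeg c) := by
  cases c
  · exact T.Θ_mem hx
  · exact T.Θbar_mem hx

end Twisting

/-- The right action of `B` on `V ⊗ B`. -/
noncomputable def actF (V : Bicomplex K) (B : CBBA K) :
    V.carrier ⊗[K] B.carrier →ₗ[K] B.carrier →ₗ[K] V.carrier ⊗[K] B.carrier :=
  ((LinearMap.lTensorHom V.carrier) ∘ₗ (LinearMap.mul K B.carrier).flip).flip

theorem actF_tmul {V : Bicomplex K} {B : CBBA K} (v : V.carrier) (b b' : B.carrier) :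
    actF V B (v ⊗ₜ b) b' = v ⊗ₜ (b * b') := rfl

/-- The twisted differentials of `V ⊗ B`. -/
noncomputable def Twisting.dF {B : CBBA K} {V : Bicomplex K} (T : Twisting V B) (c : Bool) :
    V.carrier ⊗[K] B.carrier →ₗ[K] V.carrier ⊗[K] B.carrier :=
  TensorProduct.lift
    (actF V B ∘ₗ ((TensorProduct.mk K V.carrier B.carrier).flip 1 ∘ₗ V.D c + T.coef c) +
      (TensorProduct.mk K V.carrier B.carrier).compl₁₂ V.sgn (B.D c))

theorem Twisting.dF_tmul {B : CBBA K} {V : Bicomplex K} (T : Twisting V B) (c : Bool)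
    (v : V.carrier) (b : B.carrier) :
    T.dF c (v ⊗ₜ b) = V.D c v ⊗ₜ b + actF V B (T.coef c v) b + V.sgn v ⊗ₜ B.D c b := by
  simp [Twisting.dF, actF_tmul]

/-- The local system is flat: the twisted differentials on `V ⊗ B` square to zero and
anti-commute. -/
def Twisting.Flat {B : CBBA K} {V : Bicomplex K} (T : Twisting V B) : Prop :=
  ∀ c c' t, T.dF c (T.dF c' t) + T.dF c' (T.dF c t) = 0

section tilde
variable {B : CBBA K} {V : Bicomplex K} {M : Type*} [AddCommGroup M] [Module K M]
  (act : M →ₗ[K] B.carrier →ₗ[K] M)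

/-- The extension of `ψ : V → M` to `V ⊗ B`. -/
noncomputable def tilde (ψ : V.carrier →ₗ[K] M) : V.carrier ⊗[K] B.carrier →ₗ[K] M :=
  TensorProduct.lift (act ∘ₗ ψ)

theorem tilde_tmul (ψ : V.carrier →ₗ[K] M) (v : V.carrier) (b : B.carrier) :
    tilde act ψ (v ⊗ₜ b) = act (ψ v) b := by simp [tilde]

theorem tilde_actF (hact : ∀ x b b', act x (b * b') = act (act x b) b')
    (ψ : V.carrier →ₗ[K] M) (t : V.carrier ⊗[K] B.carrier) (b : B.carrier) :
    tilde act ψ (actF V B t b) = act (tilde act ψ t) b := by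
  induction t with
  | zero => simp
  | tmul v b' => rw [actF_tmul, tilde_tmul, tilde_tmul, hact]
  | add x y hx hy => simp only [map_add, LinearMap.add_apply, hx, hy]

/-- The twisted differential χ of ψ is the commutator of the extension of ψ with the differentials
on both sides. The operators `d` and `sg` are arbitrary because the lemma is also applied to
derivations not yet known to be differentials. -/
theorem tilde_comm (hact : ∀ x b b', act x (b * b') = act (act x b) b') (T : Twisting V B)
    {c : Bool} {d sg : M →ₗ[K] M}
    (hd : ∀ x b, d (act x b) = act (d x) b + act (sg x) (B.D c b)) {ψ χ : V.carrier →ₗ[K] M}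
    {ε : ℤˣ} (hψ : ∀ v, sg (ψ v) = ε • ψ (V.sgn v))
    (hχ : ∀ v, d (ψ v) = χ v + ε • (ψ (V.D c v) + tilde act ψ (T.coef c v)))
    (t : V.carrier ⊗[K] B.carrier) :
    d (tilde act ψ t) = tilde act χ t + ε • tilde act ψ (T.dF c t) := by
  induction t with
  | zero => simp
  | tmul v b =>
    simp only [tilde_tmul, hd, hψ, hχ, T.dF_tmul, map_add, tilde_actF act hact]
    rcases Int.units_eq_one_or ε with rfl | rfl <;> simp <;> abel
  | add x y hx hy => simp only [map_add, hx, hy, smul_add]; abel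

theorem tilde_map {N : Type*} [AddCommGroup N] [Module K N]
    {act' : N →ₗ[K] B.carrier →ₗ[K] N} {f : M →ₗ[K] N} (hf : ∀ x b, f (act x b) = act' (f x) b)
    (ψ : V.carrier →ₗ[K] M) (t : V.carrier ⊗[K] B.carrier) :
    f (tilde act ψ t) = tilde act' (f ∘ₗ ψ) t := by
  induction t with
  | zero => simp
  | tmul v b => simp [tilde_tmul, hf]
  | add x y hx hy => simp only [map_add, hx, hy]

end tilde

namespace DGModule
variable {B : CBBA K} {V : Bicomplex K} (M : DGModule B) (T : Twisting V B)

theorem D_act (c : Bool) (x : M.carrier) (b : B.carrier) :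
    M.D c (M.act x b) = M.act (M.D c x) b + M.act (M.toBicomplex.sgn x) (B.D c b) := by
  have : M.act.compr₂ (M.D c) =
      M.act ∘ₗ (M.D c) + M.act.compl₁₂ M.toBicomplex.sgn (B.D c) :=
    M.toBicomplex.hom_ext fun a x hx => LinearMap.ext fun y => by
      simp only [LinearMap.compr₂_apply, LinearMap.compl₁₂_apply,
        LinearMap.add_apply, LinearMap.comp_apply]
      rw [M.toBicomplex.sgn_of_mem hx]
      have e : ∀ (ε : ℤˣ) (z : M.carrier) b, M.act (ε • z) b = ε • M.act z b := fun ε z b => by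
        rcases Int.units_eq_one_or ε with rfl | rfl <;> simp
      rw [e]
      cases c
      · exact M.d_act y hx
      · exact M.dbar_act y hx
  exact LinearMap.congr_fun (LinearMap.congr_fun this x) b

/-- The two twisted differentials on `Hom(V, M)`. -/
noncomputable def tDD (c : Bool) (n : ℤ) :
    (V.carrier →ₗ[K] M.carrier) →ₗ[K] (V.carrier →ₗ[K] M.carrier) :=
  bif c then M.tDbar T n else M.tD T n

theorem tDD_apply (c : Bool) (n : ℤ) (ψ : V.carrier →ₗ[K] M.carrier) (v : V.carrier) :
    M.tDD T c n ψ v =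
      M.D c (ψ v) - n.negOnePow • (ψ (V.D c v) + tilde M.act ψ (T.coef c v)) := by
  cases c <;> rfl

theorem D_eq (c : Bool) (n : ℤ) (ψ : V.carrier →ₗ[K] M.carrier) (v : V.carrier) :
    M.D c (ψ v) =
      M.tDD T c n ψ v + n.negOnePow • (ψ (V.D c v) + tilde M.act ψ (T.coef c v)) := by
  rw [tDD_apply, sub_add_cancel]

variable {M T}

theorem sgn_of_homDeg {a : ℤ × ℤ} {ψ : V.carrier →ₗ[K] M.carrier} (hψ : ψ ∈ homDeg V M a)
    (v : V.carrier) : M.toBicomplex.sgn (ψ v) = (a.1 + a.2).negOnePow • ψ (V.sgn v) := by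
  have : M.toBicomplex.sgn ∘ₗ ψ = (a.1 + a.2).negOnePow • (ψ ∘ₗ V.sgn) :=
    V.hom_ext fun b x hx => by
      have e : ((a.1 + a.2).negOnePow • (ψ ∘ₗ V.sgn)) x = (a.1 + a.2).negOnePow • ψ (V.sgn x) := rfl
      rw [LinearMap.comp_apply, e, V.sgn_of_mem hx, M.toBicomplex.sgn_of_mem (hψ b x hx),
        Bigraded.map_units_smul, smul_smul, ← Int.negOnePow_add]
      congr 2
      simp only [Prod.fst_add, Prod.snd_add]; ring
  exact LinearMap.congr_fun this v

theorem D_tilde {a : ℤ × ℤ} {ψ : V.carrier →ₗ[K] M.carrier} (hψ : ψ ∈ homDeg V M a) (c : Bool)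
    {n : ℤ} (hn : n = a.1 + a.2) (t : V.carrier ⊗[K] B.carrier) :
    M.D c (tilde M.act ψ t) =
      tilde M.act (M.tDD T c n ψ) t + n.negOnePow • tilde M.act ψ (T.dF c t) := by
  subst hn
  exact tilde_comm M.act M.act_mul T (M.D_act c) (sgn_of_homDeg hψ) (M.D_eq T c _ ψ) t

theorem tilde_mem {a b : ℤ × ℤ} {ψ : V.carrier →ₗ[K] M.carrier} (hψ : ψ ∈ homDeg V M a)
    {t : V.carrier ⊗[K] B.carrier} (ht : t ∈ tensorPlus V B b) :
    tilde M.act ψ t ∈ M.gr (b + a) := by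
  have : tensorPlus V B b ≤ (M.gr (b + a)).comap (tilde M.act ψ) := by
    refine iSup_le fun c => iSup_le fun e => iSup_le fun h => ?_
    rintro _ ⟨s, rfl⟩
    rw [Submodule.mem_comap]
    induction s with
    | zero => simp only [map_zero]; exact zero_mem _
    | add x y hx hy => simp only [map_add]; exact add_mem hx hy
    | tmul x y =>
      change tilde M.act ψ (x.1 ⊗ₜ y.1) ∈ _
      rw [tilde_tmul, ← h.1, add_right_comm]
      exact M.act_mem (hψ _ _ x.2) y.2
  exact this ht

theorem tDD_mem {a : ℤ × ℤ} {ψ : V.carrier →ₗ[K] M.carrier} (hψ : ψ ∈ homDeg V M a) (c : Bool)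
    (n : ℤ) : M.tDD T c n ψ ∈ homDeg V M (a + eDeg c) := by
  intro b x hx
  rw [tDD_apply, ← add_assoc]
  refine sub_mem (M.D_mem c (hψ b x hx)) (Bigraded.units_smul_mem _ _ (add_mem ?_ ?_))
  · rw [add_right_comm]; exact hψ _ _ (V.D_mem c hx)
  · rw [add_right_comm]; exact tilde_mem hψ (T.coef_mem c hx)

theorem tilde_one (ψ : V.carrier →ₗ[K] M.carrier) (v : V.carrier) :
    tilde M.act ψ (v ⊗ₜ 1) = ψ v := by rw [tilde_tmul, M.act_one]

/-- Apply `D c ∘ D c'` to the extension of ψ and use the commutator formula twice. In the sum over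
both orders the mixed terms cancel, flatness kills the terms in `dF`, and the left side vanishes in
`M`. Evaluation at `v ⊗ 1` gives the claim. -/
theorem tDD_tDD (hT : T.Flat) {a : ℤ × ℤ} {ψ : V.carrier →ₗ[K] M.carrier}
    (hψ : ψ ∈ homDeg V M a) (c c' : Bool) {n m : ℤ} (hn : n = a.1 + a.2) (hm : m = n + 1) :
    M.tDD T c m (M.tDD T c' n ψ) + M.tDD T c' m (M.tDD T c n ψ) = 0 := by
  have key : ∀ c c' : Bool, ∀ t, M.D c (M.D c' (tilde M.act ψ t)) =
      tilde M.act (M.tDD T c m (M.tDD T c' n ψ)) t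
      - n.negOnePow • tilde M.act (M.tDD T c' n ψ) (T.dF c t)
      + n.negOnePow • tilde M.act (M.tDD T c n ψ) (T.dF c' t)
      + tilde M.act ψ (T.dF c (T.dF c' t)) := by
    intro c c' t
    rw [D_tilde (T := T) hψ c' hn, map_add, Bigraded.map_units_smul, D_tilde (T := T) hψ c hn,
      D_tilde (T := T) (tDD_mem hψ c' n) c (n := m) (by
        have := eDeg_sum c'
        simp only [Prod.fst_add, Prod.snd_add]; linarith), hm, Int.negOnePow_succ, Units.neg_smul,
      smul_add, smul_smul, Int.units_mul_self, one_smul]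
    abel
  refine LinearMap.ext fun v => ?_
  have h1 := M.toBicomplex.D_D c c' (tilde M.act ψ (v ⊗ₜ 1))
  rw [key c c', key c' c] at h1
  have h2 := congrArg (tilde M.act ψ) (hT c c' (v ⊗ₜ 1))
  rw [map_add, map_zero] at h2
  rw [LinearMap.add_apply, LinearMap.zero_apply, ← tilde_one (M := M) (M.tDD T c m _),
    ← tilde_one (M := M) (M.tDD T c' m _), ← h1, ← sub_eq_zero]
  rw [← neg_eq_zero, ← h2]
  abel

end DGModule
end

section
variable {K : Type u} [Field K]

/-! ## The twisted calculus in a cbba under `B` -/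

/-- Linear maps `V → C` of bidegree `a`. -/
def CBBA.homDeg (V : Bicomplex K) (C : CBBA K) (a : ℤ × ℤ) :
    Submodule K (V.carrier →ₗ[K] C.carrier) where
  carrier := {ψ | ∀ (b : ℤ × ℤ) (x : V.carrier), x ∈ V.gr b → ψ x ∈ C.gr (b + a)}
  add_mem' h h' b x hx := Submodule.add_mem _ (h b x hx) (h' b x hx)
  zero_mem' _ _ _ := Submodule.zero_mem _
  smul_mem' r _ h b x hx := Submodule.smul_mem _ r (h b x hx)

/-- A graded algebra map, not necessarily compatible with the differentials. -/
def CBBA.IsGraded {A C : CBBA K} (f : A.carrier →ₐ[K] C.carrier) : Prop :=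
  ∀ a x, x ∈ A.gr a → f x ∈ C.gr a

theorem CBBA.IsGraded.comp_homDeg {A C : CBBA K} {f : A.carrier →ₐ[K] C.carrier}
    (hf : CBBA.IsGraded f) {V : Bicomplex K} {a : ℤ × ℤ} {ψ : V.carrier →ₗ[K] A.carrier}
    (hψ : ψ ∈ CBBA.homDeg V A a) : f.toLinearMap ∘ₗ ψ ∈ CBBA.homDeg V C a :=
  fun b x hx => hf _ _ (hψ b x hx)

namespace CBBA.Hom
variable {B C C' : CBBA K} {V : Bicomplex K}

theorem isGraded (ν : B.Hom C) : CBBA.IsGraded ν.toAlgHom := fun _ _ hx => ν.map_gr hx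

/-- The right action of `B` on `C` through `ν`. -/
noncomputable def rAct (ν : B.Hom C) : C.carrier →ₗ[K] B.carrier →ₗ[K] C.carrier :=
  (LinearMap.mul K C.carrier).compl₂ ν.toAlgHom.toLinearMap

theorem rAct_apply (ν : B.Hom C) (x : C.carrier) (b : B.carrier) : ν.rAct x b = x * ν b := rfl

/-- The map `v ⊗ b ↦ ψ v * ν b`. -/
noncomputable def tl (ν : B.Hom C) (ψ : V.carrier →ₗ[K] C.carrier) :
    V.carrier ⊗[K] B.carrier →ₗ[K] C.carrier := tilde ν.rAct ψ

theorem tl_tmul (ν : B.Hom C) (ψ : V.carrier →ₗ[K] C.carrier) (v : V.carrier) (b : B.carrier) :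
    ν.tl ψ (v ⊗ₜ b) = ψ v * ν b := tilde_tmul _ _ _ _

/-- The twisted differentials on `Hom(V, C)`. -/
noncomputable def tDD (ν : B.Hom C) (T : Twisting V B) (c : Bool) (n : ℤ) :
    (V.carrier →ₗ[K] C.carrier) →ₗ[K] (V.carrier →ₗ[K] C.carrier) := ν.toModule.tDD T c n

variable (ν : B.Hom C) {T : Twisting V B}

theorem D_eq (T : Twisting V B) (c : Bool) (n : ℤ) (ψ : V.carrier →ₗ[K] C.carrier)
    (v : V.carrier) :
    C.D c (ψ v) = ν.tDD T c n ψ v + n.negOnePow • (ψ (V.D c v) + ν.tl ψ (T.coef c v)) :=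
  ν.toModule.D_eq T c n ψ v

theorem tDD_apply (T : Twisting V B) (c : Bool) (n : ℤ) (ψ : V.carrier →ₗ[K] C.carrier)
    (v : V.carrier) :
    ν.tDD T c n ψ v = C.D c (ψ v) - n.negOnePow • (ψ (V.D c v) + ν.tl ψ (T.coef c v)) :=
  ν.toModule.tDD_apply T c n ψ v

theorem D_tl {a : ℤ × ℤ} {ψ : V.carrier →ₗ[K] C.carrier} (hψ : ψ ∈ CBBA.homDeg V C a) (c : Bool)
    {n : ℤ} (hn : n = a.1 + a.2) (t : V.carrier ⊗[K] B.carrier) :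
    C.D c (ν.tl ψ t) = ν.tl (ν.tDD T c n ψ) t + n.negOnePow • ν.tl ψ (T.dF c t) :=
  DGModule.D_tilde (M := ν.toModule) hψ c hn t

theorem tDD_mem {a : ℤ × ℤ} {ψ : V.carrier →ₗ[K] C.carrier} (hψ : ψ ∈ CBBA.homDeg V C a)
    (c : Bool) (n : ℤ) : ν.tDD T c n ψ ∈ CBBA.homDeg V C (a + eDeg c) :=
  DGModule.tDD_mem (M := ν.toModule) hψ c n

theorem tDD_tDD (hT : T.Flat) {a : ℤ × ℤ} {ψ : V.carrier →ₗ[K] C.carrier}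
    (hψ : ψ ∈ CBBA.homDeg V C a) (c c' : Bool) {n m : ℤ} (hn : n = a.1 + a.2) (hm : m = n + 1) :
    ν.tDD T c m (ν.tDD T c' n ψ) + ν.tDD T c' m (ν.tDD T c n ψ) = 0 :=
  DGModule.tDD_tDD (M := ν.toModule) hT hψ c c' hn hm

theorem tDD_self [CharZero K] (hT : T.Flat) {a : ℤ × ℤ} {ψ : V.carrier →ₗ[K] C.carrier}
    (hψ : ψ ∈ CBBA.homDeg V C a) (c : Bool) {n m : ℤ} (hn : n = a.1 + a.2) (hm : m = n + 1) :
    ν.tDD T c m (ν.tDD T c n ψ) = 0 := by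
  have h := ν.tDD_tDD hT hψ c c hn hm
  rw [← two_smul K] at h
  exact (smul_eq_zero.1 h).resolve_left two_ne_zero

theorem map_tl {ν : B.Hom C} {ν' : B.Hom C'} {f : C.carrier →ₐ[K] C'.carrier}
    (hf : ∀ b, f (ν b) = ν' b) (ψ : V.carrier →ₗ[K] C.carrier) (t : V.carrier ⊗[K] B.carrier) :
    f (ν.tl ψ t) = ν'.tl (f.toLinearMap ∘ₗ ψ) t := by
  refine tilde_map (f := f.toLinearMap) ν.rAct (fun x b => ?_) ψ t
  simp [rAct_apply, hf]

/-- All terms of the twisted differential except `D c (ψ v)` are built from values of ψ and the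
action of `B`, which `f` respects in any case. This translates compatibility with differentials into
equations in Hom(V, C). -/
theorem map_tDD_iff {ν : B.Hom C} {ν' : B.Hom C'} {f : C.carrier →ₐ[K] C'.carrier}
    (hf : ∀ b, f (ν b) = ν' b) (T : Twisting V B) (c : Bool) (n : ℤ)
    (ψ : V.carrier →ₗ[K] C.carrier) (v : V.carrier) :
    f (ν.tDD T c n ψ v) = ν'.tDD T c n (f.toLinearMap ∘ₗ ψ) v ↔
      f (C.D c (ψ v)) = C'.D c (f (ψ v)) := by
  rw [tDD_apply, tDD_apply, map_sub, Bigraded.map_units_smul, map_add, map_tl hf]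
  simp only [LinearMap.comp_apply, AlgHom.toLinearMap_apply]
  exact sub_left_inj

theorem map_tDD {ν : B.Hom C} {ν' : B.Hom C'} (f : C.Hom C')
    (hf : ∀ b, f (ν b) = ν' b) (T : Twisting V B) (c : Bool) (n : ℤ)
    (ψ : V.carrier →ₗ[K] C.carrier) :
    f.toAlgHom.toLinearMap ∘ₗ ν.tDD T c n ψ = ν'.tDD T c n (f.toAlgHom.toLinearMap ∘ₗ ψ) :=
  LinearMap.ext fun v => (map_tDD_iff hf T c n ψ v).2 (f.map_D c _)

theorem tl_eq_of_mem {S : Submodule K C.carrier} (hS : ∀ x ∈ S, ∀ b, x * ν b ∈ S)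
    {ψ : V.carrier →ₗ[K] C.carrier} (hψ : ∀ v, ψ v ∈ S) (t : V.carrier ⊗[K] B.carrier) :
    ν.tl ψ t ∈ S := by
  induction t with
  | zero => rw [map_zero]; exact zero_mem _
  | tmul v b => rw [tl_tmul]; exact hS _ (hψ v) b
  | add x y hx hy => rw [map_add]; exact add_mem hx hy

end CBBA.Hom

/-! ## Universal property of free extensions -/

section UP
variable {B : CBBA K} {U : Type u} [AddCommGroup U] [Module K U] {gr : ℤ × ℤ → Submodule K U}

/-- The generators of the free graded-commutative algebra. -/
noncomputable def FreeGCA.gen (gr : ℤ × ℤ → Submodule K U) : U →ₗ[K] FreeGCA gr :=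
  (RingQuot.mkAlgHom K (FreeGCA.Rel gr)).toLinearMap ∘ₗ TensorAlgebra.ι K

theorem FreeGCA.gen_mul_gen {a b : ℤ × ℤ} {x y : U} (hx : x ∈ gr a) (hy : y ∈ gr b) :
    FreeGCA.gen gr x * FreeGCA.gen gr y =
      ((a.1 + a.2) * (b.1 + b.2)).negOnePow • (FreeGCA.gen gr y * FreeGCA.gen gr x) := by
  have := RingQuot.mkAlgHom_rel K (FreeGCA.Rel.comm (gr := gr) hx hy)
  rw [Bigraded.map_units_smul, map_mul, map_mul] at this
  exact this

/-- Algebra maps out of a free graded-commutative algebra. -/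
noncomputable def FreeGCA.lift {R : Type*} [Ring R] [Algebra K R] (γ : U →ₗ[K] R)
    (hγ : ∀ a b, ∀ x ∈ gr a, ∀ y ∈ gr b,
      γ x * γ y = ((a.1 + a.2) * (b.1 + b.2)).negOnePow • (γ y * γ x)) : FreeGCA gr →ₐ[K] R :=
  RingQuot.liftAlgHom K ⟨TensorAlgebra.lift K γ, by
    rintro _ _ ⟨hx, hy⟩
    rw [Bigraded.map_units_smul, map_mul, map_mul, TensorAlgebra.lift_ι_apply,
      TensorAlgebra.lift_ι_apply]
    exact hγ _ _ _ hx _ hy⟩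

theorem FreeGCA.lift_gen {R : Type*} [Ring R] [Algebra K R] (γ : U →ₗ[K] R)
    (hγ : ∀ a b, ∀ x ∈ gr a, ∀ y ∈ gr b,
      γ x * γ y = ((a.1 + a.2) * (b.1 + b.2)).negOnePow • (γ y * γ x)) (x : U) :
    FreeGCA.lift γ hγ (FreeGCA.gen gr x) = γ x := by
  simp [FreeGCA.lift, FreeGCA.gen]

theorem FreeGCA.adjoin_gen (gr : ℤ × ℤ → Submodule K U) :
    Algebra.adjoin K (Set.range (FreeGCA.gen gr)) = ⊤ := by
  have h := TensorAlgebra.adjoin_range_ι (R := K) (M := U)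
  have h2 := congrArg (Subalgebra.map (RingQuot.mkAlgHom K (FreeGCA.Rel gr))) h
  rw [AlgHom.map_adjoin, Algebra.map_top, (AlgHom.range_eq_top _).2
    (RingQuot.mkAlgHom_surjective K _), ← Set.range_comp] at h2
  exact h2

variable {A : Type*} [Ring A] [Algebra K A] {i : B.carrier →ₐ[K] A} {Φ : FreeGCA gr →ₐ[K] A}

theorem adjoin_of_bijective
    (hΦ : Function.Bijective
      (LinearMap.mul' K A ∘ₗ TensorProduct.map i.toLinearMap Φ.toLinearMap)) :
    Algebra.adjoin K (Set.range i ∪ Set.range fun x => Φ (FreeGCA.gen gr x)) = ⊤ := by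
  rw [eq_top_iff]
  rintro x -
  obtain ⟨t, rfl⟩ := hΦ.2 x
  induction t with
  | zero => rw [map_zero]; exact zero_mem _
  | add x y hx hy => rw [map_add]; exact add_mem hx hy
  | tmul b u =>
    rw [LinearMap.comp_apply, TensorProduct.map_tmul, LinearMap.mul'_apply]
    refine mul_mem (Algebra.subset_adjoin (Or.inl ⟨b, rfl⟩)) ?_
    have hu : u ∈ Algebra.adjoin K (Set.range (FreeGCA.gen gr)) := by
      rw [FreeGCA.adjoin_gen]; trivial
    have : Φ u ∈ (Algebra.adjoin K (Set.range (FreeGCA.gen gr))).map Φ := ⟨u, hu, rfl⟩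
    rw [AlgHom.map_adjoin, ← Set.range_comp] at this
    exact Algebra.adjoin_mono Set.subset_union_right this

/-- The linear identification of `A` with `B ⊗ ⋀ U` leaves one candidate for `H`. Its
multiplicativity needs only the commutation of generators with `B` on both sides. -/
theorem exists_lift_of_bijective
    (hΦ : Function.Bijective
      (LinearMap.mul' K A ∘ₗ TensorProduct.map i.toLinearMap Φ.toLinearMap))
    (hgr : ⨆ a, gr a = ⊤)
    (hcomm : ∀ a c, ∀ x ∈ gr a, ∀ b ∈ B.gr c, Φ (FreeGCA.gen gr x) * i b =
      ((a.1 + a.2) * (c.1 + c.2)).negOnePow • (i b * Φ (FreeGCA.gen gr x)))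
    {R : Type*} [Ring R] [Algebra K R] (α : B.carrier →ₐ[K] R) (γ : U →ₗ[K] R)
    (hγ : ∀ a b, ∀ x ∈ gr a, ∀ y ∈ gr b,
      γ x * γ y = ((a.1 + a.2) * (b.1 + b.2)).negOnePow • (γ y * γ x))
    (hαγ : ∀ a c, ∀ x ∈ gr a, ∀ b ∈ B.gr c, γ x * α b =
      ((a.1 + a.2) * (c.1 + c.2)).negOnePow • (α b * γ x)) :
    ∃ H : A →ₐ[K] R, (∀ b, H (i b) = α b) ∧ ∀ x, H (Φ (FreeGCA.gen gr x)) = γ x := by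
  let e := LinearEquiv.ofBijective _ hΦ
  let H : A →ₗ[K] R := (LinearMap.mul' K R ∘ₗ
    TensorProduct.map α.toLinearMap (FreeGCA.lift γ hγ).toLinearMap) ∘ₗ e.symm.toLinearMap
  have hH : ∀ b u, H (i b * Φ u) = α b * FreeGCA.lift γ hγ u := by
    intro b u
    have : e.symm (i b * Φ u) = b ⊗ₜ u := by
      rw [LinearEquiv.symm_apply_eq]; rfl
    simp [H, this]
  have hHi : ∀ b, H (i b) = α b := fun b => by simpa using hH b 1
  have hHg : ∀ x, H (Φ (FreeGCA.gen gr x)) = γ x := fun x => by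
    simpa [FreeGCA.lift_gen] using hH 1 (FreeGCA.gen gr x)
  have hone : H 1 = 1 := by simpa using hH 1 1
  have ind : ∀ (P : A → Prop), P 0 → (∀ x y, P x → P y → P (x + y)) → (∀ b u, P (i b * Φ u)) →
      ∀ x, P x := by
    intro P h0 ha hm x
    obtain ⟨t, rfl⟩ := hΦ.2 x
    induction t with
    | zero => rw [map_zero]; exact h0
    | add x y hx hy => rw [map_add]; exact ha _ _ hx hy
    | tmul b u => exact hm b u
  have hmulB : ∀ b y, H (i b * y) = H (i b) * H y := by
    intro b
    refine ind _ (by simp) (fun x y hx hy => by simp only [mul_add, map_add, hx, hy]) fun b' u => ?_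
    rw [← mul_assoc, ← map_mul, hH, hH, hHi, map_mul, mul_assoc]
  -- Multiplying `i b * Φ u` on the left by a generator moves the generator past `i b`; the two
  -- commutation hypotheses produce the same sign in `A` and in `R`.
  have hmulU : ∀ x y, H (Φ (FreeGCA.gen gr x) * y) = H (Φ (FreeGCA.gen gr x)) * H y := by
    intro x y
    refine ind (fun y => H (Φ (FreeGCA.gen gr x) * y) = H (Φ (FreeGCA.gen gr x)) * H y) (by simp)
      (fun x y hx hy => by simp only [mul_add, map_add, hx, hy]) (fun b u => ?_) y
    rw [hH, hHg]
    have hx : x ∈ ⨆ a, gr a := hgr ▸ trivial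
    induction hx using Submodule.iSup_induction' with
    | zero => simp
    | add x x' _ _ h h' => simp only [map_add, add_mul, h, h']
    | mem a x hx =>
      have hb : b ∈ ⨆ a, B.gr a := B.internal.submodule_iSup_eq_top ▸ trivial
      induction hb using Submodule.iSup_induction' with
      | zero => simp
      | add x x' _ _ h h' => simp only [map_add, add_mul, mul_add, h, h']
      | mem c b hb =>
        rw [← mul_assoc, hcomm a c x hx b hb, ← mul_assoc, hαγ a c x hx b hb, smul_mul_assoc,
          smul_mul_assoc, Bigraded.map_units_smul, mul_assoc, ← map_mul, hH, map_mul,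
          FreeGCA.lift_gen, mul_assoc]
  -- Left factors that satisfy multiplicativity against every `y` form a subalgebra, and it contains
  -- the generators.
  have hmul : ∀ x y, H (x * y) = H x * H y := by
    let S : Subalgebra K A :=
      { carrier := {x | ∀ y, H (x * y) = H x * H y}
        mul_mem' := fun {x x'} hx hx' y => by rw [mul_assoc, hx, hx', hx, mul_assoc]
        add_mem' := fun {x x'} hx hx' y => by rw [add_mul, map_add, map_add, hx, hx', add_mul]
        algebraMap_mem' := fun r y => by
          rw [Algebra.algebraMap_eq_smul_one, smul_one_mul, map_smul, map_smul, hone, smul_one_mul] }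
    have hS : Algebra.adjoin K (Set.range i ∪ Set.range fun x => Φ (FreeGCA.gen gr x)) ≤ S := by
      rw [Algebra.adjoin_le_iff]
      rintro _ (⟨b, rfl⟩ | ⟨x, rfl⟩)
      · exact hmulB b
      · exact hmulU x
    rw [adjoin_of_bijective hΦ] at hS
    exact fun x => hS (show x ∈ ⊤ from trivial)
  exact ⟨AlgHom.ofLinearMap H hone hmul, hHi, hHg⟩

end UP
end

section
variable {K : Type u} [Field K]

/-! ## Free extensions on a family of bicomplexes -/

section sumGr
variable {ι : Type} [DecidableEq ι] (W : ι → Bicomplex K) (s : ι → ℤ × ℤ)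

theorem lof_mem_sumGr {i : ι} {b : ℤ × ℤ} {x : (W i).carrier} (hx : x ∈ (W i).gr b) :
    DirectSum.lof K ι (fun i => (W i).carrier) i x ∈ sumGr W s (b + s i) :=
  Submodule.mem_iSup_of_mem i ⟨x, by rwa [add_sub_cancel_right], rfl⟩

theorem sumGr_iSup : ⨆ a, sumGr W s a = ⊤ := by
  rw [eq_top_iff]
  rintro x -
  induction x using DirectSum.induction_on with
  | zero => exact zero_mem _
  | add x y hx hy => exact add_mem hx hy
  | of i x =>
    have hx : x ∈ ⨆ a, (W i).gr a := (W i).internal.submodule_iSup_eq_top ▸ trivial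
    change DirectSum.lof K ι (fun i => (W i).carrier) i x ∈ _
    induction hx using Submodule.iSup_induction' with
    | zero => rw [map_zero]; exact zero_mem _
    | add x y _ _ hx hy => rw [map_add]; exact add_mem hx hy
    | mem b x hx => exact Submodule.mem_iSup_of_mem _ (lof_mem_sumGr W s hx)

theorem sumGr_induction {a : ℤ × ℤ} {P : (⨁ i, (W i).carrier) → Prop}
    (zero : P 0) (add : ∀ x y, P x → P y → P (x + y))
    (of : ∀ i b x, x ∈ (W i).gr b → b + s i = a →
      P (DirectSum.lof K ι (fun i => (W i).carrier) i x))
    {x : ⨁ i, (W i).carrier} (hx : x ∈ sumGr W s a) : P x := by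
  induction hx using Submodule.iSup_induction' with
  | zero => exact zero
  | add x y _ _ hx hy => exact add x y hx hy
  | mem i x hx =>
    obtain ⟨y, hy, rfl⟩ := hx
    exact of i _ y hy (sub_add_cancel _ _)

/-- The action of the weight on the direct sum. -/
noncomputable def sumWeight : (⨁ i, (W i).carrier) →ₗ[K] (⨁ i, (W i).carrier) :=
  DirectSum.toModule K ι _ fun i => DirectSum.lof K ι (fun i => (W i).carrier) i ∘ₗ
    Bigraded.glue (W i).internal fun b => Bigraded.weight K (b + s i) • ((W i).gr b).subtype

theorem sumWeight_of_mem {a : ℤ × ℤ} {x : ⨁ i, (W i).carrier} (hx : x ∈ sumGr W s a) :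
    sumWeight W s x = Bigraded.weight K a • x := by
  refine sumGr_induction W s (P := fun x => sumWeight W s x = Bigraded.weight K a • x) (by simp)
    (fun x y hx hy => by rw [map_add, hx, hy, smul_add]) (fun i b x hx h => ?_) hx
  rw [sumWeight, DirectSum.toModule_lof, LinearMap.comp_apply, Bigraded.glue_of_mem _ _ hx, h,
    LinearMap.smul_apply, map_smul]
  rfl

theorem sumGr_internal [CharZero K] : DirectSum.IsInternal (sumGr W s) :=
  Bigraded.isInternal_of_eigen (sumWeight W s) Bigraded.weight_injective
    (fun _ _ hx => sumWeight_of_mem W s hx) (sumGr_iSup W s)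

end sumGr

section
variable {U : Type u} [AddCommGroup U] [Module K U] (gr : ℤ × ℤ → Submodule K U)

/-- Let a generator `x` act on `K × U` by `(k, u) ↦ (0, k x)`. Products of two such operators
vanish, so the relations hold trivially, and the action on `(1, 0)` recovers `x`. -/
theorem FreeGCA.exists_retraction :
    ∃ r : FreeGCA gr →ₗ[K] U, ∀ x, r (FreeGCA.gen gr x) = x := by
  let γ : U →ₗ[K] Module.End K (K × U) :=
    { toFun := fun x => LinearMap.inr K K U ∘ₗ LinearMap.toSpanSingleton K U x ∘ₗ LinearMap.fst K K U
      map_add' := fun x y => by ext <;> simp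
      map_smul' := fun r x => by ext <;> simp }
  have hγ : ∀ x y, γ x * γ y = 0 := fun x y => by ext <;> simp [γ]
  refine ⟨LinearMap.snd K K U ∘ₗ LinearMap.applyₗ ((1, 0) : K × U) ∘ₗ
    (FreeGCA.lift (gr := gr) γ (by simp [hγ])).toLinearMap, fun x => ?_⟩
  simp only [LinearMap.comp_apply, AlgHom.toLinearMap_apply, FreeGCA.lift_gen]
  simp [γ]

end

namespace IsFreeOver
variable {B A : CBBA K} {incl : B.Hom A} {ι : Type} [DecidableEq ι] {W : ι → Bicomplex K}
  {s : ι → ℤ × ℤ} {g : ∀ i, (W i).carrier →ₗ[K] A.carrier}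
  (h : IsFreeOver incl (sumGr W s) (DirectSum.toModule K ι A.carrier g))
include h

theorem gen_mem (i : ι) : g i ∈ CBBA.homDeg (W i) A (s i) := fun b x hx => by
  have := h.1 _ _ (lof_mem_sumGr W s hx)
  rwa [DirectSum.toModule_lof] at this

theorem adjoin_eq_top :
    Algebra.adjoin K (Set.range incl ∪ ⋃ i, Set.range (g i)) = ⊤ := by
  obtain ⟨-, Φ, hΦ, hb⟩ := h
  rw [eq_top_iff, ← adjoin_of_bijective hb, Algebra.adjoin_le_iff]
  rintro _ (⟨b, rfl⟩ | ⟨x, rfl⟩)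
  · exact Algebra.subset_adjoin (Or.inl ⟨b, rfl⟩)
  · have : Φ (FreeGCA.gen _ x) = _ := hΦ x
    simp only [this]
    induction x using DirectSum.induction_on with
    | zero => rw [map_zero]; exact zero_mem _
    | add x y hx hy => rw [map_add]; exact add_mem (hx (hΦ _)) (hy (hΦ _))
    | of i x =>
      refine Algebra.subset_adjoin (Or.inr (Set.mem_iUnion.2 ⟨i, x, ?_⟩))
      rw [← DirectSum.lof_eq_of K, DirectSum.toModule_lof]

theorem algHom_ext {R : Type*} [Ring R] [Algebra K R] {f f' : A.carrier →ₐ[K] R}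
    (h0 : ∀ b, f (incl b) = f' (incl b)) (h1 : ∀ i x, f (g i x) = f' (g i x)) : f = f' := by
  refine AlgHom.ext_of_adjoin_eq_top h.adjoin_eq_top ?_
  rintro _ (⟨b, rfl⟩ | hx)
  · exact h0 b
  · obtain ⟨i, x, rfl⟩ := Set.mem_iUnion.1 hx
    exact h1 i x

theorem exists_algHom {R : Type*} [Ring R] [Algebra K R] (α : B.carrier →ₐ[K] R)
    (γ : ∀ i, (W i).carrier →ₗ[K] R)
    (hγ : ∀ i j a b, ∀ x ∈ (W i).gr a, ∀ y ∈ (W j).gr b, γ i x * γ j y =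
      (((a + s i).1 + (a + s i).2) * ((b + s j).1 + (b + s j).2)).negOnePow • (γ j y * γ i x))
    (hαγ : ∀ i a c, ∀ x ∈ (W i).gr a, ∀ b ∈ B.gr c, γ i x * α b =
      (((a + s i).1 + (a + s i).2) * (c.1 + c.2)).negOnePow • (α b * γ i x)) :
    ∃ H : A.carrier →ₐ[K] R, (∀ b, H (incl b) = α b) ∧ ∀ i x, H (g i x) = γ i x := by
  have h' := h
  obtain ⟨hg, Φ, hΦ, hb⟩ := h'
  have hΦ' : ∀ x, Φ (FreeGCA.gen _ x) = DirectSum.toModule K ι A.carrier g x := hΦ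
  obtain ⟨H, H1, H2⟩ := exists_lift_of_bijective hb (sumGr_iSup W s)
    (fun a c x hx b hb => by
      rw [hΦ']
      exact A.mul_comm (hg a x hx) (incl.map_gr hb)) α (DirectSum.toModule K ι R γ)
    (fun a b x hx y hy => by
      refine sumGr_induction W s (P := fun x => _ * _ = _ • (_ * DirectSum.toModule K ι R γ x))
        (by simp) (fun x x' hx hx' => by simp only [map_add, add_mul, mul_add, hx, hx', smul_add])
        (fun i a' x hx e => ?_) hx
      refine sumGr_induction W s (P := fun y => _ * DirectSum.toModule K ι R γ y = _ • (_ * _))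
        (by simp) (fun x x' hx hx' => by simp only [map_add, add_mul, mul_add, hx, hx', smul_add])
        (fun j b' y hy e' => ?_) hy
      rw [DirectSum.toModule_lof, DirectSum.toModule_lof, ← e, ← e']
      exact hγ i j a' b' x hx y hy)
    (fun a c x hx b hb => by
      refine sumGr_induction W s (P := fun x => _ * _ = _ • (_ * DirectSum.toModule K ι R γ x))
        (by simp) (fun x x' hx hx' => by simp only [map_add, add_mul, mul_add, hx, hx', smul_add])
        (fun i a' x hx e => ?_) hx
      rw [DirectSum.toModule_lof, ← e]
      exact hαγ i a' c x hx b hb)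
  refine ⟨H, H1, fun i x => ?_⟩
  have := H2 (DirectSum.lof K ι (fun i => (W i).carrier) i x)
  rwa [hΦ', DirectSum.toModule_lof, DirectSum.toModule_lof] at this

theorem isGraded {C : CBBA K} {f : A.carrier →ₐ[K] C.carrier}
    (h0 : ∀ a b, b ∈ B.gr a → f (incl b) ∈ C.gr a)
    (h1 : ∀ i, f.toLinearMap ∘ₗ g i ∈ CBBA.homDeg (W i) C (s i)) : CBBA.IsGraded f := by
  intro a x hx
  have key := Bigraded.eq_of_adjoin (K := K) A.internal.submodule_iSupIndep
    (G := fun a => A.gr a ⊓ (C.gr a).comap f.toLinearMap) (fun a => inf_le_left) h.adjoin_eq_top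
    ⟨A.one_mem, by simpa using C.one_mem⟩
    (fun a b x hx y hy => ⟨A.mul_mem hx.1 hy.1, by
      have := C.mul_mem hx.2 hy.2
      simpa using this⟩) (by
      rintro _ (⟨b, rfl⟩ | hx)
      · have hb : b ∈ ⨆ a, B.gr a := B.internal.submodule_iSup_eq_top ▸ trivial
        induction hb using Submodule.iSup_induction' with
        | zero => rw [map_zero]; exact zero_mem _
        | add x y _ _ hx hy => rw [map_add]; exact add_mem hx hy
        | mem a b hb => exact Submodule.mem_iSup_of_mem a ⟨incl.map_gr hb, h0 a b hb⟩
      · obtain ⟨i, x, rfl⟩ := Set.mem_iUnion.1 hx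
        have hb : x ∈ ⨆ a, (W i).gr a := (W i).internal.submodule_iSup_eq_top ▸ trivial
        induction hb using Submodule.iSup_induction' with
        | zero => rw [map_zero]; exact zero_mem _
        | add x y _ _ hx' hy' =>
          rw [map_add]
          exact add_mem (hx' (Set.mem_iUnion.2 ⟨i, x, rfl⟩)) (hy' (Set.mem_iUnion.2 ⟨i, y, rfl⟩))
        | mem a b hb => exact Submodule.mem_iSup_of_mem _ ⟨h.gen_mem i a b hb, h1 i a b hb⟩) a
  exact (key.ge hx).2

/-- Graded algebra maps out of a free extension. -/
theorem exists_gradedHom {C : CBBA K} (ν : B.carrier →ₐ[K] C.carrier) (hν : CBBA.IsGraded ν)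
    (γ : ∀ i, (W i).carrier →ₗ[K] C.carrier) (hγ : ∀ i, γ i ∈ CBBA.homDeg (W i) C (s i)) :
    ∃ H : A.carrier →ₐ[K] C.carrier, CBBA.IsGraded H ∧ (∀ b, H (incl b) = ν b) ∧
      ∀ i, H.toLinearMap ∘ₗ g i = γ i := by
  obtain ⟨H, H0, H1⟩ := h.exists_algHom ν γ
    (fun i j a b x hx y hy => C.mul_comm (hγ i a x hx) (hγ j b y hy))
    (fun i a c x hx b hb => C.mul_comm (hγ i a x hx) (hν _ _ hb))
  have H1' : ∀ i, H.toLinearMap ∘ₗ g i = γ i := fun i => LinearMap.ext (H1 i)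
  refine ⟨H, h.isGraded (fun a b hb => ?_) (fun i => ?_), H0, H1'⟩
  · rw [H0]; exact hν a b hb
  · rw [H1']; exact hγ i

end IsFreeOver

/-- After the Koszul swap of factors the map is `B ⊗ V → B ⊗ ⋀ U ≃ A`, and `V → ⋀ U` is split
injective by `FreeGCA.exists_retraction`. This allows equations in `V ⊗ B` to be tested in `A`. -/
theorem IsFreeOver.tl_injective [CharZero K] {B A : CBBA K} {incl : B.Hom A} {ι : Type}
    [DecidableEq ι] {W : ι → Bicomplex K} {s : ι → ℤ × ℤ}
    {g : ∀ i, (W i).carrier →ₗ[K] A.carrier}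
    (h : IsFreeOver incl (sumGr W s) (DirectSum.toModule K ι A.carrier g)) {i : ι} (hs : s i = 0) :
    Function.Injective (incl.tl (g i)) := by
  have hg := h.gen_mem i
  rw [hs] at hg
  obtain ⟨-, Φ, hΦ, hb⟩ := h
  obtain ⟨r, hr⟩ := FreeGCA.exists_retraction (K := K) (sumGr W s)
  let V := W i
  let half : K := 2⁻¹
  -- Projections onto the even and odd parts of `V`. Moving `b` past `v` costs nothing for even `v`
  -- and applies the sign operator to `b` for odd `v`; θ is the resulting swap and θ' its inverse.
  let ev : V.carrier →ₗ[K] V.carrier := half • (LinearMap.id + V.sgn)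
  let od : V.carrier →ₗ[K] V.carrier := half • (LinearMap.id - V.sgn)
  let sB : B.carrier →ₗ[K] B.carrier := B.sgn.toLinearMap
  let θ : V.carrier ⊗[K] B.carrier →ₗ[K] B.carrier ⊗[K] V.carrier :=
    (TensorProduct.comm K _ _).toLinearMap ∘ₗ
      (TensorProduct.map ev LinearMap.id + TensorProduct.map od sB)
  let θ' : B.carrier ⊗[K] V.carrier →ₗ[K] V.carrier ⊗[K] B.carrier :=
    (TensorProduct.map ev LinearMap.id + TensorProduct.map od sB) ∘ₗ
    (TensorProduct.comm K _ _).toLinearMap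
  have h2 : (2 : K) ≠ 0 := two_ne_zero
  have hev : ∀ v, ev (ev v) = ev v := fun v => by
    simp only [ev, LinearMap.smul_apply, LinearMap.add_apply, LinearMap.id_apply, map_smul, map_add,
      V.sgn_sgn]
    match_scalars <;> simp only [half] <;> field_simp <;> norm_num
  have hod : ∀ v, od (od v) = od v := fun v => by
    simp only [od, LinearMap.smul_apply, LinearMap.sub_apply, LinearMap.id_apply, map_smul, map_sub,
      V.sgn_sgn]
    match_scalars <;> simp only [half] <;> field_simp <;> norm_num
  have heo : ∀ v, ev (od v) = 0 := fun v => by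
    simp only [ev, od, LinearMap.smul_apply, LinearMap.add_apply, LinearMap.sub_apply,
      LinearMap.id_apply, map_smul, map_sub, V.sgn_sgn]
    module
  have hoe : ∀ v, od (ev v) = 0 := fun v => by
    simp only [ev, od, LinearMap.smul_apply, LinearMap.add_apply, LinearMap.sub_apply,
      LinearMap.id_apply, map_smul, map_add, V.sgn_sgn]
    module
  have hsum : ∀ v, ev v + od v = v := fun v => by
    simp only [ev, od, LinearMap.smul_apply, LinearMap.add_apply, LinearMap.sub_apply,
      LinearMap.id_apply]
    match_scalars <;> simp only [half] <;> field_simp <;> norm_num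
  have hθ : ∀ t, θ' (θ t) = t := by
    intro t
    have : θ' ∘ₗ θ = LinearMap.id := TensorProduct.ext' fun v b => by
      simp [θ, θ', hev, hod, heo, hoe, sB, B.sgn_sgn, ← TensorProduct.add_tmul, hsum]
    exact LinearMap.congr_fun this t
  let lofi := DirectSum.lof K ι (fun i => (W i).carrier) i
  let m := LinearMap.mul' K A.carrier ∘ₗ TensorProduct.map incl.toAlgHom.toLinearMap Φ.toLinearMap
  have hfac : incl.tl (g i) =
      m ∘ₗ TensorProduct.map LinearMap.id (FreeGCA.gen (sumGr W s) ∘ₗ lofi) ∘ₗ θ := by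
    refine TensorProduct.ext' fun v b => ?_
    have e : ∀ x : V.carrier, Φ (FreeGCA.gen (sumGr W s) (lofi x)) = g i x := fun x => by
      have := hΦ (lofi x)
      rw [DirectSum.toModule_lof] at this
      exact this
    have key : g i v * incl b = incl b * g i (ev v) + incl (B.sgn b) * g i (od v) := by
      have : ((LinearMap.mul K A.carrier).flip (incl b)) ∘ₗ g i =
          LinearMap.mulLeft K (incl b) ∘ₗ g i ∘ₗ ev +
          LinearMap.mulLeft K (incl (B.sgn b)) ∘ₗ g i ∘ₗ od := by
        refine V.hom_ext fun a x hx => ?_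
        have hb' : b ∈ ⨆ a, B.gr a := B.internal.submodule_iSup_eq_top ▸ trivial
        simp only [LinearMap.comp_apply, LinearMap.add_apply, LinearMap.mulLeft_apply,
          LinearMap.flip_apply, LinearMap.mul_apply']
        induction hb' using Submodule.iSup_induction' with
        | zero => simp
        | add b b' _ _ e e' => simp only [map_add, mul_add, add_mul, e, e']; abel
        | mem c b hb =>
          have hgx := hg a x hx
          rw [add_zero] at hgx
          rw [A.mul_comm hgx (incl.map_gr hb), B.sgn_of_mem hb]
          have hs := V.sgn_of_mem hx
          rcases Int.even_or_odd (a.1 + a.2) with ha | ha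
          · rw [Int.negOnePow_even _ ha, one_smul] at hs
            have h1 : ev x = x := by
              simp only [ev, LinearMap.smul_apply, LinearMap.add_apply, LinearMap.id_apply, hs]
              rw [← two_smul K, smul_smul, inv_mul_cancel₀ h2, one_smul]
            have h2 : od x = 0 := by
              simp [od, hs]
            rw [h1, h2, Int.negOnePow_even _ (ha.mul_right _)]; simp
          · rw [Int.negOnePow_odd _ ha, Units.neg_smul, one_smul] at hs
            have h1 : od x = x := by
              simp only [od, LinearMap.smul_apply, LinearMap.sub_apply, LinearMap.id_apply, hs]
              rw [sub_neg_eq_add, ← two_smul K, smul_smul, inv_mul_cancel₀ h2, one_smul]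
            have h2 : ev x = 0 := by
              simp [ev, hs]
            have h3 : ((a.1 + a.2) * (c.1 + c.2)).negOnePow = (c.1 + c.2).negOnePow := by
              rcases Int.even_or_odd (c.1 + c.2) with hc | hc
              · rw [Int.negOnePow_even _ hc, Int.negOnePow_even _ (hc.mul_left _)]
              · rw [Int.negOnePow_odd _ hc, Int.negOnePow_odd _ (ha.mul hc)]
            rw [h1, h2, h3, Bigraded.map_units_smul incl.toAlgHom, smul_mul_assoc]; simp
      exact LinearMap.congr_fun this v
    rw [CBBA.Hom.tl_tmul, key]
    simp [θ, m, e, sB]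
  rw [hfac]
  have hinj : Function.LeftInverse (θ' ∘ₗ TensorProduct.map LinearMap.id
      (DirectSum.component K ι (fun i => (W i).carrier) i ∘ₗ r))
      (TensorProduct.map LinearMap.id (FreeGCA.gen (sumGr W s) ∘ₗ lofi) ∘ₗ θ) := by
    intro t
    have hm : TensorProduct.map LinearMap.id
        (DirectSum.component K ι (fun i => (W i).carrier) i ∘ₗ r) ∘ₗ
        TensorProduct.map (LinearMap.id : B.carrier →ₗ[K] B.carrier)
          (FreeGCA.gen (sumGr W s) ∘ₗ lofi) = LinearMap.id :=
      TensorProduct.ext' fun b v => by simp [hr, lofi, DirectSum.component.lof_self]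
    exact (congrArg θ' (LinearMap.congr_fun hm (θ t))).trans (hθ t)
  rw [LinearMap.coe_comp]
  exact hb.1.comp hinj.injective

end

section
variable {K : Type u} [Field K]

/-! ## Maps defined on stages of a free extension -/

theorem CBBA.D_mem_adjoin {A : CBBA K} {S : Set A.carrier} {c : Bool}
    (hs : ∀ x ∈ S, A.sgn x ∈ Algebra.adjoin K S) (hD : ∀ x ∈ S, A.D c x ∈ Algebra.adjoin K S)
    {x : A.carrier} (hx : x ∈ Algebra.adjoin K S) : A.D c x ∈ Algebra.adjoin K S := by
  have hs' : ∀ x ∈ Algebra.adjoin K S, A.sgn x ∈ Algebra.adjoin K S := by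
    have : Algebra.adjoin K S ≤ (Algebra.adjoin K S).comap A.sgn :=
      Algebra.adjoin_le_iff.2 hs
    exact fun x hx => this hx
  induction hx using Algebra.adjoin_induction with
  | mem x hx => exact hD x hx
  | algebraMap r => rw [A.D_algebraMap]; exact zero_mem _
  | add x y _ _ hx hy => rw [map_add]; exact add_mem hx hy
  | mul x y hx' hy' hx hy =>
    rw [A.D_mul]; exact add_mem (Subalgebra.mul_mem _ hx hy') (Subalgebra.mul_mem _ (hs' x hx') hy)

theorem CBBA.map_D_of_adjoin {A C : CBBA K} {f : A.carrier →ₐ[K] C.carrier}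
    (hf : CBBA.IsGraded f) {S : Set A.carrier} {c : Bool}
    (hS : ∀ x ∈ S, f (A.D c x) = C.D c (f x)) {x : A.carrier} (hx : x ∈ Algebra.adjoin K S) :
    f (A.D c x) = C.D c (f x) := by
  induction hx using Algebra.adjoin_induction with
  | mem x hx => exact hS x hx
  | algebraMap r => rw [A.D_algebraMap, AlgHom.commutes, C.D_algebraMap, map_zero]
  | add x y _ _ hx hy => simp only [map_add, hx, hy]
  | mul x y _ _ hx hy =>
    rw [A.D_mul, map_mul, C.D_mul, map_add, map_mul, map_mul, hx, hy, CBBA.map_sgn hf]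

/-- A graded algebra map under `B` that is compatible with the differentials on `S`. -/
structure CBBA.IsHomOn {A B C : CBBA K} (i₀ : B.Hom A) (ν : B.Hom C) (S : Subalgebra K A.carrier)
    (f : A.carrier →ₐ[K] C.carrier) : Prop where
  graded : CBBA.IsGraded f
  base : ∀ b, f (i₀ b) = ν b
  comm : ∀ c, ∀ x ∈ S, f (A.D c x) = C.D c (f x)

/-- The subalgebra generated by `B` and the generators of rank `< n`. -/
def genStage {B A : CBBA K} (i₀ : B.Hom A) {ι : Type} {W : ι → Bicomplex K}
    (g : ∀ i, (W i).carrier →ₗ[K] A.carrier) (rank : ι → ℕ) (n : ℕ) : Subalgebra K A.carrier :=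
  Algebra.adjoin K (Set.range i₀ ∪ ⋃ i ∈ {i | rank i < n}, Set.range (g i))

section genStage
variable {B A : CBBA K} {i₀ : B.Hom A} {ι : Type} {W : ι → Bicomplex K}
  {g : ∀ i, (W i).carrier →ₗ[K] A.carrier} {rank : ι → ℕ}

theorem genStage_mono {n m : ℕ} (h : n ≤ m) : genStage i₀ g rank n ≤ genStage i₀ g rank m :=
  Algebra.adjoin_mono (Set.union_subset_union_right _
    (Set.biUnion_subset_biUnion_left fun _ hi => lt_of_lt_of_le hi h))

theorem base_mem_genStage (b : B.carrier) (n : ℕ) : i₀ b ∈ genStage i₀ g rank n :=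
  Algebra.subset_adjoin (Or.inl ⟨b, rfl⟩)

theorem gen_mem_genStage {i : ι} {n : ℕ} (h : rank i < n) (v : (W i).carrier) :
    g i v ∈ genStage i₀ g rank n :=
  Algebra.subset_adjoin (Or.inr (Set.mem_biUnion h ⟨v, rfl⟩))

theorem genStage_ext {R : Type*} [Ring R] [Algebra K R] {f f' : A.carrier →ₐ[K] R} {n : ℕ}
    (h0 : ∀ b, f (i₀ b) = f' (i₀ b)) (h1 : ∀ i, rank i < n → ∀ v, f (g i v) = f' (g i v))
    {x : A.carrier} (hx : x ∈ genStage i₀ g rank n) : f x = f' x := by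
  have : genStage i₀ g rank n ≤ AlgHom.equalizer f f' := by
    refine Algebra.adjoin_le_iff.2 ?_
    rintro _ (⟨b, rfl⟩ | hx)
    · exact h0 b
    · simp only [Set.mem_iUnion] at hx
      obtain ⟨i, hi, v, rfl⟩ := hx
      exact h1 i hi v
  exact this hx

theorem genStage_le {S : Subalgebra K A.carrier} {n : ℕ} (h0 : ∀ b, i₀ b ∈ S)
    (h1 : ∀ i, rank i < n → ∀ v, g i v ∈ S) : genStage i₀ g rank n ≤ S := by
  refine Algebra.adjoin_le_iff.2 ?_
  rintro _ (⟨b, rfl⟩ | hx)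
  · exact h0 b
  · simp only [Set.mem_iUnion] at hx
    obtain ⟨i, hi, v, rfl⟩ := hx
    exact h1 i hi v

theorem CBBA.IsHomOn.succ {C : CBBA K} {ν : B.Hom C} {n : ℕ} {f f' : A.carrier →ₐ[K] C.carrier}
    (hf : CBBA.IsHomOn i₀ ν (genStage i₀ g rank n) f) (hf' : CBBA.IsGraded f')
    (heq : ∀ x ∈ genStage i₀ g rank n, f' x = f x)
    (hD : ∀ c, ∀ x ∈ genStage i₀ g rank n, A.D c x ∈ genStage i₀ g rank n)
    (hn : ∀ c i, rank i = n → ∀ v, f' (A.D c (g i v)) = C.D c (f' (g i v))) :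
    CBBA.IsHomOn i₀ ν (genStage i₀ g rank (n + 1)) f' := by
  have h0 : ∀ b, f' (i₀ b) = ν b := fun b => (heq _ (base_mem_genStage b n)).trans (hf.base b)
  refine ⟨hf', h0, fun c x hx => CBBA.map_D_of_adjoin hf' ?_ hx⟩
  rintro _ (⟨b, rfl⟩ | hx)
  · rw [← i₀.map_D, h0, h0, ν.map_D]
  · simp only [Set.mem_iUnion] at hx
    obtain ⟨i, hi, v, rfl⟩ := hx
    rcases Nat.lt_succ_iff_lt_or_eq.1 hi with hi | hi
    · have hv := gen_mem_genStage (i₀ := i₀) (g := g) hi v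
      rw [heq _ hv, heq _ (hD c _ hv), hf.comm c _ hv]
    · exact hn c i hi v

variable [DecidableEq ι] {s : ι → ℤ × ℤ}
  (h : IsFreeOver i₀ (sumGr W s) (DirectSum.toModule K ι A.carrier g))
include h

theorem IsFreeOver.exists_mem_genStage (rank : ι → ℕ) (x : A.carrier) :
    ∃ n, x ∈ genStage i₀ g rank n := by
  have hx : x ∈ Algebra.adjoin K (Set.range i₀ ∪ ⋃ i, Set.range (g i)) :=
    h.adjoin_eq_top ▸ trivial
  induction hx using Algebra.adjoin_induction with
  | mem x hx =>
    rcases hx with ⟨b, rfl⟩ | hx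
    · exact ⟨0, base_mem_genStage b 0⟩
    · obtain ⟨i, v, rfl⟩ := Set.mem_iUnion.1 hx
      exact ⟨rank i + 1, gen_mem_genStage (Nat.lt_succ_self _) v⟩
  | algebraMap r => exact ⟨0, algebraMap_mem _ r⟩
  | add x y _ _ hx hy =>
    obtain ⟨n, hn⟩ := hx
    obtain ⟨m, hm⟩ := hy
    exact ⟨max n m, add_mem (genStage_mono (le_max_left _ _) hn) (genStage_mono (le_max_right _ _) hm)⟩
  | mul x y _ _ hx hy =>
    obtain ⟨n, hn⟩ := hx
    obtain ⟨m, hm⟩ := hy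
    exact ⟨max n m, mul_mem (genStage_mono (le_max_left _ _) hn) (genStage_mono (le_max_right _ _) hm)⟩

theorem IsFreeOver.sgn_gen (i : ι) (v : (W i).carrier) :
    A.sgn (g i v) = ((s i).1 + (s i).2).negOnePow • g i ((W i).sgn v) :=
  DGModule.sgn_of_homDeg (M := i₀.toModule) (h.gen_mem i) v

theorem IsFreeOver.D_mem_genStage {n : ℕ} {c : Bool}
    (hD : ∀ i, rank i < n → ∀ v, A.D c (g i v) ∈ genStage i₀ g rank n) {x : A.carrier}
    (hx : x ∈ genStage i₀ g rank n) : A.D c x ∈ genStage i₀ g rank n := by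
  refine CBBA.D_mem_adjoin ?_ ?_ hx
  · rintro _ (⟨b, rfl⟩ | hx)
    · rw [← CBBA.map_sgn i₀.isGraded]; exact base_mem_genStage _ _
    · simp only [Set.mem_iUnion] at hx
      obtain ⟨i, hi, v, rfl⟩ := hx
      rw [h.sgn_gen]
      exact Bigraded.units_smul_mem (Subalgebra.toSubmodule (genStage i₀ g rank n)) _
        (gen_mem_genStage hi _)
  · rintro _ (⟨b, rfl⟩ | hx)
    · rw [← i₀.map_D]; exact base_mem_genStage _ _
    · simp only [Set.mem_iUnion] at hx
      obtain ⟨i, hi, v, rfl⟩ := hx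
      exact hD i hi v

variable {C : CBBA K} {ν : B.Hom C}

/-- Maps on a stage are represented by total graded algebra maps whose values off the stage are
irrelevant. By freeness the values on generators of rank `n` can be reset at will without affecting
stage `n`. -/
theorem IsFreeOver.exists_extend (n : ℕ) {f : A.carrier →ₐ[K] C.carrier} (hf : CBBA.IsGraded f)
    (hν : ∀ b, f (i₀ b) = ν b) (X : ∀ i, (W i).carrier →ₗ[K] C.carrier)
    (hX : ∀ i, rank i = n → X i ∈ CBBA.homDeg (W i) C (s i)) :
    ∃ f' : A.carrier →ₐ[K] C.carrier, CBBA.IsGraded f' ∧ (∀ b, f' (i₀ b) = ν b) ∧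
      (∀ x ∈ genStage i₀ g rank n, f' x = f x) ∧ ∀ i, rank i = n → f'.toLinearMap ∘ₗ g i = X i := by
  obtain ⟨f', h1, h2, h3⟩ := h.exists_gradedHom ν.toAlgHom ν.isGraded
    (fun i => if rank i = n then X i else f.toLinearMap ∘ₗ g i) (fun i => by
      split
      · next hi => exact hX i hi
      · exact hf.comp_homDeg (h.gen_mem i))
  refine ⟨f', h1, h2, fun x hx => genStage_ext (fun b => ?_) (fun i hi v => ?_) hx, fun i hi => ?_⟩
  · exact (h2 b).trans (hν b).symm
  · have := LinearMap.congr_fun (h3 i) v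
    rw [if_neg hi.ne] at this
    exact this
  · rw [h3, if_pos hi]

theorem IsFreeOver.exists_isHomOn_zero (ν : B.Hom C) :
    ∃ f : A.carrier →ₐ[K] C.carrier, CBBA.IsHomOn i₀ ν (genStage i₀ g rank 0) f := by
  obtain ⟨f, h1, h2, -⟩ := h.exists_gradedHom ν.toAlgHom ν.isGraded (fun i => 0)
    (fun i => zero_mem _)
  refine ⟨f, h1, h2, fun c x hx => CBBA.map_D_of_adjoin h1 ?_ hx⟩
  rintro _ (⟨b, rfl⟩ | hx)
  · rw [← i₀.map_D, h2, h2]; exact ν.map_D c b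
  · simp at hx

/-- A generator of rank `k` receives its value from `f (k + 1)`, the first map required to be
correct on it. Each element and its differential lie in a common finite stage, where the limit
agrees with some `f m`. -/
theorem IsFreeOver.exists_limit {f : ℕ → A.carrier →ₐ[K] C.carrier}
    (hf : ∀ n, CBBA.IsHomOn i₀ ν (genStage i₀ g rank n) (f n))
    (heq : ∀ n, ∀ x ∈ genStage i₀ g rank n, f (n + 1) x = f n x) :
    ∃ F : A.Hom C, F.comp i₀ = ν ∧ ∀ n, ∀ x ∈ genStage i₀ g rank n, F x = f n x := by
  have heq' : ∀ n m, n ≤ m → ∀ x ∈ genStage i₀ g rank n, f m x = f n x := by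
    intro n m hnm x hx
    induction m, hnm using Nat.le_induction with
    | base => rfl
    | succ m hm ih => rw [heq m x (genStage_mono hm hx), ih]
  obtain ⟨F, h1, h2, h3⟩ := h.exists_gradedHom ν.toAlgHom ν.isGraded
    (fun i => (f (rank i + 1)).toLinearMap ∘ₗ g i)
    (fun i => (hf (rank i + 1)).graded.comp_homDeg (h.gen_mem i))
  have h4 : ∀ n, ∀ x ∈ genStage i₀ g rank n, F x = f n x := fun n x hx =>
    genStage_ext (fun b => (h2 b).trans ((hf n).base b).symm) (fun i hi v => by
      have := LinearMap.congr_fun (h3 i) v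
      exact this.trans (heq' _ _ hi _ (gen_mem_genStage (Nat.lt_succ_self _) v)).symm) hx
  have h5 : ∀ c x, F (A.D c x) = C.D c (F x) := by
    intro c x
    obtain ⟨n, hn⟩ := h.exists_mem_genStage rank x
    obtain ⟨m, hm⟩ := h.exists_mem_genStage rank (A.D c x)
    have hn' := genStage_mono (le_max_left n m) hn
    rw [h4 _ _ hn', h4 _ _ (genStage_mono (le_max_right n m) hm), (hf _).comm c _ hn']
  exact ⟨⟨F, fun hx => h1 _ _ hx, h5 false, h5 true⟩, CBBA.Hom.ext' h2, h4⟩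

theorem IsFreeOver.exists_hom_of_step (P : ℕ → (A.carrier →ₐ[K] C.carrier) → Prop)
    (zero : ∃ f, CBBA.IsHomOn i₀ ν (genStage i₀ g rank 0) f ∧ P 0 f)
    (step : ∀ n f, CBBA.IsHomOn i₀ ν (genStage i₀ g rank n) f → P n f →
      ∃ f', CBBA.IsHomOn i₀ ν (genStage i₀ g rank (n + 1)) f' ∧
        (∀ x ∈ genStage i₀ g rank n, f' x = f x) ∧ P (n + 1) f') :
    ∃ F : A.Hom C, F.comp i₀ = ν ∧
      ∀ n, ∃ f, P n f ∧ ∀ x ∈ genStage i₀ g rank n, F x = f x := by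
  choose! next hn1 hn2 hn3 using step
  obtain ⟨f0, hf0, hP0⟩ := zero
  let f : ℕ → A.carrier →ₐ[K] C.carrier := fun n => Nat.rec f0 (fun n f => next n f) n
  have hf : ∀ n, CBBA.IsHomOn i₀ ν (genStage i₀ g rank n) (f n) ∧ P n (f n) := by
    intro n
    induction n with
    | zero => exact ⟨hf0, hP0⟩
    | succ n ih => exact ⟨hn1 n _ ih.1 ih.2, hn3 n _ ih.1 ih.2⟩
  obtain ⟨F, h1, h2⟩ := h.exists_limit (fun n => (hf n).1) fun n => hn2 n _ (hf n).1 (hf n).2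
  exact ⟨F, h1, fun n => ⟨f n, (hf n).2, h2 n⟩⟩

end genStage
end

section
variable {K : Type u} [Field K]

/-! ## Successive Hirsch extensions -/

namespace SuccHirschExt
variable {B A C : CBBA K} (E : SuccHirschExt B A)

theorem gen_mem (n : ℕ) : E.gen n ∈ CBBA.homDeg (E.V n) A 0 := E.free.gen_mem n

theorem tDD_gen_mem (c : Bool) (n : ℕ) (v : (E.V n).carrier) :
    E.incl.tDD (E.T n) c 0 (E.gen n) v ∈ E.stage n := by
  cases c
  · exact E.phi_mem n v
  · exact E.phibar_mem n v

theorem stage_mono {n m : ℕ} (h : n ≤ m) : E.stage n ≤ E.stage m := genStage_mono h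

theorem incl_mem_stage (b : B.carrier) (n : ℕ) : E.incl b ∈ E.stage n := base_mem_genStage b n

theorem gen_mem_stage {k n : ℕ} (h : k < n) (v : (E.V k).carrier) : E.gen k v ∈ E.stage n :=
  gen_mem_genStage (rank := id) h v

theorem tl_mem_stage {V : Bicomplex K} {n : ℕ} {ψ : V.carrier →ₗ[K] A.carrier}
    (hψ : ∀ v, ψ v ∈ E.stage n) (t : V.carrier ⊗[K] B.carrier) : E.incl.tl ψ t ∈ E.stage n :=
  E.incl.tl_eq_of_mem (S := Subalgebra.toSubmodule (E.stage n))
    (fun _ hx b => (E.stage n).mul_mem hx (E.incl_mem_stage b n)) hψ t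

theorem D_gen_mem_stage (c : Bool) {k n : ℕ} (h : k < n) (v : (E.V k).carrier) :
    A.D c (E.gen k v) ∈ E.stage n := by
  rw [E.incl.D_eq (E.T k) c 0]
  refine add_mem (E.stage_mono h.le (E.tDD_gen_mem c k v))
    (Bigraded.units_smul_mem (Subalgebra.toSubmodule (E.stage n)) _
      (add_mem (E.gen_mem_stage h _) (E.tl_mem_stage (fun v => E.gen_mem_stage h v) _)))

theorem D_mem_stage (c : Bool) {n : ℕ} {x : A.carrier} (hx : x ∈ E.stage n) :
    A.D c x ∈ E.stage n :=
  E.free.D_mem_genStage (rank := id) (fun _ hi v => E.D_gen_mem_stage c hi v) hx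

/-- Modulo `A_n` the differentials of `A` act on the copy of `V_n ⊗ B` through `dF`, so their
anticommutation puts the image of the anticommutator of `dF` in `A_n`. That image also lies in the
span of the products `V_n · B`, which meets `A_n` only in 0; injectivity of `tl` finishes. -/
theorem flat [CharZero K] (n : ℕ) : (E.T n).Flat := by
  -- ρ is the projection of `A` onto `A_n` that kills all generators of rank at least `n`; it
  -- separates `A_n` from `V_n · B`.
  obtain ⟨ρ, -, h1, h2⟩ := E.free.exists_gradedHom E.incl.toAlgHom E.incl.isGraded
    (fun i => if i < n then E.gen i else 0) (fun i => by
      split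
      · exact E.gen_mem i
      · exact zero_mem _)
  have hρ : ∀ x ∈ E.stage n, ρ x = x := fun x hx =>
    genStage_ext (rank := id) (f' := AlgHom.id K _) h1 (fun i hi v => by
      have := LinearMap.congr_fun (h2 i) v
      rwa [if_pos (show i < n from hi)] at this) hx
  have hρ0 : ∀ t, ρ (E.incl.tl (E.gen n) t) = 0 := fun t => by
    rw [CBBA.Hom.map_tl (ν' := E.incl) h1, h2, if_neg (lt_irrefl n)]
    induction t with
    | zero => rw [map_zero]
    | tmul v b => rw [CBBA.Hom.tl_tmul]; simp
    | add x y hx hy => rw [map_add, hx, hy, add_zero]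
  intro c c' t
  apply E.free.tl_injective (i := n) rfl
  have key : ∀ c c' t, A.D c (A.D c' (E.incl.tl (E.gen n) t)) -
      E.incl.tl (E.gen n) ((E.T n).dF c ((E.T n).dF c' t)) ∈ E.stage n := by
    intro c c' t
    rw [E.incl.D_tl (T := E.T n) (E.gen_mem n) c' (n := 0) rfl, Int.negOnePow_zero, one_smul,
      map_add, E.incl.D_tl (T := E.T n) (E.gen_mem n) c (n := 0) rfl, Int.negOnePow_zero, one_smul,
      ← add_assoc, add_sub_cancel_right]
    exact add_mem (E.D_mem_stage c (E.tl_mem_stage (E.tDD_gen_mem c' n) t))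
      (E.tl_mem_stage (E.tDD_gen_mem c n) _)
  have hmem : E.incl.tl (E.gen n) ((E.T n).dF c ((E.T n).dF c' t) +
      (E.T n).dF c' ((E.T n).dF c t)) ∈ E.stage n := by
    have h3 := add_mem (key c c' t) (key c' c t)
    rw [sub_add_sub_comm, A.D_D, zero_sub, ← map_add] at h3
    simpa using neg_mem h3
  rw [map_zero, ← hρ _ hmem, hρ0]

variable {E} {ν : B.Hom C}

/-- Since ∂ = ∂_V + φ + Θ on `V_n`, compatibility with ∂ at the new generators says precisely that
the twisted differential of `X` is `f φ`; likewise for ∂̄. -/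
theorem exists_extend {n : ℕ} {f : A.carrier →ₐ[K] C.carrier}
    (hf : CBBA.IsHomOn E.incl ν (E.stage n) f) {X : (E.V n).carrier →ₗ[K] C.carrier}
    (hX : X ∈ CBBA.homDeg (E.V n) C 0)
    (hD : ∀ c, ν.tDD (E.T n) c 0 X =
      f.toLinearMap ∘ₗ E.incl.tDD (E.T n) c 0 (E.gen n)) :
    ∃ f' : A.carrier →ₐ[K] C.carrier, CBBA.IsHomOn E.incl ν (E.stage (n + 1)) f' ∧
      (∀ x ∈ E.stage n, f' x = f x) ∧ f'.toLinearMap ∘ₗ E.gen n = X := by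
  obtain ⟨f', h1, h2, h3, h4⟩ := E.free.exists_extend (rank := id) n hf.graded hf.base
    (fun i => if h : i = n then h ▸ X else 0) (by rintro i rfl; simpa using hX)
  have h4' : f'.toLinearMap ∘ₗ E.gen n = X := by simpa using h4 n rfl
  refine ⟨f', CBBA.IsHomOn.succ (rank := id) hf h1 h3 (fun c x hx => E.D_mem_stage c hx) ?_, h3, h4'⟩
  rintro c i hi v
  obtain rfl : i = n := hi
  rw [← CBBA.Hom.map_tDD_iff (ν := E.incl) (ν' := ν) h2 (E.T _) c 0, h4']
  exact (h3 _ (E.tDD_gen_mem c _ v)).trans (LinearMap.congr_fun (hD c) v).symm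

end SuccHirschExt

/-! ## Acyclic surjections -/

/-- The subspace `N` has vanishing twisted Bott-Chern cohomology, in the sense that every cocycle
with values in `N` is the image under `∂∂̄` of a map with values in `N`. -/
def CBBA.Hom.IsAcyclicOn {P B : CBBA K} (β : B.Hom P) {V : Bicomplex K}
    (T : Twisting V B) (N : Submodule K P.carrier) : Prop :=
  ∀ (a : ℤ × ℤ) (n : ℤ), n = a.1 + a.2 → ∀ χ ∈ CBBA.homDeg V P a, (∀ c, β.tDD T c n χ = 0) →
    (∀ v, χ v ∈ N) →
    ∃ κ ∈ CBBA.homDeg V P (a - (1, 1)), (∀ v, κ v ∈ N) ∧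
      β.tDD T false (n - 1) (β.tDD T true (n - 2) κ) = χ

/-- The kernel of `q` has vanishing twisted Bott-Chern cohomology. -/
abbrev CBBA.Hom.IsAcyclicFor {P Q B : CBBA K} (q : P.Hom Q) (β : B.Hom P) {V : Bicomplex K}
    (T : Twisting V B) : Prop := β.IsAcyclicOn T (LinearMap.ker q.toAlgHom.toLinearMap)

theorem CBBA.Hom.tDD_mem_of_mem {P B : CBBA K} {β : B.Hom P} {V : Bicomplex K}
    {T : Twisting V B} {N : Submodule K P.carrier} (hND : ∀ c, ∀ x ∈ N, P.D c x ∈ N)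
    (hNB : ∀ x ∈ N, ∀ b, x * β b ∈ N) {ψ : V.carrier →ₗ[K] P.carrier} (hψ : ∀ v, ψ v ∈ N)
    (c : Bool) (k : ℤ) (v : V.carrier) : β.tDD T c k ψ v ∈ N := by
  rw [β.tDD_apply]
  exact sub_mem (hND c _ (hψ v)) (Bigraded.units_smul_mem N _
    (add_mem (hψ _) (β.tl_eq_of_mem hNB hψ _)))

/-- Bott-Chern acyclicity in all bidegrees is used three times. As ∂̄u₀ is closed it equals ∂∂̄α;
then u₀ + ∂α is closed and equals ∂∂̄γ, so a₁ = ∂̄γ - α solves ∂a₁ = u₀. The remaining error u₁ -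
∂̄a₁ is closed, hence ∂∂̄ε, and subtracting ∂ε from a₁ removes it without disturbing the first
equation. -/
theorem CBBA.Hom.IsAcyclicOn.exists_primitive [CharZero K] {P B : CBBA K}
    {β : B.Hom P} {V : Bicomplex K} {T : Twisting V B} {N : Submodule K P.carrier}
    (h : β.IsAcyclicOn T N) (hND : ∀ c, ∀ x ∈ N, P.D c x ∈ N)
    (hNB : ∀ x ∈ N, ∀ b, x * β b ∈ N) (hT : T.Flat)
    {a : ℤ × ℤ} {n m : ℤ} (hn : n = a.1 + a.2) (hm : m = n + 1)
    {u : Bool → V.carrier →ₗ[K] P.carrier} (hu : ∀ c, u c ∈ CBBA.homDeg V P (a + eDeg c))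
    (hq : ∀ c v, u c v ∈ N)
    (hD : ∀ c c', β.tDD T c m (u c') + β.tDD T c' m (u c) = 0) :
    ∃ ω ∈ CBBA.homDeg V P a, (∀ v, ω v ∈ N) ∧ ∀ c, β.tDD T c n ω = u c := by
  have hself : ∀ c, β.tDD T c m (u c) = 0 := fun c => by
    have := hD c c
    rw [← two_smul K] at this
    exact (smul_eq_zero.1 this).resolve_left two_ne_zero
  have hqD : ∀ (ψ : V.carrier →ₗ[K] P.carrier) c k, (∀ v, ψ v ∈ N) →
      ∀ v, β.tDD T c k ψ v ∈ N := fun ψ c k hψ v => CBBA.Hom.tDD_mem_of_mem hND hNB hψ c k v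
  have e1 : a + eDeg false + eDeg true = a + (1, 1) := by simp [eDeg, add_assoc]
  have e1' : a + eDeg true + eDeg false = a + (1, 1) := by simp [eDeg, add_assoc]
  -- `∂̄ u₀ = ∂ ∂̄ α`
  obtain ⟨α, hα, hqα, hα'⟩ := h (a + (1, 1)) (m + 1) (by simp [hm, hn]; ring)
    (β.tDD T true m (u false)) (e1 ▸ β.tDD_mem (hu false) true m) (fun c => by
      cases c
      · have h2 := β.tDD_tDD hT (hu false) false true (n := m) (m := m + 1)
          (by simp [eDeg, hm, hn]; ring) rfl
        rw [hself, map_zero, add_zero] at h2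
        exact h2
      · exact β.tDD_self hT (hu false) true (by simp [eDeg, hm, hn]; ring) rfl) (hqD _ _ _ (hq false))
  rw [add_sub_cancel_right] at hα
  rw [add_sub_cancel_right, show m + 1 - 2 = n by omega] at hα'
  -- `u₀ + ∂ α = ∂ ∂̄ γ`
  have hαα : β.tDD T true m (β.tDD T false n α) = -β.tDD T true m (u false) := by
    have h2 := β.tDD_tDD hT hα false true hn hm
    rw [hα'] at h2
    exact eq_neg_of_add_eq_zero_right h2
  obtain ⟨γ, hγ, hqγ, hγ'⟩ := h (a + (1, 0)) m (by simp [hm, hn]; ring)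
    (u false + β.tDD T false n α) (add_mem (hu false) (β.tDD_mem hα false n)) (fun c => by
      cases c
      · rw [map_add, hself, β.tDD_self hT hα false hn hm, add_zero]
      · rw [map_add, hαα, add_neg_cancel]) (fun v => by
      exact add_mem (hq _ v) (hqD _ _ _ hqα v))
  rw [show m - 1 = n by omega] at hγ'
  have e2 : a + (1, 0) - (1, 1) + eDeg true = a := by
    ext <;> simp [eDeg]
  let a1 := β.tDD T true (m - 2) γ - α
  have ha1 : a1 ∈ CBBA.homDeg V P a := sub_mem (e2 ▸ β.tDD_mem hγ true (m - 2)) hα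
  have hqa1 : ∀ v, a1 v ∈ N := fun v => sub_mem (hqD _ _ _ hqγ v) (hqα v)
  have ha1' : β.tDD T false n a1 = u false := by
    rw [map_sub, hγ', add_sub_cancel_right]
  -- `u₁ - ∂̄ a₁ = ∂ ∂̄ ε`
  obtain ⟨ε, hε, hqε, hε'⟩ := h (a + (0, 1)) m (by simp [hm, hn]; ring)
    (u true - β.tDD T true n a1) (sub_mem (hu true) (β.tDD_mem ha1 true n)) (fun c => by
      cases c
      · have h2 := β.tDD_tDD hT ha1 false true hn hm
        rw [ha1'] at h2
        rw [map_sub, eq_neg_of_add_eq_zero_left h2, sub_neg_eq_add]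
        exact hD false true
      · rw [map_sub, hself, β.tDD_self hT ha1 true hn hm, sub_zero]) (fun v => by
      exact sub_mem (hq _ v) (hqD _ _ _ hqa1 v))
  have e3 : a + (0, 1) - (1, 1) + eDeg false = a := by
    ext <;> simp [eDeg]
  have hεd : a + (0, 1) - (1, 1) = a - (1, 0) := by ext <;> simp
  have hn2 : m - 2 = (a + (0, 1) - (1, 1)).1 + (a + (0, 1) - (1, 1)).2 := by
    simp [hm, hn]; ring
  rw [show m - 1 = n by omega] at hε'
  refine ⟨a1 - β.tDD T false (m - 2) ε, sub_mem ha1 (e3 ▸ β.tDD_mem hε false (m - 2)), fun v => ?_,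
    fun c => ?_⟩
  · exact sub_mem (hqa1 v) (hqD _ _ _ hqε v)
  · cases c
    · rw [map_sub, ha1', β.tDD_self hT hε false hn2 (by omega), sub_zero]
    · have h2 := β.tDD_tDD hT hε false true hn2 (show n = _ by omega)
      rw [hε'] at h2
      rw [map_sub, eq_neg_of_add_eq_zero_right h2, sub_neg_eq_add, add_sub_cancel]

theorem CBBA.Hom.D_mem_ker {P Q : CBBA K} (q : P.Hom Q) (c : Bool) (x : P.carrier)
    (hx : x ∈ LinearMap.ker q.toAlgHom.toLinearMap) :
    P.D c x ∈ LinearMap.ker q.toAlgHom.toLinearMap := by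
  rw [LinearMap.mem_ker, AlgHom.toLinearMap_apply] at *
  rw [q.map_D, hx, map_zero]

theorem CBBA.Hom.mul_mem_ker {P Q : CBBA K} (q : P.Hom Q) (x : P.carrier)
    (hx : x ∈ LinearMap.ker q.toAlgHom.toLinearMap) (y : P.carrier) :
    x * y ∈ LinearMap.ker q.toAlgHom.toLinearMap := by
  rw [LinearMap.mem_ker, AlgHom.toLinearMap_apply] at *
  rw [map_mul, hx, zero_mul]

theorem CBBA.exists_lift_homDeg {P Q : CBBA K} (q : P.Hom Q) (hq : Function.Surjective q)
    {V : Bicomplex K} {a : ℤ × ℤ} {ψ : V.carrier →ₗ[K] Q.carrier}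
    (hψ : ψ ∈ CBBA.homDeg V Q a) :
    ∃ ψ' ∈ CBBA.homDeg V P a, q.toAlgHom.toLinearMap ∘ₗ ψ' = ψ :=
  Bigraded.exists_graded_lift V.internal Q.internal P.internal q.toAlgHom.toLinearMap hq
    (fun _ _ hx => q.map_gr hx) hψ

/-- Strict lifts through acyclic surjections. -/
theorem SuccHirschExt.exists_strict_lift [CharZero K] {B A P Q : CBBA K} (E : SuccHirschExt B A)
    {q : P.Hom Q} (hq : Function.Surjective q) {β : B.Hom P}
    (hac : ∀ n, q.IsAcyclicFor β (E.T n)) (f : A.Hom Q) (hf : f.comp E.incl = q.comp β) :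
    ∃ F : A.Hom P, F.comp E.incl = β ∧ q.comp F = f := by
  have hfb : ∀ b, f (E.incl b) = q (β b) := fun b => by
    have := congrArg (fun h : B.Hom Q => h b) hf
    exact this
  obtain ⟨F, h1, h2⟩ := E.free.exists_hom_of_step (rank := id) (ν := β)
    (P := fun n g => ∀ x ∈ E.stage n, q (g x) = f x) (by
      obtain ⟨g, hg⟩ := E.free.exists_isHomOn_zero (rank := id) β
      refine ⟨g, hg, fun x hx => ?_⟩
      exact genStage_ext (rank := id) (f := q.toAlgHom.comp g) (f' := f.toAlgHom)
        (fun b => by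
          rw [AlgHom.comp_apply, hg.base]; exact (hfb b).symm) (fun i hi => (Nat.not_lt_zero _ hi).elim) hx)
    (fun n g hg hP => by
      -- `X0` lifts `f` on `V_n` only as a graded linear map. The defect `gφ c - tDD c X0` of the
      -- two extension equations lies in ker q and is a compatible pair, so its primitive ω corrects
      -- `X0` without changing the image under `q`.
      obtain ⟨X0, hX0, hX0'⟩ := CBBA.exists_lift_homDeg q hq (f.isGraded.comp_homDeg (E.gen_mem n))
      let φ : Bool → (E.V n).carrier →ₗ[K] A.carrier := fun c => E.incl.tDD (E.T n) c 0 (E.gen n)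
      have hφ : ∀ c, φ c ∈ CBBA.homDeg (E.V n) A (eDeg c) := fun c => by
        have := E.incl.tDD_mem (T := E.T n) (E.gen_mem n) c 0
        rwa [zero_add] at this
      let gφ : Bool → (E.V n).carrier →ₗ[K] P.carrier := fun c => g.toLinearMap ∘ₗ φ c
      have hgφ : ∀ c c' k, β.tDD (E.T n) c k (gφ c') =
          g.toLinearMap ∘ₗ E.incl.tDD (E.T n) c k (φ c') := fun c c' k => LinearMap.ext fun v =>
        ((CBBA.Hom.map_tDD_iff (ν' := β) hg.base (E.T n) c k (φ c') v).2
          (hg.comm c _ (E.tDD_gen_mem c' n v))).symm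
      obtain ⟨ω, hω, hqω, hω'⟩ := (hac n).exists_primitive q.D_mem_ker
        (fun x hx b => q.mul_mem_ker x hx _) (E.flat n) (a := 0) (n := 0) (m := 1)
        (by simp) (by simp) (u := fun c => gφ c - β.tDD (E.T n) c 0 X0) (fun c => by
          rw [zero_add]
          have := β.tDD_mem (T := E.T n) hX0 c 0
          rw [zero_add] at this
          exact sub_mem (hg.graded.comp_homDeg (hφ c)) this) (fun c v => by
          have e1 := LinearMap.congr_fun (CBBA.Hom.map_tDD (ν' := q.comp β) q (fun _ => rfl)
            (E.T n) c 0 X0) v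
          rw [hX0'] at e1
          have e2 := LinearMap.congr_fun (CBBA.Hom.map_tDD (ν' := q.comp β) f hfb
            (E.T n) c 0 (E.gen n)) v
          rw [LinearMap.mem_ker, LinearMap.sub_apply, map_sub]
          refine sub_eq_zero.2 ?_
          exact (hP _ (E.tDD_gen_mem c n v)).trans (e2.trans e1.symm)) (fun c c' => by
          rw [map_sub, map_sub, hgφ, hgφ, sub_add_sub_comm, ← LinearMap.comp_add,
            E.incl.tDD_tDD (E.flat n) (E.gen_mem n) c c' (by simp) (by simp),
            β.tDD_tDD (E.flat n) hX0 c c' (by simp) (by simp), LinearMap.comp_zero, sub_zero])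
      obtain ⟨g', hg1, hg2, hg3⟩ := SuccHirschExt.exists_extend hg (X := X0 + ω) (add_mem hX0 hω)
        (fun c => by rw [map_add, hω', add_sub_cancel])
      refine ⟨g', hg1, hg2, fun x hx => ?_⟩
      refine genStage_ext (rank := id) (f := q.toAlgHom.comp g') (f' := f.toAlgHom) (fun b => ?_)
        (fun i hi v => ?_) hx
      · rw [AlgHom.comp_apply, hg1.base]; exact (hfb b).symm
      · rw [AlgHom.comp_apply]
        rcases Nat.lt_succ_iff_lt_or_eq.1 (show i < n + 1 from hi) with hi | rfl
        · rw [hg2 _ (E.gen_mem_stage hi v)]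
          exact hP _ (E.gen_mem_stage hi v)
        · have e := LinearMap.congr_fun hg3 v
          have e0 := LinearMap.congr_fun hX0' v
          change q (g' (E.gen _ v)) = _
          rw [show g' (E.gen _ v) = X0 v + ω v from e, map_add, show q (ω v) = 0 from hqω v, add_zero]
          exact e0)
  refine ⟨F, h1, CBBA.Hom.ext' fun x => ?_⟩
  obtain ⟨n, hn⟩ := E.free.exists_mem_genStage id x
  obtain ⟨g, hg, hFg⟩ := h2 n
  change q (F x) = f x
  rw [hFg x hn]
  exact hg x hn

end

section
variable {K : Type u} [Field K]

/-! ## Derivations on free extensions -/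

/-- The automorphism that multiplies elements of total degree `m` by `(-1)^(m n)`. -/
noncomputable def CBBA.sgnPow (A : CBBA K) (n : ℤ) : A.carrier →ₐ[K] A.carrier :=
  if Even n then AlgHom.id K _ else A.sgn

theorem CBBA.sgnPow_of_mem (A : CBBA K) (n : ℤ) {a : ℤ × ℤ} {x : A.carrier} (hx : x ∈ A.gr a) :
    A.sgnPow n x = ((a.1 + a.2) * n).negOnePow • x := by
  unfold CBBA.sgnPow
  split
  · next h => rw [Int.negOnePow_even _ (h.mul_left _), one_smul]; rfl
  · next h =>
    rw [A.sgn_of_mem hx]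
    rw [Int.not_even_iff_odd] at h
    congr 1
    rcases Int.even_or_odd (a.1 + a.2) with h' | h'
    · rw [Int.negOnePow_even _ h', Int.negOnePow_even _ (h'.mul_right _)]
    · rw [Int.negOnePow_odd _ h', Int.negOnePow_odd _ (h'.mul h)]

theorem CBBA.sgnPow_mem (A : CBBA K) (n : ℤ) {a : ℤ × ℤ} {x : A.carrier} (hx : x ∈ A.gr a) :
    A.sgnPow n x ∈ A.gr a := by
  rw [A.sgnPow_of_mem n hx]; exact Bigraded.units_smul_mem _ _ hx

theorem units_smul_of_mul_negOnePow {M : Type*} [AddCommGroup M] {n m k : ℤ} (h : Even (n + m + k))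
    (x : M) : n.negOnePow • m.negOnePow • x = k.negOnePow • x := by
  rw [smul_smul, ← Int.negOnePow_add]
  congr 1
  rw [Int.negOnePow_eq_iff]
  obtain ⟨r, hr⟩ := h
  exact ⟨r - k, by linarith⟩

/-- A σ-derivation δ is the same as a multiplicative map `x ↦ !![σ x, δ x; 0, x]` to triangular
matrices, so derivations with prescribed values come from the universal property for algebra maps.
-/
theorem IsFreeOver.exists_derivation {B A : CBBA K} {i₀ : B.Hom A} {ι : Type} [DecidableEq ι]
    {W : ι → Bicomplex K} {s : ι → ℤ × ℤ} {g : ∀ i, (W i).carrier →ₗ[K] A.carrier}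
    (h : IsFreeOver i₀ (sumGr W s) (DirectSum.toModule K ι A.carrier g)) (e : ℤ × ℤ)
    (δB : B.carrier →ₗ[K] A.carrier)
    (hB : ∀ b b', δB (b * b') = δB b * i₀ b' + A.sgnPow (e.1 + e.2) (i₀ b) * δB b')
    (hBe : ∀ a b, b ∈ B.gr a → δB b ∈ A.gr (a + e))
    (δ₀ : ∀ i, (W i).carrier →ₗ[K] A.carrier)
    (hδ₀ : ∀ i, δ₀ i ∈ CBBA.homDeg (W i) A (s i + e)) :
    ∃ δ : A.carrier →ₗ[K] A.carrier, (∀ b, δ (i₀ b) = δB b) ∧ (∀ i v, δ (g i v) = δ₀ i v) ∧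
      (∀ x y, δ (x * y) = δ x * y + A.sgnPow (e.1 + e.2) x * δ y) ∧
      ∀ a x, x ∈ A.gr a → δ x ∈ A.gr (a + e) := by
  let σ := A.sgnPow (e.1 + e.2)
  let Mt : A.carrier → A.carrier → Matrix (Fin 2) (Fin 2) A.carrier := fun x x' => !![σ x, x'; 0, x]
  have Mt_mul : ∀ x x' y y', Mt x x' * Mt y y' = Mt (x * y) (x' * y + σ x * y') := by
    intro x x' y y'
    simp only [Mt, Matrix.mul_fin_two, map_mul]
    congr 1
    ext i j
    fin_cases i <;> fin_cases j <;> simp [add_comm]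
  have Mt_add : ∀ x x' y y', Mt x x' + Mt y y' = Mt (x + y) (x' + y') := by
    intro x x' y y'
    ext i j
    fin_cases i <;> fin_cases j <;> simp [Mt]
  have Mt_smul : ∀ (r : K) x x', r • Mt x x' = Mt (r • x) (r • x') := by
    intro r x x'
    ext i j
    fin_cases i <;> fin_cases j <;> simp [Mt]
  have Mt_one : Mt 1 0 = 1 := by
    ext i j
    fin_cases i <;> fin_cases j <;> simp [Mt]
  have Mt_units : ∀ (r : ℤˣ) x x', r • Mt x x' = Mt (r • x) (r • x') := by
    intro r x x'
    rcases Int.units_eq_one_or r with rfl | rfl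
    · simp
    · ext i j
      fin_cases i <;> fin_cases j <;> simp [Mt]
  -- Commuting `σ x` past `y'` produces `y' * x`, and `x'` past `y` produces `σ y * x'`: the power
  -- of the sign operator in σ absorbs the contribution of `e` to the Koszul sign.
  have hcomm : ∀ {a b : ℤ × ℤ} {x x' y y' : A.carrier}, x ∈ A.gr a → x' ∈ A.gr (a + e) →
      y ∈ A.gr b → y' ∈ A.gr (b + e) →
      Mt x x' * Mt y y' = ((a.1 + a.2) * (b.1 + b.2)).negOnePow • (Mt y y' * Mt x x') := by
    intro a b x x' y y' hx hx' hy hy'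
    rw [Mt_mul, Mt_mul, Mt_units, A.mul_comm hx hy]
    congr 1
    rw [smul_add, add_comm]
    congr 1
    · rw [A.mul_comm (A.sgnPow_mem _ hx) hy', A.sgnPow_of_mem _ hx, mul_smul_comm]
      refine units_smul_of_mul_negOnePow ?_ _
      simp only [Prod.fst_add, Prod.snd_add]
      exact ⟨(a.1 + a.2) * (b.1 + b.2 + e.1 + e.2), by ring⟩
    · rw [A.mul_comm hx' hy, A.sgnPow_of_mem _ hy, smul_mul_assoc]
      symm
      refine units_smul_of_mul_negOnePow ?_ _
      simp only [Prod.fst_add, Prod.snd_add]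
      exact ⟨(b.1 + b.2) * (a.1 + a.2 + e.1 + e.2), by ring⟩
  have hB1 : δB 1 = 0 := by
    have := hB 1 1
    simpa using this
  let MtL : ∀ {X : Type u} [AddCommGroup X] [Module K X] (p p' : X →ₗ[K] A.carrier), X →ₗ[K] Matrix (Fin 2) (Fin 2) A.carrier :=
    fun p p' =>
      { toFun := fun x => Mt (p x) (p' x)
        map_add' := fun x y => by rw [map_add, map_add, Mt_add]
        map_smul' := fun r x => by rw [map_smul, map_smul, RingHom.id_apply, Mt_smul] }
  let α : B.carrier →ₐ[K] Matrix (Fin 2) (Fin 2) A.carrier := AlgHom.ofLinearMap (MtL i₀.toAlgHom.toLinearMap δB)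
    (by change Mt (i₀ 1) (δB 1) = 1; rw [hB1, map_one, Mt_one])
    (fun b b' => by
      change Mt (i₀ (b * b')) (δB (b * b')) = Mt _ _ * Mt _ _
      rw [Mt_mul, hB, map_mul]; rfl)
  obtain ⟨H, H1, H2⟩ := h.exists_algHom α (fun i => MtL (g i) (δ₀ i))
    (fun i j a b x hx y hy => by
      refine hcomm (h.gen_mem i a x hx) ?_ (h.gen_mem j b y hy) ?_
      · rw [add_assoc]; exact hδ₀ i a x hx
      · rw [add_assoc]; exact hδ₀ j b y hy)
    (fun i a c x hx b hb => by
      refine hcomm (h.gen_mem i a x hx) ?_ (i₀.map_gr hb) (hBe c b hb)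
      rw [add_assoc]; exact hδ₀ i a x hx)
  have hH : ∀ x, H x = Mt x (H x 0 1) := by
    intro x
    have hx : x ∈ Algebra.adjoin K (Set.range i₀ ∪ ⋃ i, Set.range (g i)) :=
      h.adjoin_eq_top ▸ trivial
    induction hx using Algebra.adjoin_induction with
    | mem x hx =>
      rcases hx with ⟨b, rfl⟩ | hx
      · rw [H1]; rfl
      · obtain ⟨i, v, rfl⟩ := Set.mem_iUnion.1 hx
        rw [H2]; rfl
    | algebraMap r =>
      rw [AlgHom.commutes, Algebra.algebraMap_eq_smul_one, Algebra.algebraMap_eq_smul_one,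
        ← Mt_one, Mt_smul]
      rfl
    | add x y _ _ hx hy => rw [map_add, hx, hy, Mt_add]; rfl
    | mul x y _ _ hx hy => rw [map_mul, hx, hy, Mt_mul]; rfl
  let δ : A.carrier →ₗ[K] A.carrier :=
    { toFun := fun x => H x 0 1
      map_add' := fun x y => by rw [map_add]; rfl
      map_smul' := fun r x => by rw [map_smul]; rfl }
  have hδmul : ∀ x y, δ (x * y) = δ x * y + σ x * δ y := by
    intro x y
    change H (x * y) 0 1 = _
    rw [map_mul, hH x, hH y, Mt_mul]
    rfl
  have hδB : ∀ b, δ (i₀ b) = δB b := fun b => by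
    change H (i₀ b) 0 1 = _
    rw [H1]; rfl
  have hδg : ∀ i v, δ (g i v) = δ₀ i v := fun i v => by
    change H (g i v) 0 1 = _
    rw [H2]; rfl
  refine ⟨δ, hδB, hδg, hδmul, fun a x hx => ?_⟩
  have key := Bigraded.eq_of_adjoin (K := K) A.internal.submodule_iSupIndep
    (G := fun a => A.gr a ⊓ (A.gr (a + e)).comap δ) (fun a => inf_le_left) h.adjoin_eq_top
    ⟨A.one_mem, by
      have := hδB 1
      rw [map_one, hB1] at this
      rw [SetLike.mem_coe, Submodule.mem_comap]
      rw [this]; exact zero_mem _⟩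
    (fun a b x hx y hy => ⟨A.mul_mem hx.1 hy.1, by
      rw [SetLike.mem_coe, Submodule.mem_comap]
      rw [hδmul]
      refine add_mem ?_ ?_
      · rw [add_right_comm]; exact A.mul_mem hx.2 hy.1
      · rw [add_assoc]; exact A.mul_mem (A.sgnPow_mem _ hx.1) hy.2⟩) (by
      rintro _ (⟨b, rfl⟩ | hx)
      · have hb : b ∈ ⨆ a, B.gr a := B.internal.submodule_iSup_eq_top ▸ trivial
        induction hb using Submodule.iSup_induction' with
        | zero => rw [map_zero]; exact zero_mem _
        | add x y _ _ hx hy => rw [map_add]; exact add_mem hx hy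
        | mem a b hb =>
          refine Submodule.mem_iSup_of_mem a ⟨i₀.map_gr hb, ?_⟩
          rw [SetLike.mem_coe, Submodule.mem_comap]
          rw [hδB]; exact hBe a b hb
      · obtain ⟨i, x, rfl⟩ := Set.mem_iUnion.1 hx
        have hb : x ∈ ⨆ a, (W i).gr a := (W i).internal.submodule_iSup_eq_top ▸ trivial
        induction hb using Submodule.iSup_induction' with
        | zero => rw [map_zero]; exact zero_mem _
        | add x y _ _ hx' hy' =>
          rw [map_add]
          exact add_mem (hx' (Set.mem_iUnion.2 ⟨i, x, rfl⟩)) (hy' (Set.mem_iUnion.2 ⟨i, y, rfl⟩))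
        | mem a b hb =>
          refine Submodule.mem_iSup_of_mem _ ⟨h.gen_mem i a b hb, ?_⟩
          rw [SetLike.mem_coe, Submodule.mem_comap]
          rw [hδg, add_assoc]; exact hδ₀ i a b hb) a
  exact (key.ge hx).2

/-! ## Existence of free extensions -/

section parity

/-- The parity grading defined by an involution. -/
def parityGr {R : Type*} [Ring R] [Algebra K R] (τ : R →ₐ[K] R) (i : ZMod 2) : Submodule K R :=
  Module.End.eigenspace τ.toLinearMap (((-1 : ℤˣ) ^ i : ℤˣ) : ℤ)

theorem mem_parityGr {R : Type*} [Ring R] [Algebra K R] {τ : R →ₐ[K] R} {i : ZMod 2} {x : R} :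
    x ∈ parityGr τ i ↔ τ x = ((-1 : ℤˣ) ^ i) • x := by
  rw [parityGr, Module.End.mem_eigenspace_iff, Units.smul_def]
  simp [Int.cast_smul_eq_zsmul]

theorem parityGr_internal [CharZero K] {R : Type*} [Ring R] [Algebra K R] {τ : R →ₐ[K] R}
    (hτ : ∀ x, τ (τ x) = x) : DirectSum.IsInternal (parityGr τ) := by
  have h2 : (2 : K) ≠ 0 := two_ne_zero
  refine Bigraded.isInternal_of_eigen τ.toLinearMap
    (c := fun i : ZMod 2 => ((((-1 : ℤˣ) ^ i : ℤˣ) : ℤ) : K)) ?_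
    (fun i x hx => Module.End.mem_eigenspace_iff.1 hx) ?_
  · intro i j hij
    have h1 : (1 : K) ≠ -1 := by
      intro h
      have : (2 : K) = 0 := by linear_combination h
      exact h2 this
    have h01 : ∀ i : ZMod 2, i = 0 ∨ i = 1 := by decide
    rcases h01 i with rfl | rfl <;> rcases h01 j with rfl | rfl
    · rfl
    · simp [h1] at hij
    · simp [h1.symm] at hij
    · rfl
  · rw [eq_top_iff]
    rintro x -
    have hx : x = (2⁻¹ : K) • (x + τ x) + (2⁻¹ : K) • (x - τ x) := by
      match_scalars <;> field_simp <;> norm_num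
    rw [hx]
    refine add_mem (Submodule.mem_iSup_of_mem 0 ?_) (Submodule.mem_iSup_of_mem 1 ?_)
    · rw [mem_parityGr]; simp [hτ, add_comm]
    · rw [mem_parityGr]; simp [hτ, ← smul_neg]

/-- The product on `P ⊗ ⋀ U` is taken from `GradedTensorProduct`; its Koszul signs depend only on
parity, so a ℤ/2-grading from the sign involution suffices. -/
noncomputable instance parityGr_gradedAlgebra [CharZero K] {R : Type*} [Ring R] [Algebra K R] {τ : R →ₐ[K] R}
    [hτ : Fact (∀ x, τ (τ x) = x)] : GradedAlgebra (parityGr τ) :=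
  { (parityGr_internal hτ.out).chooseDecomposition with
    one_mem := by rw [mem_parityGr]; simp
    mul_mem := fun i j x y hx hy => by
      rw [mem_parityGr] at *
      rw [map_mul, hx, hy, smul_mul_smul_comm, uzpow_add] }

theorem uzpow_intCast_mul (n m : ℤ) :
    (-1 : ℤˣ) ^ ((n : ZMod 2) * (m : ZMod 2)) = (n * m).negOnePow := by
  rw [← Int.cast_mul, uzpow_intCast]; rfl

end parity
end

/-! ### The graded tensor product of a cbba with a free graded-commutative algebra. -/

section
variable {K : Type u} [Field K]

theorem FreeGCA.algHom_ext {U : Type u} [AddCommGroup U] [Module K U] {gr : ℤ × ℤ → Submodule K U}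
    {R : Type*} [Ring R] [Algebra K R] {f f' : FreeGCA gr →ₐ[K] R}
    (h : ∀ x, f (FreeGCA.gen gr x) = f' (FreeGCA.gen gr x)) : f = f' :=
  AlgHom.ext_of_adjoin_eq_top (FreeGCA.adjoin_gen gr) (by rintro _ ⟨x, rfl⟩; exact h x)

/-- The sign involution of the free graded-commutative algebra. -/
theorem FreeGCA.exists_sgn {U : Type u} [AddCommGroup U] [Module K U] {gr : ℤ × ℤ → Submodule K U}
    (hU : DirectSum.IsInternal gr) :
    ∃ τ : FreeGCA gr →ₐ[K] FreeGCA gr, (∀ x, τ (τ x) = x) ∧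
      ∀ x, τ (FreeGCA.gen gr x) = FreeGCA.gen gr (Bigraded.sgn hU x) := by
  let τ : FreeGCA gr →ₐ[K] FreeGCA gr := FreeGCA.lift (FreeGCA.gen gr ∘ₗ Bigraded.sgn hU) (by
    intro a b x hx y hy
    exact FreeGCA.gen_mul_gen (Bigraded.sgn_mem hU hx) (Bigraded.sgn_mem hU hy))
  have h : ∀ x, τ (FreeGCA.gen gr x) = FreeGCA.gen gr (Bigraded.sgn hU x) :=
    fun x => FreeGCA.lift_gen _ _ x
  refine ⟨τ, fun x => ?_, h⟩
  have : τ.comp τ = AlgHom.id K _ := FreeGCA.algHom_ext fun x => by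
    rw [AlgHom.comp_apply, h, h, Bigraded.sgn_sgn]; rfl
  exact DFunLike.congr_fun this x

/-- The graded tensor product `P ⊗ ⋀ U`, as an algebra. -/
theorem exists_gradedTensor [CharZero K] (P : CBBA K) {U : Type u} [AddCommGroup U] [Module K U]
    {gr : ℤ × ℤ → Submodule K U} (hU : DirectSum.IsInternal gr) :
    ∃ (F : Type u) (_ : Ring F) (_ : Algebra K F) (i : P.carrier →ₐ[K] F)
      (Φ : FreeGCA gr →ₐ[K] F),
      Function.Bijective (LinearMap.mul' K F ∘ₗ TensorProduct.map i.toLinearMap Φ.toLinearMap) ∧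
      ∀ a c, ∀ x ∈ gr a, ∀ b ∈ P.gr c, Φ (FreeGCA.gen gr x) * i b =
        ((a.1 + a.2) * (c.1 + c.2)).negOnePow • (i b * Φ (FreeGCA.gen gr x)) := by
  obtain ⟨τ, hτ, hτg⟩ := FreeGCA.exists_sgn hU
  have : Fact (∀ x, τ (τ x) = x) := ⟨hτ⟩
  have : Fact (∀ x, P.sgn (P.sgn x) = x) := ⟨P.sgn_sgn⟩
  refine ⟨GradedTensorProduct K (parityGr P.sgn) (parityGr τ), inferInstance, inferInstance,
    GradedTensorProduct.includeLeft _ _, GradedTensorProduct.includeRight _ _, ?_, ?_⟩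
  · have : LinearMap.mul' K (GradedTensorProduct K (parityGr P.sgn) (parityGr τ)) ∘ₗ
        TensorProduct.map (GradedTensorProduct.includeLeft _ _).toLinearMap
          (GradedTensorProduct.includeRight _ _).toLinearMap =
        (GradedTensorProduct.of K (parityGr P.sgn) (parityGr τ)).toLinearMap :=
      TensorProduct.ext' fun a b => by
        simpa using GradedTensorProduct.tmul_one_mul_one_tmul (parityGr P.sgn) (parityGr τ) a b
    rw [this]
    exact (GradedTensorProduct.of K (parityGr P.sgn) (parityGr τ)).bijective
  · intro a c x hx b hb
    have hx' : FreeGCA.gen gr x ∈ parityGr τ (((a.1 + a.2 : ℤ)) : ZMod 2) := by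
      rw [mem_parityGr, hτg, Bigraded.sgn_of_mem hU hx, Bigraded.map_units_smul, uzpow_intCast]
      rfl
    have hb' : b ∈ parityGr P.sgn (((c.1 + c.2 : ℤ)) : ZMod 2) := by
      rw [mem_parityGr, P.sgn_of_mem hb, uzpow_intCast]; rfl
    have h1 := GradedTensorProduct.tmul_coe_mul_coe_tmul (R := K) (parityGr P.sgn) (parityGr τ)
      (1 : P.carrier) ⟨_, hx'⟩ ⟨_, hb'⟩ (1 : FreeGCA gr)
    have h2 := GradedTensorProduct.tmul_one_mul_one_tmul (R := K) (parityGr P.sgn) (parityGr τ)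
      b (FreeGCA.gen gr x)
    rw [uzpow_intCast_mul, one_mul, mul_one] at h1
    refine h1.trans ?_
    congr 1
    exact h2.symm

/-- The same bigraded algebra with zero differentials. -/
abbrev CBBA.forget (P : CBBA K) : CBBA K where
  carrier := P.carrier
  gr := P.gr
  internal := P.internal
  one_mem := P.one_mem
  mul_mem := P.mul_mem
  mul_comm := P.mul_comm
  d := 0
  dbar := 0
  d_mem _ := zero_mem _
  dbar_mem _ := zero_mem _
  d_d _ := rfl
  dbar_dbar _ := rfl
  d_dbar _ := by simp
  d_mul _ _ := by simp
  dbar_mul _ _ := by simp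

/-- The underlying algebra is `P ⊗ ⋀ U`. Its bigrading is recovered from the automorphism that
multiplies each homogeneous generator by the weight of its bidegree. Differentials are left zero:
they are introduced afterwards as derivations. -/
theorem exists_forget_free [CharZero K] (P : CBBA K) {ι : Type} [DecidableEq ι]
    (W : ι → Bicomplex K) (s : ι → ℤ × ℤ) :
    ∃ (F : CBBA K) (j : P.forget.Hom F) (g : ∀ i, (W i).carrier →ₗ[K] F.carrier),
      IsFreeOver j (sumGr W s) (DirectSum.toModule K ι F.carrier g) := by
  have hU := sumGr_internal W s
  obtain ⟨F, _, _, i, Φ, hb, hc⟩ := exists_gradedTensor P hU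
  let gn : (⨁ i, (W i).carrier) →ₗ[K] F := Φ.toLinearMap ∘ₗ FreeGCA.gen (sumGr W s)
  have hgn : ∀ x, Φ (FreeGCA.gen (sumGr W s) x) = gn x := fun x => rfl
  have hgs : ∀ x, (gn ∘ₗ sumWeight W s) x = gn (sumWeight W s x) := fun _ => rfl
  have hgg : ∀ {a b : ℤ × ℤ} {x y}, x ∈ sumGr W s a → y ∈ sumGr W s b →
      gn x * gn y = ((a.1 + a.2) * (b.1 + b.2)).negOnePow • (gn y * gn x) := by
    intro a b x y hx hy
    rw [← hgn, ← hgn, ← map_mul, FreeGCA.gen_mul_gen hx hy, Bigraded.map_units_smul, map_mul]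
  -- the weight automorphism
  let wP : P.carrier →ₗ[K] P.carrier :=
    Bigraded.glue P.internal fun a => Bigraded.weight K a • (P.gr a).subtype
  have hwP : ∀ {a x}, x ∈ P.gr a → wP x = Bigraded.weight K a • x := fun {a x} hx => by
    simp only [wP]
    rw [Bigraded.glue_of_mem _ _ hx]; rfl
  let wPa : P.carrier →ₐ[K] P.carrier := AlgHom.ofLinearMap wP
    (by rw [hwP P.one_mem, Bigraded.weight_zero, one_smul]) (fun x y => by
      have : (LinearMap.mul K P.carrier).compr₂ wP = (LinearMap.mul K P.carrier).compl₁₂ wP wP :=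
        P.hom_ext fun a x hx => P.hom_ext fun b y hy => by
          simp only [LinearMap.compr₂_apply, LinearMap.compl₁₂_apply, LinearMap.mul_apply']
          rw [hwP hx, hwP hy, hwP (P.mul_mem hx hy), smul_mul_smul_comm, Bigraded.weight_add]
      exact LinearMap.congr_fun (LinearMap.congr_fun this x) y)
  obtain ⟨σ, hσ1, hσ2⟩ := exists_lift_of_bijective hb (sumGr_iSup W s) hc (i.comp wPa)
    (gn ∘ₗ sumWeight W s) (fun a b x hx y hy => by
      rw [hgs, hgs, sumWeight_of_mem W s hx, sumWeight_of_mem W s hy]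
      exact hgg (Submodule.smul_mem _ _ hx) (Submodule.smul_mem _ _ hy))
    (fun a c x hx b hb => by
      rw [hgs, sumWeight_of_mem W s hx]
      refine hc a c _ (Submodule.smul_mem _ _ hx) (wPa b) ?_
      change wP b ∈ _
      rw [hwP hb]
      exact Submodule.smul_mem _ _ hb)
  let gr : ℤ × ℤ → Submodule K F := fun a =>
    Module.End.eigenspace σ.toLinearMap (Bigraded.weight K a)
  have hgr : ∀ {a x}, x ∈ gr a ↔ σ x = Bigraded.weight K a • x :=
    fun {a x} => Module.End.mem_eigenspace_iff
  have one_mem : (1 : F) ∈ gr 0 := by rw [hgr, map_one, Bigraded.weight_zero, one_smul]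
  have mul_mem : ∀ {a b : ℤ × ℤ} {x y : F}, x ∈ gr a → y ∈ gr b → x * y ∈ gr (a + b) := by
    intro a b x y hx hy
    rw [hgr] at *
    rw [map_mul, hx, hy, smul_mul_smul_comm, Bigraded.weight_add]
  have hi : ∀ {a x}, x ∈ P.gr a → i x ∈ gr a := fun {a x} hx => by
    rw [hgr, hσ1]
    change i (wP x) = _
    rw [hwP hx, map_smul]
  have hg : ∀ {a x}, x ∈ sumGr W s a → gn x ∈ gr a := fun {a x} hx => by
    rw [hgr, ← hgn, hσ2, hgs, sumWeight_of_mem W s hx, map_smul, ← hgn]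
  have hadj := adjoin_of_bijective hb
  have hgenS : ∀ (G : ℤ × ℤ → Submodule K F), (∀ a x, x ∈ P.gr a → i x ∈ G a) →
      (∀ a x, x ∈ sumGr W s a → gn x ∈ G a) →
      ∀ x ∈ Set.range i ∪ Set.range fun x => Φ (FreeGCA.gen (sumGr W s) x), x ∈ ⨆ a, G a := by
    rintro G h1 h2 _ (⟨b, rfl⟩ | ⟨x, rfl⟩)
    · have hb : b ∈ ⨆ a, P.gr a := P.internal.submodule_iSup_eq_top ▸ trivial
      induction hb using Submodule.iSup_induction' with
      | zero => rw [map_zero]; exact zero_mem _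
      | add x y _ _ hx hy => rw [map_add]; exact add_mem hx hy
      | mem a b hb => exact Submodule.mem_iSup_of_mem a (h1 a b hb)
    · change gn x ∈ _
      have hx : x ∈ ⨆ a, sumGr W s a := sumGr_iSup W s ▸ trivial
      induction hx using Submodule.iSup_induction' with
      | zero => rw [map_zero]; exact zero_mem _
      | add x y _ _ hx hy => rw [map_add]; exact add_mem hx hy
      | mem a b hb => exact Submodule.mem_iSup_of_mem a (h2 a b hb)
  have internal : DirectSum.IsInternal gr :=
    Bigraded.isInternal_of_eigen σ.toLinearMap Bigraded.weight_injective (fun a x hx => hgr.1 hx)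
      (Bigraded.iSup_eq_top_of_adjoin hadj one_mem (fun a b x hx y hy => mul_mem hx hy)
        (hgenS gr (fun a x hx => hi hx) (fun a x hx => hg hx)))
  -- graded commutativity
  let L : ℤ → F → Submodule K F := fun n x => LinearMap.eqLocus (LinearMap.mulLeft K x)
    (n.negOnePow • LinearMap.mulRight K x)
  have hL : ∀ {n : ℤ} {x y : F}, y ∈ L n x ↔ x * y = n.negOnePow • (y * x) := fun {n x y} => Iff.rfl
  have hneg : ∀ {n : ℤ} {x y : F}, x * y = n.negOnePow • (y * x) → y * x = n.negOnePow • (x * y) :=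
    fun {n x y} h => by rw [h, smul_smul, Int.units_mul_self, one_smul]
  -- Graded commutation with the generators propagates to all homogeneous elements. It is applied
  -- first to generators `x` (`commP`, `commU`) and then to arbitrary `x`.
  have comm1 : ∀ {a : ℤ × ℤ} {x : F}, x ∈ gr a →
      (∀ c b, b ∈ P.gr c → x * i b = ((a.1 + a.2) * (c.1 + c.2)).negOnePow • (i b * x)) →
      (∀ c y, y ∈ sumGr W s c → x * gn y = ((a.1 + a.2) * (c.1 + c.2)).negOnePow • (gn y * x)) →
      ∀ b y, y ∈ gr b → x * y = ((a.1 + a.2) * (b.1 + b.2)).negOnePow • (y * x) := by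
    intro a x hx h1 h2 b y hy
    have key := Bigraded.eq_of_adjoin (K := K) internal.submodule_iSupIndep
      (G := fun b => gr b ⊓ L ((a.1 + a.2) * (b.1 + b.2)) x) (fun b => inf_le_left) hadj
      ⟨one_mem, by rw [SetLike.mem_coe, hL]; simp⟩
      (fun b c y hy z hz => ⟨mul_mem hy.1 hz.1, by
        rw [SetLike.mem_coe, hL, ← mul_assoc, hL.1 hy.2, smul_mul_assoc, mul_assoc, hL.1 hz.2,
          mul_smul_comm, smul_smul, mul_assoc, ← Int.negOnePow_add]
        congr 2
        simp only [Prod.fst_add, Prod.snd_add]; ring⟩)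
      (hgenS _ (fun c b hb => ⟨hi hb, h1 c b hb⟩) (fun c y hy => ⟨hg hy, h2 c y hy⟩)) b
    exact (key.ge hy).2
  have commP : ∀ {a b} {x y}, x ∈ P.gr a → y ∈ gr b →
      i x * y = ((a.1 + a.2) * (b.1 + b.2)).negOnePow • (y * i x) := fun {a b x y} hx hy =>
    comm1 (hi hx) (fun c b hb => by
      rw [← map_mul, P.mul_comm hx hb, Bigraded.map_units_smul, map_mul])
      (fun c y hy => hneg (by rw [_root_.mul_comm (a.1 + a.2)]; exact hc c a y hy x hx)) b y hy
  have commU : ∀ {a b} {x y}, x ∈ sumGr W s a → y ∈ gr b →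
      gn x * y = ((a.1 + a.2) * (b.1 + b.2)).negOnePow • (y * gn x) := fun {a b x y} hx hy =>
    comm1 (hg hx) (fun c b hb => hc a c x hx b hb) (fun c y hy => hgg hx hy) b y hy
  let FF : CBBA K :=
    { carrier := F
      gr := gr
      internal := internal
      one_mem := one_mem
      mul_mem := mul_mem
      mul_comm := fun {a b x y} hx hy => comm1 hx
        (fun c p hp => hneg (by rw [_root_.mul_comm (a.1 + a.2)]; exact commP hp hx))
        (fun c u hu => hneg (by rw [_root_.mul_comm (a.1 + a.2)]; exact commU hu hx)) b y hy
      d := 0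
      dbar := 0
      d_mem := fun _ => zero_mem _
      dbar_mem := fun _ => zero_mem _
      d_d := fun _ => rfl
      dbar_dbar := fun _ => rfl
      d_dbar := fun _ => by simp
      d_mul := fun _ _ => by simp
      dbar_mul := fun _ _ => by simp }
  let j : P.forget.Hom FF :=
    { toAlgHom := i
      map_gr := fun hx => hi hx
      map_d := fun x => map_zero i
      map_dbar := fun x => map_zero i }
  have hmod : DirectSum.toModule K ι F
      (fun k => gn ∘ₗ DirectSum.lof K ι (fun i => (W i).carrier) k) = gn := by
    refine DirectSum.linearMap_ext K fun k => LinearMap.ext fun x => ?_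
    simp
  refine ⟨FF, j, fun k => gn ∘ₗ DirectSum.lof K ι (fun i => (W i).carrier) k, ?_, Φ, ?_, hb⟩
  · intro a x hx
    change DirectSum.toModule K ι F _ x ∈ gr a
    rw [hmod]; exact hg hx
  · intro x
    change _ = DirectSum.toModule K ι F _ x
    rw [hmod]; rfl

end

section
variable {K : Type u} [Field K]

/-! ## Adjoining squares -/

/-- The generators `q, ∂q, ∂̄q, ∂∂̄q` of a square are permuted by the differentials. -/
def sqTab {M : Type*} [AddCommGroup M] (c : Bool) (q : Fin 4 → M) : Fin 4 → M :=
  bif c then ![q 2, -q 3, 0, 0] else ![q 1, 0, q 3, 0]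

/-- The bidegrees of the corners of a square. -/
def sqDeg : Fin 4 → ℤ × ℤ := ![(-1, -1), (0, -1), (-1, 0), (0, 0)]

/-- The total degrees of the corners of a square. -/
def sqTot : Fin 4 → ℤ := ![-2, -1, -1, 0]

theorem sqTot_eq (k : Fin 4) : sqTot k = (sqDeg k).1 + (sqDeg k).2 := by
  fin_cases k <;> rfl

theorem CBBA.sgnPow_eDeg (A : CBBA K) (c : Bool) :
    A.sgnPow ((eDeg c).1 + (eDeg c).2) = A.sgn := by
  rw [eDeg_sum]; simp [CBBA.sgnPow]

theorem sgn_of_degree (A : CBBA K) {δ : A.carrier →ₗ[K] A.carrier} {c : Bool}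
    (hδ : ∀ a x, x ∈ A.gr a → δ x ∈ A.gr (a + eDeg c)) (x : A.carrier) :
    δ (A.sgn x) = -A.sgn (δ x) := by
  have : δ ∘ₗ A.sgn.toLinearMap = -(A.sgn.toLinearMap ∘ₗ δ) := A.hom_ext fun a x hx => by
    simp only [LinearMap.comp_apply, LinearMap.neg_apply, AlgHom.toLinearMap_apply]
    rw [A.sgn_of_mem hx, A.sgn_of_mem (hδ a x hx), Bigraded.map_units_smul, negOnePow_add_eDeg,
      Units.neg_smul, neg_neg]
  exact LinearMap.congr_fun this x

/-- Here the argument for `tDD_tDD` runs in reverse: operators prescribed on ψ and χ by the twisted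
formula, with second twisted differentials η antisymmetric in the indices, anticommute on ψ because
`T` is flat. -/
theorem tilde_anticomm {B : CBBA K} {V : Bicomplex K} {M : Type*} [AddCommGroup M] [Module K M]
    (act : M →ₗ[K] B.carrier →ₗ[K] M) (hact : ∀ x b b', act x (b * b') = act (act x b) b')
    (hact1 : ∀ x, act x 1 = x) {T : Twisting V B} (hT : T.Flat)
    {d : Bool → M →ₗ[K] M} {sg : M →ₗ[K] M}
    (hd : ∀ c x b, d c (act x b) = act (d c x) b + act (sg x) (B.D c b))
    {ψ : V.carrier →ₗ[K] M} {χ : Bool → V.carrier →ₗ[K] M} {η : Bool → Bool → V.carrier →ₗ[K] M}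
    {ε : ℤˣ} (hψ : ∀ v, sg (ψ v) = ε • ψ (V.sgn v))
    (hψχ : ∀ c v, d c (ψ v) = χ c v + ε • (ψ (V.D c v) + tilde act ψ (T.coef c v)))
    (hχ : ∀ c v, sg (χ c v) = (-ε) • χ c (V.sgn v))
    (hχη : ∀ c c' v, d c (χ c' v) =
      η c c' v + (-ε) • (χ c' (V.D c v) + tilde act (χ c') (T.coef c v)))
    (hη : ∀ c c' v, η c c' v + η c' c v = 0) (c c' : Bool) (v : V.carrier) :
    d c (d c' (ψ v)) + d c' (d c (ψ v)) = 0 := by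
  have key : ∀ c c' t, d c (d c' (tilde act ψ t)) =
      tilde act (η c c') t - ε • tilde act (χ c') (T.dF c t)
      + ε • tilde act (χ c) (T.dF c' t) + tilde act ψ (T.dF c (T.dF c' t)) := by
    intro c c' t
    rw [tilde_comm act hact T (hd c') hψ (hψχ c'), map_add, Bigraded.map_units_smul,
      tilde_comm act hact T (hd c) hψ (hψχ c), tilde_comm act hact T (hd c) (hχ c') (hχη c c'),
      Units.neg_smul, smul_add, smul_smul, Int.units_mul_self, one_smul]
    abel
  have h1 : ∀ ψ : V.carrier →ₗ[K] M, tilde act ψ (v ⊗ₜ 1) = ψ v := fun ψ => by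
    rw [tilde_tmul, hact1]
  have h2 := congrArg (tilde act ψ) (hT c c' (v ⊗ₜ 1))
  rw [map_add, map_zero] at h2
  have h3 := hη c c' v
  rw [← h1 (η c c'), ← h1 (η c' c)] at h3
  rw [← h1 ψ, key, key, ← add_zero (0 : M)]
  nth_rw 1 [← h2]
  rw [← h3]
  abel

theorem tilde_zero {B : CBBA K} {V : Bicomplex K} {M : Type*} [AddCommGroup M] [Module K M]
    (act : M →ₗ[K] B.carrier →ₗ[K] M) : tilde act (0 : V.carrier →ₗ[K] M) = 0 :=
  TensorProduct.ext' fun v b => by simp [tilde_tmul]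

theorem tilde_neg {B : CBBA K} {V : Bicomplex K} {M : Type*} [AddCommGroup M] [Module K M]
    (act : M →ₗ[K] B.carrier →ₗ[K] M) (ψ : V.carrier →ₗ[K] M) : tilde act (-ψ) = -tilde act ψ :=
  TensorProduct.ext' fun v b => by simp [tilde_tmul]

/-- The bigraded algebra `F` with new differentials. -/
abbrev CBBA.withD [CharZero K] (F : CBBA K) (δ : Bool → F.carrier →ₗ[K] F.carrier)
    (hδ : ∀ c a x, x ∈ F.gr a → δ c x ∈ F.gr (a + eDeg c))
    (hmul : ∀ c x y, δ c (x * y) = δ c x * y + F.sgn x * δ c y)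
    (hsq : ∀ c c' x, δ c (δ c' x) + δ c' (δ c x) = 0) : CBBA K :=
  have hself : ∀ c x, δ c (δ c x) = 0 := fun c x => by
    have := hsq c c x
    rw [← two_smul K] at this
    exact (smul_eq_zero.1 this).resolve_left two_ne_zero
  have hmul' : ∀ c {a : ℤ × ℤ} {x : F.carrier} (y : F.carrier), x ∈ F.gr a →
      δ c (x * y) = δ c x * y + (a.1 + a.2).negOnePow • (x * δ c y) := fun c a x y hx => by
    rw [hmul, F.sgn_of_mem hx, smul_mul_assoc]
  { carrier := F.carrier
    gr := F.gr
    internal := F.internal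
    one_mem := F.one_mem
    mul_mem := F.mul_mem
    mul_comm := F.mul_comm
    d := δ false
    dbar := δ true
    d_mem := fun hx => hδ false _ _ hx
    dbar_mem := fun hx => hδ true _ _ hx
    d_d := hself false
    dbar_dbar := hself true
    d_dbar := hsq false true
    d_mul := hmul' false
    dbar_mul := hmul' true }

theorem CBBA.Hom.tDD_congr {B C : CBBA K} {V : Bicomplex K} (ν : B.Hom C) (T : Twisting V B)
    (c : Bool) {n m : ℤ} (h : n.negOnePow = m.negOnePow) : ν.tDD T c n = ν.tDD T c m :=
  LinearMap.ext fun ψ => LinearMap.ext fun v => by rw [ν.tDD_apply, ν.tDD_apply, h]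

/-- The square generated by `ψ`. -/
noncomputable def CBBA.Hom.sq {B C : CBBA K} {V : Bicomplex K} (ν : B.Hom C) (T : Twisting V B)
    (ψ : V.carrier →ₗ[K] C.carrier) : Fin 4 → V.carrier →ₗ[K] C.carrier :=
  ![ψ, ν.tDD T false (-2) ψ, ν.tDD T true (-2) ψ, ν.tDD T false (-1) (ν.tDD T true (-2) ψ)]

section sq
variable {B C C' : CBBA K} {V : Bicomplex K} {T : Twisting V B} {ν : B.Hom C}
  {ψ : V.carrier →ₗ[K] C.carrier}

theorem CBBA.Hom.sq_mem (hψ : ψ ∈ CBBA.homDeg V C (-1, -1)) (k : Fin 4) :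
    ν.sq T ψ k ∈ CBBA.homDeg V C (sqDeg k) := by
  fin_cases k
  · exact hψ
  · exact ν.tDD_mem hψ false _
  · exact ν.tDD_mem hψ true _
  · exact ν.tDD_mem (ν.tDD_mem hψ true _) false _

theorem CBBA.Hom.tDD_sq [CharZero K] (hT : T.Flat) (hψ : ψ ∈ CBBA.homDeg V C (-1, -1)) (c : Bool)
    (k : Fin 4) : ν.tDD T c (sqTot k) (ν.sq T ψ k) = sqTab c (ν.sq T ψ) k := by
  have h1 := ν.tDD_mem (T := T) hψ true (-2)
  have e1 := ν.tDD_tDD hT hψ true false (n := -2) (m := -1) (by simp) (by simp)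
  have e2 := ν.tDD_tDD hT h1 true false (n := -1) (m := 0) (by simp [eDeg]) (by simp)
  have e3 := fun c => ν.tDD_self hT hψ c (n := -2) (m := -1) (by simp) (by simp)
  cases c <;> fin_cases k
  · rfl
  · exact e3 false
  · rfl
  · exact ν.tDD_self hT h1 false (n := -1) (m := 0) (by simp [eDeg]) (by simp)
  · rfl
  · exact eq_neg_of_add_eq_zero_left e1
  · exact e3 true
  · rw [e3 true, map_zero, add_zero] at e2
    exact e2

theorem CBBA.Hom.map_sq {ν' : B.Hom C'} (f : C.Hom C') (hf : ∀ b, f (ν b) = ν' b) (k : Fin 4) :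
    f.toAlgHom.toLinearMap ∘ₗ ν.sq T ψ k = ν'.sq T (f.toAlgHom.toLinearMap ∘ₗ ψ) k := by
  fin_cases k
  · rfl
  · exact CBBA.Hom.map_tDD f hf T _ _ _
  · exact CBBA.Hom.map_tDD f hf T _ _ _
  · exact (CBBA.Hom.map_tDD f hf T _ _ _).trans
      (congrArg _ (CBBA.Hom.map_tDD f hf T _ _ _))

end sq

/-- The cbba obtained from `P` by freely adjoining the squares generated by `φ n : V n → P^□` of
bidegree `(-1,-1)`. -/
structure SquareExt {B P : CBBA K} (β : B.Hom P) (V : ℕ → Bicomplex K)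
    (T : ∀ n, Twisting (V n) B) where
  obj : CBBA K
  inc : P.Hom obj
  φ : ∀ n, (V n).carrier →ₗ[K] obj.carrier
  φ_mem : ∀ n, φ n ∈ CBBA.homDeg (V n) obj (-1, -1)
  free : IsFreeOver inc (sumGr (fun i : ℕ × Fin 4 => V i.1) (fun i => sqDeg i.2))
    (DirectSum.toModule K (ℕ × Fin 4) obj.carrier
      (fun i => (inc.comp β).sq (T i.1) (φ i.1) i.2))

theorem SquareExt.exists_of_flat [CharZero K] {B P : CBBA K} (β : B.Hom P) (V : ℕ → Bicomplex K)
    (T : ∀ n, Twisting (V n) B) (hT : ∀ n, (T n).Flat) : Nonempty (SquareExt β V T) := by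
  obtain ⟨F, j, g, h⟩ := exists_forget_free P (fun i : ℕ × Fin 4 => V i.1) (fun i => sqDeg i.2)
  let βF : B.carrier →ₐ[K] F.carrier := AlgHom.comp (B := P.carrier) j.toAlgHom β.toAlgHom
  let act : F.carrier →ₗ[K] B.carrier →ₗ[K] F.carrier :=
    (LinearMap.mul K F.carrier).compl₂ βF.toLinearMap
  have hact_apply : ∀ x b, act x b = x * βF b := fun x b => rfl
  let βf : B.forget.Hom F :=
    { toAlgHom := βF
      map_gr := fun hx => j.map_gr (β.map_gr hx)
      map_d := fun x => by
        rw [show B.forget.d x = 0 from rfl, map_zero]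
        exact (map_zero j.toAlgHom).symm.trans (j.map_d (β x))
      map_dbar := fun x => by
        rw [show B.forget.dbar x = 0 from rfl, map_zero]
        exact (map_zero j.toAlgHom).symm.trans (j.map_dbar (β x)) }
  have htl : ∀ {V : Bicomplex K} {a b : ℤ × ℤ} {ψ : V.carrier →ₗ[K] F.carrier}
      {t : V.carrier ⊗[K] B.carrier}, ψ ∈ CBBA.homDeg V F a → t ∈ tensorPlus V B b →
      tilde act ψ t ∈ F.gr (b + a) := fun {V a b ψ t} hψ ht =>
    DGModule.tilde_mem (B := B.forget) (M := βf.toModule) hψ ht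
  let q : ∀ n, Fin 4 → (V n).carrier →ₗ[K] F.carrier := fun n k => g (n, k)
  have hq : ∀ n k, q n k ∈ CBBA.homDeg (V n) F (sqDeg k) := fun n k => h.gen_mem (n, k)
  -- The corners of the square must be permuted by the twisted differentials according to `sqTab`;
  -- `rest` is the part of the ordinary differential that this adds to the table.
  let rest : Bool → ∀ n, Fin 4 → (V n).carrier →ₗ[K] F.carrier := fun c n k =>
    (sqTot k).negOnePow • (q n k ∘ₗ (V n).D c + tilde act (q n k) ∘ₗ (T n).coef c)
  have htab : ∀ c n k, sqTab c (q n) k ∈ CBBA.homDeg (V n) F (sqDeg k + eDeg c) := by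
    intro c n k
    cases c <;> fin_cases k
    · exact hq n 1
    · exact zero_mem _
    · exact hq n 3
    · exact zero_mem _
    · exact hq n 2
    · exact neg_mem (hq n 3)
    · exact zero_mem _
    · exact zero_mem _
  have hrest : ∀ c n k, rest c n k ∈ CBBA.homDeg (V n) F (sqDeg k + eDeg c) := by
    intro c n k b x hx
    refine Bigraded.units_smul_mem _ _ (add_mem ?_ ?_)
    · have := hq n k _ _ ((V n).D_mem c hx)
      rwa [add_right_comm, add_assoc] at this
    · have := htl (hq n k) ((T n).coef_mem c hx)
      rwa [add_right_comm, add_assoc] at this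
  have hex := fun c => h.exists_derivation (eDeg c)
    (LinearMap.comp (M₂ := P.carrier) j.toAlgHom.toLinearMap (P.D c))
    (fun b b' => by
      change j (P.D c (b * b')) = j (P.D c b) * j b' + F.sgnPow _ (j b) * j (P.D c b')
      rw [CBBA.sgnPow_eDeg, P.D_mul, map_add]
      erw [map_mul, map_mul, CBBA.map_sgn (A := P) (fun _ _ hx => j.map_gr hx)])
    (fun a b hb => j.map_gr (P.D_mem c hb))
    (fun i => sqTab c (q i.1) i.2 + rest c i.1 i.2)
    (fun i => add_mem (htab c i.1 i.2) (hrest c i.1 i.2))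
  choose δ hδj hδg hδmul hδdeg using hex
  have hδmul : ∀ c x y, δ c (x * y) = δ c x * y + F.sgn x * δ c y := fun c x y => by
    rw [hδmul, CBBA.sgnPow_eDeg]
  have hδj : ∀ c (b : P.carrier), δ c (j b) = j (P.D c b) := hδj
  have hδg : ∀ c n k v, δ c (q n k v) = sqTab c (q n) k v + rest c n k v :=
    fun c n k v => hδg c (n, k) v
  have hδsgn := fun c => sgn_of_degree F (hδdeg c)
  have hsgq : ∀ n k v, F.sgn (q n k v) = (sqTot k).negOnePow • q n k ((V n).sgn v) :=
    fun n k v => by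
      rw [sqTot_eq]; exact h.sgn_gen (n, k) v
  -- The derivations anticommute on `P` by assumption and on corners by flatness. On a product the
  -- mixed terms cancel because each δ anticommutes with the sign operator.
  have hsq : ∀ c c' x, δ c (δ c' x) + δ c' (δ c x) = 0 := by
    intro c c' x
    have hx : x ∈ Algebra.adjoin K (Set.range j ∪ ⋃ i, Set.range (g i)) :=
      h.adjoin_eq_top ▸ trivial
    induction hx using Algebra.adjoin_induction with
    | mem x hx =>
      rcases hx with ⟨b, rfl⟩ | hx
      · have e := P.D_D c c' b
        rw [hδj, hδj, hδj, hδj]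
        exact (map_add j.toAlgHom _ _).symm.trans ((congrArg j e).trans (map_zero j.toAlgHom))
      · obtain ⟨⟨n, k⟩, v, rfl⟩ := Set.mem_iUnion.1 hx
        refine tilde_anticomm act (fun x b b' => ?_) (fun x => ?_) (hT n) (d := δ)
          (sg := F.sgn.toLinearMap) (fun c x b => ?_) (ψ := q n k)
          (χ := fun c => sqTab c (q n) k)
          -- Only the corner `q n 0` has nonzero second twisted differentials: ∂∂̄ gives `q n 3` and
          -- ∂̄∂ gives its negative.
          (η := fun c c' => if k = 0 ∧ c ≠ c' then (bif c then - q n 3 else q n 3) else 0)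
          (hsgq n k) (fun c v => hδg c n k v) (fun c v => ?_) (fun c c' v => ?_) (fun c c' v => ?_)
          c c' v
        · rw [hact_apply, hact_apply, hact_apply, map_mul, mul_assoc]
        · rw [hact_apply, map_one, mul_one]
        · rw [hact_apply, hδmul]
          exact congrArg₂ _ rfl (congrArg _ ((hδj c (β b)).trans
            (congrArg j (β.map_D c b).symm)))
        · have h1 := hsgq n 1 v
          have h2 := hsgq n 2 v
          have h3 := hsgq n 3 v
          cases c <;> fin_cases k <;>
            simp [sqTab, sqTot, Int.negOnePow_even, Int.negOnePow_odd] at h1 h2 h3 ⊢ <;> assumption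
        · have h1 := hδg c n 1 v
          have h2 := hδg c n 2 v
          have h3 := hδg c n 3 v
          have hr : ∀ k, rest c n k v = (sqTot k).negOnePow •
            (q n k ((V n).D c v) + tilde act (q n k) ((T n).coef c v)) := fun _ => rfl
          rw [hr] at h1 h2 h3
          cases c <;> cases c' <;> fin_cases k <;>
            simp [sqTab, sqTot, Int.negOnePow_even, Int.negOnePow_odd, tilde_zero, tilde_neg]
              at h1 h2 h3 ⊢ <;> simp only [h1, h2, h3] <;> abel
        · cases c <;> cases c' <;> by_cases hk : k = 0 <;> simp [hk]
    | algebraMap r =>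
      have : ∀ c, δ c 1 = 0 := fun c => by
        have := hδmul c 1 1
        simpa using this
      simp [Algebra.algebraMap_eq_smul_one, this]
    | add x y _ _ hx hy =>
      simp only [map_add]
      rw [← add_zero (0 : F.carrier)]
      nth_rw 1 [← hx]
      rw [← hy]; abel
    | mul x y _ _ hx hy =>
      simp only [hδmul, map_add, hδsgn, F.sgn_sgn]
      have e1 := congrArg (· * y) hx
      have e2 := congrArg (x * ·) hy
      simp only [add_mul, mul_add, zero_mul, mul_zero] at e1 e2
      rw [← add_zero (0 : F.carrier)]
      nth_rw 1 [← e1]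
      rw [← e2]
      simp only [neg_mul]
      abel
  let O : CBBA K := F.withD δ hδdeg hδmul hsq
  let inc : P.Hom O :=
    { toAlgHom := j.toAlgHom
      map_gr := fun hx => j.map_gr hx
      map_d := fun x => (hδj false x).symm
      map_dbar := fun x => (hδj true x).symm }
  have hDq : ∀ c n k v, (inc.comp β).tDD (T n) c (sqTot k) (q n k) v = sqTab c (q n) k v := by
    intro c n k v
    rw [CBBA.Hom.tDD_apply]
    have e : O.D c (q n k v) = δ c (q n k v) := by cases c <;> rfl
    rw [e, hδg]
    exact add_sub_cancel_right _ _
  have hDq' : ∀ c n k, (inc.comp β).tDD (T n) c (sqTot k) (q n k) = sqTab c (q n) k :=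
    fun c n k => LinearMap.ext fun v => (hDq c n k v).trans (by cases c <;> fin_cases k <;> rfl)
  have e1 : ∀ n, (inc.comp β).tDD (T n) false (-2) (q n 0) = q n 1 := fun n => hDq' false n 0
  have e2 : ∀ n, (inc.comp β).tDD (T n) true (-2) (q n 0) = q n 2 := fun n => hDq' true n 0
  have e3 : ∀ n, (inc.comp β).tDD (T n) false (-1) (q n 2) = q n 3 := fun n => hDq' false n 2
  have hg : (fun i : ℕ × Fin 4 => (inc.comp β).sq (T i.1) (q i.1 0) i.2) = g := by
    funext ⟨n, k⟩
    fin_cases k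
    · rfl
    · exact e1 n
    · exact e2 n
    · exact (congrArg _ (e2 n)).trans (e3 n)
  refine ⟨⟨O, inc, fun n => q n 0, fun n => hq n 0, ?_⟩⟩
  rw [hg]
  exact h

end

/-! ### Maps out of square extensions and the contraction onto the base. -/

section
variable {K : Type u} [Field K]

theorem CBBA.sgn_zero_deg (A : CBBA K) {u : A.carrier →ₗ[K] A.carrier} {e : ℤ × ℤ}
    (he : Even (e.1 + e.2)) (hu : ∀ a x, x ∈ A.gr a → u x ∈ A.gr (a + e)) (x : A.carrier) :
    u (A.sgn x) = A.sgn (u x) := by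
  have : u ∘ₗ A.sgn.toLinearMap = A.sgn.toLinearMap ∘ₗ u := A.hom_ext fun a x hx => by
    simp only [LinearMap.comp_apply, AlgHom.toLinearMap_apply]
    rw [A.sgn_of_mem hx, A.sgn_of_mem (hu a x hx), Bigraded.map_units_smul]
    congr 1
    rw [Int.negOnePow_eq_iff]
    simp only [Prod.fst_add, Prod.snd_add]
    obtain ⟨r, hr⟩ := he
    exact ⟨-r, by linarith⟩
  exact LinearMap.congr_fun this x

theorem IsFreeOver.induction {B A : CBBA K} {incl : B.Hom A} {ι : Type} [DecidableEq ι]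
    {W : ι → Bicomplex K} {s : ι → ℤ × ℤ} {g : ∀ i, (W i).carrier →ₗ[K] A.carrier}
    (h : IsFreeOver incl (sumGr W s) (DirectSum.toModule K ι A.carrier g))
    {P : A.carrier → Prop} (base : ∀ b, P (incl b)) (gen : ∀ i v, P (g i v))
    (add : ∀ x y, P x → P y → P (x + y)) (mul : ∀ x y, P x → P y → P (x * y)) (x : A.carrier) :
    P x := by
  have hx : x ∈ Algebra.adjoin K (Set.range incl ∪ ⋃ i, Set.range (g i)) :=
    h.adjoin_eq_top ▸ trivial
  induction hx using Algebra.adjoin_induction with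
  | mem x hx =>
    rcases hx with ⟨b, rfl⟩ | hx
    · exact base b
    · obtain ⟨i, v, rfl⟩ := Set.mem_iUnion.1 hx
      exact gen i v
  | algebraMap r =>
    have := base (algebraMap K _ r)
    rwa [AlgHom.commutes] at this
  | add x y _ _ hx hy => exact add x y hx hy
  | mul x y _ _ hx hy => exact mul x y hx hy

/-- Linear operators that commute with the action of `B` are compatible with `tl`. -/
theorem CBBA.Hom.map_tl_of_linear {B C C' : CBBA K} {V : Bicomplex K} {ν : B.Hom C}
    {ν' : B.Hom C'} {u : C.carrier →ₗ[K] C'.carrier} (hu : ∀ x b, u (x * ν b) = u x * ν' b)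
    (ψ : V.carrier →ₗ[K] C.carrier) (t : V.carrier ⊗[K] B.carrier) :
    u (ν.tl ψ t) = ν'.tl (u ∘ₗ ψ) t :=
  tilde_map (f := u) (act' := ν'.rAct) ν.rAct hu ψ t

/-- The terms of the twisted differential coming from `V` and the twisting commute with composition
by a `B`-linear operator, so commutators with `D` may be computed with twisted differentials. -/
theorem CBBA.Hom.commutator_tDD {B C : CBBA K} {V : Bicomplex K} {ν : B.Hom C}
    {T : Twisting V B} {u : C.carrier →ₗ[K] C.carrier} (hu : ∀ x b, u (x * ν b) = u x * ν b)
    (c : Bool) {n m : ℤ} {ε : ℤˣ} (h : m.negOnePow = ε * n.negOnePow)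
    (ψ : V.carrier →ₗ[K] C.carrier) (v : V.carrier) :
    C.D c (u (ψ v)) - ε • u (C.D c (ψ v)) =
      ν.tDD T c m (u ∘ₗ ψ) v - ε • u (ν.tDD T c n ψ v) := by
  rw [ν.D_eq T c n ψ v, show u (ψ v) = (u ∘ₗ ψ) v from rfl, ν.D_eq T c m (u ∘ₗ ψ) v, h, map_add,
    Bigraded.map_units_smul, map_add, CBBA.Hom.map_tl_of_linear hu]
  simp only [LinearMap.comp_apply, smul_add, mul_smul]
  abel

namespace SquareExt
variable {B P : CBBA K} {β : B.Hom P} {V : ℕ → Bicomplex K} {T : ∀ n, Twisting (V n) B}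
  (S : SquareExt β V T)

/-- The map `B → P^□`. -/
def base : B.Hom S.obj := S.inc.comp β

/-- The generators. -/
noncomputable def q (n : ℕ) (k : Fin 4) : (V n).carrier →ₗ[K] S.obj.carrier :=
  S.base.sq (T n) (S.φ n) k

theorem q_mem (n : ℕ) (k : Fin 4) : S.q n k ∈ CBBA.homDeg (V n) S.obj (sqDeg k) :=
  CBBA.Hom.sq_mem (S.φ_mem n) k

variable [CharZero K] (hT : ∀ n, (T n).Flat)
include hT

/-- Squares carry no relations: ψ is arbitrary of bidegree (-1,-1), the other corners are its
twisted differentials, and both targets obey the same table `sqTab`. -/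
theorem exists_hom {C : CBBA K} (γ : P.Hom C) (ψ : ∀ n, (V n).carrier →ₗ[K] C.carrier)
    (hψ : ∀ n, ψ n ∈ CBBA.homDeg (V n) C (-1, -1)) :
    ∃ H : S.obj.Hom C, H.comp S.inc = γ ∧
      (∀ n, H.toAlgHom.toLinearMap ∘ₗ S.φ n = ψ n) ∧
      ∀ n k v, H (S.q n k v) = (γ.comp β).sq (T n) (ψ n) k v := by
  obtain ⟨H, H1, H2, H3⟩ := S.free.exists_gradedHom γ.toAlgHom γ.isGraded
    (fun i => (γ.comp β).sq (T i.1) (ψ i.1) i.2) (fun i => CBBA.Hom.sq_mem (hψ i.1) i.2)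
  have H3' : ∀ n k, H.toLinearMap ∘ₗ S.q n k = (γ.comp β).sq (T n) (ψ n) k := fun n k => H3 (n, k)
  have H2' : ∀ b, H (S.base b) = (γ.comp β) b := fun b => H2 (β b)
  have htab : ∀ c n k, H.toLinearMap ∘ₗ sqTab c (S.q n) k =
      sqTab c ((γ.comp β).sq (T n) (ψ n)) k := fun c n k => by
    have e := H3' n
    cases c <;> fin_cases k
    · exact e 1
    · exact LinearMap.comp_zero _
    · exact e 3
    · exact LinearMap.comp_zero _
    · exact e 2
    · exact (LinearMap.comp_neg _ _).trans (congrArg _ (e 3))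
    · exact LinearMap.comp_zero _
    · exact LinearMap.comp_zero _
  have H4 : ∀ c x, H (S.obj.D c x) = C.D c (H x) := by
    intro c x
    refine CBBA.map_D_of_adjoin H1 (S := Set.range S.inc ∪ ⋃ i : ℕ × Fin 4, Set.range (S.q i.1 i.2))
      ?_ (S.free.adjoin_eq_top ▸ trivial)
    rintro _ (⟨b, rfl⟩ | hx)
    · rw [← S.inc.map_D]
      exact (H2 _).trans ((γ.map_D c b).trans (congrArg _ (H2 b).symm))
    · obtain ⟨⟨n, k⟩, v, rfl⟩ := Set.mem_iUnion.1 hx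
      refine (CBBA.Hom.map_tDD_iff H2' (T n) c (sqTot k) (S.q n k) v).1 ?_
      rw [H3', CBBA.Hom.tDD_sq (hT n) (hψ n)]
      exact (congrArg H (LinearMap.congr_fun (CBBA.Hom.tDD_sq (hT n) (S.φ_mem n) c k) v)).trans
        (LinearMap.congr_fun (htab c n k) v)
  exact ⟨⟨H, fun hx => H1 _ _ hx, H4 false, H4 true⟩, CBBA.Hom.ext' H2, fun n => H3' n 0,
    fun n k v => LinearMap.congr_fun (H3' n k) v⟩

theorem exists_ret : ∃ r : S.obj.Hom P, (∀ x, r (S.inc x) = x) ∧ ∀ n k v, r (S.q n k v) = 0 := by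
  obtain ⟨r, h1, -, h3⟩ := S.exists_hom hT ⟨AlgHom.id K _, fun hx => hx, fun _ => rfl, fun _ => rfl⟩
    (fun n => 0) (fun n => zero_mem _)
  refine ⟨r, fun x => congrArg (fun f : P.Hom P => f x) h1, fun n k v => ?_⟩
  rw [h3]
  fin_cases k <;> simp [CBBA.Hom.sq]

/-- The retraction `P^□ → P`. -/
noncomputable def ret : S.obj.Hom P := (S.exists_ret hT).choose

theorem ret_inc (x : P.carrier) : S.ret hT (S.inc x) = x := (S.exists_ret hT).choose_spec.1 x

theorem ret_q (n : ℕ) (k : Fin 4) (v : (V n).carrier) : S.ret hT (S.q n k v) = 0 :=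
  (S.exists_ret hT).choose_spec.2 n k v

/-- With s(∂∂̄φ) = φ, the commutator t = [∂̄, s] sends ∂φ to φ and ∂∂̄φ to ∂̄φ, and E = [∂, t] is
the identity on all four corners and zero on P. Thus E multiplies a product of m generators by m and
is invertible on the kernel of the retraction. The last clause, for endomorphisms that keep or kill
each square, is what later gives acyclicity stage by stage. -/
theorem exists_contraction : ∃ s Einv : S.obj.carrier →ₗ[K] S.obj.carrier,
    (∀ x p, s (x * S.inc p) = s x * S.inc p) ∧ (∀ x p, Einv (x * S.inc p) = Einv x * S.inc p) ∧
    (∀ a x, x ∈ S.obj.gr a → s x ∈ S.obj.gr (a - (1, 1))) ∧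
    (∀ a x, x ∈ S.obj.gr a → Einv x ∈ S.obj.gr a) ∧
    (∀ x, S.ret hT (s x) = 0) ∧ (∀ c x, Einv (S.obj.D c x) = S.obj.D c (Einv x)) ∧
    (∀ x, S.ret hT x = 0 → 
      S.obj.D false (S.obj.D true (s (Einv x)) - s (S.obj.D true (Einv x))) +
      (S.obj.D true (s (S.obj.D false (Einv x))) - s (S.obj.D true (S.obj.D false (Einv x)))) = x) ∧
    ∀ (f : S.obj.carrier →ₐ[K] S.obj.carrier) (f₀ : P.carrier → P.carrier),
      (∀ p, f (S.inc p) = S.inc (f₀ p)) → 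
      (∀ n, (∀ k v, f (S.q n k v) = S.q n k v) ∨ (∀ k v, f (S.q n k v) = 0)) →
      ∀ x, f (s (Einv x)) = s (Einv (f x)) := by
  let O := S.obj
  -- The derivation s has even total degree, so no sign occurs in its Leibniz rule; it lowers corner
  -- 3 to corner 0 and kills `P` and the other corners.
  obtain ⟨s, hsP, hsg, hsmul, hsdeg⟩ := S.free.exists_derivation (-1, -1) 0 (fun b b' => by simp)
    (fun a b _ => zero_mem _) (fun i => if i.2 = 3 then S.q i.1 0 else 0) (fun i => by
      split
      · next h =>
        have := S.q_mem i.1 0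
        rw [h]; exact this
      · exact zero_mem _)
  have hsmul : ∀ x y, s (x * y) = s x * y + x * s y := fun x y => by
    rw [hsmul]; simp [CBBA.sgnPow]
  have hsP : ∀ p, s (S.inc p) = 0 := hsP
  have hsq : ∀ n k, s ∘ₗ S.q n k = if k = 3 then S.q n 0 else 0 := fun n k =>
    LinearMap.ext fun v => hsg (n, k) v
  have hssgn := O.sgn_zero_deg (u := s) (e := (-1, -1)) ⟨-1, rfl⟩ hsdeg
  have hsB : ∀ x b, s (x * S.base b) = s x * S.base b := fun x b => by
    rw [hsmul]; change _ + x * s (S.inc (β b)) = _; rw [hsP, mul_zero, add_zero]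
  have hDq : ∀ c n k, S.base.tDD (T n) c (sqTot k) (S.q n k) = sqTab c (S.q n) k := fun c n k =>
    CBBA.Hom.tDD_sq (hT n) (S.φ_mem n) c k
  -- the odd derivation `t = [∂̄, s]`
  let t : O.carrier →ₗ[K] O.carrier := O.D true ∘ₗ s - s ∘ₗ O.D true
  have ht : ∀ x, t x = O.D true (s x) - s (O.D true x) := fun x => rfl
  have htmul : ∀ x y, t (x * y) = t x * y + O.sgn x * t y := fun x y => by
    simp only [ht, hsmul, O.D_mul, map_add, hssgn]; noncomm_ring
  have htP : ∀ p, t (S.inc p) = 0 := fun p => by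
    rw [ht, hsP, ← S.inc.map_D, hsP, map_zero, sub_zero]
  have htq : ∀ n k v, t (S.q n k v) = (![0, S.q n 0, 0, S.q n 2] : Fin 4 → _) k v := by
    intro n k v
    have e := CBBA.Hom.commutator_tDD hsB true (T := T n) (n := sqTot k) (m := sqTot k) (ε := 1)
      (by simp) (S.q n k) v
    rw [one_smul, one_smul, hDq, hsq] at e
    refine (ht _).trans (e.trans ?_)
    have hs' : ∀ k v, s (S.q n k v) = (if k = 3 then S.q n 0 else 0) v :=
      fun k v => LinearMap.congr_fun (hsq n k) v
    have e0 := hDq true n 0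
    rw [S.base.tDD_congr (T n) true (n := sqTot 0) (m := 0) (by decide)] at e0
    fin_cases k
    · simp [sqTab, hs']
    · simp [sqTab, hs']
    · simp [sqTab]
    · simpa [sqTab, sqTot] using LinearMap.congr_fun e0 v
  have htsgn : ∀ x, t (O.sgn x) = -O.sgn (t x) := fun x => by
    simp only [ht, hssgn, O.D_sgn, map_neg, map_sub]; abel
  have htB : ∀ x b, t (x * S.base b) = t x * S.base b := fun x b => by
    rw [htmul]; change _ + _ * t (S.inc (β b)) = _; rw [htP, mul_zero, add_zero]
  -- the Euler derivation `E = [∂, t]`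
  let E : O.carrier →ₗ[K] O.carrier := O.D false ∘ₗ t + t ∘ₗ O.D false
  have hE : ∀ x, E x = O.D false (t x) + t (O.D false x) := fun x => rfl
  have hEmul : ∀ x y, E (x * y) = E x * y + x * E y := fun x y => by
    simp only [hE, htmul, O.D_mul, map_add, htsgn, O.D_sgn, O.sgn_sgn]; noncomm_ring
  have hEP : ∀ p, E (S.inc p) = 0 := fun p => by
    rw [hE, htP, ← S.inc.map_D, htP, map_zero, add_zero]
  have hEq : ∀ n k v, E (S.q n k v) = S.q n k v := by
    intro n k v
    have htq' : ∀ k, t ∘ₗ S.q n k = (![0, S.q n 0, 0, S.q n 2] : Fin 4 → _) k := fun k =>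
      LinearMap.ext (htq n k)
    have e := CBBA.Hom.commutator_tDD htB false (T := T n) (n := sqTot k) (m := sqTot k + 1)
      (ε := -1) (by simp [Int.negOnePow_succ]) (S.q n k) v
    rw [hDq, htq'] at e
    simp only [Units.neg_smul, one_smul, sub_neg_eq_add] at e
    refine (hE _).trans (e.trans ?_)
    have e0 := hDq false n 0
    have e2 := hDq false n 2
    rw [S.base.tDD_congr (T n) false (n := sqTot 0) (m := 0) (by decide)] at e0
    rw [S.base.tDD_congr (T n) false (n := sqTot 2) (m := 1) (by decide)] at e2
    have e0' := LinearMap.congr_fun e0 v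
    have e2' := LinearMap.congr_fun e2 v
    fin_cases k
    · simp [sqTab, htq]
    · simpa [sqTab, sqTot] using e0'
    · simp [sqTab, htq]
    · simpa [sqTab, sqTot] using e2'
  have hEdeg : ∀ a x, x ∈ O.gr a → E x ∈ O.gr a := fun a x hx => by
    have h1 := O.D_mem false (O.D_mem true (hsdeg a x hx))
    have h2 := O.D_mem false (hsdeg _ _ (O.D_mem true hx))
    have h3 := O.D_mem true (hsdeg _ _ (O.D_mem false hx))
    have h4 := hsdeg _ _ (O.D_mem true (O.D_mem false hx))
    have e : a + (-1, -1) + eDeg true + eDeg false = a := by ext <;> simp [eDeg]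
    have e2 : a + eDeg true + (-1, -1) + eDeg false = a := by ext <;> simp [eDeg]
    have e3 : a + eDeg false + (-1, -1) + eDeg true = a := by ext <;> simp [eDeg]
    have e4 : a + eDeg false + eDeg true + (-1, -1) = a := by ext <;> simp [eDeg]
    rw [e] at h1
    rw [e2] at h2
    rw [e3] at h3
    rw [e4] at h4
    rw [hE, ht, ht, map_sub]
    exact add_mem (sub_mem h1 h2) (sub_mem h3 h4)
  -- the decomposition into eigenspaces
  let G : ℕ → Submodule K O.carrier := fun m => Module.End.eigenspace E (m : K)
  have hG : ∀ {m x}, x ∈ G m ↔ E x = (m : K) • x := Module.End.mem_eigenspace_iff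
  have Gmul : ∀ a b, ∀ x ∈ G a, ∀ y ∈ G b, x * y ∈ G (a + b) := by
    intro a b x hx y hy
    rw [hG] at *
    rw [hEmul, hx, hy, smul_mul_assoc, mul_smul_comm, ← add_smul, Nat.cast_add]
  -- To see that the zero eigenspace of E is exactly the image of `P`, replace it by that image: the
  -- family still spans, hence equals the eigenspace decomposition.
  let G' : ℕ → Submodule K O.carrier := fun m =>
    if m = 0 then LinearMap.range S.inc.toAlgHom.toLinearMap else G m
  have hle : ∀ m, G' m ≤ G m := by
    intro m
    by_cases hm : m = 0
    · simp only [G', if_pos hm]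
      rintro _ ⟨p, rfl⟩
      rw [hG, hm, Nat.cast_zero, zero_smul]; exact hEP p
    · simp only [G', if_neg hm]; exact le_rfl
  have htop' : ⨆ m, G' m = ⊤ := by
    refine Bigraded.iSup_eq_top_of_adjoin S.free.adjoin_eq_top ⟨1, map_one S.inc.toAlgHom⟩
      (fun a b x hx y hy => ?_) ?_
    · by_cases h : a + b = 0
      · obtain ⟨rfl, rfl⟩ : a = 0 ∧ b = 0 := by omega
        obtain ⟨p, rfl⟩ := hx
        obtain ⟨p', rfl⟩ := hy
        exact ⟨p * p', map_mul S.inc.toAlgHom _ _⟩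
      · simp only [G', if_neg h]
        exact Gmul a b x (hle a hx) y (hle b hy)
    · rintro _ (⟨p, rfl⟩ | hx)
      · exact Submodule.mem_iSup_of_mem 0 ⟨p, rfl⟩
      · obtain ⟨⟨n, k⟩, v, rfl⟩ := Set.mem_iUnion.1 hx
        refine Submodule.mem_iSup_of_mem 1 ?_
        simp only [G', if_neg one_ne_zero]
        rw [hG, Nat.cast_one, one_smul]
        exact hEq n k v
  have htop : ⨆ m, G m = ⊤ := top_le_iff.1 (htop' ▸ iSup_mono hle)
  have hint : DirectSum.IsInternal G :=
    Bigraded.isInternal_of_eigen E (c := fun m : ℕ => (m : K)) Nat.cast_injective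
      (fun _ _ hx => hG.1 hx) htop
  have hGG := Bigraded.eq_of_le_of_iSup_eq_top hint.submodule_iSupIndep hle htop'
  -- Since `0⁻¹ = 0` in `K`, this operator vanishes on the image of `P` and inverts E on the other
  -- eigenspaces. It commutes with everything that commutes with E.
  let Einv : O.carrier →ₗ[K] O.carrier := Bigraded.glue hint fun m => (m : K)⁻¹ • (G m).subtype
  have hEinv : ∀ {m x}, x ∈ G m → Einv x = (m : K)⁻¹ • x := fun {m x} hx => by
    simp only [Einv]; rw [Bigraded.glue_of_mem hint _ hx]; rfl
  have hcomm : ∀ u : O.carrier →ₗ[K] O.carrier, (∀ x, E (u x) = u (E x)) →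
      ∀ x, Einv (u x) = u (Einv x) := by
    intro u hu x
    have : Einv ∘ₗ u = u ∘ₗ Einv := Bigraded.hom_ext htop fun m x hx => by
      rw [LinearMap.comp_apply, LinearMap.comp_apply, hEinv hx, map_smul]
      refine hEinv ?_
      rw [hG] at *
      rw [hu, hx, map_smul]
    exact LinearMap.congr_fun this x
  have hrs : ∀ x, S.ret hT (s x) = 0 := by
    refine S.free.induction (fun b => by rw [hsP, map_zero]) (fun i v => ?_)
      (fun x y hx hy => by rw [map_add, map_add, hx, hy, add_zero])
      (fun x y hx hy => by rw [hsmul, map_add, map_mul, map_mul, hx, hy, zero_mul, mul_zero, add_zero])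
    rw [hsg]
    split
    · exact S.ret_q hT _ _ _
    · exact map_zero (S.ret hT).toAlgHom
  have hrE : ∀ x, S.ret hT (E x) = 0 := fun x => by
    have hrD : ∀ c x, S.ret hT (O.D c x) = P.D c (S.ret hT x) := (S.ret hT).map_D
    rw [hE, ht, ht]
    simp only [map_add, map_sub, hrD, hrs, map_zero, sub_zero, add_zero]
  have hEE : ∀ x, E (Einv x) = x - S.inc (S.ret hT x) := by
    intro x
    have : E ∘ₗ Einv = LinearMap.id - S.inc.toAlgHom.toLinearMap ∘ₗ (S.ret hT).toAlgHom.toLinearMap :=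
      Bigraded.hom_ext htop fun m x hx => by
        simp only [LinearMap.comp_apply, LinearMap.sub_apply, LinearMap.id_apply,
          AlgHom.toLinearMap_apply]
        rw [hEinv hx]
        by_cases hm : m = 0
        · subst hm
          rw [← hGG] at hx
          obtain ⟨p, rfl⟩ := hx
          rw [AlgHom.toLinearMap_apply, S.ret_inc, sub_self, Nat.cast_zero, inv_zero, zero_smul,
            map_zero]
        · have hm' : (m : K) ≠ 0 := Nat.cast_ne_zero.2 hm
          have hx' := hG.1 hx
          have h0 := hrE x
          rw [hx', map_smul] at h0
          rw [(smul_eq_zero.1 h0).resolve_left hm', map_zero, sub_zero, map_smul, hx', smul_smul,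
            inv_mul_cancel₀ hm', one_smul]
    exact LinearMap.congr_fun this x
  have hDD : ∀ x, O.D true (O.D true x) = 0 := O.dbar_dbar
  have hDD' : ∀ x, O.D false (O.D false x) = 0 := O.d_d
  have hDt : ∀ x, O.D true (t x) = -t (O.D true x) := fun x => by
    rw [ht, ht, map_sub, hDD, hDD, map_zero]; abel
  have hED : ∀ c x, E (O.D c x) = O.D c (E x) := by
    intro c x
    cases c
    · rw [hE, hE, hDD', map_zero, map_add, hDD', add_zero, zero_add]
    · have h1 : ∀ y, O.D true (O.D false y) = -O.D false (O.D true y) := fun y =>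
        eq_neg_of_add_eq_zero_left (O.D_D true false y)
      rw [hE, hE, map_add, h1, hDt, hDt, h1, map_neg, map_neg]; abel
  refine ⟨s, Einv, fun x p => by rw [hsmul, hsP, mul_zero, add_zero], fun x p =>
    hcomm (LinearMap.mulRight K (S.inc p)) (fun x => ?_) x, fun a x hx => ?_, fun a x hx => ?_,
    hrs, fun c => hcomm _ (hED c), fun x hx => ?_, fun f f₀ hf hfq x => ?_⟩
  · simp only [LinearMap.mulRight_apply]
    rw [hEmul, hEP, mul_zero, add_zero]
  · have := hsdeg a x hx
    rwa [show a + (-1, -1) = a - (1, 1) from rfl] at this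
  -- E preserves bidegrees, so it commutes with the projection π onto bidegree `a`. Then `Einv`
  -- commutes with π too, and therefore preserves bidegrees.
  · let π : O.carrier →ₗ[K] O.carrier :=
      Bigraded.glue O.internal fun b => if b = a then (O.gr b).subtype else 0
    have hπ : ∀ b y, y ∈ O.gr b → π y = if b = a then y else 0 := fun b y hy => by
      simp only [π]
      rw [Bigraded.glue_of_mem O.internal _ hy]
      split <;> rfl
    have hEπ : ∀ x, E (π x) = π (E x) := by
      intro x
      have : E ∘ₗ π = π ∘ₗ E := O.hom_ext fun b y hy => by
        rw [LinearMap.comp_apply, LinearMap.comp_apply, hπ b y hy, hπ b _ (hEdeg b y hy)]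
        split
        · rfl
        · exact map_zero _
      exact LinearMap.congr_fun this x
    have hπmem : ∀ x, π x ∈ O.gr a := by
      intro x
      have hx : x ∈ ⨆ b, O.gr b := O.internal.submodule_iSup_eq_top ▸ trivial
      induction hx using Submodule.iSup_induction' with
      | zero => rw [map_zero]; exact zero_mem _
      | add x y _ _ hx hy => rw [map_add]; exact add_mem hx hy
      | mem b y hy =>
        rw [hπ b y hy]
        split
        · next h => exact h ▸ hy
        · exact zero_mem _
    have e := hcomm π hEπ x
    rw [hπ a x hx, if_pos rfl] at e
    rw [e]; exact hπmem _
  · have e := hEE x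
    rw [hx, map_zero, sub_zero] at e
    exact e
  · have hfs : ∀ x, f (s x) = s (f x) := by
      refine S.free.induction (fun b => ?_) (fun i v => ?_)
        (fun x y hx hy => by simp only [map_add, hx, hy])
        (fun x y hx hy => by rw [hsmul, map_add, map_mul, map_mul, map_mul, hsmul, hx, hy])
      · rw [hsP, hf, hsP, map_zero]
      · rw [hsg]
        rcases hfq i.1 with h | h
        · rw [show f ((S.inc.comp β).sq (T i.1) (S.φ i.1) i.2 v) = _ from h i.2 v]
          refine Eq.trans ?_ (hsg i v).symm
          split
          · exact h 0 v
          · exact map_zero f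
        · rw [show f ((S.inc.comp β).sq (T i.1) (S.φ i.1) i.2 v) = _ from h i.2 v, map_zero]
          split
          · exact h 0 v
          · exact map_zero f
    have hfE : ∀ x, E (f x) = f (E x) := by
      refine S.free.induction (fun b => ?_) (fun i v => ?_)
        (fun x y hx hy => by simp only [map_add, hx, hy])
        (fun x y hx hy => by rw [map_mul, hEmul, hEmul, map_add, map_mul, map_mul, hx, hy])
      · rw [hEP, hf, hEP, map_zero]
      · rw [show E ((S.inc.comp β).sq (T i.1) (S.φ i.1) i.2 v) = _ from hEq i.1 i.2 v]
        rcases hfq i.1 with h | h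
        · rw [h i.2 v, show f ((S.inc.comp β).sq (T i.1) (S.φ i.1) i.2 v) = _ from h i.2 v]
          exact hEq i.1 i.2 v
        · rw [h i.2 v, show f ((S.inc.comp β).sq (T i.1) (S.φ i.1) i.2 v) = _ from h i.2 v, map_zero]
    rw [hfs]
    exact congrArg s (hcomm f.toLinearMap hfE x).symm

/-- The kernel of the retraction is acyclic, compatibly with the projections `f` to subalgebras
generated by some of the generators. -/
theorem ret_isAcyclicOn {V' : Bicomplex K} (T' : Twisting V' B)
    (f : S.obj.carrier →ₐ[K] S.obj.carrier) (f₀ : P.carrier → P.carrier)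
    (hf : ∀ p, f (S.inc p) = S.inc (f₀ p))
    (hfq : ∀ n, (∀ k v, f (S.q n k v) = S.q n k v) ∨ (∀ k v, f (S.q n k v) = 0)) :
    S.base.IsAcyclicOn T' (LinearMap.ker (S.ret hT).toAlgHom.toLinearMap ⊓
      LinearMap.eqLocus f.toLinearMap LinearMap.id) := by
  obtain ⟨s, Einv, hs, hE, hsdeg, hEdeg, hrs, hED, hsE, hfs⟩ := S.exists_contraction hT
  intro a n hn χ hχ hD hN
  have hsB : ∀ x b, s (x * S.base b) = s x * S.base b := fun x b => hs x (β b)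
  have hEB : ∀ x b, Einv (x * S.base b) = Einv x * S.base b := fun x b => hE x (β b)
  have hcancel : ∀ {u : S.obj.carrier →ₗ[K] S.obj.carrier} (_ : ∀ x b, u (x * S.base b) =
      u x * S.base b) c {m : ℤ} {ε : ℤˣ} (_ : m.negOnePow = ε * n.negOnePow) v,
      S.base.tDD T' c m (u ∘ₗ χ) v = S.obj.D c (u (χ v)) - ε • u (S.obj.D c (χ v)) := by
    intro u hu c m ε h v
    rw [CBBA.Hom.commutator_tDD hu c h χ v, hD c, LinearMap.zero_apply, map_zero, smul_zero,
      sub_zero]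
  -- w is again closed, so [∂̄, s]w = ∂̄(s w) and E w = ∂∂̄(s w) for twisted differentials. Since χ
  -- lies in the kernel of the retraction, E w = χ, and `s ∘ₗ w` is the primitive.
  let w := Einv ∘ₗ χ
  have hw : ∀ c, S.base.tDD T' c n w = 0 := fun c => LinearMap.ext fun v => by
    rw [hcancel hEB c (ε := 1) (by rw [one_mul]) v, one_smul, hED, sub_self]; rfl
  refine ⟨s ∘ₗ w, fun b x hx => ?_, fun v => ⟨hrs _, ?_⟩, ?_⟩
  · rw [← add_sub_assoc]; exact hsdeg _ _ (hEdeg _ _ (hχ b x hx))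
  · have := hfs f f₀ hf hfq (χ v)
    rw [show f (χ v) = χ v from (hN v).2] at this
    exact this
  · have h2 : (n - 2).negOnePow = 1 * n.negOnePow := by
      rw [Int.negOnePow_sub, Int.negOnePow_even 2 even_two, one_mul, mul_one]
    have h1 : (n - 1).negOnePow = (-1) * n.negOnePow := by
      rw [Int.negOnePow_sub, Int.negOnePow_odd 1 odd_one, mul_comm]
    let t : S.obj.carrier →ₗ[K] S.obj.carrier := S.obj.D true ∘ₗ s - s ∘ₗ S.obj.D true
    have htB : ∀ x b, t (x * S.base b) = t x * S.base b := fun x b => by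
      have hss := S.obj.sgn_zero_deg (u := s) (e := (-1, -1)) ⟨-1, rfl⟩
        (fun a x hx => by simpa [sub_eq_add_neg] using hsdeg a x hx) x
      simp only [t, LinearMap.sub_apply, LinearMap.comp_apply, hsB, S.obj.D_mul, map_add,
        ← S.base.map_D, hss]
      noncomm_ring
    have et : S.base.tDD T' true (n - 2) (s ∘ₗ w) = t ∘ₗ w := LinearMap.ext fun v => by
      have e := CBBA.Hom.commutator_tDD (T := T') hsB true h2 w v
      rw [hw, LinearMap.zero_apply, map_zero, smul_zero, sub_zero, one_smul] at e
      exact e.symm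
    rw [et]
    refine LinearMap.ext fun v => ?_
    have e := CBBA.Hom.commutator_tDD (T := T') htB false h1 w v
    rw [hw, LinearMap.zero_apply, map_zero, smul_zero, sub_zero, Units.neg_smul, one_smul,
      sub_neg_eq_add] at e
    exact e.symm.trans (hsE (χ v) (hN v).1)

theorem ret_isAcyclicFor {V' : Bicomplex K} (T' : Twisting V' B) :
    (S.ret hT).IsAcyclicFor S.base T' := by
  have h := S.ret_isAcyclicOn hT T' (AlgHom.id K _) id (fun _ => rfl)
    (fun n => Or.inl fun _ _ => rfl)
  have e : LinearMap.eqLocus (AlgHom.id K S.obj.carrier).toLinearMap LinearMap.id = ⊤ :=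
    top_le_iff.1 fun x _ => rfl
  rwa [e, inf_top_eq] at h

theorem ret_surjective : Function.Surjective (S.ret hT) := fun x => ⟨S.inc x, S.ret_inc hT x⟩

end SquareExt
end

section
variable {K : Type u} [Field K]

/-! ## The universal property of cylinders -/

theorem CBBA.Hom.comp_assoc {A B C D : CBBA K} (h : C.Hom D) (g : B.Hom C) (f : A.Hom B) :
    (h.comp g).comp f = h.comp (g.comp f) := rfl

/-- The identity. -/
def CBBA.Hom.id (A : CBBA K) : A.Hom A := ⟨AlgHom.id K _, fun hx => hx, fun _ => rfl, fun _ => rfl⟩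

theorem CBBA.Hom.congr_comp {A B C : CBBA K} {g : B.Hom C} {f : A.Hom B} {h : A.Hom C}
    (e : g.comp f = h) (x : A.carrier) : g (f x) = h x := congrArg (fun f : A.Hom C => f x) e

namespace SuccHirschExt

theorem hom_ext {B A C : CBBA K} (E : SuccHirschExt B A) {f g : A.Hom C}
    (h : f.comp E.incl = g.comp E.incl) (hg : ∀ n v, f (E.gen n v) = g (E.gen n v)) : f = g :=
  CBBA.Hom.ext' fun x => DFunLike.congr_fun
    (E.free.algHom_ext (f := f.toAlgHom) (f' := g.toAlgHom) (CBBA.Hom.congr_comp h) hg) x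

namespace Cylinder
variable {B A C : CBBA K} {E : SuccHirschExt B A} (Z : E.Cylinder)

theorem base_eq' : Z.y.comp E.incl = Z.base := Z.base_eq.symm

theorem stage_eq (n : ℕ) :
    Z.stage n = genStage Z.base (fun i : ℕ × Fin 5 => Z.gens i.1 i.2) Prod.fst n := by
  unfold CylinderData.stage genStage
  congr 2
  ext z
  simp only [Set.mem_iUnion, Set.mem_Iio, Set.mem_ofPred_eq, Prod.exists]
  constructor
  · rintro ⟨k, hk, i, hz⟩; exact ⟨k, i, hk, hz⟩
  · rintro ⟨k, i, hk, hz⟩; exact ⟨k, hk, i, hz⟩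

theorem stage_mono {n m : ℕ} (h : n ≤ m) : Z.stage n ≤ Z.stage m := by
  rw [stage_eq, stage_eq]; exact genStage_mono h

theorem base_mem_stage (b : B.carrier) (n : ℕ) : Z.base b ∈ Z.stage n :=
  Algebra.subset_adjoin (Or.inl ⟨b, rfl⟩)

theorem x_mem_stage {n : ℕ} {a : A.carrier} (ha : a ∈ E.stage n) : Z.x a ∈ Z.stage n := by
  have : E.stage n ≤ (Z.stage n).comap Z.x.toAlgHom :=
    genStage_le (rank := id) (fun b => Z.base_mem_stage b n)
      fun k hk v => Z.gens_mem_stage hk 0 v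
  exact this ha

theorem y_mem_stage {n : ℕ} {a : A.carrier} (ha : a ∈ E.stage n) : Z.y a ∈ Z.stage n := by
  have : E.stage n ≤ (Z.stage n).comap Z.y.toAlgHom :=
    genStage_le (rank := id) (fun b => by
      rw [Subalgebra.mem_comap, CBBA.Hom.congr_comp Z.base_eq' b]; exact Z.base_mem_stage b n)
      fun k hk v => Z.gens_mem_stage hk 1 v
  exact this ha

/-- The square generated by `φ`. -/
noncomputable def sq (n : ℕ) (k : Fin 4) : (E.V n).carrier →ₗ[K] Z.obj.carrier :=
  Z.base.sq (E.T n) (Z.φ n) k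

theorem sq_three (n : ℕ) : Z.sq n 3 = Z.δ n + Z.ω n := Z.eq n

theorem sq_mem (n : ℕ) (k : Fin 4) : Z.sq n k ∈ CBBA.homDeg (E.V n) Z.obj (sqDeg k) :=
  CBBA.Hom.sq_mem (Z.φ_deg n) k

theorem ω_mem_stage (n : ℕ) (v : (E.V n).carrier) : Z.ω n v ∈ Z.stage n :=
  Z.ideal_le_stage n (Z.ω_mem n v)

theorem sq_mem_stage {k n : ℕ} (h : k < n) (j : Fin 4) (v : (E.V k).carrier) :
    Z.sq k j v ∈ Z.stage n := by
  fin_cases j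
  · exact Z.gens_mem_stage h 2 v
  · exact Z.gens_mem_stage h 3 v
  · exact Z.gens_mem_stage h 4 v
  · have := LinearMap.congr_fun (Z.sq_three k) v
    refine this ▸ add_mem (sub_mem (Z.gens_mem_stage h 0 v) (Z.gens_mem_stage h 1 v))
      (Z.stage_mono h.le (Z.ω_mem_stage k v))

theorem tl_mem_stage {V : Bicomplex K} {n : ℕ} {ψ : V.carrier →ₗ[K] Z.obj.carrier}
    (hψ : ∀ v, ψ v ∈ Z.stage n) (t : V.carrier ⊗[K] B.carrier) : Z.base.tl ψ t ∈ Z.stage n :=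
  Z.base.tl_eq_of_mem (S := Subalgebra.toSubmodule (Z.stage n))
    (fun _ hx b => (Z.stage n).mul_mem hx (Z.base_mem_stage b n)) hψ t

theorem tDD_x (c : Bool) (n : ℕ) (k : ℤ) :
    Z.base.tDD (E.T n) c k (Z.x.toAlgHom.toLinearMap ∘ₗ E.gen n) =
      Z.x.toAlgHom.toLinearMap ∘ₗ E.incl.tDD (E.T n) c k (E.gen n) :=
  (CBBA.Hom.map_tDD Z.x (fun _ => rfl) _ _ _ _).symm

theorem tDD_y (c : Bool) (n : ℕ) (k : ℤ) :
    Z.base.tDD (E.T n) c k (Z.y.toAlgHom.toLinearMap ∘ₗ E.gen n) =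
      Z.y.toAlgHom.toLinearMap ∘ₗ E.incl.tDD (E.T n) c k (E.gen n) :=
  (CBBA.Hom.map_tDD Z.y (CBBA.Hom.congr_comp Z.base_eq') _ _ _ _).symm

theorem ω_eq (n : ℕ) : Z.ω n = Z.sq n 3 - Z.δ n := by rw [sq_three, add_sub_cancel_left]

section
variable [CharZero K]

theorem tDD_sq (c : Bool) (n : ℕ) (k : Fin 4) :
    Z.base.tDD (E.T n) c (sqTot k) (Z.sq n k) = sqTab c (Z.sq n) k :=
  CBBA.Hom.tDD_sq (E.flat n) (Z.φ_deg n) c k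

theorem D_sq_mem_stage (c : Bool) {k n : ℕ} (h : k < n) (j : Fin 4) (v : (E.V k).carrier) :
    Z.obj.D c (Z.sq k j v) ∈ Z.stage n := by
  rw [Z.base.D_eq (E.T k) c (sqTot j), tDD_sq]
  refine add_mem ?_ (Bigraded.units_smul_mem (Subalgebra.toSubmodule (Z.stage n)) _
      (add_mem (Z.sq_mem_stage h _ _) (Z.tl_mem_stage (fun v => Z.sq_mem_stage h _ v) _)))
  cases c <;> fin_cases j
  · exact Z.sq_mem_stage h 1 v
  · exact zero_mem _
  · exact Z.sq_mem_stage h 3 v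
  · exact zero_mem _
  · exact Z.sq_mem_stage h 2 v
  · exact neg_mem (Z.sq_mem_stage h 3 v)
  · exact zero_mem _
  · exact zero_mem _

theorem D_mem_stage (c : Bool) {n : ℕ} {z : Z.obj.carrier} (hz : z ∈ Z.stage n) :
    Z.obj.D c z ∈ Z.stage n := by
  rw [stage_eq] at *
  refine Z.free.D_mem_genStage (rank := Prod.fst) (fun i hi v => ?_) hz
  rw [← stage_eq]
  obtain ⟨k, j⟩ := i
  change k < n at hi
  fin_cases j
  · have := Z.x_mem_stage (E.D_gen_mem_stage c hi v)
    rwa [Z.x.map_D] at this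
  · have := Z.y_mem_stage (E.D_gen_mem_stage c hi v)
    rwa [Z.y.map_D] at this
  · exact Z.D_sq_mem_stage c hi 0 v
  · exact Z.D_sq_mem_stage c hi 1 v
  · exact Z.D_sq_mem_stage c hi 2 v

theorem ω_deg (n : ℕ) : Z.ω n ∈ CBBA.homDeg (E.V n) Z.obj 0 := by
  rw [ω_eq]
  exact sub_mem (Z.sq_mem n 3) (sub_mem (Z.x.isGraded.comp_homDeg (E.gen_mem n))
    (Z.y.isGraded.comp_homDeg (E.gen_mem n)))

/-- δ + ω is the fourth corner of a square and hence closed, so the twisted differentials of ω are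
the negatives of those of δ = x - y. -/
theorem tDD_ω (c : Bool) (n : ℕ) : Z.base.tDD (E.T n) c 0 (Z.ω n) =
    Z.y.toAlgHom.toLinearMap ∘ₗ E.incl.tDD (E.T n) c 0 (E.gen n) -
      Z.x.toAlgHom.toLinearMap ∘ₗ E.incl.tDD (E.T n) c 0 (E.gen n) := by
  have h3 : Z.base.tDD (E.T n) c 0 (Z.sq n 3) = 0 := by
    refine (Z.tDD_sq c n 3).trans ?_
    cases c <;> rfl
  rw [ω_eq, map_sub, h3, CylinderData.δ, map_sub, tDD_x, tDD_y, zero_sub, neg_sub]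

variable {Z} {ν : B.Hom C}

theorem map_tDD_ω {n : ℕ} {H : Z.obj.carrier →ₐ[K] C.carrier}
    (hH : CBBA.IsHomOn Z.base ν (Z.stage n) H) (c : Bool) :
    ν.tDD (E.T n) c 0 (H.toLinearMap ∘ₗ Z.ω n) =
      H.toLinearMap ∘ₗ Z.y.toAlgHom.toLinearMap ∘ₗ E.incl.tDD (E.T n) c 0 (E.gen n) -
      H.toLinearMap ∘ₗ Z.x.toAlgHom.toLinearMap ∘ₗ E.incl.tDD (E.T n) c 0 (E.gen n) := by
  rw [← LinearMap.comp_sub, ← tDD_ω]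
  exact LinearMap.ext fun v => ((CBBA.Hom.map_tDD_iff hH.base _ _ _ _ v).2
    (hH.comm c _ (Z.ω_mem_stage n v))).symm

/-- `hω` is the relation ∂∂̄φ = x - y + ω in the target. It sends the fourth corner to the fourth
corner of the square of ψ, after which the table `sqTab` makes the map compatible with differentials
on the whole square. -/
theorem exists_extend {n : ℕ} {H : Z.obj.carrier →ₐ[K] C.carrier}
    (hH : CBBA.IsHomOn Z.base ν (Z.stage n) H) {X Y ψ : (E.V n).carrier →ₗ[K] C.carrier}
    (hX : X ∈ CBBA.homDeg (E.V n) C 0) (hY : Y ∈ CBBA.homDeg (E.V n) C 0)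
    (hψ : ψ ∈ CBBA.homDeg (E.V n) C (-1, -1))
    (hDX : ∀ c, ν.tDD (E.T n) c 0 X = H.toLinearMap ∘ₗ Z.x.toAlgHom.toLinearMap ∘ₗ
      E.incl.tDD (E.T n) c 0 (E.gen n))
    (hDY : ∀ c, ν.tDD (E.T n) c 0 Y = H.toLinearMap ∘ₗ Z.y.toAlgHom.toLinearMap ∘ₗ
      E.incl.tDD (E.T n) c 0 (E.gen n))
    (hω : ν.sq (E.T n) ψ 3 = X - Y + H.toLinearMap ∘ₗ Z.ω n) :
    ∃ H' : Z.obj.carrier →ₐ[K] C.carrier, CBBA.IsHomOn Z.base ν (Z.stage (n + 1)) H' ∧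
      (∀ z ∈ Z.stage n, H' z = H z) ∧
      (∀ v, H' (Z.x (E.gen n v)) = X v) ∧ (∀ v, H' (Z.y (E.gen n v)) = Y v) ∧
      ∀ k v, H' (Z.sq n k v) = ν.sq (E.T n) ψ k v := by
  let s := ν.sq (E.T n) ψ
  let fam : ∀ m, Fin 5 → (E.V m).carrier →ₗ[K] C.carrier := fun m k =>
    if h : m = n then h ▸ (![X, Y, s 0, s 1, s 2] k) else 0
  have hfam : ∀ k, fam n k = ![X, Y, s 0, s 1, s 2] k := fun k => by simp [fam]
  have hs := CBBA.Hom.sq_mem (ν := ν) (T := E.T n) hψ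
  obtain ⟨H', h1, h2, h3, h4⟩ := Z.free.exists_extend (rank := Prod.fst) n hH.graded hH.base
    (fun i => fam i.1 i.2) (by
      rintro ⟨m, k⟩ rfl
      dsimp only
      rw [hfam]
      fin_cases k
      · exact hX
      · exact hY
      · exact hs 0
      · exact hs 1
      · exact hs 2)
  have h3' : ∀ z ∈ Z.stage n, H' z = H z := by
    intro z hz
    rw [stage_eq] at hz
    exact h3 z hz
  have h4' : ∀ k, H'.toLinearMap ∘ₗ Z.gens n k = ![X, Y, s 0, s 1, s 2] k := fun k =>
    (h4 (n, k) rfl).trans (hfam k)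
  have hsq : ∀ k, H'.toLinearMap ∘ₗ Z.sq n k = s k := by
    intro k
    fin_cases k
    · exact h4' 2
    · exact h4' 3
    · exact h4' 4
    · refine (congrArg (H'.toLinearMap ∘ₗ ·) (Z.sq_three n)).trans ?_
      refine Eq.trans ?_ hω.symm
      rw [LinearMap.comp_add, CylinderData.δ, LinearMap.comp_sub]
      have e0 := h4' 0
      have e1 := h4' 1
      have eω : H'.toLinearMap ∘ₗ Z.ω n = H.toLinearMap ∘ₗ Z.ω n :=
        LinearMap.ext fun v => h3' _ (Z.ω_mem_stage n v)
      rw [eω]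
      exact congrArg₂ _ (congrArg₂ _ e0 e1) rfl
  have htab : ∀ c k, H'.toLinearMap ∘ₗ sqTab c (Z.sq n) k = sqTab c s k := fun c k => by
    cases c <;> fin_cases k
    · exact hsq 1
    · exact LinearMap.comp_zero _
    · exact hsq 3
    · exact LinearMap.comp_zero _
    · exact hsq 2
    · exact (LinearMap.comp_neg _ _).trans (congrArg _ (hsq 3))
    · exact LinearMap.comp_zero _
    · exact LinearMap.comp_zero _
  have hDsq : ∀ c k v, H' (Z.obj.D c (Z.sq n k v)) = C.D c (H' (Z.sq n k v)) := by
    intro c k v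
    refine (CBBA.Hom.map_tDD_iff h2 (E.T n) c (sqTot k) (Z.sq n k) v).1 ?_
    rw [hsq, CBBA.Hom.tDD_sq (E.flat n) hψ, tDD_sq]
    exact LinearMap.congr_fun (htab c k) v
  refine ⟨H', ?_, h3', LinearMap.congr_fun (h4' 0), LinearMap.congr_fun (h4' 1),
    fun k => LinearMap.congr_fun (hsq k)⟩
  rw [stage_eq] at hH ⊢
  refine CBBA.IsHomOn.succ (rank := Prod.fst) hH h1 h3
    (fun c x hx => by rw [← stage_eq] at *; exact Z.D_mem_stage c hx) ?_
  rintro c ⟨m, k⟩ hm v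
  obtain rfl : m = n := hm
  fin_cases k
  · refine (CBBA.Hom.map_tDD_iff h2 (E.T m) c 0 (Z.x.toAlgHom.toLinearMap ∘ₗ E.gen m) v).1 ?_
    rw [show H'.toLinearMap ∘ₗ Z.x.toAlgHom.toLinearMap ∘ₗ E.gen m = X from h4' 0, hDX, tDD_x]
    exact h3' _ (Z.x_mem_stage (E.tDD_gen_mem c m v))
  · refine (CBBA.Hom.map_tDD_iff h2 (E.T m) c 0 (Z.y.toAlgHom.toLinearMap ∘ₗ E.gen m) v).1 ?_
    rw [show H'.toLinearMap ∘ₗ Z.y.toAlgHom.toLinearMap ∘ₗ E.gen m = Y from h4' 1, hDY, tDD_y]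
    exact h3' _ (Z.y_mem_stage (E.tDD_gen_mem c m v))
  · exact hDsq c 0 v
  · exact hDsq c 1 v
  · exact hDsq c 2 v

end
end Cylinder
end SuccHirschExt
end

/-! ### Universal property of cylinders and lifting of homotopies. -/

section
variable {K : Type u} [Field K] [CharZero K]

namespace SuccHirschExt.Cylinder
variable {B A C : CBBA K} {E : SuccHirschExt B A} (Z : E.Cylinder) {ν : B.Hom C}

theorem exists_isHomOn_zero (ν : B.Hom C) : ∃ H, CBBA.IsHomOn Z.base ν (Z.stage 0) H := by
  rw [stage_eq]; exact Z.free.exists_isHomOn_zero (rank := Prod.fst) ν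

theorem exists_limit {H : ℕ → Z.obj.carrier →ₐ[K] C.carrier}
    (hH : ∀ n, CBBA.IsHomOn Z.base ν (Z.stage n) (H n))
    (heq : ∀ n, ∀ z ∈ Z.stage n, H (n + 1) z = H n z) :
    ∃ F : Z.obj.Hom C, F.comp Z.base = ν ∧ ∀ n, ∀ z ∈ Z.stage n, F z = H n z := by
  simp only [stage_eq] at *
  exact Z.free.exists_limit hH heq

theorem exists_mem_stage (z : Z.obj.carrier) : ∃ n, z ∈ Z.stage n := by
  simp only [stage_eq]
  exact Z.free.exists_mem_genStage Prod.fst z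

theorem exists_hom_of_step (P : ℕ → (Z.obj.carrier →ₐ[K] C.carrier) → Prop)
    (zero : ∀ H, CBBA.IsHomOn Z.base ν (Z.stage 0) H → P 0 H)
    (step : ∀ n H, CBBA.IsHomOn Z.base ν (Z.stage n) H → P n H →
      ∃ H', CBBA.IsHomOn Z.base ν (Z.stage (n + 1)) H' ∧
        (∀ z ∈ Z.stage n, H' z = H z) ∧ P (n + 1) H') :
    ∃ F : Z.obj.Hom C, F.comp Z.base = ν ∧
      ∀ n, ∃ H, P n H ∧ ∀ z ∈ Z.stage n, F z = H z := by
  obtain ⟨H0, h0⟩ := Z.exists_isHomOn_zero ν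
  have h0' := zero H0 h0
  simp only [stage_eq] at *
  exact Z.free.exists_hom_of_step P ⟨H0, h0, h0'⟩ step

theorem stage_ext {R : Type*} [Ring R] [Algebra K R] {f f' : Z.obj.carrier →ₐ[K] R} {n : ℕ}
    (h0 : ∀ b, f (Z.base b) = f' (Z.base b))
    (h1 : ∀ k, k < n → ∀ i v, f (Z.gens k i v) = f' (Z.gens k i v))
    {z : Z.obj.carrier} (hz : z ∈ Z.stage n) : f z = f' z := by
  rw [stage_eq] at hz
  exact genStage_ext (rank := Prod.fst) h0 (fun i hi v => h1 i.1 hi i.2 v) hz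

/-- The relation x = ∂∂̄φ + y - ω, with ω from an earlier stage, determines the values on the x-copy
inductively. -/
theorem hom_ext {H H' : Z.obj.Hom C} (hy : H.comp Z.y = H'.comp Z.y)
    (hφ : ∀ n v, H (Z.φ n v) = H' (Z.φ n v)) : H = H' := by
  have hb : ∀ b, H (Z.base b) = H' (Z.base b) := fun b => by
    rw [← CBBA.Hom.congr_comp Z.base_eq']
    exact CBBA.Hom.congr_comp hy _
  have hsq : ∀ n k v, H (Z.sq n k v) = H' (Z.sq n k v) := fun n k v => by
    have e1 := LinearMap.congr_fun (CBBA.Hom.map_sq (ν := Z.base) (T := E.T n) (ψ := Z.φ n) H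
      (ν' := H.comp Z.base) (fun _ => rfl) k) v
    have e2 := LinearMap.congr_fun (CBBA.Hom.map_sq (ν := Z.base) (T := E.T n) (ψ := Z.φ n) H'
      (ν' := H.comp Z.base) (fun b => (hb b).symm) k) v
    have e3 : H.toAlgHom.toLinearMap ∘ₗ Z.φ n = H'.toAlgHom.toLinearMap ∘ₗ Z.φ n :=
      LinearMap.ext (hφ n)
    rw [e3] at e1
    exact e1.trans e2.symm
  have key : ∀ n, ∀ z ∈ Z.stage n, H z = H' z := by
    intro n
    induction n with
    | zero => exact fun z hz => Z.stage_ext hb (fun k hk => absurd hk (Nat.not_lt_zero k)) hz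
    | succ n ih =>
      intro z hz
      refine Z.stage_ext hb (fun k hk i v => ?_) hz
      fin_cases i
      · have e : Z.x (E.gen k v) = Z.sq k 3 v + Z.y (E.gen k v) - Z.ω k v := by
          rw [sq_three, LinearMap.add_apply, CylinderData.δ, LinearMap.sub_apply]
          simp only [LinearMap.comp_apply, AlgHom.toLinearMap_apply]
          abel
        change H (Z.x (E.gen k v)) = H' (Z.x (E.gen k v))
        rw [e, map_sub, map_sub, map_add, map_add, hsq, CBBA.Hom.congr_comp hy,
          ih _ (Z.stage_mono (Nat.lt_succ_iff.1 hk) (Z.ω_mem_stage k v))]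
        rfl
      · exact CBBA.Hom.congr_comp hy _
      · exact hsq k 0 v
      · exact hsq k 1 v
      · exact hsq k 2 v
  exact CBBA.Hom.ext' fun z => by
    obtain ⟨n, hn⟩ := Z.exists_mem_stage z
    exact key n z hn

theorem agree_succ {n : ℕ} {H H' : Z.obj.carrier →ₐ[K] C.carrier} {i : A.Hom Z.obj}
    (hi : ∀ a ∈ E.stage n, i a ∈ Z.stage n) (hib : i.comp E.incl = Z.base) {f : A.Hom C}
    (hH : ∀ a ∈ E.stage n, H (i a) = f a) (hf : f.comp E.incl = ν)
    (hH' : CBBA.IsHomOn Z.base ν (Z.stage (n + 1)) H') (heq : ∀ z ∈ Z.stage n, H' z = H z)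
    (hX : ∀ v, H' (i (E.gen n v)) = f (E.gen n v)) :
    ∀ a ∈ E.stage (n + 1), H' (i a) = f a := by
  intro a ha
  refine genStage_ext (rank := _root_.id) (f := H'.comp i.toAlgHom) (f' := f.toAlgHom) (fun b => ?_)
    (fun k hk v => ?_) ha
  · rw [AlgHom.comp_apply, CBBA.Hom.congr_comp hib, hH'.base]
    exact (CBBA.Hom.congr_comp hf b).symm
  · rw [AlgHom.comp_apply]
    rcases Nat.lt_succ_iff_lt_or_eq.1 (show k < n + 1 from hk) with hk | rfl
    · rw [heq _ (hi _ (E.gen_mem_stage hk v))]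
      exact hH _ (E.gen_mem_stage hk v)
    · exact hX v

theorem agree_zero {H : Z.obj.carrier →ₐ[K] C.carrier} {i : A.Hom Z.obj}
    (hib : i.comp E.incl = Z.base) {f : A.Hom C} (hf : f.comp E.incl = ν)
    (hH : CBBA.IsHomOn Z.base ν (Z.stage 0) H) : ∀ a ∈ E.stage 0, H (i a) = f a := by
  intro a ha
  refine genStage_ext (rank := _root_.id) (f := H.comp i.toAlgHom) (f' := f.toAlgHom) (fun b => ?_)
    (fun k hk v => absurd hk (Nat.not_lt_zero k)) ha
  rw [AlgHom.comp_apply, CBBA.Hom.congr_comp hib, hH.base]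
  exact (CBBA.Hom.congr_comp hf b).symm

theorem tDD_of_agree {n : ℕ} {H : Z.obj.carrier →ₐ[K] C.carrier} {i : A.Hom Z.obj} {f : A.Hom C}
    (hH : ∀ a ∈ E.stage n, H (i a) = f a) (hf : f.comp E.incl = ν) (c : Bool) :
    ν.tDD (E.T n) c 0 (f.toAlgHom.toLinearMap ∘ₗ E.gen n) =
      H.toLinearMap ∘ₗ i.toAlgHom.toLinearMap ∘ₗ E.incl.tDD (E.T n) c 0 (E.gen n) := by
  rw [← CBBA.Hom.map_tDD f (CBBA.Hom.congr_comp hf)]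
  exact LinearMap.ext fun v => (hH _ (E.tDD_gen_mem c n v)).symm

/-- The value on the x-generators is forced to be Y + ∂∂̄ψ - Hω, and the formula for the
differentials of ω shows it to be admissible. Together with `hom_ext` this gives a cylinder the
universal property of the square extension of A along y. -/
theorem exists_hom (g : A.Hom C) (ψ : ∀ n, (E.V n).carrier →ₗ[K] C.carrier)
    (hψ : ∀ n, ψ n ∈ CBBA.homDeg (E.V n) C (-1, -1)) :
    ∃ H : Z.obj.Hom C, H.comp Z.y = g ∧ ∀ n v, H (Z.φ n v) = ψ n v := by
  obtain ⟨F, hF, hF'⟩ := Z.exists_hom_of_step (ν := g.comp E.incl)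
    (fun n H => (∀ a ∈ E.stage n, H (Z.y a) = g a) ∧ ∀ k < n, ∀ v, H (Z.φ k v) = ψ k v)
    (fun H hH => ⟨Z.agree_zero Z.base_eq' rfl hH, fun k hk => absurd hk (Nat.not_lt_zero k)⟩)
    (fun n H hH ⟨hy, hφ⟩ => by
      let ν := g.comp E.incl
      let Y := g.toAlgHom.toLinearMap ∘ₗ E.gen n
      have hY : Y ∈ CBBA.homDeg (E.V n) C 0 := g.isGraded.comp_homDeg (E.gen_mem n)
      have hDY := Z.tDD_of_agree (i := Z.y) (ν := ν) hy rfl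
      have hs := CBBA.Hom.sq_mem (ν := ν) (T := E.T n) (hψ n) 3
      let X := Y + ν.sq (E.T n) (ψ n) 3 - H.toLinearMap ∘ₗ Z.ω n
      have hX : X ∈ CBBA.homDeg (E.V n) C 0 :=
        sub_mem (add_mem hY hs) (hH.graded.comp_homDeg (Z.ω_deg n))
      have hDX : ∀ c, ν.tDD (E.T n) c 0 X = H.toLinearMap ∘ₗ Z.x.toAlgHom.toLinearMap ∘ₗ
          E.incl.tDD (E.T n) c 0 (E.gen n) := fun c => by
        have h3 : ν.tDD (E.T n) c 0 (ν.sq (E.T n) (ψ n) 3) = 0 := by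
          refine (CBBA.Hom.tDD_sq (E.flat n) (hψ n) c 3).trans ?_
          cases c <;> rfl
        rw [map_sub, map_add, h3, add_zero, hDY, map_tDD_ω hH, sub_sub_cancel]
      obtain ⟨H', h1, h2, h3, h4, h5⟩ := exists_extend hH hX hY (hψ n) hDX hDY (by
        simp only [X]; abel)
      refine ⟨H', h1, h2, Z.agree_succ (fun a ha => Z.y_mem_stage ha) Z.base_eq' hy rfl h1 h2 h4,
        fun k hk v => ?_⟩
      rcases Nat.lt_succ_iff_lt_or_eq.1 hk with hk | rfl
      · exact (h2 _ (Z.gens_mem_stage hk 2 v)).trans (hφ k hk v)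
      · exact h5 0 v)
  refine ⟨F, E.hom_ext ?_ fun n v => ?_, fun n v => ?_⟩
  · rw [CBBA.Hom.comp_assoc, base_eq', hF]
  · obtain ⟨H, ⟨hH, -⟩, hFH⟩ := hF' (n + 1)
    have hv := E.gen_mem_stage (Nat.lt_succ_self n) v
    exact (hFH _ (Z.y_mem_stage hv)).trans (hH _ hv)
  · obtain ⟨H, ⟨-, hH⟩, hFH⟩ := hF' (n + 1)
    exact (hFH _ (Z.gens_mem_stage (Nat.lt_succ_self n) 2 v)).trans (hH n (Nat.lt_succ_self n) v)

/-- Lifts of homotopies with prescribed ends through acyclic surjections. -/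
theorem exists_lift {P Q : CBBA K} {q : P.Hom Q} (hq : Function.Surjective q) {β : B.Hom P}
    (hac : ∀ n, q.IsAcyclicFor β (E.T n)) (F : Z.obj.Hom Q) {f g : A.Hom P}
    (hf : f.comp E.incl = β) (hg : g.comp E.incl = β) (hfx : q.comp f = F.comp Z.x)
    (hgy : q.comp g = F.comp Z.y) :
    ∃ H : Z.obj.Hom P, H.comp Z.x = f ∧ H.comp Z.y = g ∧ q.comp H = F := by
  have hqβ : q.comp β = F.comp Z.base := by
    rw [← hf, ← CBBA.Hom.comp_assoc, hfx]; rfl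
  obtain ⟨H, hH, hH'⟩ := Z.exists_hom_of_step (ν := β)
    (fun n H => (∀ a ∈ E.stage n, H (Z.x a) = f a) ∧ (∀ a ∈ E.stage n, H (Z.y a) = g a) ∧
      ∀ z ∈ Z.stage n, q (H z) = F z)
    (fun H hH => ⟨Z.agree_zero rfl hf hH, Z.agree_zero Z.base_eq' hg hH, fun z hz =>
      Z.stage_ext (f := q.toAlgHom.comp H) (f' := F.toAlgHom) (fun b => by
        rw [AlgHom.comp_apply, hH.base]; exact CBBA.Hom.congr_comp hqβ b)
        (fun k hk => absurd hk (Nat.not_lt_zero k)) hz⟩)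
    (fun n H hH ⟨hx, hy, hqH⟩ => by
      let X := f.toAlgHom.toLinearMap ∘ₗ E.gen n
      let Y := g.toAlgHom.toLinearMap ∘ₗ E.gen n
      have hX : X ∈ CBBA.homDeg (E.V n) P 0 := f.isGraded.comp_homDeg (E.gen_mem n)
      have hY : Y ∈ CBBA.homDeg (E.V n) P 0 := g.isGraded.comp_homDeg (E.gen_mem n)
      have hDX := Z.tDD_of_agree (i := Z.x) (ν := β) hx hf
      have hDY := Z.tDD_of_agree (i := Z.y) (ν := β) hy hg
      -- ψ lifts the image of φ merely as a graded map. The defect of ∂∂̄ψ = X - Y + Hω is a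
      -- Bott-Chern cocycle in ker q, hence equals ∂∂̄κ with κ in ker q, and ψ + κ satisfies the
      -- relation while still lifting.
      obtain ⟨ψ, hψ, hψ'⟩ := CBBA.exists_lift_homDeg q hq (F.isGraded.comp_homDeg (Z.φ_deg n))
      have hs := CBBA.Hom.sq_mem (ν := β) (T := E.T n) hψ 3
      have hFψ : ∀ ψ : (E.V n).carrier →ₗ[K] P.carrier,
          q.toAlgHom.toLinearMap ∘ₗ ψ = F.toAlgHom.toLinearMap ∘ₗ Z.φ n →
          ∀ k v, q (β.sq (E.T n) ψ k v) = F (Z.sq n k v) := fun ψ hψ k v => by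
        have e1 := LinearMap.congr_fun (CBBA.Hom.map_sq (ν := β) (T := E.T n) (ψ := ψ) q
          (ν' := q.comp β) (fun _ => rfl) k) v
        have e2 := LinearMap.congr_fun (CBBA.Hom.map_sq (ν := Z.base) (T := E.T n) (ψ := Z.φ n) F
          (ν' := q.comp β) (fun b => (CBBA.Hom.congr_comp hqβ b).symm) k) v
        rw [hψ] at e1
        exact e1.trans e2.symm
      have hF3 := hFψ ψ hψ'
      obtain ⟨κ, hκ, hqκ, hκ'⟩ := hac n 0 0 rfl
        (X - Y + H.toLinearMap ∘ₗ Z.ω n - β.sq (E.T n) ψ 3)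
        (sub_mem (add_mem (sub_mem hX hY) (hH.graded.comp_homDeg (Z.ω_deg n))) hs)
        (fun c => by
          have h3 : β.tDD (E.T n) c 0 (β.sq (E.T n) ψ 3) = 0 := by
            refine (CBBA.Hom.tDD_sq (E.flat n) hψ c 3).trans ?_
            cases c <;> rfl
          rw [map_sub, map_add, map_sub, h3, hDX, hDY, map_tDD_ω hH]; abel)
        (fun v => by
          have e := congrArg F (LinearMap.congr_fun (Z.ω_eq n) v)
          change q (f (E.gen n v) - g (E.gen n v) + H (Z.ω n v) - β.sq (E.T n) ψ 3 v) = 0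
          rw [map_sub, map_add, map_sub, hF3, hqH _ (Z.ω_mem_stage n v), e,
            CBBA.Hom.congr_comp hfx, CBBA.Hom.congr_comp hgy, LinearMap.sub_apply, CylinderData.δ,
            LinearMap.sub_apply, map_sub, map_sub]
          simp only [LinearMap.comp_apply, AlgHom.toLinearMap_apply, CBBA.Hom.comp, AlgHom.comp_apply]
          abel)
      have hψκ : ψ + κ ∈ CBBA.homDeg (E.V n) P (-1, -1) := add_mem hψ hκ
      obtain ⟨H', h1, h2, h3, h4, h5⟩ := exists_extend hH hX hY hψκ hDX hDY (by
        have e : β.sq (E.T n) (ψ + κ) 3 = β.sq (E.T n) ψ 3 +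
            β.tDD (E.T n) false (0 - 1) (β.tDD (E.T n) true (0 - 2) κ) := by
          refine (congrArg _ (map_add _ _ _)).trans (map_add _ _ _)
        rw [e, hκ', add_sub_cancel])
      refine ⟨H', h1, h2, Z.agree_succ (fun a ha => Z.x_mem_stage ha) rfl hx hf h1 h2 h3,
        Z.agree_succ (fun a ha => Z.y_mem_stage ha) Z.base_eq' hy hg h1 h2 h4, fun z hz => ?_⟩
      refine Z.stage_ext (f := q.toAlgHom.comp H') (f' := F.toAlgHom) (fun b => by
        rw [AlgHom.comp_apply, h1.base]; exact CBBA.Hom.congr_comp hqβ b) (fun k hk i v => ?_) hz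
      rw [AlgHom.comp_apply]
      rcases Nat.lt_succ_iff_lt_or_eq.1 hk with hk | rfl
      · rw [h2 _ (Z.gens_mem_stage hk i v)]
        exact hqH _ (Z.gens_mem_stage hk i v)
      · have hqψ := hFψ (ψ + κ) (by
          rw [LinearMap.comp_add, hψ']
          exact (congrArg _ (LinearMap.ext hqκ)).trans (add_zero _))
        fin_cases i
        · exact (congrArg q (h3 v)).trans (CBBA.Hom.congr_comp hfx (E.gen k v))
        · exact (congrArg q (h4 v)).trans (CBBA.Hom.congr_comp hgy (E.gen k v))
        · exact (congrArg q (h5 0 v)).trans (hqψ 0 v)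
        · exact (congrArg q (h5 1 v)).trans (hqψ 1 v)
        · exact (congrArg q (h5 2 v)).trans (hqψ 2 v))
  refine ⟨H, E.hom_ext ?_ fun n v => ?_, E.hom_ext ?_ fun n v => ?_, CBBA.Hom.ext' fun z => ?_⟩
  · rw [hf, ← hH]; rfl
  · obtain ⟨H', ⟨h, -, -⟩, hHH⟩ := hH' (n + 1)
    have hv := E.gen_mem_stage (Nat.lt_succ_self n) v
    exact (hHH _ (Z.x_mem_stage hv)).trans (h _ hv)
  · rw [hg, ← hH, ← base_eq']; rfl
  · obtain ⟨H', ⟨-, h, -⟩, hHH⟩ := hH' (n + 1)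
    have hv := E.gen_mem_stage (Nat.lt_succ_self n) v
    exact (hHH _ (Z.y_mem_stage hv)).trans (h _ hv)
  · obtain ⟨n, hn⟩ := Z.exists_mem_stage z
    obtain ⟨H', ⟨-, -, h⟩, hHH⟩ := hH' n
    exact (congrArg q (hHH z hn)).trans (h z hn)

/-! ## Homotopy is an equivalence relation -/

/-- If φ dies then its whole square dies. Since ω lies in the ideal of the earlier φ, ∂φ, ∂̄φ and δ,
induction kills ω and so δ = ∂∂̄φ - ω. Here the ideal condition on ω is essential. -/
theorem map_δ_eq_zero {H : Z.obj.Hom C} (hφ : ∀ n v, H (Z.φ n v) = 0) (n : ℕ) :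
    ∀ v, H (Z.δ n v) = 0 := by
  have hsq : ∀ n k v, H (Z.sq n k v) = 0 := fun n k v => by
    have e := LinearMap.congr_fun (CBBA.Hom.map_sq (ν := Z.base) (T := E.T n) (ψ := Z.φ n) H
      (ν' := H.comp Z.base) (fun _ => rfl) k) v
    rw [show H.toAlgHom.toLinearMap ∘ₗ Z.φ n = 0 from LinearMap.ext (hφ n)] at e
    refine e.trans ?_
    fin_cases k <;> simp [CBBA.Hom.sq]
  induction n using Nat.strong_induction_on with
  | _ n ih =>
    intro v
    have hω : ∀ z ∈ Z.ideal n, H z = 0 := by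
      intro z hz
      induction hz using Submodule.mul_induction_on' with
      | add x _ y _ hx hy => rw [map_add, hx, hy, add_zero]
      | mem_mul_mem s _ t ht =>
        rw [map_mul]
        have : H t = 0 := by
          induction ht using Submodule.span_induction with
          | zero => exact map_zero _
          | add x y _ _ hx hy => rw [map_add, hx, hy, add_zero]
          | smul r x _ hx => rw [map_smul, hx, smul_zero]
          | mem t ht =>
            simp only [Set.mem_iUnion] at ht
            obtain ⟨k, hk, ((⟨v, rfl⟩ | ⟨v, rfl⟩) | ⟨v, rfl⟩) | ⟨v, rfl⟩⟩ := ht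
            · exact hsq k 0 v
            · exact hsq k 1 v
            · exact hsq k 2 v
            · exact ih k hk v
        rw [this, mul_zero]
    have e := congrArg H (LinearMap.congr_fun (Z.sq_three n) v)
    rw [hsq, LinearMap.add_apply, map_add, hω _ (Z.ω_mem n v), add_zero] at e
    exact e.symm

theorem comp_x_eq_comp_y {H : Z.obj.Hom C} (hφ : ∀ n v, H (Z.φ n v) = 0) :
    H.comp Z.x = H.comp Z.y :=
  E.hom_ext (by rw [CBBA.Hom.comp_assoc, CBBA.Hom.comp_assoc, Z.base_eq]) fun n v => by
    have e := Z.map_δ_eq_zero hφ n v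
    rw [CylinderData.δ, LinearMap.sub_apply, map_sub, sub_eq_zero] at e
    exact e

theorem exists_collapse : ∃ r : Z.obj.Hom A, r.comp Z.x = CBBA.Hom.id A ∧
    r.comp Z.y = CBBA.Hom.id A ∧ ∀ n v, r (Z.φ n v) = 0 := by
  obtain ⟨r, h1, h2⟩ := Z.exists_hom (CBBA.Hom.id A) (fun _ => 0) (fun _ => zero_mem _)
  exact ⟨r, (Z.comp_x_eq_comp_y h2).trans h1, h1, h2⟩

/-- The cylinder maps by `e` to the square extension of A along y, with left inverse `e'`, and its
collapse `r` becomes the acyclic retraction. Both `e y` and `e x` are sections of this retraction,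
so `r`, a homotopy from the identity to itself, lifts to a homotopy from `e y` to `e x`; then apply
`e'`. -/
theorem exists_swap : ∃ τ : Z.obj.Hom Z.obj, τ.comp Z.x = Z.y ∧ τ.comp Z.y = Z.x := by
  obtain ⟨S⟩ := SquareExt.exists_of_flat E.incl E.V E.T E.flat
  obtain ⟨r, hrx, hry, hrφ⟩ := Z.exists_collapse
  obtain ⟨e, hey, heφ⟩ := Z.exists_hom S.inc S.φ S.φ_mem
  obtain ⟨e', he'i, he'φ, -⟩ := S.exists_hom E.flat Z.y Z.φ Z.φ_deg
  have hee : e'.comp e = CBBA.Hom.id _ := Z.hom_ext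
    (by rw [CBBA.Hom.comp_assoc, hey, he'i]; rfl)
    (fun n v => (congrArg e' (heφ n v)).trans (LinearMap.congr_fun (he'φ n) v))
  have hret : (S.ret E.flat).comp S.inc = CBBA.Hom.id A := CBBA.Hom.ext' (S.ret_inc E.flat)
  have hre : (S.ret E.flat).comp e = r := Z.hom_ext
    (by rw [CBBA.Hom.comp_assoc, hey, hret, hry])
    (fun n v => (congrArg (S.ret E.flat) (heφ n v)).trans
      ((S.ret_q E.flat n 0 v).trans (hrφ n v).symm))
  obtain ⟨H, hHx, hHy, -⟩ := Z.exists_lift (S.ret_surjective E.flat)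
    (fun n => S.ret_isAcyclicFor E.flat (E.T n)) r (f := e.comp Z.y) (g := e.comp Z.x)
    (by rw [hey]; rfl) (by rw [CBBA.Hom.comp_assoc, Z.base_eq, ← CBBA.Hom.comp_assoc, hey]; rfl)
    (by rw [← CBBA.Hom.comp_assoc, hre, hry, hrx]) (by rw [← CBBA.Hom.comp_assoc, hre, hry, hrx])
  refine ⟨e'.comp H, ?_, ?_⟩
  · rw [CBBA.Hom.comp_assoc, hHx, ← CBBA.Hom.comp_assoc, hee]; rfl
  · rw [CBBA.Hom.comp_assoc, hHy, ← CBBA.Hom.comp_assoc, hee]; rfl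

/-- Glue a second cylinder `z` onto `Z` at the end `x` by adjoining squares to `Z`; `M` restricts to
`H₂` on `Z` and to `H₁` along `z`. The retraction onto `Z` is acyclic and identifies the far end `z
x` with `x`, so the identity of `Z` lifts to a homotopy `W` from `z x` to the end `y` of `Z`, and `M
W` is the concatenation. -/
theorem exists_concat {H₁ H₂ : Z.obj.Hom C} (h : H₁.comp Z.y = H₂.comp Z.x) :
    ∃ H : Z.obj.Hom C, H.comp Z.x = H₁.comp Z.x ∧ H.comp Z.y = H₂.comp Z.y := by
  obtain ⟨S⟩ := SquareExt.exists_of_flat Z.base E.V E.T E.flat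
  obtain ⟨r, hrx, hry, hrφ⟩ := Z.exists_collapse
  obtain ⟨M, hM, hMφ, -⟩ := S.exists_hom E.flat H₂ (fun n => H₁.toAlgHom.toLinearMap ∘ₗ Z.φ n)
    (fun n => H₁.isGraded.comp_homDeg (Z.φ_deg n))
  obtain ⟨z, hzy, hzφ⟩ := Z.exists_hom (S.inc.comp Z.x) S.φ S.φ_mem
  have hMz : M.comp z = H₁ := Z.hom_ext
    (by rw [CBBA.Hom.comp_assoc, hzy, ← CBBA.Hom.comp_assoc, hM, h])
    (fun n v => (congrArg M (hzφ n v)).trans (LinearMap.congr_fun (hMφ n) v))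
  have hret : (S.ret E.flat).comp S.inc = CBBA.Hom.id _ := CBBA.Hom.ext' (S.ret_inc E.flat)
  have hrz : (S.ret E.flat).comp z = Z.x.comp r := Z.hom_ext
    (by rw [CBBA.Hom.comp_assoc, hzy, ← CBBA.Hom.comp_assoc, hret, CBBA.Hom.comp_assoc, hry]; rfl)
    (fun n v => (congrArg (S.ret E.flat) (hzφ n v)).trans
      ((S.ret_q E.flat n 0 v).trans ((congrArg Z.x (hrφ n v)).trans (map_zero Z.x.toAlgHom)).symm))
  obtain ⟨W, hWx, hWy, -⟩ := Z.exists_lift (S.ret_surjective E.flat)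
    (fun n => S.ret_isAcyclicFor E.flat (E.T n)) (CBBA.Hom.id _) (f := z.comp Z.x)
    (g := S.inc.comp Z.y)
    (by rw [CBBA.Hom.comp_assoc, Z.base_eq, ← CBBA.Hom.comp_assoc, hzy]; rfl)
    (by rw [CBBA.Hom.comp_assoc, base_eq']; rfl)
    (by rw [← CBBA.Hom.comp_assoc, hrz, CBBA.Hom.comp_assoc, hrx]; rfl)
    (by rw [← CBBA.Hom.comp_assoc, hret])
  refine ⟨M.comp W, ?_, ?_⟩
  · rw [CBBA.Hom.comp_assoc, hWx, ← CBBA.Hom.comp_assoc, hMz]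
  · rw [CBBA.Hom.comp_assoc, hWy, ← CBBA.Hom.comp_assoc, hM]

theorem equivalence : Equivalence (SuccHirschExt.Homotopic Z (ν := ν)) where
  refl f := by
    obtain ⟨r, hrx, hry, -⟩ := Z.exists_collapse
    exact ⟨f.1.comp r, by rw [CBBA.Hom.comp_assoc, hrx]; rfl,
      by rw [CBBA.Hom.comp_assoc, hry]; rfl⟩
  symm := by
    rintro f g ⟨H, hx, hy⟩
    obtain ⟨τ, hτx, hτy⟩ := Z.exists_swap
    exact ⟨H.comp τ, by rw [CBBA.Hom.comp_assoc, hτx, hy], by rw [CBBA.Hom.comp_assoc, hτy, hx]⟩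
  trans := by
    rintro f g h ⟨H, hx, hy⟩ ⟨H', hx', hy'⟩
    obtain ⟨H'', h1, h2⟩ := Z.exists_concat (hy.trans hx'.symm)
    exact ⟨H'', h1.trans hx, h2.trans hy'⟩

end SuccHirschExt.Cylinder
end

section
variable {K : Type u} [Field K]

/-! ## Existence of cylinders -/

theorem IsFreeOver.exists_proj {B A : CBBA K} {i₀ : B.Hom A} {ι : Type} [DecidableEq ι]
    {W : ι → Bicomplex K} {s : ι → ℤ × ℤ} {g : ∀ i, (W i).carrier →ₗ[K] A.carrier}
    (h : IsFreeOver i₀ (sumGr W s) (DirectSum.toModule K ι A.carrier g)) (rank : ι → ℕ) (n : ℕ) :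
    ∃ π : A.carrier →ₐ[K] A.carrier, CBBA.IsGraded π ∧ (∀ x, π x ∈ genStage i₀ g rank n) ∧
      ∀ x ∈ genStage i₀ g rank n, π x = x := by
  obtain ⟨π, h0, h1, h2⟩ := h.exists_gradedHom i₀.toAlgHom i₀.isGraded
    (fun i => if rank i < n then g i else 0) (fun i => by
      split
      · exact h.gen_mem i
      · exact zero_mem _)
  refine ⟨π, h0, fun x => ?_, fun x hx => ?_⟩
  · refine h.induction (P := fun x => π x ∈ genStage i₀ g rank n) (fun b => ?_) (fun i v => ?_)
      (fun x y hx hy => by rw [map_add]; exact add_mem hx hy)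
      (fun x y hx hy => by rw [map_mul]; exact mul_mem hx hy) x
    · rw [h1]; exact base_mem_genStage b n
    · have e := LinearMap.congr_fun (h2 i) v
      refine (show π (g i v) = _ from e) ▸ ?_
      split
      · next hi => exact gen_mem_genStage hi v
      · exact zero_mem _
  · refine genStage_ext (f' := AlgHom.id K _) h1 (fun i hi v => ?_) hx
    have e := LinearMap.congr_fun (h2 i) v
    rwa [if_pos hi] at e

theorem SuccHirschExt.exists_proj {B A : CBBA K} (E : SuccHirschExt B A) (n : ℕ) :
    ∃ π : A.carrier →ₐ[K] A.carrier, CBBA.IsGraded π ∧ (∀ x, π x ∈ E.stage n) ∧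
      ∀ x ∈ E.stage n, π x = x :=
  E.free.exists_proj id n

theorem CBBA.comm_mem {C : CBBA K} {V V' : Bicomplex K} {a a' : ℤ × ℤ}
    {τ : V.carrier →ₗ[K] C.carrier} {σ : V'.carrier →ₗ[K] C.carrier}
    (hτ : τ ∈ CBBA.homDeg V C a) (hσ : σ ∈ CBBA.homDeg V' C a') (M : Submodule K C.carrier)
    (h : ∀ v v', σ v' * τ v ∈ M) (v : V.carrier) (v' : V'.carrier) : τ v * σ v' ∈ M := by
  have hv : v ∈ ⨆ a, V.gr a := V.internal.submodule_iSup_eq_top ▸ trivial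
  have hv' : v' ∈ ⨆ a, V'.gr a := V'.internal.submodule_iSup_eq_top ▸ trivial
  induction hv using Submodule.iSup_induction' with
  | zero => rw [map_zero, zero_mul]; exact zero_mem _
  | add x y _ _ hx hy => rw [map_add, add_mul]; exact add_mem hx hy
  | mem b x hx =>
    induction hv' using Submodule.iSup_induction' with
    | zero => rw [map_zero, mul_zero]; exact zero_mem _
    | add x y _ _ hx hy => rw [map_add, mul_add]; exact add_mem hx hy
    | mem c y hy =>
      rw [C.mul_comm (hτ b x hx) (hσ c y hy)]
      exact Bigraded.units_smul_mem M _ (h x y)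

theorem CBBA.Hom.mem_homDeg {B C : CBBA K} (ν : B.Hom C) :
    ν.toAlgHom.toLinearMap ∈ CBBA.homDeg B.toBicomplex C 0 := fun b x hx => by
  rw [add_zero]; exact ν.map_gr hx

namespace SuccHirschExt.CylinderData
variable {B A : CBBA K} {E : SuccHirschExt B A} (Z : E.CylinderData)

theorem stage_mono {n m : ℕ} (h : n ≤ m) : Z.stage n ≤ Z.stage m :=
  Algebra.adjoin_mono (Set.union_subset_union_right _
    (Set.biUnion_subset_biUnion_left fun _ hi => lt_of_lt_of_le hi h))

/-- The generators of the ideal. -/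
noncomputable def idealGen (n : ℕ) : Fin 4 → (E.V n).carrier →ₗ[K] Z.obj.carrier :=
  ![Z.φ n, Z.dφ n, Z.dbarφ n, Z.δ n]

theorem ideal_eq (n : ℕ) : Z.ideal n = Subalgebra.toSubmodule (Z.stage n) *
    Submodule.span K (⋃ k ∈ Set.Iio n, ⋃ j, Set.range (Z.idealGen k j)) := by
  have : ∀ k, Set.range (Z.φ k) ∪ Set.range (Z.dφ k) ∪ Set.range (Z.dbarφ k) ∪ Set.range (Z.δ k) =
      ⋃ j, Set.range (Z.idealGen k j) := by
    intro k
    ext z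
    simp only [Set.mem_iUnion, Set.mem_union]
    constructor
    · rintro (((h | h) | h) | h)
      · exact ⟨0, h⟩
      · exact ⟨1, h⟩
      · exact ⟨2, h⟩
      · exact ⟨3, h⟩
    · rintro ⟨j, h⟩
      fin_cases j
      · exact Or.inl (Or.inl (Or.inl h))
      · exact Or.inl (Or.inl (Or.inr h))
      · exact Or.inl (Or.inr h)
      · exact Or.inr h
  simp only [ideal, this]

theorem ideal_mono {n m : ℕ} (h : n ≤ m) : Z.ideal n ≤ Z.ideal m := by
  rw [ideal_eq, ideal_eq]
  refine Submodule.mul_le.2 fun s hs t ht => Submodule.mul_mem_mul (Z.stage_mono h hs)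
    (Submodule.span_mono ?_ ht)
  exact Set.biUnion_subset_biUnion_left fun _ hi => lt_of_lt_of_le hi h

theorem mul_mem_ideal {n : ℕ} {s z : Z.obj.carrier} (hs : s ∈ Z.stage n) (hz : z ∈ Z.ideal n) :
    s * z ∈ Z.ideal n := by
  unfold ideal at *
  induction hz using Submodule.mul_induction_on' with
  | add x _ y _ hx hy => rw [mul_add]; exact add_mem hx hy
  | mem_mul_mem t ht w hw =>
    rw [← mul_assoc]
    exact Submodule.mul_mem_mul ((Z.stage n).mul_mem hs ht) hw

theorem idealGen_mem {k n : ℕ} (h : k < n) (j : Fin 4) (v : (E.V k).carrier) :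
    Z.idealGen k j v ∈ Z.ideal n := by
  rw [ideal_eq, ← one_mul (Z.idealGen k j v)]
  refine Submodule.mul_mem_mul (Z.stage n).one_mem (Submodule.subset_span ?_)
  simp only [Set.mem_iUnion]
  exact ⟨k, h, j, v, rfl⟩

variable (hφ : ∀ n, Z.φ n ∈ CBBA.homDeg (E.V n) Z.obj (-1, -1))
include hφ

theorem gens_deg (k : ℕ) (i : Fin 5) : ∃ a, Z.gens k i ∈ CBBA.homDeg (E.V k) Z.obj a := by
  fin_cases i
  · exact ⟨0, Z.x.isGraded.comp_homDeg (E.gen_mem k)⟩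
  · exact ⟨0, Z.y.isGraded.comp_homDeg (E.gen_mem k)⟩
  · exact ⟨_, hφ k⟩
  · exact ⟨_, Z.base.tDD_mem (T := E.T k) (hφ k) false (-2)⟩
  · exact ⟨_, Z.base.tDD_mem (T := E.T k) (hφ k) true (-2)⟩

theorem idealGen_deg (k : ℕ) (i : Fin 4) : ∃ a, Z.idealGen k i ∈ CBBA.homDeg (E.V k) Z.obj a := by
  fin_cases i
  · exact ⟨_, hφ k⟩
  · exact ⟨_, Z.base.tDD_mem (T := E.T k) (hφ k) false (-2)⟩
  · exact ⟨_, Z.base.tDD_mem (T := E.T k) (hφ k) true (-2)⟩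
  · exact ⟨0, sub_mem (Z.x.isGraded.comp_homDeg (E.gen_mem k))
      (Z.y.isGraded.comp_homDeg (E.gen_mem k))⟩

/-- `ideal` is defined by left multiples only. Generators of the stage and of the ideal are
homogeneous for homogeneous vectors, so graded commutativity makes it two-sided within the stage. -/
theorem ideal_mul_mem {n : ℕ} {z w : Z.obj.carrier} (hz : z ∈ Z.ideal n) (hw : w ∈ Z.stage n) :
    z * w ∈ Z.ideal n := by
  have key : ∀ w ∈ Z.stage n, ∀ z ∈ Z.ideal n, z * w ∈ Z.ideal n := by
    intro w hw
    induction hw using Algebra.adjoin_induction with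
    | algebraMap r =>
      intro z hz
      rw [← Algebra.commutes, ← Algebra.smul_def]; exact Submodule.smul_mem _ _ hz
    | add x y _ _ hx hy => intro z hz; rw [mul_add]; exact add_mem (hx z hz) (hy z hz)
    | mul x y _ _ hx hy => intro z hz; rw [← mul_assoc]; exact hy _ (hx z hz)
    | mem w hw =>
      intro z hz
      have hz' := hz
      rw [ideal_eq] at hz'
      induction hz' using Submodule.mul_induction_on' with
      | add x hx y hy hx' hy' =>
        rw [add_mul]
        rw [← ideal_eq] at hx hy
        exact add_mem (hx' hx) (hy' hy)
      | mem_mul_mem s hs t ht =>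
        rw [mul_assoc]
        refine Z.mul_mem_ideal hs ?_
        induction ht using Submodule.span_induction with
        | zero => rw [zero_mul]; exact zero_mem _
        | add x y hx hy hx' hy' => 
          rw [add_mul]
          refine add_mem (hx' ?_) (hy' ?_) <;> rw [ideal_eq] <;> exact Submodule.mul_mem_mul hs ‹_›
        | smul r x hx hx' => 
          rw [smul_mul_assoc]
          refine Submodule.smul_mem _ _ (hx' ?_)
          rw [ideal_eq]; exact Submodule.mul_mem_mul hs ‹_›
        | mem t ht =>
          simp only [Set.mem_iUnion] at ht
          obtain ⟨k, hk, j, v, rfl⟩ := ht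
          obtain ⟨a, ha⟩ := Z.idealGen_deg hφ k j
          rcases hw with ⟨b, rfl⟩ | hw
          · refine CBBA.comm_mem ha Z.base.mem_homDeg _ (fun v b => ?_) v b
            exact Z.mul_mem_ideal (Algebra.subset_adjoin (Or.inl ⟨b, rfl⟩)) (Z.idealGen_mem hk j v)
          · simp only [Set.mem_iUnion] at hw
            obtain ⟨k', hk', i, v', rfl⟩ := hw
            obtain ⟨a', ha'⟩ := Z.gens_deg hφ k' i
            refine CBBA.comm_mem ha ha' _ (fun v v' => ?_) v v'
            exact Z.mul_mem_ideal (Z.gens_mem_stage hk' i v') (Z.idealGen_mem hk j v)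
  exact key w hw z hz

end SuccHirschExt.CylinderData

/-- Freeness concerns the algebra alone, so it transfers along an algebra isomorphism that ignores
differentials; likewise `e` compares the bases only as algebras. -/
theorem IsFreeOver.of_bijective {B B' F O : CBBA K} {j : B'.Hom F} {i : B.Hom O} {U : Type u}
    [AddCommGroup U] [Module K U] {gr : ℤ × ℤ → Submodule K U} {gF : U →ₗ[K] F.carrier}
    {g : U →ₗ[K] O.carrier} (h : IsFreeOver j gr gF) (hg : ∀ a x, x ∈ gr a → g x ∈ O.gr a)
    {κ : F.carrier →ₐ[K] O.carrier} (hκ : Function.Bijective κ) (e : B.carrier ≃ₐ[K] B'.carrier)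
    (hj : ∀ b, κ (j (e b)) = i b) (hκg : ∀ x, κ (gF x) = g x) : IsFreeOver i gr g := by
  obtain ⟨-, Φ, hΦ, hb⟩ := h
  refine ⟨hg, κ.comp Φ, fun x => ?_, ?_⟩
  · rw [AlgHom.comp_apply, hΦ, hκg]
  · have : LinearMap.mul' K O.carrier ∘ₗ TensorProduct.map i.toAlgHom.toLinearMap
        (κ.comp Φ).toLinearMap = κ.toLinearMap ∘ₗ (LinearMap.mul' K F.carrier ∘ₗ
          TensorProduct.map j.toAlgHom.toLinearMap Φ.toLinearMap) ∘ₗ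
          (TensorProduct.congr e.toLinearEquiv (LinearEquiv.refl K (FreeGCA gr))).toLinearMap :=
      TensorProduct.ext' fun b u => by simp [hj]
    rw [this, LinearMap.coe_comp, LinearMap.coe_comp]
    exact hκ.comp (hb.comp (LinearEquiv.bijective _))

end

/-! ### Stages of the square extension of `A` and the second end of the cylinder. -/

section
variable {K : Type u} [Field K] [CharZero K]

namespace SquareExt
variable {B A : CBBA K} {E : SuccHirschExt B A} (S : SquareExt E.incl E.V E.T)

/-- The subalgebra generated by `A_n` and the squares on `V 0, …, V (n - 1)`. -/
def stage (n : ℕ) : Subalgebra K S.obj.carrier :=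
  Algebra.adjoin K (S.inc '' (E.stage n) ∪ ⋃ k ∈ Set.Iio n, ⋃ j, Set.range (S.q k j))

theorem inc_mem_stage {n : ℕ} {a : A.carrier} (ha : a ∈ E.stage n) : S.inc a ∈ S.stage n :=
  Algebra.subset_adjoin (Or.inl ⟨a, ha, rfl⟩)

theorem q_mem_stage {k n : ℕ} (h : k < n) (j : Fin 4) (v : (E.V k).carrier) :
    S.q k j v ∈ S.stage n := by
  refine Algebra.subset_adjoin (Or.inr ?_)
  simp only [Set.mem_iUnion]
  exact ⟨k, h, j, v, rfl⟩

theorem stage_induction {n : ℕ} {P : S.obj.carrier → Prop} (inc : ∀ a ∈ E.stage n, P (S.inc a))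
    (q : ∀ k < n, ∀ j v, P (S.q k j v)) (add : ∀ x ∈ S.stage n, ∀ y ∈ S.stage n,
      P x → P y → P (x + y)) (mul : ∀ x ∈ S.stage n, ∀ y ∈ S.stage n, P x → P y → P (x * y))
    {z : S.obj.carrier} (hz : z ∈ S.stage n) : P z := by
  induction hz using Algebra.adjoin_induction with
  | mem z hz =>
    rcases hz with ⟨a, ha, rfl⟩ | hz
    · exact inc a ha
    · simp only [Set.mem_iUnion] at hz
      obtain ⟨k, hk, j, v, rfl⟩ := hz
      exact q k hk j v
  | algebraMap r =>
    have := inc (algebraMap K _ r) (algebraMap_mem _ r)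
    rwa [AlgHom.commutes] at this
  | add x y hx hy hx' hy' => exact add x hx y hy hx' hy'
  | mul x y hx hy hx' hy' => exact mul x hx y hy hx' hy'

theorem stage_mono {n m : ℕ} (h : n ≤ m) : S.stage n ≤ S.stage m := fun _ hz =>
  S.stage_induction (fun _ ha => S.inc_mem_stage (E.stage_mono h ha))
    (fun _ hk j v => S.q_mem_stage (hk.trans_le h) j v) (fun _ _ _ _ hx hy => add_mem hx hy)
    (fun _ _ _ _ hx hy => mul_mem hx hy) hz

theorem base_mem_stage (b : B.carrier) (n : ℕ) : S.base b ∈ S.stage n :=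
  S.inc_mem_stage (E.incl_mem_stage b n)

theorem sgn_q (n : ℕ) (k : Fin 4) (v : (E.V n).carrier) :
    S.obj.sgn (S.q n k v) = (sqTot k).negOnePow • S.q n k ((E.V n).sgn v) := by
  rw [sqTot_eq]; exact S.free.sgn_gen (n, k) v

theorem tDD_q (c : Bool) (n : ℕ) (k : Fin 4) :
    S.base.tDD (E.T n) c (sqTot k) (S.q n k) = sqTab c (S.q n) k :=
  CBBA.Hom.tDD_sq (E.flat n) (S.φ_mem n) c k

theorem tl_mem_stage {V : Bicomplex K} {n : ℕ} {ψ : V.carrier →ₗ[K] S.obj.carrier}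
    (hψ : ∀ v, ψ v ∈ S.stage n) (t : V.carrier ⊗[K] B.carrier) : S.base.tl ψ t ∈ S.stage n :=
  S.base.tl_eq_of_mem (S := Subalgebra.toSubmodule (S.stage n))
    (fun _ hx b => (S.stage n).mul_mem hx (S.base_mem_stage b n)) hψ t

theorem sgn_mem_stage {n : ℕ} {z : S.obj.carrier} (hz : z ∈ S.stage n) :
    S.obj.sgn z ∈ S.stage n := by
  refine S.stage_induction (P := fun z => S.obj.sgn z ∈ S.stage n) (fun a ha => ?_)
    (fun k hk j v => ?_) (fun _ _ _ _ hx hy => by rw [map_add]; exact add_mem hx hy)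
    (fun _ _ _ _ hx hy => by rw [map_mul]; exact mul_mem hx hy) hz
  · rw [← CBBA.map_sgn S.inc.isGraded]
    refine S.inc_mem_stage ?_
    refine genStage_le (rank := id) (S := (E.stage n).comap A.sgn) (fun b => ?_)
      (fun i hi v => ?_) ha
    · rw [Subalgebra.mem_comap, ← CBBA.map_sgn E.incl.isGraded]
      exact E.incl_mem_stage _ n
    · rw [Subalgebra.mem_comap, E.free.sgn_gen]
      exact Bigraded.units_smul_mem (Subalgebra.toSubmodule (E.stage n)) _ (E.gen_mem_stage hi _)
  · rw [sgn_q]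
    exact Bigraded.units_smul_mem (Subalgebra.toSubmodule (S.stage n)) _ (S.q_mem_stage hk _ _)

theorem D_mem_stage (c : Bool) {n : ℕ} {z : S.obj.carrier} (hz : z ∈ S.stage n) :
    S.obj.D c z ∈ S.stage n := by
  refine S.stage_induction (P := fun z => S.obj.D c z ∈ S.stage n) (fun a ha => ?_)
    (fun k hk j v => ?_) (fun _ _ _ _ hx hy => by rw [map_add]; exact add_mem hx hy)
    (fun x hx' y hy' hx hy => by
      rw [S.obj.D_mul]
      exact add_mem (mul_mem hx hy') (mul_mem (S.sgn_mem_stage hx') hy)) hz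
  · rw [← S.inc.map_D]
    exact S.inc_mem_stage (E.D_mem_stage c ha)
  · rw [S.base.D_eq (E.T k) c (sqTot j), tDD_q]
    refine add_mem ?_ (Bigraded.units_smul_mem (Subalgebra.toSubmodule (S.stage n)) _
        (add_mem (S.q_mem_stage hk _ _) (S.tl_mem_stage (fun v => S.q_mem_stage hk _ v) _)))
    cases c <;> fin_cases j
    · exact S.q_mem_stage hk 1 v
    · exact zero_mem _
    · exact S.q_mem_stage hk 3 v
    · exact zero_mem _
    · exact S.q_mem_stage hk 2 v
    · exact neg_mem (S.q_mem_stage hk 3 v)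
    · exact zero_mem _
    · exact zero_mem _

/-- The part of a stage that lies in the kernel of the retraction. -/
noncomputable def kerStage (n : ℕ) : Submodule K S.obj.carrier :=
  LinearMap.ker (S.ret E.flat).toAlgHom.toLinearMap ⊓ Subalgebra.toSubmodule (S.stage n)

/-- The stage is the fixed set of a projection π that keeps the squares of rank below `n`, kills the
others, and restricts to the projection of `A` onto `A_n`. The contraction commutes with π, so
primitives remain in the stage. -/
theorem kerStage_isAcyclicOn (n : ℕ) {V : Bicomplex K} (T : Twisting V B) :
    S.base.IsAcyclicOn T (S.kerStage n) := by
  obtain ⟨πA, hπ, hπmem, hπid⟩ := E.exists_proj n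
  obtain ⟨π, -, h1, h2⟩ := S.free.exists_gradedHom (S.inc.toAlgHom.comp πA)
    (fun a x hx => S.inc.map_gr (hπ a x hx)) (fun i => if i.1 < n then S.q i.1 i.2 else 0) (fun i => by
      split
      · exact S.q_mem i.1 i.2
      · exact zero_mem _)
  have hinc : ∀ a, π (S.inc a) = S.inc (πA a) := h1
  have hq : ∀ k j v, π (S.q k j v) = if k < n then S.q k j v else 0 := fun k j v => by
    have e := LinearMap.congr_fun (h2 (k, j)) v
    refine (show π (S.q k j v) = _ from e).trans ?_
    dsimp only
    split <;> rfl
  have key := S.ret_isAcyclicOn E.flat T π πA hinc (fun k => by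
    by_cases hk : k < n
    · exact Or.inl fun j v => by rw [hq, if_pos hk]
    · exact Or.inr fun j v => by rw [hq, if_neg hk])
  have e : LinearMap.eqLocus π.toLinearMap LinearMap.id = Subalgebra.toSubmodule (S.stage n) := by
    refine le_antisymm (fun z hz => ?_) (fun z hz => ?_)
    · rw [← show π z = z from hz]
      refine S.free.induction (P := fun z => π z ∈ S.stage n) (fun b => ?_) (fun i v => ?_)
        (fun x y hx hy => by rw [map_add]; exact add_mem hx hy)
        (fun x y hx hy => by rw [map_mul]; exact mul_mem hx hy) z
      · rw [hinc]; exact S.inc_mem_stage (hπmem b)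
      · refine (show π _ = _ from hq i.1 i.2 v) ▸ ?_
        split
        · next hi => exact S.q_mem_stage hi _ v
        · exact zero_mem _
    · refine S.stage_induction (P := fun z => π z = z) (fun a ha => ?_) (fun k hk j v => ?_)
        (fun x _ y _ hx hy => by rw [map_add, hx, hy]) (fun x _ y _ hx hy => by rw [map_mul, hx, hy]) hz
      · rw [hinc, hπid a ha]
      · rw [hq, if_pos hk]
  rwa [e] at key

/-- The map x is a second section of the retraction, built stagewise next to the inclusion y. On
`V_n` one needs ω with differentials yφ - xφ; these form a compatible pair in the kernel of the
retraction within stage `n`, so ω can be chosen there. -/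
theorem exists_end : ∃ x : A.Hom S.obj, x.comp E.incl = S.base ∧
    ∀ n v, S.q n 3 v - x (E.gen n v) + S.inc (E.gen n v) ∈ S.kerStage n := by
  obtain ⟨x, hx, hx'⟩ := E.free.exists_hom_of_step (rank := id) (ν := S.base)
    (P := fun n f => (∀ a ∈ E.stage n, S.ret E.flat (f a) = a ∧ f a ∈ S.stage n) ∧
      ∀ k < n, ∀ v, S.q k 3 v - f (E.gen k v) + S.inc (E.gen k v) ∈ S.kerStage k) (by
      obtain ⟨f, hf⟩ := E.free.exists_isHomOn_zero (rank := id) S.base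
      refine ⟨f, hf, fun a ha => ⟨?_, ?_⟩, fun k hk => absurd hk (Nat.not_lt_zero k)⟩
      · exact genStage_ext (rank := id) (f := (S.ret E.flat).toAlgHom.comp f) (f' := AlgHom.id K _)
          (fun b => by rw [AlgHom.comp_apply, hf.base]; exact S.ret_inc E.flat _)
          (fun i hi => absurd hi (Nat.not_lt_zero _)) ha
      · exact genStage_le (rank := id) (S := (S.stage 0).comap f)
          (fun b => by rw [Subalgebra.mem_comap, hf.base]; exact S.base_mem_stage b 0)
          (fun i hi => absurd hi (Nat.not_lt_zero _)) ha)
    (fun n f hf ⟨hP, hω⟩ => by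
      have hP1 := fun c v => hP _ (E.tDD_gen_mem c n v)
      let Y := S.inc.toAlgHom.toLinearMap ∘ₗ E.gen n
      have hY : Y ∈ CBBA.homDeg (E.V n) S.obj 0 := S.inc.isGraded.comp_homDeg (E.gen_mem n)
      have hYD : ∀ c k ψ, S.base.tDD (E.T n) c k (S.inc.toAlgHom.toLinearMap ∘ₗ ψ) =
          S.inc.toAlgHom.toLinearMap ∘ₗ E.incl.tDD (E.T n) c k ψ := fun c k ψ =>
        (CBBA.Hom.map_tDD S.inc (fun _ => rfl) _ _ _ _).symm
      let φ : Bool → (E.V n).carrier →ₗ[K] A.carrier := fun c => E.incl.tDD (E.T n) c 0 (E.gen n)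
      have hφ : ∀ c, φ c ∈ CBBA.homDeg (E.V n) A (0 + eDeg c) := fun c =>
        E.incl.tDD_mem (E.gen_mem n) c 0
      have hφφ : ∀ c c', E.incl.tDD (E.T n) c 1 (φ c') + E.incl.tDD (E.T n) c' 1 (φ c) = 0 :=
        fun c c' => E.incl.tDD_tDD (E.flat n) (E.gen_mem n) c c' (n := 0) (by simp) (by simp)
      have hfφ : ∀ c c' k, S.base.tDD (E.T n) c k (f.toLinearMap ∘ₗ φ c') =
          f.toLinearMap ∘ₗ E.incl.tDD (E.T n) c k (φ c') := fun c c' k => LinearMap.ext fun v =>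
        ((CBBA.Hom.map_tDD_iff (ν' := S.base) hf.base (E.T n) c k (φ c') v).2
          (hf.comm c _ (E.tDD_gen_mem c' n v))).symm
      have hN : ∀ x ∈ S.kerStage n, ∀ b, x * S.base b ∈ S.kerStage n := fun x hx b =>
        ⟨(S.ret E.flat).mul_mem_ker x hx.1 _, (S.stage n).mul_mem hx.2 (S.base_mem_stage b n)⟩
      obtain ⟨ω, hωd, hωN, hωD⟩ := (S.kerStage_isAcyclicOn n (E.T n)).exists_primitive
        (fun c x hx => ⟨(S.ret E.flat).D_mem_ker c x hx.1, S.D_mem_stage c hx.2⟩) hN (E.flat n)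
        (a := 0) (n := 0) (m := 1) (by simp) (by simp)
        (u := fun c => S.inc.toAlgHom.toLinearMap ∘ₗ φ c - f.toLinearMap ∘ₗ φ c)
        (fun c => sub_mem (S.inc.isGraded.comp_homDeg (hφ c)) (hf.graded.comp_homDeg (hφ c)))
        (fun c v => by
          refine ⟨?_, sub_mem (S.inc_mem_stage (E.tDD_gen_mem c n v)) (hP1 c v).2⟩
          change S.ret E.flat (S.inc (φ c v) - f (φ c v)) = 0
          rw [map_sub, S.ret_inc, (hP1 c v).1, sub_self])
        (fun c c' => by
          rw [map_sub, map_sub, hYD, hYD, hfφ, hfφ, sub_add_sub_comm, ← LinearMap.comp_add,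
            ← LinearMap.comp_add, hφφ, LinearMap.comp_zero, LinearMap.comp_zero, sub_zero])
      have hq3 : ∀ c, S.base.tDD (E.T n) c 0 (S.q n 3) = 0 := fun c => by
        refine (S.tDD_q c n 3).trans ?_
        cases c <;> rfl
      -- This value is the relation ∂∂̄φ = x - y + ω solved for x; as ∂∂̄φ is closed, its twisted
      -- differentials are those of y minus those of ω, namely xφ and xφ̄.
      obtain ⟨f', h1, h2, h3⟩ := SuccHirschExt.exists_extend hf (X := Y + S.q n 3 - ω)
        (sub_mem (add_mem hY (S.q_mem n 3)) hωd) (fun c => by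
          rw [map_sub, map_add, hq3, hYD, hωD, add_zero, sub_sub_cancel])
      have h3' : ∀ v, f' (E.gen n v) = S.inc (E.gen n v) + S.q n 3 v - ω v :=
        LinearMap.congr_fun h3
      have hmn := S.stage_mono (Nat.le_succ n)
      refine ⟨f', h1, h2, ⟨fun a ha => ⟨?_, ?_⟩, fun k hk v => ?_⟩⟩
      · refine genStage_ext (rank := id) (f := (S.ret E.flat).toAlgHom.comp f')
          (f' := AlgHom.id K _)
          (fun b => by rw [AlgHom.comp_apply, h1.base]; exact S.ret_inc E.flat _)
          (fun i hi v => ?_) ha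
        rw [AlgHom.comp_apply]
        rcases Nat.lt_succ_iff_lt_or_eq.1 (show i < n + 1 from hi) with hi | rfl
        · rw [h2 _ (E.gen_mem_stage hi v)]; exact (hP _ (E.gen_mem_stage hi v)).1
        · rw [h3', map_sub, map_add, S.ret_inc, S.ret_q, show S.ret E.flat (ω v) = 0 from
            (hωN v).1, add_zero, sub_zero]; rfl
      · refine genStage_le (rank := id) (S := (S.stage (n + 1)).comap f')
          (fun b => by rw [Subalgebra.mem_comap, h1.base]; exact S.base_mem_stage b _)
          (fun i hi v => ?_) ha
        rw [Subalgebra.mem_comap]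
        rcases Nat.lt_succ_iff_lt_or_eq.1 (show i < n + 1 from hi) with hi | rfl
        · rw [h2 _ (E.gen_mem_stage hi v)]; exact hmn (hP _ (E.gen_mem_stage hi v)).2
        · rw [h3']
          exact sub_mem (add_mem (S.inc_mem_stage (E.gen_mem_stage (Nat.lt_succ_self i) v))
            (S.q_mem_stage (Nat.lt_succ_self i) _ _)) (hmn (hωN v).2)
      · rcases Nat.lt_succ_iff_lt_or_eq.1 hk with hk | rfl
        · rw [h2 _ (E.gen_mem_stage hk v)]; exact hω k hk v
        · rw [h3', show S.q k 3 v - (S.inc (E.gen k v) + S.q k 3 v - ω v) + S.inc (E.gen k v) = ω v by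
            abel]
          exact hωN v)
  refine ⟨x, hx, fun n v => ?_⟩
  obtain ⟨f, ⟨-, hf⟩, hxf⟩ := hx' (n + 1)
  rw [hxf _ (E.gen_mem_stage (Nat.lt_succ_self n) v)]
  exact hf n (Nat.lt_succ_self n) v

end SquareExt
end

/-! ### The square extension becomes a cylinder after a change of generators. -/

section
variable {K : Type u} [Field K] [CharZero K]

namespace SquareExt
variable {B A : CBBA K} {E : SuccHirschExt B A} (S : SquareExt E.incl E.V E.T)

theorem exists_mem_stage (z : S.obj.carrier) : ∃ n, z ∈ S.stage n := by
  have two : ∀ {x y}, (∃ n, x ∈ S.stage n) → (∃ n, y ∈ S.stage n) →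
      ∃ n, x ∈ S.stage n ∧ y ∈ S.stage n := fun ⟨n, hx⟩ ⟨m, hy⟩ =>
    ⟨max n m, S.stage_mono (le_max_left n m) hx, S.stage_mono (le_max_right n m) hy⟩
  refine S.free.induction (P := fun z => ∃ n, z ∈ S.stage n) (fun a => ?_)
    (fun i v => ⟨i.1 + 1, S.q_mem_stage (Nat.lt_succ_self _) i.2 v⟩)
    (fun x y hx hy => ?_) (fun x y hx hy => ?_) z
  · obtain ⟨n, hn⟩ := E.free.exists_mem_genStage _root_.id a
    exact ⟨n, S.inc_mem_stage hn⟩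
  · obtain ⟨n, hx, hy⟩ := two hx hy
    exact ⟨n, add_mem hx hy⟩
  · obtain ⟨n, hx, hy⟩ := two hx hy
    exact ⟨n, mul_mem hx hy⟩

variable {x : A.Hom S.obj} (hx : x.comp E.incl = S.base)

/-- The cylinder data given by a second embedding `x` of `A` besides the inclusion. -/
abbrev cylinderData : E.CylinderData := ⟨S.obj, x, S.inc, hx, S.φ⟩

theorem cylinderData_base : (S.cylinderData hx).base = S.base := hx

theorem cylinderData_dφ (n : ℕ) : (S.cylinderData hx).dφ n = S.q n 1 := by
  change (S.cylinderData hx).base.tDD (E.T n) false (-2) (S.φ n) = _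
  rw [cylinderData_base]; rfl

theorem cylinderData_dbarφ (n : ℕ) : (S.cylinderData hx).dbarφ n = S.q n 2 := by
  change (S.cylinderData hx).base.tDD (E.T n) true (-2) (S.φ n) = _
  rw [cylinderData_base]; rfl

theorem cylinderData_ddbarφ (n : ℕ) : (S.cylinderData hx).ddbarφ n = S.q n 3 := by
  change (S.cylinderData hx).base.tDD (E.T n) false (-1) ((S.cylinderData hx).dbarφ n) = _
  rw [cylinderData_base, cylinderData_dbarφ]; rfl

theorem cylinderData_gens (n : ℕ) : (S.cylinderData hx).gens n =
    ![x.toAlgHom.toLinearMap ∘ₗ E.gen n, S.inc.toAlgHom.toLinearMap ∘ₗ E.gen n, S.q n 0, S.q n 1,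
      S.q n 2] := by
  unfold SuccHirschExt.CylinderData.gens
  rw [cylinderData_dφ, cylinderData_dbarφ]; rfl

variable (hω : ∀ n v, S.q n 3 v - x (E.gen n v) + S.inc (E.gen n v) ∈ S.kerStage n)
include hω

/-- Elements of the kernel of the retraction lie in the ideal. The only corner not among its
generators is ∂∂̄φ = δ + ω, where ω lies in the kernel at an earlier stage and so, by induction, in
the earlier ideal. Products follow because the ideal is two-sided. -/
theorem sub_ret_mem_ideal (n : ℕ) : ∀ z ∈ S.stage n, z ∈ (S.cylinderData hx).stage n ∧
    z - S.inc (S.ret E.flat z) ∈ (S.cylinderData hx).ideal n := by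
  induction n using Nat.strong_induction_on with
  | _ n ih =>
  have hinc : ∀ a ∈ E.stage n, S.inc a ∈ (S.cylinderData hx).stage n := fun a ha =>
    genStage_le (rank := id) (S := ((S.cylinderData hx).stage n).comap S.inc.toAlgHom) (fun b => by
      rw [Subalgebra.mem_comap]
      refine Algebra.subset_adjoin (Or.inl ⟨b, ?_⟩)
      rw [cylinderData_base]; rfl) (fun i hi v => (S.cylinderData hx).gens_mem_stage hi 1 v) ha
  have hq : ∀ k < n, ∀ j v, S.q k j v ∈ (S.cylinderData hx).ideal n := by
    intro k hk j v
    have h3 : S.q k 3 v ∈ (S.cylinderData hx).ideal n := by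
      have h1 := (ih k hk _ (hω k v).2).2
      rw [show S.ret E.flat _ = 0 from (hω k v).1, map_zero, sub_zero] at h1
      have h2 := add_mem ((S.cylinderData hx).idealGen_mem hk 3 v) ((S.cylinderData hx).ideal_mono hk.le h1)
      rwa [show (S.cylinderData hx).idealGen k 3 v = x (E.gen k v) - S.inc (E.gen k v) from rfl,
        show x (E.gen k v) - S.inc (E.gen k v) +
          (S.q k 3 v - x (E.gen k v) + S.inc (E.gen k v)) = S.q k 3 v by abel] at h2
    fin_cases j <;> dsimp only
    · exact (S.cylinderData hx).idealGen_mem hk 0 v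
    · rw [show S.q k ⟨1, by decide⟩ = _ from (S.cylinderData_dφ hx k).symm]
      exact (S.cylinderData hx).idealGen_mem hk 1 v
    · rw [show S.q k ⟨2, by decide⟩ = _ from (S.cylinderData_dbarφ hx k).symm]
      exact (S.cylinderData hx).idealGen_mem hk 2 v
    · exact h3
  intro z hz
  refine S.stage_induction (P := fun z => z ∈ (S.cylinderData hx).stage n ∧ z - S.inc (S.ret E.flat z) ∈ (S.cylinderData hx).ideal n)
    (fun a ha => ⟨hinc a ha, ?_⟩) (fun k hk j v => ⟨(S.cylinderData hx).ideal_le_stage n (hq k hk j v), ?_⟩)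
    (fun y _ z _ hy hz => ⟨add_mem hy.1 hz.1, ?_⟩) (fun y _ z _ hy hz => ⟨mul_mem hy.1 hz.1, ?_⟩) hz
  · rw [S.ret_inc, sub_self]; exact zero_mem _
  · rw [S.ret_q, map_zero, sub_zero]; exact hq k hk j v
  · rw [map_add, map_add, add_sub_add_comm]; exact add_mem hy.2 hz.2
  · rw [map_mul, map_mul, show y * z - S.inc (S.ret E.flat y) * S.inc (S.ret E.flat z) =
      y * (z - S.inc (S.ret E.flat z)) + (y - S.inc (S.ret E.flat y)) * S.inc (S.ret E.flat z) by
      noncomm_ring]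
    refine add_mem ((S.cylinderData hx).mul_mem_ideal hy.1 hz.2) ((S.cylinderData hx).ideal_mul_mem S.φ_mem hy.2 ?_)
    rw [show S.inc (S.ret E.flat z) = z - (z - S.inc (S.ret E.flat z)) by abel]
    exact sub_mem hz.1 ((S.cylinderData hx).ideal_le_stage n hz.2)

/-- Passing from the generators (y, φ, ∂φ, ∂̄φ, ∂∂̄φ) to (x, y, φ, ∂φ, ∂̄φ) is a triangular
substitution, since ∂∂̄φ = x - y + ω with ω of lower rank. Hence the free algebra `F` on the second
family maps bijectively to the square extension. -/
theorem cylinder_free : IsFreeOver (S.cylinderData hx).base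
    (sumGr (fun i : ℕ × Fin 5 => E.V i.1) (fun i =>
      (![(0, 0), (0, 0), (-1, -1), (0, -1), (-1, 0)] : Fin 5 → ℤ × ℤ) i.2))
    (DirectSum.toModule K (ℕ × Fin 5) S.obj.carrier
      (fun i => (S.cylinderData hx).gens i.1 i.2)) := by
  obtain ⟨F, j, gF, hF⟩ := exists_forget_free B (fun i : ℕ × Fin 5 => E.V i.1) (fun i =>
      (![(0, 0), (0, 0), (-1, -1), (0, -1), (-1, 0)] : Fin 5 → ℤ × ℤ) i.2)
  let D := S.cylinderData hx
  have hDg : ∀ n, D.gens n = _ := S.cylinderData_gens hx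
  obtain ⟨κ, hκ, hκb, hκg⟩ := hF.exists_gradedHom (C := S.obj) D.base.toAlgHom D.base.isGraded
    (fun i => D.gens i.1 i.2) (fun ⟨n, i⟩ => by
      dsimp only
      rw [hDg]
      fin_cases i
      · exact x.isGraded.comp_homDeg (E.gen_mem n)
      · exact S.inc.isGraded.comp_homDeg (E.gen_mem n)
      · exact S.q_mem n 0
      · exact S.q_mem n 1
      · exact S.q_mem n 2)
  have hκg' : ∀ n i v, κ (gF (n, i) v) = D.gens n i v := fun n i v =>
    LinearMap.congr_fun (hκg (n, i)) v
  have hκb' : ∀ b : B.carrier, κ (j b) = S.inc (E.incl b) := fun b => by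
    rw [hκb]
    exact CBBA.Hom.congr_comp hx b
  have surj : Function.Surjective κ := fun z => by
    obtain ⟨n, hn⟩ := S.exists_mem_stage z
    have hz := (S.sub_ret_mem_ideal hx hω n z hn).1
    have : D.stage n ≤ κ.range := by
      refine Algebra.adjoin_le_iff.2 ?_
      rintro _ (⟨b, rfl⟩ | hw)
      · exact ⟨j b, hκb b⟩
      · simp only [Set.mem_iUnion] at hw
        obtain ⟨k, -, i, v, rfl⟩ := hw
        exact ⟨gF (k, i) v, hκg' k i v⟩
    exact this hz
  obtain ⟨lA, hlA, hlAb, hlAg⟩ := E.free.exists_gradedHom (C := F)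
    (show B.carrier →ₐ[K] F.carrier from j.toAlgHom) j.isGraded (fun n => gF (n, 1))
    (fun n => hF.gen_mem (n, 1))
  have hlAg' : ∀ n v, lA (E.gen n v) = gF (n, 1) v := fun n v => LinearMap.congr_fun (hlAg n) v
  have hωs : ∀ n v, S.q n 3 v - x (E.gen n v) + S.inc (E.gen n v) ∈ S.stage n := fun n v =>
    (hω n v).2
  have hgen : ∀ k n, k < n → ∀ i v, D.gens k i v ∈ S.stage n := by
    intro k n hk i v
    rw [hDg]
    have h1 : S.inc (E.gen k v) ∈ S.stage n := S.inc_mem_stage (E.gen_mem_stage hk v)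
    fin_cases i
    · have := sub_mem (add_mem (S.q_mem_stage hk 3 v) h1) (S.stage_mono hk.le (hωs k v))
      rwa [show S.q k 3 v + S.inc (E.gen k v) -
        (S.q k 3 v - x (E.gen k v) + S.inc (E.gen k v)) = x (E.gen k v) by abel] at this
    · exact h1
    · exact S.q_mem_stage hk 0 v
    · exact S.q_mem_stage hk 1 v
    · exact S.q_mem_stage hk 2 v
  -- A left inverse of κ is needed only on each stage of `F`, as every element lies in some stage;
  -- this gives injectivity.
  have inv : ∀ n, ∃ l : S.obj.carrier →ₐ[K] F.carrier, CBBA.IsGraded l ∧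
      (∀ a, l (S.inc a) = lA a) ∧ ∀ z ∈ genStage j gF Prod.fst n, l (κ z) = z := by
    intro n
    induction n with
    | zero =>
      obtain ⟨l, h0, h1, -⟩ := S.free.exists_gradedHom lA hlA (fun i => 0) (fun i => zero_mem _)
      refine ⟨l, h0, h1, fun z hz => ?_⟩
      exact genStage_ext (f := l.comp κ) (f' := AlgHom.id K _)
        (fun b => by rw [AlgHom.comp_apply, hκb', h1]; exact hlAb b)
        (fun i hi => absurd hi (Nat.not_lt_zero _)) hz
    | succ n ih =>
      obtain ⟨l, h0, h1, h2⟩ := ih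
      let ω : (E.V n).carrier →ₗ[K] S.obj.carrier := S.q n 3 - x.toAlgHom.toLinearMap ∘ₗ E.gen n +
        S.inc.toAlgHom.toLinearMap ∘ₗ E.gen n
      have hωd : ω ∈ CBBA.homDeg (E.V n) S.obj 0 := add_mem (sub_mem (S.q_mem n 3)
        (x.isGraded.comp_homDeg (E.gen_mem n))) (S.inc.isGraded.comp_homDeg (E.gen_mem n))
      -- The fourth corner is sent to x - y + l(ω); `l` is already correct on ω, which belongs to
      -- stage `n`.
      obtain ⟨l', h0', h1', h2'⟩ := S.free.exists_gradedHom lA hlA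
        (fun i => if h : i.1 = n then h ▸ (![gF (n, 2), gF (n, 3), gF (n, 4),
          gF (n, 0) - gF (n, 1) + l.toLinearMap ∘ₗ ω] : Fin 4 → _) i.2
          else l.toLinearMap ∘ₗ S.q i.1 i.2) (fun ⟨k, i⟩ => by
          by_cases hk : k = n
          · subst hk
            simp only [dite_true]
            fin_cases i
            · exact hF.gen_mem (k, 2)
            · exact hF.gen_mem (k, 3)
            · exact hF.gen_mem (k, 4)
            · exact add_mem (sub_mem (hF.gen_mem (k, 0)) (hF.gen_mem (k, 1)))
                (h0.comp_homDeg hωd)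
          · simp only [hk, dite_false]
            exact h0.comp_homDeg (S.q_mem k i))
      have hn : ∀ i v, l' (S.q n i v) = (![gF (n, 2), gF (n, 3), gF (n, 4),
          gF (n, 0) - gF (n, 1) + l.toLinearMap ∘ₗ ω] : Fin 4 → _) i v := fun i v => by
        have e := LinearMap.congr_fun (h2' (n, i)) v
        simp only [dite_true] at e
        exact e
      have hlt : ∀ k, k < n → ∀ i v, l' (S.q k i v) = l (S.q k i v) := fun k hk i v => by
        have e := LinearMap.congr_fun (h2' (k, i)) v
        simp only [hk.ne, dite_false] at e
        exact e
      have agree : ∀ z ∈ S.stage n, l' z = l z := fun z hz =>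
        S.stage_induction (P := fun z => l' z = l z) (fun a _ => by rw [h1, h1'])
          (fun k hk i v => hlt k hk i v) (fun x _ y _ hx hy => by rw [map_add, map_add, hx, hy])
          (fun x _ y _ hx hy => by rw [map_mul, map_mul, hx, hy]) hz
      refine ⟨l', h0', h1', fun z hz => ?_⟩
      refine genStage_ext (f := l'.comp κ) (f' := AlgHom.id K _)
        (fun b => by rw [AlgHom.comp_apply, hκb', h1']; exact hlAb b) (fun ⟨k, i⟩ hi v => ?_) hz
      rw [AlgHom.comp_apply, AlgHom.id_apply]
      rcases Nat.lt_succ_iff_lt_or_eq.1 (show k < n + 1 from hi) with hk | rfl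
      · rw [hκg', agree _ (hgen k n hk i v), ← hκg']
        exact h2 _ (gen_mem_genStage (g := gF) (i := (k, i)) (rank := Prod.fst) hk v)
      · rw [hκg', hDg]
        have hinc : l' (S.inc (E.gen k v)) = gF (k, 1) v := by rw [h1', hlAg']
        fin_cases i
        · have e1 : l' (ω v) = l (ω v) := agree _ (hωs k v)
          have e2 : ω v = S.q k 3 v - x (E.gen k v) + S.inc (E.gen k v) := rfl
          have e3 : l' (S.q k 3 v) = gF (k, 0) v - gF (k, 1) v + l (ω v) := hn 3 v
          have e4 : x (E.gen k v) = S.q k 3 v + S.inc (E.gen k v) - ω v := by rw [e2]; abel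
          change l' (x (E.gen k v)) = gF (k, 0) v
          rw [e4, map_sub, map_add, hinc, e1, e3]
          abel
        · exact hinc
        · exact hn 0 v
        · exact hn 1 v
        · exact hn 2 v
  have inj : Function.Injective κ := (injective_iff_map_eq_zero κ).2 fun z hz => by
    obtain ⟨n, hn⟩ := hF.exists_mem_genStage Prod.fst z
    obtain ⟨l, -, -, hl⟩ := inv n
    rw [← hl z hn, hz, map_zero]
  have hg : ∀ z, κ (DirectSum.toModule K _ _ gF z) =
      DirectSum.toModule K (ℕ × Fin 5) S.obj.carrier (fun i => D.gens i.1 i.2) z := by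
    have : κ.toLinearMap ∘ₗ DirectSum.toModule K _ _ gF =
        DirectSum.toModule K (ℕ × Fin 5) S.obj.carrier (fun i => D.gens i.1 i.2) :=
      DirectSum.linearMap_ext K fun i => LinearMap.ext fun v => by
        simp only [LinearMap.comp_apply, DirectSum.toModule_lof, AlgHom.toLinearMap_apply]
        exact hκg' i.1 i.2 v
    exact LinearMap.congr_fun this
  exact hF.of_bijective (fun a z hz => hg z ▸ hκ a _ (hF.1 a z hz)) ⟨inj, surj⟩ AlgEquiv.refl
    hκb hg

end SquareExt

theorem SuccHirschExt.nonempty_cylinder {B A : CBBA K} (E : SuccHirschExt B A) :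
    Nonempty E.Cylinder := by
  obtain ⟨S⟩ := SquareExt.exists_of_flat E.incl E.V E.T E.flat
  obtain ⟨x, hx, hω⟩ := S.exists_end
  refine ⟨{ S.cylinderData hx with
    φ_deg := S.φ_mem
    free := S.cylinder_free hx hω
    ω := fun n => S.q n 3 - (S.cylinderData hx).δ n
    ω_mem := fun n v => ?_
    eq := fun n => ?_ }⟩
  · have h := (S.sub_ret_mem_ideal hx hω n _ (hω n v).2).2
    rw [show S.ret E.flat _ = 0 from (hω n v).1, map_zero, sub_zero, sub_add] at h
    exact h
  · exact (S.cylinderData_ddbarφ hx n).trans (add_sub_cancel _ _).symm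

end

section
variable {K : Type u} [Field K]

/-! ## Maps into mapping cones -/

namespace DGModule
variable {B : CBBA K} {V : Bicomplex K} {M N : DGModule B} (F : DGModule.Hom M N)

/-- The map `w + l ⊗ a + ∂l ⊗ b + ∂̄l ⊗ c` into the cone. -/
def coneMap (w : V.carrier →ₗ[K] N.carrier) (a b c : V.carrier →ₗ[K] M.carrier) :
    V.carrier →ₗ[K] (Cone F).carrier :=
  LinearMap.prod w (LinearMap.prod a (LinearMap.prod b c))

variable {F} {w w' : V.carrier →ₗ[K] N.carrier} {a b c a' b' c' : V.carrier →ₗ[K] M.carrier}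

theorem coneMap_mem {e : ℤ × ℤ} : coneMap F w a b c ∈ homDeg V (Cone F) e ↔
    w ∈ homDeg V N e ∧ a ∈ homDeg V M (e + (1, 1)) ∧ b ∈ homDeg V M (e + (0, 1)) ∧
      c ∈ homDeg V M (e + (1, 0)) := by
  constructor
  · intro h
    refine ⟨fun d x hx => (h d x hx).1, fun d x hx => ?_, fun d x hx => ?_, fun d x hx => ?_⟩ <;>
      rw [← add_assoc]
    exacts [(h d x hx).2.1, (h d x hx).2.2.1, (h d x hx).2.2.2]
  · rintro ⟨h1, h2, h3, h4⟩ d x hx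
    refine ⟨h1 d x hx, ?_, ?_, ?_⟩
    · have := h2 d x hx; rwa [← add_assoc] at this
    · have := h3 d x hx; rwa [← add_assoc] at this
    · have := h4 d x hx; rwa [← add_assoc] at this

theorem coneMap_surjective (o : V.carrier →ₗ[K] (Cone F).carrier) :
    ∃ w a b c, o = coneMap F w a b c :=
  ⟨LinearMap.fst K _ _ ∘ₗ o, LinearMap.fst K _ _ ∘ₗ LinearMap.snd K _ _ ∘ₗ o,
    LinearMap.fst K _ _ ∘ₗ LinearMap.snd K _ _ ∘ₗ LinearMap.snd K _ _ ∘ₗ o,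
    LinearMap.snd K _ _ ∘ₗ LinearMap.snd K _ _ ∘ₗ LinearMap.snd K _ _ ∘ₗ o, rfl⟩

theorem coneMap_inj : coneMap F w a b c = coneMap F w' a' b' c' ↔
    w = w' ∧ a = a' ∧ b = b' ∧ c = c' := by
  constructor
  · intro h
    have e := fun v => LinearMap.congr_fun h v
    exact ⟨LinearMap.ext fun v => congrArg (fun z => z.1) (e v),
      LinearMap.ext fun v => congrArg (fun z => z.2.1) (e v),
      LinearMap.ext fun v => congrArg (fun z => z.2.2.1) (e v),
      LinearMap.ext fun v => congrArg (fun z => z.2.2.2) (e v)⟩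
  · rintro ⟨rfl, rfl, rfl, rfl⟩; rfl

theorem tilde_coneMap (t : V.carrier ⊗[K] B.carrier) :
    tilde (Cone F).act (coneMap F w a b c) t =
      (tilde N.act w t, tilde M.act a t, tilde M.act b t, tilde M.act c t) := by
  induction t with
  | zero => simp only [map_zero]; rfl
  | tmul v x => simp only [tilde_tmul]; rfl
  | add x y hx hy => simp only [map_add, hx, hy]; rfl

/-- The components at l, ∂l, ∂̄l have total degrees k + 2, k + 1, k + 1. Only parity enters the
sign, so the component at l is differentiated with index `k`. -/
theorem tD_coneMap (T : Twisting V B) (k : ℤ) :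
    (Cone F).tDD T false k (coneMap F w a b c) =
      coneMap F (N.tDD T false k w - F.toLinearMap ∘ₗ c) (M.tDD T false k a)
        (a - M.tDD T false (k + 1) b) (-M.tDD T false (k + 1) c) := by
  refine LinearMap.ext fun v => ?_
  rw [tDD_apply, tilde_coneMap]
  refine Prod.ext ?_ (Prod.ext ?_ (Prod.ext ?_ ?_))
  · change N.D false (w v) - F.toLinearMap (c v) - k.negOnePow • (w (V.D false v) + _) =
      N.tDD T false k w v - F.toLinearMap (c v)
    rw [tDD_apply]; abel
  · change _ = M.tDD T false k a v
    rw [tDD_apply]; rfl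
  · change a v - M.D false (b v) - k.negOnePow • (b (V.D false v) + _) =
      a v - M.tDD T false (k + 1) b v
    rw [tDD_apply, Int.negOnePow_succ, Units.neg_smul]; abel
  · change -M.D false (c v) - k.negOnePow • (c (V.D false v) + _) = -M.tDD T false (k + 1) c v
    rw [tDD_apply, Int.negOnePow_succ, Units.neg_smul]; abel

theorem tDbar_coneMap (T : Twisting V B) (k : ℤ) :
    (Cone F).tDD T true k (coneMap F w a b c) =
      coneMap F (N.tDD T true k w + F.toLinearMap ∘ₗ b) (M.tDD T true k a)
        (-M.tDD T true (k + 1) b) (a - M.tDD T true (k + 1) c) := by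
  refine LinearMap.ext fun v => ?_
  rw [tDD_apply, tilde_coneMap]
  refine Prod.ext ?_ (Prod.ext ?_ (Prod.ext ?_ ?_))
  · change N.D true (w v) + F.toLinearMap (b v) - k.negOnePow • (w (V.D true v) + _) =
      N.tDD T true k w v + F.toLinearMap (b v)
    rw [tDD_apply]; abel
  · change _ = M.tDD T true k a v
    rw [tDD_apply]; rfl
  · change -M.D true (b v) - k.negOnePow • (b (V.D true v) + _) = -M.tDD T true (k + 1) b v
    rw [tDD_apply, Int.negOnePow_succ, Units.neg_smul]; abel
  · change a v - M.D true (c v) - k.negOnePow • (c (V.D true v) + _) =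
      a v - M.tDD T true (k + 1) c v
    rw [tDD_apply, Int.negOnePow_succ, Units.neg_smul]; abel

end DGModule

/-! ## Partial maps and total maps -/

namespace CBBA.PartialHom
variable {B A C : CBBA K} {S : Subalgebra K A.carrier} {i₀ : B.Hom A} {ν : B.Hom C}

theorem ext' {g g' : A.PartialHom S C} (h : ∀ a, g.toAlgHom a = g'.toAlgHom a) : g = g' := by
  obtain ⟨g, _, _, _⟩ := g
  obtain ⟨g', _, _, _⟩ := g'
  obtain rfl : g = g' := AlgHom.ext h
  rfl

/-- The restriction of a map of algebras that commutes with the differentials on `S`. -/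
def ofIsHomOn {f : A.carrier →ₐ[K] C.carrier} (hf : CBBA.IsHomOn i₀ ν S f) :
    A.PartialHom S C where
  toAlgHom := f.comp S.val
  map_gr hx := hf.graded _ _ hx
  map_d x _ h := (congrArg f h).trans (hf.comm false x x.2)
  map_dbar x _ h := (congrArg f h).trans (hf.comm true x x.2)

/-- Precomposing with a projection of `A` onto `S` turns a map on the stage into a total graded
algebra map, the form used by the extension lemmas. -/
theorem exists_isHomOn (g : A.PartialHom S C) {π : A.carrier →ₐ[K] A.carrier}
    (hπ : CBBA.IsGraded π) (hmem : ∀ x, π x ∈ S) (hid : ∀ x ∈ S, π x = x)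
    (hi : ∀ b, i₀ b ∈ S) (hg : ∀ b (a : S), (a : A.carrier) = i₀ b → g.toAlgHom a = ν b)
    (hD : ∀ c, ∀ x ∈ S, A.D c x ∈ S) :
    ∃ f, CBBA.IsHomOn i₀ ν S f ∧ ∀ a : S, f a = g.toAlgHom a := by
  have key : ∀ x (hx : x ∈ S), (π.codRestrict S hmem) x = ⟨x, hx⟩ := fun x hx =>
    Subtype.ext (hid x hx)
  refine ⟨g.toAlgHom.comp (π.codRestrict S hmem), ⟨fun a x hx => g.map_gr (hπ a x hx),
    fun b => hg b _ (hid _ (hi b)), fun c x hx => ?_⟩, fun a => congrArg g.toAlgHom (key a a.2)⟩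
  rw [AlgHom.comp_apply, AlgHom.comp_apply, key x hx, key _ (hD c x hx)]
  cases c
  · exact g.map_d ⟨x, hx⟩ _ rfl
  · exact g.map_dbar ⟨x, hx⟩ _ rfl

end CBBA.PartialHom

end

section
variable {K : Type u} [Field K] [CharZero K]

/-! ## Lifting up to homotopy -/

section cone
variable {B C C' : CBBA K} {V : Bicomplex K} {ν' : B.Hom C'} {ν : B.Hom C} {p : C'.Hom C}
  (hp : p.comp ν' = ν)

/-- The map `w + l ⊗ a + ∂l ⊗ b + ∂̄l ⊗ c` into the cone of `p`. -/
def CBBA.Hom.coneMap (w : V.carrier →ₗ[K] C.carrier) (a b c : V.carrier →ₗ[K] C'.carrier) :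
    V.carrier →ₗ[K] (DGModule.Cone (p.toModuleHom ν' ν hp)).carrier :=
  DGModule.coneMap (p.toModuleHom ν' ν hp) w a b c

variable {hp} {w w' : V.carrier →ₗ[K] C.carrier} {a b c a' b' c' : V.carrier →ₗ[K] C'.carrier}

theorem CBBA.Hom.coneMap_mem {e : ℤ × ℤ} : CBBA.Hom.coneMap hp w a b c ∈
    DGModule.homDeg V (DGModule.Cone (p.toModuleHom ν' ν hp)) e ↔
    w ∈ CBBA.homDeg V C e ∧ a ∈ CBBA.homDeg V C' (e + (1, 1)) ∧
      b ∈ CBBA.homDeg V C' (e + (0, 1)) ∧ c ∈ CBBA.homDeg V C' (e + (1, 0)) :=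
  DGModule.coneMap_mem

theorem CBBA.Hom.coneMap_surjective
    (o : V.carrier →ₗ[K] (DGModule.Cone (p.toModuleHom ν' ν hp)).carrier) :
    ∃ w a b c, o = CBBA.Hom.coneMap hp w a b c :=
  DGModule.coneMap_surjective o

theorem CBBA.Hom.coneMap_inj : CBBA.Hom.coneMap hp w a b c = CBBA.Hom.coneMap hp w' a' b' c' ↔
    w = w' ∧ a = a' ∧ b = b' ∧ c = c' :=
  DGModule.coneMap_inj

theorem CBBA.Hom.coneMap_eq_zero : CBBA.Hom.coneMap hp w a b c = 0 ↔
    w = 0 ∧ a = 0 ∧ b = 0 ∧ c = 0 :=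
  DGModule.coneMap_inj (w' := 0) (a' := 0) (b' := 0) (c' := 0)

theorem CBBA.Hom.tD_coneMap (T : Twisting V B) (k : ℤ) :
    (DGModule.Cone (p.toModuleHom ν' ν hp)).tDD T false k (CBBA.Hom.coneMap hp w a b c) =
      CBBA.Hom.coneMap hp (ν.tDD T false k w - p.toAlgHom.toLinearMap ∘ₗ c) (ν'.tDD T false k a)
        (a - ν'.tDD T false (k + 1) b) (-ν'.tDD T false (k + 1) c) :=
  DGModule.tD_coneMap T k

theorem CBBA.Hom.tDbar_coneMap (T : Twisting V B) (k : ℤ) :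
    (DGModule.Cone (p.toModuleHom ν' ν hp)).tDD T true k (CBBA.Hom.coneMap hp w a b c) =
      CBBA.Hom.coneMap hp (ν.tDD T true k w + p.toAlgHom.toLinearMap ∘ₗ b) (ν'.tDD T true k a)
        (-ν'.tDD T true (k + 1) b) (a - ν'.tDD T true (k + 1) c) :=
  DGModule.tDbar_coneMap T k

end cone

namespace SuccHirschExt
variable {B A C C' : CBBA K} {E : SuccHirschExt B A}

/-- `G` and `H` are, on the `n`-th stages, a lift of `f` and a homotopy from `f` to `p G`. -/
structure IsLift (Z : E.Cylinder) (ν' : B.Hom C') (ν : B.Hom C) (p : C'.Hom C) (f : A.Hom C)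
    (n : ℕ) (G : A.carrier →ₐ[K] C'.carrier) (H : Z.obj.carrier →ₐ[K] C.carrier) : Prop where
  g : CBBA.IsHomOn E.incl ν' (E.stage n) G
  h : CBBA.IsHomOn Z.base ν (Z.stage n) H
  x : ∀ a ∈ E.stage n, H (Z.x a) = f a
  y : ∀ a ∈ E.stage n, H (Z.y a) = p (G a)

variable {Z : E.Cylinder} {ν' : B.Hom C'} {ν : B.Hom C} {p : C'.Hom C} {f : A.Hom C} {n : ℕ}

namespace PartialLift

theorem ext' {L L' : PartialLift Z ν' p f n} (hg : ∀ a, L.g.toAlgHom a = L'.g.toAlgHom a)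
    (hh : ∀ z, L.h.toAlgHom z = L'.h.toAlgHom z) : L = L' := by
  obtain ⟨g, h, _, _, _⟩ := L
  obtain ⟨g', h', _, _, _⟩ := L'
  obtain rfl : g = g' := CBBA.PartialHom.ext' hg
  obtain rfl : h = h' := CBBA.PartialHom.ext' hh
  rfl

theorem exists_isLift (L : PartialLift Z ν' p f n) (hf : f.comp E.incl = ν) :
    ∃ G H, IsLift Z ν' ν p f n G H ∧ (∀ a : E.stage n, G a = L.g.toAlgHom a) ∧
      ∀ z : Z.stage n, H z = L.h.toAlgHom z := by
  obtain ⟨π, hπ, hm, hi⟩ := E.exists_proj n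
  obtain ⟨ρ, hρ, hm', hi'⟩ := Z.free.exists_proj Prod.fst n
  simp only [← Cylinder.stage_eq] at hm' hi'
  obtain ⟨G, hG, hGL⟩ := L.g.exists_isHomOn (i₀ := E.incl) hπ hm hi (fun b => E.incl_mem_stage b n)
    L.g_base (fun c x hx => E.D_mem_stage c hx)
  obtain ⟨H, hH, hHL⟩ := L.h.exists_isHomOn (i₀ := Z.base) (ν := ν) hρ hm' hi'
    (fun b => Z.base_mem_stage b n)
    (fun b z hz => (L.h_x ⟨E.incl b, E.incl_mem_stage b n⟩ z hz).trans (CBBA.Hom.congr_comp hf b))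
    (fun c x hx => Z.D_mem_stage c hx)
  refine ⟨G, H, ⟨hG, hH, fun a ha => ?_, fun a ha => ?_⟩, hGL, hHL⟩
  · rw [← L.h_x ⟨a, ha⟩ ⟨Z.x a, Z.x_mem_stage ha⟩ rfl, ← hHL]
  · rw [hGL ⟨a, ha⟩, ← L.h_y ⟨a, ha⟩ ⟨Z.y a, Z.y_mem_stage ha⟩ rfl, ← hHL]

/-- The partial lift given by total maps. -/
def ofIsLift {G : A.carrier →ₐ[K] C'.carrier} {H : Z.obj.carrier →ₐ[K] C.carrier}
    (h : IsLift Z ν' ν p f n G H) : PartialLift Z ν' p f n where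
  g := .ofIsHomOn h.g
  h := .ofIsHomOn h.h
  g_base b _ e := (congrArg G e).trans (h.g.base b)
  h_x a _ e := (congrArg H e).trans (h.x a a.2)
  h_y a _ e := (congrArg H e).trans (h.y a a.2)

theorem nonempty_unique_zero (hp : p.comp ν' = ν) (hf : f.comp E.incl = ν) :
    Nonempty (Unique (PartialLift Z ν' p f 0)) := by
  obtain ⟨G, hG⟩ := E.free.exists_isHomOn_zero (rank := _root_.id) ν'
  obtain ⟨H, hH⟩ := Z.exists_isHomOn_zero ν
  have hL : IsLift Z ν' ν p f 0 G H := ⟨hG, hH, Z.agree_zero rfl hf hH, fun a ha =>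
    genStage_ext (rank := _root_.id) (f := H.comp Z.y.toAlgHom) (f' := p.toAlgHom.comp G)
      (fun b => by
        rw [AlgHom.comp_apply, AlgHom.comp_apply, CBBA.Hom.congr_comp Z.base_eq', hH.base, hG.base]
        exact (CBBA.Hom.congr_comp hp b).symm)
      (fun i hi => absurd hi (Nat.not_lt_zero _)) ha⟩
  refine ⟨⟨⟨ofIsLift hL⟩, fun L => ?_⟩⟩
  obtain ⟨G', H', hL', hG', hH'⟩ := L.exists_isLift hf
  refine ext' (fun a => (hG' a).symm.trans ?_) (fun z => (hH' z).symm.trans ?_)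
  · exact genStage_ext (rank := _root_.id) (f := G') (f' := G)
      (fun b => (hL'.g.base b).trans (hG.base b).symm)
      (fun i hi => absurd hi (Nat.not_lt_zero _)) a.2
  · exact Z.stage_ext (f := H') (f' := H) (fun b => (hL'.h.base b).trans (hH.base b).symm)
      (fun k hk => absurd hk (Nat.not_lt_zero _)) z.2

theorem exists_limit (hf : f.comp E.incl = ν) (L : ∀ n, PartialLift Z ν' p f n)
    (hL : ∀ n, (L (n + 1)).Extends (L n)) :
    ∃ (f' : A.Hom C') (H : Z.obj.Hom C), f'.comp E.incl = ν' ∧ H.comp Z.x = f ∧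
      H.comp Z.y = p.comp f' ∧ ∀ n, (∀ a : E.stage n, f' a = (L n).g.toAlgHom a) ∧
        ∀ z : Z.stage n, H z = (L n).h.toAlgHom z := by
  choose G H hGH hG hH using fun n => (L n).exists_isLift hf
  obtain ⟨f', hf', hf'G⟩ := E.free.exists_limit (rank := _root_.id) (fun n => (hGH n).g)
    (fun n a ha => by
      rw [hG (n + 1) ⟨a, E.stage_mono (Nat.le_succ n) ha⟩, hG n ⟨a, ha⟩]
      exact (hL n).1 _ _ rfl)
  obtain ⟨F, -, hF⟩ := Z.exists_limit (fun n => (hGH n).h) (fun n z hz => by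
      rw [hH (n + 1) ⟨z, Z.stage_mono (Nat.le_succ n) hz⟩, hH n ⟨z, hz⟩]
      exact (hL n).2 _ _ rfl)
  refine ⟨f', F, hf', CBBA.Hom.ext' fun a => ?_, CBBA.Hom.ext' fun a => ?_, fun n =>
    ⟨fun a => (hf'G n a a.2).trans (hG n a), fun z => (hF n z z.2).trans (hH n z)⟩⟩
  · obtain ⟨n, ha⟩ := E.free.exists_mem_genStage _root_.id a
    exact (hF n _ (Z.x_mem_stage ha)).trans ((hGH n).x a ha)
  · obtain ⟨n, ha⟩ := E.free.exists_mem_genStage _root_.id a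
    exact ((hF n _ (Z.y_mem_stage ha)).trans ((hGH n).y a ha)).trans
      (congrArg p (hf'G n a ha).symm)

end PartialLift

namespace IsLift
variable {G : A.carrier →ₐ[K] C'.carrier} {H : Z.obj.carrier →ₐ[K] C.carrier}
  (h : IsLift Z ν' ν p f n G H)

/-- The obstruction cochain. -/
noncomputable def obstruction (_ : IsLift Z ν' ν p f n G H) (hp : p.comp ν' = ν) :
    (E.V n).carrier →ₗ[K] (DGModule.Cone (p.toModuleHom ν' ν hp)).carrier :=
  CBBA.Hom.coneMap hp (f.toAlgHom.toLinearMap ∘ₗ E.gen n + H.toLinearMap ∘ₗ Z.ω n)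
    (ν'.tDD (E.T n) true 1 (G.toLinearMap ∘ₗ E.incl.tDD (E.T n) false 0 (E.gen n)))
    (-(G.toLinearMap ∘ₗ E.incl.tDD (E.T n) true 0 (E.gen n)))
    (G.toLinearMap ∘ₗ E.incl.tDD (E.T n) false 0 (E.gen n))

theorem _root_.SuccHirschExt.PartialLift.obstruction_eq {L : PartialLift Z ν' p f n}
    (hG : ∀ a : E.stage n, G a = L.g.toAlgHom a) (hH : ∀ z : Z.stage n, H z = L.h.toAlgHom z)
    (hp : p.comp ν' = ν) : L.obstruction hp = h.obstruction hp := by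
  have e1 : L.g.toAlgHom.toLinearMap ∘ₗ E.phi n =
      G.toLinearMap ∘ₗ E.incl.tDD (E.T n) false 0 (E.gen n) :=
    LinearMap.ext fun v => (hG (E.phi n v)).symm
  have e2 : L.g.toAlgHom.toLinearMap ∘ₗ E.phibar n =
      G.toLinearMap ∘ₗ E.incl.tDD (E.T n) true 0 (E.gen n) :=
    LinearMap.ext fun v => (hG (E.phibar n v)).symm
  have e3 : L.h.toAlgHom.toLinearMap ∘ₗ Z.ωStage n = H.toLinearMap ∘ₗ Z.ω n :=
    LinearMap.ext fun v => (hH (Z.ωStage n v)).symm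
  change CBBA.Hom.coneMap hp
    (f.toAlgHom.toLinearMap ∘ₗ E.gen n + L.h.toAlgHom.toLinearMap ∘ₗ Z.ωStage n)
    (ν'.tDD (E.T n) true 1 (L.g.toAlgHom.toLinearMap ∘ₗ E.phi n))
    (-(L.g.toAlgHom.toLinearMap ∘ₗ E.phibar n)) (L.g.toAlgHom.toLinearMap ∘ₗ E.phi n) = _
  rw [e1, e2, e3]
  rfl

include h

theorem tDD_add_tDD (c c' : Bool) :
    ν'.tDD (E.T n) c 1 (G.toLinearMap ∘ₗ E.incl.tDD (E.T n) c' 0 (E.gen n)) +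
      ν'.tDD (E.T n) c' 1 (G.toLinearMap ∘ₗ E.incl.tDD (E.T n) c 0 (E.gen n)) = 0 := by
  have hG : ∀ c c', ν'.tDD (E.T n) c 1 (G.toLinearMap ∘ₗ E.incl.tDD (E.T n) c' 0 (E.gen n)) =
      G.toLinearMap ∘ₗ E.incl.tDD (E.T n) c 1 (E.incl.tDD (E.T n) c' 0 (E.gen n)) :=
    fun c c' => LinearMap.ext fun v => ((CBBA.Hom.map_tDD_iff h.g.base (E.T n) c 1 _ v).2
      (h.g.comm c _ (E.tDD_gen_mem c' n v))).symm
  rw [hG, hG, ← LinearMap.comp_add, E.incl.tDD_tDD (E.flat n) (E.gen_mem n) c c' (n := 0)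
    (by simp) (by simp), LinearMap.comp_zero]

theorem tDD_self (c : Bool) :
    ν'.tDD (E.T n) c 1 (G.toLinearMap ∘ₗ E.incl.tDD (E.T n) c 0 (E.gen n)) = 0 := by
  have h := h.tDD_add_tDD c c
  rw [← two_smul K] at h
  exact (smul_eq_zero.1 h).resolve_left two_ne_zero

theorem map_phi_mem (c : Bool) :
    G.toLinearMap ∘ₗ E.incl.tDD (E.T n) c 0 (E.gen n) ∈ CBBA.homDeg (E.V n) C' (eDeg c) := by
  have := h.g.graded.comp_homDeg (E.incl.tDD_mem (T := E.T n) (E.gen_mem n) c 0)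
  rwa [zero_add] at this

theorem comp_y (c : Bool) :
    H.toLinearMap ∘ₗ Z.y.toAlgHom.toLinearMap ∘ₗ E.incl.tDD (E.T n) c 0 (E.gen n) =
      p.toAlgHom.toLinearMap ∘ₗ G.toLinearMap ∘ₗ E.incl.tDD (E.T n) c 0 (E.gen n) :=
  LinearMap.ext fun v => h.y _ (E.tDD_gen_mem c n v)

variable (hp : p.comp ν' = ν) (hf : f.comp E.incl = ν)

include hf in
theorem tDD_add_ω (c : Bool) :
    ν.tDD (E.T n) c 0 (f.toAlgHom.toLinearMap ∘ₗ E.gen n + H.toLinearMap ∘ₗ Z.ω n) =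
      p.toAlgHom.toLinearMap ∘ₗ G.toLinearMap ∘ₗ E.incl.tDD (E.T n) c 0 (E.gen n) := by
  rw [map_add, Z.tDD_of_agree h.x hf, Cylinder.map_tDD_ω h.h, h.comp_y,
    add_sub_cancel]

include hf in
-- The `C`-component is closed in the cone because the differentials of f + hω are p gφ and p gφ̄.
-- The other components vanish because gφ and gφ̄ form a compatible pair; the entry ∂̄(gφ) at l is
-- exactly what cancels the mixed terms.
theorem obstruction_mem : h.obstruction hp ∈
    (DGModule.Cone (p.toModuleHom ν' ν hp)).cocyclesBC (E.T n) 0 := by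
  have hw := h.tDD_add_ω hf
  have hφ := h.map_phi_mem
  refine ⟨⟨?_, ?_⟩, ?_⟩
  · refine CBBA.Hom.coneMap_mem.2 ⟨?_, ?_, ?_, ?_⟩
    · exact add_mem (f.isGraded.comp_homDeg (E.gen_mem n)) (h.h.graded.comp_homDeg (Z.ω_deg n))
    · exact ν'.tDD_mem (hφ false) true 1
    · have := neg_mem (hφ true)
      rwa [← zero_add (eDeg true)] at this
    · have := hφ false
      rwa [← zero_add (eDeg false)] at this
  · change (DGModule.Cone (p.toModuleHom ν' ν hp)).tDD (E.T n) false 0 (h.obstruction hp) = 0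
    unfold obstruction
    rw [CBBA.Hom.tD_coneMap, CBBA.Hom.coneMap_eq_zero]
    refine ⟨sub_eq_zero.2 (hw false), ?_, ?_, ?_⟩
    · have e := ν'.tDD_tDD (E.flat n) (hφ false) false true (n := 1) (m := 0 + 2)
        (by simp [eDeg]) (by simp)
      rw [h.tDD_self, map_zero, add_zero, ν'.tDD_congr _ _ (m := 0) (by decide)] at e
      exact e
    · have e := h.tDD_add_tDD true false
      rw [map_neg, sub_neg_eq_add]
      exact e
    · exact neg_eq_zero.2 (h.tDD_self false)
  · change (DGModule.Cone (p.toModuleHom ν' ν hp)).tDD (E.T n) true 0 (h.obstruction hp) = 0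
    unfold obstruction
    rw [CBBA.Hom.tDbar_coneMap, CBBA.Hom.coneMap_eq_zero]
    refine ⟨?_, ?_, ?_, ?_⟩
    · rw [LinearMap.comp_neg, ← sub_eq_add_neg]
      exact sub_eq_zero.2 (hw true)
    · have e := ν'.tDD_self (E.flat n) (hφ false) true (n := 1) (m := 0 + 2)
        (by simp [eDeg]) (by simp)
      rw [ν'.tDD_congr _ _ (m := 0) (by decide)] at e
      exact e
    · rw [map_neg, neg_neg]; exact h.tDD_self true
    · exact sub_self _

include hf in
-- Applying ∂∂̄ to ψ + l⊗a + ∂l⊗b + ∂̄l⊗c and comparing components yields ∂Y = gφ, ∂̄Y = gφ̄ and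
-- ∂∂̄ψ = f - pY + hω for one combination Y of a, b, c. These are the equations for extending g by Y
-- and h by (f, pY, ψ).
theorem obstruction_mem_iff : h.obstruction hp ∈
    (DGModule.Cone (p.toModuleHom ν' ν hp)).boundariesBC (E.T n) 0 ↔
    ∃ G' H', IsLift Z ν' ν p f (n + 1) G' H' ∧ (∀ a ∈ E.stage n, G' a = G a) ∧
      ∀ z ∈ Z.stage n, H' z = H z := by
  have hpν : ∀ b, p (ν' b) = ν b := CBBA.Hom.congr_comp hp
  constructor
  · rintro ⟨ξ, hξ, e⟩
    obtain ⟨ψ, a, b, c, rfl⟩ := CBBA.Hom.coneMap_surjective ξ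
    obtain ⟨hψ, ha, hb, hc⟩ := CBBA.Hom.coneMap_mem.1 hξ
    change (DGModule.Cone (p.toModuleHom ν' ν hp)).tDD (E.T n) false (-1)
      ((DGModule.Cone (p.toModuleHom ν' ν hp)).tDD (E.T n) true (-2) _) = _ at e
    rw [CBBA.Hom.tDbar_coneMap, CBBA.Hom.tD_coneMap] at e
    obtain ⟨e1, -, e3, e4⟩ := CBBA.Hom.coneMap_inj.1 e
    replace ha : a ∈ CBBA.homDeg (E.V n) C' 0 := ha
    replace hb : b ∈ CBBA.homDeg (E.V n) C' (-1, 0) := hb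
    replace hc : c ∈ CBBA.homDeg (E.V n) C' (0, -1) := hc
    replace e1 : ν.tDD (E.T n) false (-1) (ν.tDD (E.T n) true (-2) ψ + p.toAlgHom.toLinearMap ∘ₗ b) -
      p.toAlgHom.toLinearMap ∘ₗ (a - ν'.tDD (E.T n) true (-1) c) =
        f.toAlgHom.toLinearMap ∘ₗ E.gen n + H.toLinearMap ∘ₗ Z.ω n := e1
    replace e3 : ν'.tDD (E.T n) true (-2) a - ν'.tDD (E.T n) false 0 (-ν'.tDD (E.T n) true (-1) b) =
      -(G.toLinearMap ∘ₗ E.incl.tDD (E.T n) true 0 (E.gen n)) := e3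
    replace e4 : -ν'.tDD (E.T n) false 0 (a - ν'.tDD (E.T n) true (-1) c) =
      G.toLinearMap ∘ₗ E.incl.tDD (E.T n) false 0 (E.gen n) := e4
    -- In the `C`-component p is applied to ∂̄c - a + ∂b, which dictates this value. The terms ∂̄c
    -- and ∂b are invisible to ∂̄ and ∂ respectively and supply the mixed terms of the other
    -- equation.
    let Y := ν'.tDD (E.T n) true (-1) c - a + ν'.tDD (E.T n) false (-1) b
    have hY : Y ∈ CBBA.homDeg (E.V n) C' 0 :=
      add_mem (sub_mem (ν'.tDD_mem hc true (-1)) ha) (ν'.tDD_mem hb false (-1))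
    have hDY : ∀ d, ν'.tDD (E.T n) d 0 Y =
        G.toLinearMap ∘ₗ E.incl.tDD (E.T n) d 0 (E.gen n) := by
      rintro (_ | _)
      · rw [← e4, map_add, ν'.tDD_self (E.flat n) hb false (n := -1) (by simp) (by simp), add_zero,
          ← map_neg, neg_sub]
      · have := ν'.tDD_tDD (E.flat n) hb false true (n := -1) (m := 0) (by simp) (by simp)
        rw [← neg_eq_iff_eq_neg.2 e3, map_add, map_sub,
          ν'.tDD_self (E.flat n) hc true (n := -1) (by simp) (by simp),
          ν'.tDD_congr _ _ (n := -2) (m := 0) (by decide), map_neg,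
          eq_neg_of_add_eq_zero_left this]
        abel
    obtain ⟨G', hG', hG'G, hG'Y⟩ := SuccHirschExt.exists_extend h.g hY hDY
    obtain ⟨H', hH', hH'H, hH'x, hH'y, -⟩ := Cylinder.exists_extend h.h (ψ := ψ)
      (f.isGraded.comp_homDeg (E.gen_mem n)) (p.isGraded.comp_homDeg hY) hψ
      (Z.tDD_of_agree h.x hf)
      (fun d => by rw [h.comp_y, ← hDY, CBBA.Hom.map_tDD p hpν]) (by
        change ν.tDD (E.T n) false (-1) (ν.tDD (E.T n) true (-2) ψ) = _
        rw [map_add, ← CBBA.Hom.map_tDD p hpν] at e1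
        rw [LinearMap.comp_add, LinearMap.comp_sub]
        rw [LinearMap.comp_sub] at e1
        rw [sub_add_eq_add_sub, ← e1]
        abel)
    refine ⟨G', H', ⟨hG', hH', Z.agree_succ (fun _ => Z.x_mem_stage) rfl h.x hf hH' hH'H hH'x,
      fun a ha => ?_⟩, hG'G, hH'H⟩
    refine genStage_ext (rank := _root_.id) (f := H'.comp Z.y.toAlgHom) (f' := p.toAlgHom.comp G')
      (fun b => ?_) (fun k hk v => ?_) ha
    · rw [AlgHom.comp_apply, AlgHom.comp_apply, CBBA.Hom.congr_comp Z.base_eq', hH'.base, hG'.base]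
      exact (hpν b).symm
    · rw [AlgHom.comp_apply, AlgHom.comp_apply]
      rcases Nat.lt_succ_iff_lt_or_eq.1 (show k < n + 1 from hk) with hk | rfl
      · have := E.gen_mem_stage hk v
        rw [hH'H _ (Z.y_mem_stage this), h.y _ this, hG'G _ this]
      · rw [hH'y]
        exact congrArg p (LinearMap.congr_fun hG'Y v).symm
  · rintro ⟨G', H', h', hG, hH⟩
    let Y := G'.toLinearMap ∘ₗ E.gen n
    let ψ := H'.toLinearMap ∘ₗ Z.φ n
    have hGφ : ∀ c, G'.toLinearMap ∘ₗ E.incl.tDD (E.T n) c 0 (E.gen n) =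
        G.toLinearMap ∘ₗ E.incl.tDD (E.T n) c 0 (E.gen n) := fun c =>
      LinearMap.ext fun v => hG _ (E.tDD_gen_mem c n v)
    have hY : Y ∈ CBBA.homDeg (E.V n) C' 0 := h'.g.graded.comp_homDeg (E.gen_mem n)
    have hDY : ∀ d, ν'.tDD (E.T n) d 0 Y =
        G.toLinearMap ∘ₗ E.incl.tDD (E.T n) d 0 (E.gen n) := fun d => by
      rw [← hGφ]
      exact LinearMap.ext fun v => ((CBBA.Hom.map_tDD_iff h'.g.base (E.T n) d 0 _ v).2
        (h'.g.comm d _ (E.gen_mem_stage (Nat.lt_succ_self n) v))).symm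
    have hψ : ψ ∈ CBBA.homDeg (E.V n) C (-1, -1) := h'.h.graded.comp_homDeg (Z.φ_deg n)
    have hs : ∀ c k (j : Fin 4), H'.toLinearMap ∘ₗ Z.base.tDD (E.T n) c k (Z.sq n j) =
        ν.tDD (E.T n) c k (H'.toLinearMap ∘ₗ Z.sq n j) := fun c k j =>
      LinearMap.ext fun v => (CBBA.Hom.map_tDD_iff h'.h.base (E.T n) c k _ v).2
        (h'.h.comm c _ (Z.sq_mem_stage (Nat.lt_succ_self n) j v))
    have h3 : ν.tDD (E.T n) false (-1) (ν.tDD (E.T n) true (-2) ψ) =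
        f.toAlgHom.toLinearMap ∘ₗ E.gen n - p.toAlgHom.toLinearMap ∘ₗ Y +
          H.toLinearMap ∘ₗ Z.ω n := by
      have e1 : H'.toLinearMap ∘ₗ Z.sq n 2 = ν.tDD (E.T n) true (-2) ψ := hs true (-2) 0
      have e2 : H'.toLinearMap ∘ₗ Z.sq n 3 =
          ν.tDD (E.T n) false (-1) (H'.toLinearMap ∘ₗ Z.sq n 2) := hs false (-1) 2
      rw [← e1, ← e2, Z.sq_three]
      refine LinearMap.ext fun v => ?_
      have hv := E.gen_mem_stage (Nat.lt_succ_self n) v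
      change H' (Z.x (E.gen n v) - Z.y (E.gen n v) + Z.ω n v) = f (E.gen n v) - p (G' (E.gen n v)) +
        H (Z.ω n v)
      rw [map_add, map_sub, h'.x _ hv, h'.y _ hv, hH _ (Z.ω_mem_stage n v)]
    -- Conversely ψ - l⊗Y is a primitive; the sign comes from the identification of ∂∂̄l⊗m with -p m
    -- in the cone.
    refine ⟨CBBA.Hom.coneMap hp ψ (-Y) 0 0, CBBA.Hom.coneMap_mem.2 ⟨hψ, neg_mem hY, zero_mem _,
      zero_mem _⟩, ?_⟩
    change (DGModule.Cone (p.toModuleHom ν' ν hp)).tDD (E.T n) false (-1)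
      ((DGModule.Cone (p.toModuleHom ν' ν hp)).tDD (E.T n) true (-2) _) = _
    rw [CBBA.Hom.tDbar_coneMap, CBBA.Hom.tD_coneMap]
    unfold obstruction
    rw [CBBA.Hom.coneMap_inj]
    have e0 : ∀ d, ν'.tDD (E.T n) d (-2) = ν'.tDD (E.T n) d 0 := fun d =>
      ν'.tDD_congr _ _ (by decide)
    refine ⟨?_, ?_, ?_, ?_⟩
    · change ν.tDD (E.T n) false (-1) (ν.tDD (E.T n) true (-2) ψ + p.toAlgHom.toLinearMap ∘ₗ 0) -
        p.toAlgHom.toLinearMap ∘ₗ (-Y - ν'.tDD (E.T n) true (-1) 0) = _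
      rw [LinearMap.comp_zero, add_zero, map_zero, sub_zero, h3, LinearMap.comp_neg]
      abel
    · rw [e0, map_neg, map_neg, hDY, ν'.tDD_congr _ _ (n := -1) (m := 1) (by simp)]
      exact (eq_neg_of_add_eq_zero_left (h.tDD_add_tDD true false)).symm
    · change ν'.tDD (E.T n) true (-2) (-Y) - ν'.tDD (E.T n) false 0 (-ν'.tDD (E.T n) true (-1) 0) = _
      rw [e0, map_neg, hDY, map_zero, neg_zero, map_zero, sub_zero]
    · change -ν'.tDD (E.T n) false 0 (-Y - ν'.tDD (E.T n) true (-1) 0) = _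
      rw [map_zero, sub_zero, map_neg, neg_neg, hDY]

end IsLift

theorem PartialLift.obstruction_spec (L : PartialLift Z ν' p f n) (hp : p.comp ν' = ν)
    (hf : f.comp E.incl = ν) :
    ∃ hL : L.obstruction hp ∈ (DGModule.Cone (p.toModuleHom ν' ν hp)).cocyclesBC (E.T n) 0,
      (Submodule.Quotient.mk ⟨L.obstruction hp, hL⟩ :
          (DGModule.Cone (p.toModuleHom ν' ν hp)).TwistedHomotopy (E.T n)) = 0 ↔
        ∃ L' : PartialLift Z ν' p f (n + 1), L'.Extends L := by
  obtain ⟨G, H, h, hG, hH⟩ := L.exists_isLift hf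
  have e := L.obstruction_eq h hG hH hp
  refine ⟨e ▸ h.obstruction_mem hp hf, ?_⟩
  rw [Submodule.Quotient.mk_eq_zero, Submodule.submoduleOf, Submodule.mem_comap,
    Submodule.subtype_apply, show _ ∈ _ ↔ _ from Eq.to_iff (congrArg (· ∈ _) e), h.obstruction_mem_iff hp hf]
  constructor
  · rintro ⟨G', H', h', hG', hH'⟩
    refine ⟨.ofIsLift h', fun a a' haa => ?_, fun z z' hzz => ?_⟩
    · rw [← hG, ← hG' a a.2, ← haa]; rfl
    · rw [← hH, ← hH' z z.2, ← hzz]; rfl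
  · rintro ⟨L', hL'⟩
    obtain ⟨G', H', h', hG', hH'⟩ := L'.exists_isLift hf
    refine ⟨G', H', h', fun a ha => ?_, fun z hz => ?_⟩
    · rw [hG ⟨a, ha⟩, hG' ⟨a, E.stage_mono (Nat.le_succ n) ha⟩]
      exact hL'.1 _ _ rfl
    · rw [hH ⟨z, hz⟩, hH' ⟨z, Z.stage_mono (Nat.le_succ n) hz⟩]
      exact hL'.2 _ _ rfl

end SuccHirschExt
end

section
variable {K : Type u} [Field K] [CharZero K]

/-! ## Quasi-isomorphisms -/

section quasiIso
variable {B P Q : CBBA K} {V : Bicomplex K}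

/-- The map induced by `q` on twisted cohomology is injective in Bott-Chern and surjective in
Aeppli cohomology. -/
structure CBBA.Hom.IsHalfQuasiIso (q : P.Hom Q) (β : B.Hom P) (T : Twisting V B) : Prop where
  bc : ∀ (a : ℤ × ℤ), ∀ χ ∈ CBBA.homDeg V P a, (∀ c, β.tDD T c (a.1 + a.2) χ = 0) →
    (∃ ζ ∈ CBBA.homDeg V Q (a - (1, 1)), (q.comp β).tDD T false (a.1 + a.2 - 1)
      ((q.comp β).tDD T true (a.1 + a.2 - 2) ζ) = q.toAlgHom.toLinearMap ∘ₗ χ) →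
    ∃ ξ ∈ CBBA.homDeg V P (a - (1, 1)),
      β.tDD T false (a.1 + a.2 - 1) (β.tDD T true (a.1 + a.2 - 2) ξ) = χ
  aeppli : ∀ (a : ℤ × ℤ), ∀ ζ ∈ CBBA.homDeg V Q a, (q.comp β).tDD T false (a.1 + a.2 + 1)
      ((q.comp β).tDD T true (a.1 + a.2) ζ) = 0 →
    ∃ θ ∈ CBBA.homDeg V P a, β.tDD T false (a.1 + a.2 + 1) (β.tDD T true (a.1 + a.2) θ) = 0 ∧
      ∃ μ : Bool → V.carrier →ₗ[K] Q.carrier, (∀ c, μ c ∈ CBBA.homDeg V Q (a - eDeg c)) ∧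
        ζ = q.toAlgHom.toLinearMap ∘ₗ θ + ((q.comp β).tDD T false (a.1 + a.2 - 1) (μ false) +
          (q.comp β).tDD T true (a.1 + a.2 - 1) (μ true))

theorem DGModule.Hom.IsQuasiIsoFor.isHalfQuasiIso {ν : B.Hom Q} {β : B.Hom P} {q : P.Hom Q}
    {h : q.comp β = ν} {T : Twisting V B} (hq : (q.toModuleHom β ν h).IsQuasiIsoFor T) :
    q.IsHalfQuasiIso β T := by
  subst h
  refine ⟨fun a χ hχ hD ⟨ζ, hζ, e⟩ => ?_, fun a ζ hζ hD => ?_⟩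
  · let x : β.toModule.cocyclesBC T a := ⟨χ, ⟨hχ, hD false⟩, hD true⟩
    have h0 : (q.toModuleHom β _ rfl).mapHBC T a (Submodule.Quotient.mk x) = 0 := by
      refine (Submodule.Quotient.mk_eq_zero _).2 ?_
      exact ⟨ζ, hζ, e⟩
    have h1 := (hq a).1.1 (h0.trans (map_zero _).symm)
    obtain ⟨ξ, hξ, e'⟩ := (Submodule.Quotient.mk_eq_zero _).1 h1
    exact ⟨ξ, hξ, e'⟩
  · let x : (q.comp β).toModule.cocyclesA T a := ⟨ζ, hζ, hD⟩
    obtain ⟨y, hy⟩ := (hq a).2.2 (Submodule.Quotient.mk x)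
    obtain ⟨⟨θ, hθ, hθ'⟩, rfl⟩ := Submodule.Quotient.mk_surjective _ y
    have h1 := (Submodule.Quotient.eq _).1 hy.symm
    obtain ⟨_, ⟨μ, hμ, rfl⟩, _, ⟨μ', hμ', rfl⟩, e⟩ := Submodule.mem_sup.1 h1
    refine ⟨θ, hθ, hθ', fun c => bif c then μ' else μ, fun c => ?_, ?_⟩
    · cases c
      · exact hμ
      · exact hμ'
    · exact (add_comm _ _).trans (sub_eq_iff_eq_add.1 e.symm).symm |>.symm

/-- A cocycle χ in the kernel is ∂∂̄ξ by injectivity on Bott-Chern cohomology. As ∂∂̄qξ = 0,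
surjectivity on Aeppli cohomology gives qξ = qθ + ∂μ + ∂̄μ' with ∂∂̄θ = 0. Lifting μ and μ' through
q and subtracting moves ξ into the kernel without changing ∂∂̄ξ. -/
theorem CBBA.Hom.IsHalfQuasiIso.isAcyclicFor {q : P.Hom Q} {β : B.Hom P} {T : Twisting V B}
    (h : q.IsHalfQuasiIso β T) (hT : T.Flat) (hq : Function.Surjective q) :
    q.IsAcyclicFor β T := by
  rintro a _ rfl χ hχ hD hN
  have hqD : ∀ c k ψ, q.toAlgHom.toLinearMap ∘ₗ β.tDD T c k ψ =
      (q.comp β).tDD T c k (q.toAlgHom.toLinearMap ∘ₗ ψ) := fun c k ψ =>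
    CBBA.Hom.map_tDD q (fun _ => rfl) T c k ψ
  have hqχ : q.toAlgHom.toLinearMap ∘ₗ χ = 0 := LinearMap.ext hN
  obtain ⟨ξ, hξ, e⟩ := h.bc a χ hχ hD ⟨0, zero_mem _, by rw [map_zero, map_zero, hqχ]⟩
  have e1 : (a - (1, 1)).1 + (a - (1, 1)).2 = a.1 + a.2 - 2 := by
    simp only [Prod.fst_sub, Prod.snd_sub]; ring
  have e2 : a.1 + a.2 - 2 + 1 = a.1 + a.2 - 1 := by ring
  obtain ⟨θ, hθ, hθ', μ, hμ, e'⟩ := h.aeppli (a - (1, 1)) (q.toAlgHom.toLinearMap ∘ₗ ξ)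
    (q.isGraded.comp_homDeg hξ) (by rw [e1, e2, ← hqD, ← hqD, e, hqχ])
  rw [e1, e2] at hθ'
  rw [e1] at e'
  choose μ' hμ' hqμ using fun c => CBBA.exists_lift_homDeg q hq (hμ c)
  have hs : ∀ c, (a - (1, 1) - eDeg c).1 + (a - (1, 1) - eDeg c).2 = a.1 + a.2 - 2 - 1 := by
    intro c
    have := eDeg_sum c
    simp only [Prod.fst_sub, Prod.snd_sub]
    linarith
  have hdeg : ∀ c, β.tDD T c (a.1 + a.2 - 2 - 1) (μ' c) ∈ CBBA.homDeg V P (a - (1, 1)) :=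
    fun c => by
      have := β.tDD_mem (T := T) (hμ' c) c (a.1 + a.2 - 2 - 1)
      rwa [sub_add_cancel] at this
  refine ⟨ξ - (θ + (β.tDD T false (a.1 + a.2 - 2 - 1) (μ' false) +
    β.tDD T true (a.1 + a.2 - 2 - 1) (μ' true))),
    sub_mem hξ (add_mem hθ (add_mem (hdeg false) (hdeg true))), fun v => ?_, ?_⟩
  · have : q.toAlgHom.toLinearMap ∘ₗ (ξ - (θ + (β.tDD T false (a.1 + a.2 - 2 - 1) (μ' false) +
        β.tDD T true (a.1 + a.2 - 2 - 1) (μ' true)))) = 0 := by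
      rw [LinearMap.comp_sub, LinearMap.comp_add, LinearMap.comp_add, hqD, hqD, hqμ, hqμ, ← e',
        sub_self]
    exact LinearMap.congr_fun this v
  · have f1 := β.tDD_tDD hT (hμ' false) true false (n := a.1 + a.2 - 2 - 1) (m := a.1 + a.2 - 2)
      (hs false).symm (by ring)
    have f2 : β.tDD T false (a.1 + a.2 - 1) (β.tDD T false (a.1 + a.2 - 2)
        (β.tDD T true (a.1 + a.2 - 2 - 1) (μ' false))) = 0 := by
      refine β.tDD_self hT (β.tDD_mem (hμ' false) true _) false ?_ (by ring)
      have := hs false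
      simp only [Prod.fst_add, Prod.snd_add] at this ⊢
      simp only [eDeg] at *
      simp at *
      linarith
    have f3 := β.tDD_self hT (hμ' true) true (n := a.1 + a.2 - 2 - 1) (m := a.1 + a.2 - 2)
      (hs true).symm (by ring)
    simp only [map_sub, map_add, e, hθ', f3, eq_neg_of_add_eq_zero_left f1, map_neg, f2, neg_zero,
      add_zero, sub_zero]

/-- The map χ - i r χ takes values in the acyclic kernel of r, so Bott-Chern questions on `P'`
reduce to `P`; Aeppli representatives are transported by i. -/
theorem CBBA.Hom.IsHalfQuasiIso.of_retract {P' : CBBA K} {q : P.Hom Q} {β : B.Hom P}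
    {T : Twisting V B} (h : q.IsHalfQuasiIso β T) {q' : P'.Hom Q} {i : P.Hom P'} {r : P'.Hom P}
    (hqi : q'.comp i = q) (hri : ∀ x, r (i x) = x) (hr : r.IsAcyclicFor (i.comp β) T) :
    q'.IsHalfQuasiIso (i.comp β) T := by
  subst hqi
  have hiD : ∀ c k ψ, i.toAlgHom.toLinearMap ∘ₗ β.tDD T c k ψ =
      (i.comp β).tDD T c k (i.toAlgHom.toLinearMap ∘ₗ ψ) := fun c k ψ =>
    CBBA.Hom.map_tDD i (fun _ => rfl) T c k ψ
  have hrD : ∀ c k ψ, r.toAlgHom.toLinearMap ∘ₗ (i.comp β).tDD T c k ψ =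
      β.tDD T c k (r.toAlgHom.toLinearMap ∘ₗ ψ) := fun c k ψ =>
    CBBA.Hom.map_tDD r (fun b => hri (β b)) T c k ψ
  have hqD : ∀ c k ψ, q'.toAlgHom.toLinearMap ∘ₗ (i.comp β).tDD T c k ψ =
      (q'.comp (i.comp β)).tDD T c k (q'.toAlgHom.toLinearMap ∘ₗ ψ) := fun c k ψ =>
    CBBA.Hom.map_tDD q' (fun _ => rfl) T c k ψ
  refine ⟨fun a χ hχ hD ⟨ζ, hζ, e⟩ => ?_, fun a ζ hζ hD => ?_⟩
  · let χ₀ := r.toAlgHom.toLinearMap ∘ₗ χ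
    have hχ₀ : χ₀ ∈ CBBA.homDeg V P a := r.isGraded.comp_homDeg hχ
    have hD₀ : ∀ c, β.tDD T c (a.1 + a.2) χ₀ = 0 := fun c => by
      rw [← hrD, hD, LinearMap.comp_zero]
    obtain ⟨ξ, hξ, -, eξ⟩ := hr a _ rfl (χ - i.toAlgHom.toLinearMap ∘ₗ χ₀)
      (sub_mem hχ (i.isGraded.comp_homDeg hχ₀))
      (fun c => by rw [map_sub, ← hiD, hD, hD₀, LinearMap.comp_zero, sub_zero]) (fun v => by
        change r (χ v - i (r (χ v))) = 0
        rw [map_sub, hri, sub_self])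
    obtain ⟨ξ₀, hξ₀, eξ₀⟩ := h.bc a χ₀ hχ₀ hD₀ ⟨ζ - q'.toAlgHom.toLinearMap ∘ₗ ξ,
      sub_mem hζ (q'.isGraded.comp_homDeg hξ), by
        change (q'.comp (i.comp β)).tDD T false _ ((q'.comp (i.comp β)).tDD T true _ _) =
          q'.toAlgHom.toLinearMap ∘ₗ i.toAlgHom.toLinearMap ∘ₗ χ₀
        rw [map_sub, map_sub, e, ← hqD, ← hqD, eξ, LinearMap.comp_sub, sub_sub_cancel]⟩
    refine ⟨ξ + i.toAlgHom.toLinearMap ∘ₗ ξ₀, add_mem hξ (i.isGraded.comp_homDeg hξ₀), ?_⟩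
    rw [map_add, map_add, eξ, ← hiD, ← hiD, eξ₀, sub_add_cancel]
  · obtain ⟨θ, hθ, hθ', μ, hμ, e⟩ := h.aeppli a ζ hζ hD
    exact ⟨i.toAlgHom.toLinearMap ∘ₗ θ, i.isGraded.comp_homDeg hθ,
      by rw [← hiD, ← hiD, hθ', LinearMap.comp_zero], μ, hμ, e⟩

/-- The bicomplex with zero differentials on the shifted bigraded space underlying `C`. -/
abbrev CBBA.shiftTrivial (C : CBBA K) (s : ℤ × ℤ) : Bicomplex K where
  carrier := C.carrier
  gr a := C.gr (a + s)
  internal := isInternal_shift C.internal s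
  d := 0
  dbar := 0
  d_mem _ := zero_mem _
  dbar_mem _ := zero_mem _
  d_d _ := rfl
  dbar_dbar _ := rfl
  d_dbar _ := add_zero _

theorem exists_flat_twisting (C B : CBBA K) (s : ℤ × ℤ) :
    ∃ T : Twisting (C.shiftTrivial s) B, T.Flat := by
  refine ⟨⟨0, 0, fun _ => zero_mem _, fun _ => zero_mem _⟩, fun c c' t => ?_⟩
  have hV : ∀ c v, (C.shiftTrivial s).D c v = 0 := fun c v => by cases c <;> rfl
  induction t with
  | zero => simp
  | add x y hx hy =>
    simp only [map_add]
    rw [add_add_add_comm, hx, hy, add_zero]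
  | tmul v b =>
    have h : ∀ c v b, Twisting.dF (⟨0, 0, fun _ => zero_mem _, fun _ => zero_mem _⟩ :
        Twisting (C.shiftTrivial s) B) c (v ⊗ₜ b) = (C.shiftTrivial s).sgn v ⊗ₜ B.D c b := by
      intro c v b
      rw [Twisting.dF_tmul, hV]
      have : Twisting.coef (⟨0, 0, fun _ => zero_mem _, fun _ => zero_mem _⟩ :
        Twisting (C.shiftTrivial s) B) c v = 0 := by cases c <;> rfl
      rw [this]
      simp
    rw [h, h, h, h, ← TensorProduct.tmul_add, B.D_D, TensorProduct.tmul_zero]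

/-- Every map factors as a section of an acyclic retraction followed by a surjection. -/
theorem CBBA.Hom.exists_factorization (p : P.Hom Q) (β : B.Hom P) :
    ∃ (R : CBBA K) (i : P.Hom R) (r : R.Hom P) (q : R.Hom Q), q.comp i = p ∧ (∀ x, r (i x) = x) ∧
      Function.Surjective q ∧
      ∀ (V : Bicomplex K) (T : Twisting V B), r.IsAcyclicFor (i.comp β) T := by
  obtain ⟨T, hT⟩ := exists_flat_twisting Q B (-1, -1)
  -- Squares on the space underlying `Q`, shifted so that the identity has bidegree (-1,-1). Sending
  -- φ to the identity makes q onto; the copy of index 0 already suffices for this.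
  obtain ⟨S⟩ := SquareExt.exists_of_flat β (fun _ => Q.shiftTrivial (-1, -1)) (fun _ => T)
    (fun _ => hT)
  obtain ⟨q, h1, h2, -⟩ := S.exists_hom (fun _ => hT) p (fun _ => LinearMap.id)
    (fun _ _ _ hx => hx)
  exact ⟨S.obj, S.inc, S.ret fun _ => hT, q, h1, S.ret_inc _,
    fun x => ⟨S.φ 0 x, LinearMap.congr_fun (h2 0) x⟩, fun V T' => S.ret_isAcyclicFor _ T'⟩

end quasiIso

namespace SuccHirschExt
variable {B A C C' : CBBA K} {E : SuccHirschExt B A} {ν : B.Hom C} {ν' : B.Hom C'} {p : C'.Hom C}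
  {hp : p.comp ν' = ν}

theorem IsQuasiIso.exists_lift (h : E.IsQuasiIso p hp) (hs : Function.Surjective p)
    (f : E.MapsRel ν) : ∃ f' : E.MapsRel ν', p.comp f'.1 = f.1 := by
  obtain ⟨F, h1, h2⟩ := E.exists_strict_lift hs
    (fun n => (h n).isHalfQuasiIso.isAcyclicFor (E.flat n) hs) f.1 (f.2.trans hp.symm)
  exact ⟨⟨F, h1⟩, h2⟩

/-- Factor p = q i with r i = id, q onto, and both q and r acyclic. For injectivity, a homotopy from
p f to p g lifts through q to one from i f to i g, and r carries it to C'. For surjectivity, f lifts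
strictly to F : A → R, and f' = r F is the candidate. -/
theorem IsQuasiIso.bijective_hHom_map (h : E.IsQuasiIso p hp) (Z : E.Cylinder) :
    Function.Bijective (hHom.map Z p hp) := by
  obtain ⟨R, i, r, q, hqi, hri, hqs, hr⟩ := p.exists_factorization ν'
  have hri' : r.comp i = CBBA.Hom.id C' := CBBA.Hom.ext' hri
  have hac : ∀ n, q.IsAcyclicFor (i.comp ν') (E.T n) := fun n =>
    ((h n).isHalfQuasiIso.of_retract hqi hri (hr _ _)).isAcyclicFor (E.flat n) hqs
  constructor
  · rintro ⟨f⟩ ⟨g⟩ e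
    -- Equality of classes only gives the generated equivalence relation; since homotopy is already
    -- an equivalence, it yields an actual homotopy.
    have e' := (Z.equivalence (ν := ν)).eqvGen_iff.1 (Quot.eqvGen_exact e)
    obtain ⟨H, hx, hy⟩ := e'
    obtain ⟨H', hx', hy', -⟩ := Z.exists_lift hqs hac H (f := i.comp f.1) (g := i.comp g.1)
      (by rw [CBBA.Hom.comp_assoc, f.2]) (by rw [CBBA.Hom.comp_assoc, g.2])
      (by rw [← CBBA.Hom.comp_assoc, hqi]; exact hx.symm)
      (by rw [← CBBA.Hom.comp_assoc, hqi]; exact hy.symm)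
    refine Quot.sound ⟨r.comp H', ?_, ?_⟩
    · rw [CBBA.Hom.comp_assoc, hx', ← CBBA.Hom.comp_assoc, hri']; rfl
    · rw [CBBA.Hom.comp_assoc, hy', ← CBBA.Hom.comp_assoc, hri']; rfl
  · rintro ⟨f⟩
    obtain ⟨F, h1, h2⟩ := E.exists_strict_lift hqs hac f.1
      (by rw [f.2, ← CBBA.Hom.comp_assoc, hqi, hp])
    let f' : E.MapsRel ν' := ⟨r.comp F, by
      rw [CBBA.Hom.comp_assoc, h1, ← CBBA.Hom.comp_assoc, hri']; rfl⟩
    refine ⟨Quot.mk _ f', Quot.sound ?_⟩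
    obtain ⟨k, hkx, hky, -⟩ := Z.exists_collapse
    -- i f' and F have the same image f' under r, so the constant homotopy of f' lifts through r to
    -- a homotopy from i f' to F; q turns it into one from p f' to f.
    obtain ⟨H, hx, hy, -⟩ := Z.exists_lift (fun x => ⟨i x, hri x⟩) (fun n => hr _ (E.T n))
      (f'.1.comp k) (f := i.comp f'.1) (g := F) (by rw [CBBA.Hom.comp_assoc, f'.2]) h1
      (by rw [← CBBA.Hom.comp_assoc, hri', CBBA.Hom.comp_assoc, hkx]; rfl)
      (by rw [CBBA.Hom.comp_assoc, hky]; rfl)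
    refine ⟨q.comp H, ?_, ?_⟩
    · rw [CBBA.Hom.comp_assoc, hx, ← CBBA.Hom.comp_assoc, hqi]; rfl
    · rw [CBBA.Hom.comp_assoc, hy, h2]

end SuccHirschExt
end

/-! ### Assembly of the existence, equivalence, obstruction and lifting statements. -/

theorem mainTheorem4 {K : Type u} [Field K] [CharZero K] {B A C C' : CBBA K}
    (hB : B.Nonneg) (hA : A.Nonneg) (hC : C.Nonneg) (hC' : C'.Nonneg)
    (E : SuccHirschExt B A) (ν : B.Hom C) (ν' : B.Hom C') (p : C'.Hom C) (hp : p.comp ν' = ν) :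
    Nonempty E.Cylinder ∧
    (∀ Z : E.Cylinder,
      Equivalence (SuccHirschExt.Homotopic Z (ν := ν)) ∧
      Equivalence (SuccHirschExt.Homotopic Z (ν := ν'))) ∧
    -- (i) the obstructions to lifting up to homotopy
    (∀ (Z : E.Cylinder) (f : E.MapsRel ν),
      Nonempty (Unique (SuccHirschExt.PartialLift Z ν' p f.1 0)) ∧
      (∀ (n : ℕ) (L : SuccHirschExt.PartialLift Z ν' p f.1 n),
        ∃ hL : L.obstruction hp ∈
            (DGModule.Cone (p.toModuleHom ν' ν hp)).cocyclesBC (E.T n) 0,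
          (Submodule.Quotient.mk ⟨L.obstruction hp, hL⟩ :
              (DGModule.Cone (p.toModuleHom ν' ν hp)).TwistedHomotopy (E.T n)) = 0 ↔
            ∃ L' : SuccHirschExt.PartialLift Z ν' p f.1 (n + 1), L'.Extends L) ∧
      (∀ L : ∀ n, SuccHirschExt.PartialLift Z ν' p f.1 n, (∀ n, (L (n + 1)).Extends (L n)) →
        ∃ (f' : E.MapsRel ν') (H : Z.obj.Hom C),
          H.comp Z.x = f.1 ∧ H.comp Z.y = p.comp f'.1 ∧
          ∀ n, (∀ a : E.stage n, f'.1 a = (L n).g.toAlgHom a) ∧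
            (∀ z : Z.stage n, H z = (L n).h.toAlgHom z))) ∧
    -- (ii) strict lifts through surjective quasi-isomorphisms
    (Function.Surjective p → E.IsQuasiIso p hp →
      ∀ f : E.MapsRel ν, ∃ f' : E.MapsRel ν', p.comp f'.1 = f.1) ∧
    -- the bijection on homotopy classes
    (E.IsQuasiIso p hp → ∀ Z : E.Cylinder,
      Function.Bijective (SuccHirschExt.hHom.map Z p hp)) := by
  refine ⟨E.nonempty_cylinder, fun Z => ⟨Z.equivalence, Z.equivalence⟩, fun Z f =>
    ⟨SuccHirschExt.PartialLift.nonempty_unique_zero hp f.2, fun n L => L.obstruction_spec hp f.2,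
      fun L hL => ?_⟩, fun hs h f => h.exists_lift hs f, fun h Z => h.bijective_hHom_map Z⟩
  obtain ⟨f', H, h1, h2⟩ := SuccHirschExt.PartialLift.exists_limit f.2 L hL
  exact ⟨⟨f', h1⟩, H, h2⟩
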